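/- Let $(V,\|\cdot\|)$ be a separable Banach space with the Radon–Nikodým property (absolutely continuous curves with values in $V$ are a.e. differentiable) and let $T>0$. **Dissipation.** Let $\Psi:V\to[0,\infty)$ be continuous, convex, positively $1$-homogeneous, with $\Psi(v)>0$ for $v\ne0$. Let $\Phi(v)=F(\|v\|)$ with $F\in C^1([0,\infty))$ convex, $F(r)>0$ for $r>0$, $F(0)=F'(0)=0$ and $\lim_{r\to\infty}F'(r)=+\infty$. For $\varepsilon>0$ put $\Psi_\varepsilon(v)=\Psi(v)+\varepsilon^{-1}\Phi(\varepsilon v)$. Let $K^*=\{\xi\in V^*:\langle\xi,w\rangle\le\Psi(w)\ \forall w\in V\}$. **Energy.** Let $D\subset V$ and let $\mathcal E:[0,T]\times D\to\mathbb R$ be lower semicontinuous; set $\mathcal E_t(u)=+\infty$ for $u\notin D$. Let $\partial\mathcal E_t$ be the Fréchet subdifferential of $\mathcal E_t$ and, for $E>0$, $D_E=\{u\in D:\Psi(u)+\sup_{t\in[0,T]}\mathcal E_t(u)\le E\}$. Assume: (1) $D_E$ is compact for every $E>0$; (2) for $u\in D$ the map $t\mapsto\mathcal E_t(u)$ is differentiable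 on $[0,T]$; its derivative $\mathcal P_t(u)$ satisfies, for some constant $C_P\ge0$ and all $(t,u)\in(0,T)\times D$, $E>0$, the bound $|\mathcal P_t(u)|\le C_P(\Psi(u)+\mathcal E_t(u))$ and $\limsup_{w\to u,\,w\in D_E}\mathcal P_t(w)\le\mathcal P_t(u)$; (3) for every $E>0$ there is an upper semicontinuous $\omega^E:[0,T]\times D_E\times D_E\to\mathbb R$ with $\omega^E_t(u,u)=0$ and $$\mathcal E_t(v)\ge\mathcal E_t(u)+\langle\xi,v-u\rangle-\omega^E_t(u,v)\min\{\Psi(v-u),\Psi(u-v)\}$$ for all $t\in[0,T]$, $u,v\in D_E$, $\xi\in\partial\mathcal E_t(u)$. **BV solutions.** For an interval $[a,b]$ and a curve $u$, $\mathrm{Var}_\Psi(u;[a,b])$ is the supremum of $\sum_m\Psi(u(t_m)-u(t_{m-1}))$ over partitions $a=t_0<\dots<t_M=b$, and $\mathrm{BV}([0,T];Z,\Psi)$ is the set of curves $u:[0,T]\to Z$ with $\mathrm{Var}_\Psi(u;[0,T])<\infty$. Write $u(t_\pm)$ for the one-sided limits, with $u(0_-)=u(0)$ and $u(T_+)=u(T)$,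 and $J_u=\{t\in[0,T]:u(t_-)\ne u(t)\text{ or }u(t)\ne u(t_+)\}$. Let $$\mathfrak e_t(u)=\inf\{\|\xi-z\|_*:\xi\in-\partial\mathcal E_t(u),\ z\in K^*\}\in[0,\infty].$$ An admissible transition at time $t$ from $u_0$ to $u_1$ is a curve $\vartheta:[0,1]\to D_E$, for some $E>0$, with $\vartheta(0)=u_0$, $\vartheta(1)=u_1$, that is $\Psi$-absolutely continuous (i.e. $\Psi(\vartheta(r)-\vartheta(s))\le\int_s^r m$ for $s<r$ and some nonnegative $m\in L^1(0,1)$) and is locally absolutely continuous in norm on $G=\{r\in[0,1]:\mathfrak e_t(\vartheta(r))>0\}$. The Finsler cost is $$\Delta_t(u_0,u_1)=\inf_\vartheta\Big\{\int_G\big(\Psi(\dot\vartheta)+\mathfrak e_t(\vartheta)\|\dot\vartheta\|\big)\,dr+\int_{[0,1]\setminus G}|\vartheta'|_\Psi\,dr\Big\},\qquad|\vartheta'|_\Psi(r)=\lim_{h\to0}\Psi\Big(\frac{\vartheta(r+h)-\vartheta(r)}h\Big),$$ the infimum running over all admissible transitions ($\inf\emptyset=+\infty$, $\infty\cdot0=0$).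 For a cost $c_t(\cdot,\cdot)$ put $$\mathrm{Jmp}_c(u;[a,b])=c_a(u(a),u(a_+))+c_b(u(b_-),u(b))+\sum_{t\in J_u\cap(a,b)}\big(c_t(u(t_-),u(t))+c_t(u(t),u(t_+))\big),$$ and let $\mathrm{Var}_{\mathfrak f}=\mathrm{Var}_\Psi-\mathrm{Jmp}_\Psi+\mathrm{Jmp}_\Delta$, where $\mathrm{Jmp}_\Psi$ uses the cost $\Psi(y-x)$ for a jump from $x$ to $y$. A curve $u\in\mathrm{BV}([0,T];D,\Psi)$ is a *BV solution* if $0\in K^*+\partial\mathcal E_t(u(t))$ for all $t\in[0,T]\setminus J_u$, and $$\mathrm{Var}_{\mathfrak f}(u;[0,t])+\mathcal E_t(u(t))=\mathcal E_0(u(0))+\int_0^t\mathcal P_s(u(s))\,ds\qquad\text{for all }t\in(0,T].$$ **Discrete scheme.** For $\tau,\varepsilon>0$ let $N_\tau=\lceil T/\tau\rceil$ and $t_n=n\tau$, and put $\mathcal E_t:=\mathcal E_T$ for $t>T$. Let $U^0_{\tau,\varepsilon}\in V$ and $$U^n_{\tau,\varepsilon}\in\operatorname*{Argmin}_{U\in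 V}\Big\{\tau\,\Psi_\varepsilon\Big(\frac{U-U^{n-1}_{\tau,\varepsilon}}\tau\Big)+\mathcal E_{t_n}(U)\Big\},\qquad n=1,\dots,N_\tau .$$ Let $\overline U_{\tau,\varepsilon}$ be the left-continuous piecewise constant interpolant ($=U^n_{\tau,\varepsilon}$ on $(t_{n-1},t_n]$, $=U^0_{\tau,\varepsilon}$ at $0$) and $U_{\tau,\varepsilon}$ the piecewise affine interpolant of the values $U^n_{\tau,\varepsilon}$ at the nodes $t_n$. **Theorem.** Let $u_0\in D$ and suppose that $U^0_{\tau,\varepsilon}\to u_0$ in $V$ and $\mathcal E_0(U^0_{\tau,\varepsilon})\to\mathcal E_0(u_0)$ as $\tau,\varepsilon\downarrow0$. Then for all sequences $\tau_k,\varepsilon_k>0$ with $\varepsilon_k\to0$ and $\tau_k/\varepsilon_k\to0$ there exist $E>0$, a subsequence (not relabeled) and a curve $u\in\mathrm{BV}([0,T];D_E,\Psi)$ such that, as $k\to\infty$, for every $t\in[0,T]$, $$\overline U_{\tau_k,\varepsilon_k}(t)\to u(t)\ \text{ and }\ U_{\tau_k,\varepsilon_k}(t)\to u(t)\ \text{ in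 }V,\qquad\mathcal E_t\big(\overline U_{\tau_k,\varepsilon_k}(t)\big)\to\mathcal E_t(u(t)),$$ and $u$ is a BV solution. -/

import Mathlib

open Set Filter Topology MeasureTheory
open scoped ENNReal Pointwise

noncomputable section

namespace BalancedViscosity

section Curves

variable {V : Type*} [NormedAddCommGroup V] [NormedSpace ℝ V]

/-- Curves `u : [a,b] → Z` that are absolutely continuous with respect to the gauge `N`:
`N (u t - u s) ≤ ∫_s^t m` for some nonnegative `m ∈ L¹(a,b)`. For `N = ‖·‖` and `Z = V` these are
the usual absolutely continuous curves. -/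
def IsACCurve (N : V → ℝ) (Z : Set V) (a b : ℝ) (u : ℝ → V) : Prop :=
  (∀ t ∈ Icc a b, u t ∈ Z) ∧
    ∃ m : ℝ → ℝ, (∀ r, 0 ≤ m r) ∧ IntegrableOn m (Icc a b) ∧
      ∀ s t, a ≤ s → s < t → t ≤ b → N (u t - u s) ≤ ∫ r in s..t, m r

/-- `u ∈ AC_loc(G;V)`: `u` is absolutely continuous in norm on every compact interval in `G`. -/
def IsACLocOn (G : Set ℝ) (u : ℝ → V) : Prop :=
  ∀ c d, c ≤ d → Icc c d ⊆ G → IsACCurve (fun v => ‖v‖) univ c d u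

variable (V) in
/-- The Radon-Nikodým property of `V`: absolutely continuous curves with values in `V` are
differentiable almost everywhere. -/
def HasRadonNikodymProperty : Prop :=
  ∀ (a b : ℝ) (u : ℝ → V), IsACCurve (fun v => ‖v‖) univ a b u →
    ∀ᵐ t ∂(volume.restrict (Ioo a b)), DifferentiableAt ℝ u t

/-- The metric derivative `lim_{h → 0} Ψ ((u (t + h) - u t) / h)`. It is written as a `limsup`;
the limit exists at almost every `t` when `u` is `Ψ`-absolutely continuous. -/
def metricDeriv (Ψ : V → ℝ) (u : ℝ → V) (t : ℝ) : ℝ≥0∞ :=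
  limsup (fun h : ℝ => ENNReal.ofReal (Ψ (h⁻¹ • (u (t + h) - u t)))) (𝓝[≠] 0)

/-- The pointwise total variation of `u` on `[a,b]` induced by the (asymmetric) gauge `Ψ`. -/
def gaugeVar (Ψ : V → ℝ) (u : ℝ → V) (a b : ℝ) : ℝ≥0∞ :=
  ⨆ p : ℕ × { t : ℕ → ℝ // Monotone t ∧ ∀ i, t i ∈ Icc a b },
    ∑ i ∈ Finset.range p.1,
      ENNReal.ofReal (Ψ (u ((p.2 : ℕ → ℝ) (i + 1)) - u ((p.2 : ℕ → ℝ) i)))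

/-- `u(t₋)` for a curve on `[0,T]`, with the convention `u(0₋) = u(0)`. -/
def leftValue (u : ℝ → V) (t : ℝ) : V :=
  if t ≤ 0 then u t else Function.leftLim u t

/-- `u(t₊)` for a curve on `[0,T]`, with the convention `u(T₊) = u(T)`. -/
def rightValue (T : ℝ) (u : ℝ → V) (t : ℝ) : V :=
  if T ≤ t then u t else Function.rightLim u t

/-- The jump set `J_u ⊆ [0,T]`. -/
def jumpSet (T : ℝ) (u : ℝ → V) : Set ℝ :=
  {t ∈ Icc 0 T | leftValue u t ≠ u t ∨ u t ≠ rightValue T u t}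

/-- The jump variation of `u` on `[a,b]` when a jump from `x` to `y` at time `t` costs `c t x y`. -/
def jumpVar (T : ℝ) (c : ℝ → V → V → ℝ≥0∞) (u : ℝ → V) (a b : ℝ) : ℝ≥0∞ :=
  c a (u a) (rightValue T u a) + c b (leftValue u b) (u b) +
    ∑' t : ↥(jumpSet T u ∩ Ioo a b),
      (c t (leftValue u t) (u t) + c t (u t) (rightValue T u t))

end Curves

/-- The data `(V, 𝓔, Ψ, Φ)` of a rate-independent system on `[0,T]`, where `Φ = F ∘ ‖·‖` and the
energy `𝓔 : [0,T] × D → ℝ` is `energy`; values of `energy` off `[0,T] × D` play no role. -/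
structure RIS (V : Type*) where
  T : ℝ
  Ψ : V → ℝ
  F : ℝ → ℝ
  D : Set V
  energy : ℝ → V → ℝ

namespace RIS

variable {V : Type*} [NormedAddCommGroup V] [NormedSpace ℝ V] (S : RIS V)

/-- The viscous potential `Φ(v) = F(‖v‖)`. -/
def Φ (v : V) : ℝ := S.F ‖v‖

/-- `Ψ_ε(v) = Ψ(v) + ε⁻¹ Φ(ε v)`. -/
def viscousPotential (ε : ℝ) (v : V) : ℝ := S.Ψ v + ε⁻¹ * S.Φ (ε • v)

/-- `min (Ψ(w), Ψ(-w))`. -/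
def minGauge (w : V) : ℝ := min (S.Ψ w) (S.Ψ (-w))

/-- The stability set `K* = {ξ : ⟨ξ,w⟩ ≤ Ψ(w) for all w}`. -/
def Kstar : Set (StrongDual ℝ V) := {ξ | ∀ w, ξ w ≤ S.Ψ w}

open Classical in
/-- The energy extended by `+∞` outside `D`. -/
def extEnergy (t : ℝ) (u : V) : EReal := if u ∈ S.D then (S.energy t u : EReal) else ⊤

/-- `D_E = {u ∈ D : Ψ(u) + sup_{t ∈ [0,T]} 𝓔_t(u) ≤ E}`. -/
def sublevel (E : ℝ) : Set V := {u ∈ S.D | ∀ t ∈ Icc 0 S.T, S.Ψ u + S.energy t u ≤ E}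

/-- The power `∂ₜ𝓔_t(u)` (one-sided at `t = 0` and `t = T`). -/
def power (t : ℝ) (u : V) : ℝ := derivWithin (fun s => S.energy s u) (Icc 0 S.T) t

/-- The Fréchet subdifferential of `𝓔_t` at `u`. Only `v ∈ D` matters as `𝓔_t = +∞` elsewhere. -/
def frechetSubdiff (t : ℝ) (u : V) : Set (StrongDual ℝ V) :=
  {ξ | u ∈ S.D ∧ ∀ c : ℝ, 0 < c → ∀ᶠ v in 𝓝 u, v ∈ S.D →
    -(c * ‖v - u‖) ≤ S.energy t v - S.energy t u - ξ (v - u)}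

/-- The assumptions on the two dissipation potentials. -/
structure DissipationAssumptions : Prop where
  psi_continuous : Continuous S.Ψ
  psi_convex : ConvexOn ℝ univ S.Ψ
  psi_pos : ∀ v, v ≠ 0 → 0 < S.Ψ v
  psi_homogeneous : ∀ (c : ℝ) (v : V), 0 ≤ c → S.Ψ (c • v) = c * S.Ψ v
  F_contDiff : ContDiffOn ℝ 1 S.F (Ici 0)
  F_convex : ConvexOn ℝ (Ici 0) S.F
  F_pos : ∀ r, 0 < r → 0 < S.F r
  F_zero : S.F 0 = 0
  F_deriv_zero : derivWithin S.F (Ici 0) 0 = 0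
  F_superlinear : Tendsto (derivWithin S.F (Ici 0)) atTop atTop

/-- The assumptions on the energy: lower semicontinuity, coercivity, power control and
`Ψ`-uniform subdifferentiability. -/
structure EnergyAssumptions : Prop where
  lsc : LowerSemicontinuousOn (fun p : ℝ × V => S.energy p.1 p.2) (Icc 0 S.T ×ˢ S.D)
  coercive : ∀ E : ℝ, 0 < E → IsCompact (S.sublevel E)
  differentiable : ∀ u ∈ S.D, DifferentiableOn ℝ (fun t => S.energy t u) (Icc 0 S.T)
  power_control : ∃ C : ℝ, 0 ≤ C ∧ ∀ t ∈ Ioo 0 S.T, ∀ u ∈ S.D,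
    |S.power t u| ≤ C * (S.Ψ u + S.energy t u)
  power_usc : ∀ t ∈ Ioo 0 S.T, ∀ u ∈ S.D, ∀ E : ℝ, 0 < E →
    UpperSemicontinuousWithinAt (S.power t) (S.sublevel E) u
  uniform_subdiff : ∀ E : ℝ, 0 < E → ∃ ω : ℝ → V → V → ℝ,
    UpperSemicontinuousOn (fun p : ℝ × V × V => ω p.1 p.2.1 p.2.2)
      (Icc 0 S.T ×ˢ (S.sublevel E ×ˢ S.sublevel E)) ∧
    (∀ t ∈ Icc 0 S.T, ∀ u ∈ S.sublevel E, ω t u u = 0) ∧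
    ∀ t ∈ Icc 0 S.T, ∀ u ∈ S.sublevel E, ∀ v ∈ S.sublevel E, ∀ ξ ∈ S.frechetSubdiff t u,
      S.energy t u + ξ (v - u) - ω t u v * S.minGauge (v - u) ≤ S.energy t v

/-- `𝔢_t(u) = inf {‖ξ - z‖ : ξ ∈ -∂𝓔_t(u), z ∈ K*}`, equal to `+∞` if `∂𝓔_t(u) = ∅`. -/
def slope (t : ℝ) (u : V) : ℝ≥0∞ :=
  ⨅ ξ ∈ -S.frechetSubdiff t u, ⨅ z ∈ S.Kstar, ENNReal.ofReal ‖ξ - z‖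

/-- The Finsler dissipation functional `𝔣_t(u;v) = Ψ(v) + 𝔢_t(u) ‖v‖`. -/
def finsler (t : ℝ) (u v : V) : ℝ≥0∞ :=
  ENNReal.ofReal (S.Ψ v) + S.slope t u * ENNReal.ofReal ‖v‖

/-- The set `G_t[θ]` of those parameters in `[0,1]` at which `θ` is not locally stable. -/
def unstableSet (t : ℝ) (θ : ℝ → V) : Set ℝ := {r ∈ Icc 0 1 | 0 < S.slope t (θ r)}

/-- The admissible transition curves `θ : [0,1] → V` from `u₀` to `u₁` at time `t`. -/
def transitions (t : ℝ) (u₀ u₁ : V) : Set (ℝ → V) :=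
  {θ | (∃ E : ℝ, 0 < E ∧ IsACCurve S.Ψ (S.sublevel E) 0 1 θ) ∧
    IsACLocOn (S.unstableSet t θ) θ ∧ θ 0 = u₀ ∧ θ 1 = u₁}

open Classical in
/-- The density `𝔣_t[θ;θ'](r)`: the Finsler functional of `θ` and its derivative on `G_t[θ]`, the
metric `Ψ`-derivative elsewhere. -/
def finslerDensity (t : ℝ) (θ : ℝ → V) (r : ℝ) : ℝ≥0∞ :=
  if r ∈ S.unstableSet t θ then S.finsler t (θ r) (deriv θ r) else metricDeriv S.Ψ θ r

/-- The Finsler dissipation cost between `u₀` and `u₁` at time `t` (`+∞` if there is no admissible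
transition). -/
def finslerCost (t : ℝ) (u₀ u₁ : V) : ℝ≥0∞ :=
  ⨅ θ ∈ S.transitions t u₀ u₁, ∫⁻ r in Icc (0 : ℝ) 1, S.finslerDensity t θ r

/-- The `𝔣`-total variation `Var_Ψ - Jmp_Ψ + Jmp_𝔣` of `u` on `[a,b]`. -/
def finslerVar (u : ℝ → V) (a b : ℝ) : ℝ≥0∞ :=
  gaugeVar S.Ψ u a b - jumpVar S.T (fun _ x y => ENNReal.ofReal (S.Ψ (y - x))) u a b
    + jumpVar S.T S.finslerCost u a b

/-- `u ∈ BV([0,T];Z,Ψ)`. -/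
def IsBVCurve (Z : Set V) (u : ℝ → V) : Prop :=
  (∀ t ∈ Icc 0 S.T, u t ∈ Z) ∧ gaugeVar S.Ψ u 0 S.T < ⊤

/-- Balanced Viscosity solutions of the rate-independent system: local stability outside the jump
set, and the energy balance. The balance in `EReal` forces the `𝔣`-variation to be finite. -/
structure IsBVSolution (u : ℝ → V) : Prop where
  bv : S.IsBVCurve S.D u
  stable : ∀ t ∈ Icc 0 S.T \ jumpSet S.T u, 0 ∈ S.Kstar + S.frechetSubdiff t (u t)
  power_integrable : IntervalIntegrable (fun s => S.power s (u s)) volume 0 S.T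
  balance : ∀ t ∈ Ioc 0 S.T,
    (S.finslerVar u 0 t : EReal) + (S.energy t (u t) : EReal) =
      ((S.energy 0 (u 0) + ∫ s in (0 : ℝ)..t, S.power s (u s) : ℝ) : EReal)

/-- Solutions `U⁰, …, U^N` of the viscous incremental minimization problem with time step `τ` and
viscosity `ε`, where `N = ⌈T/τ⌉` and `tₙ = nτ`. If `t_N` exceeds `T`, the energy at time `t_N` is
understood as the energy at time `T`. -/
def IsDiscreteSolution (τ ε : ℝ) (U : ℕ → V) : Prop :=
  ∀ n < ⌈S.T / τ⌉₊, IsMinOn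
    (fun W : V => ((τ * S.viscousPotential ε (τ⁻¹ • (W - U n)) : ℝ) : EReal)
      + S.extEnergy (min (((n + 1 : ℕ) : ℝ) * τ) S.T) W) univ (U (n + 1))

end RIS

section Interpolants

variable {V : Type*} [NormedAddCommGroup V] [NormedSpace ℝ V]

/-- The left-continuous piecewise constant interpolant: `Uⁿ` on `((n-1)τ, nτ]`, and `U⁰` at `0`. -/
def pwConst (τ : ℝ) (U : ℕ → V) (t : ℝ) : V := U ⌈t / τ⌉₊

/-- The piecewise affine interpolant of the values `Uⁿ` at `nτ`; in the formula `n = ⌈t/τ⌉`, that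
is `(n-1)τ < t ≤ nτ`, and the value at `t = 0` is `U⁰`. -/
def pwAffine (τ : ℝ) (U : ℕ → V) (t : ℝ) : V :=
  ((t - ((⌈t / τ⌉₊ : ℝ) - 1) * τ) / τ) • U ⌈t / τ⌉₊
    + (((⌈t / τ⌉₊ : ℝ) * τ - t) / τ) • U (⌈t / τ⌉₊ - 1)

end Interpolants

end BalancedViscosity

end

open BalancedViscosity

/-! Minimality of a discrete step with increment δ gives, through an Euler–Lagrange equation,
functionals ξ ∈ ∂𝓔 and z ∈ K* such that y = ‖ξ + z‖ bounds the slope at the new point, y is a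
subgradient of F at the viscous speed ‖δ‖ε/τ, and Ψ(δ) + y‖δ‖ ≤ ⟨ξ, −δ⟩. Inserted into uniform
subdifferentiability, this yields a discrete energy inequality whose dissipated part is the
Finsler-type sum of Ψ(δ) + y‖δ‖, up to an error ωΨ(δ). Since F is superlinear and τ/ε → 0, all steps
tend to zero uniformly, and so does ω along them. The states stay in one compact D_E and the
dissipated sums are bounded, so Helly's principle gives pointwise limits: u of the interpolants and
A of the dissipated sums.

Three facts hold in the limit. Cost (`finslerCost_le_of_chains`): the part of the discrete chain
that collapses to a jump time converges, after reparametrization by a truncated arclength, to an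
admissible transition whose cost is at most the jump of A. Hence the 𝔣-variation of u is at most A.
Energy (`cost_add_energy_le`): lower semicontinuity of 𝓔 and upper semicontinuity of the power give
A(t) + 𝓔_t(u(t)) ≤ 𝓔_0(u(0)) + ∫𝓟. Stability (`slope_eq_zero_of_tendsto`): because y is conjugate to
the speed and F is positive away from 0 with F'(0) = 0, the steps with y ≥ c occupy total time O(ε),
so each time interval contains almost stable nodes; lower semicontinuity of the slope then makes all
one-sided limits of u stable.

The opposite inequality is a chain rule. Across a jump, the released energy is at most the Finsler
cost (`ofReal_energy_sub_le`); between jumps, stability of u(t₊) and smallness of ω bound it by the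
Ψ-variation. Together (`energy_add_integral_le`) 𝓔_0(u(0)) + ∫𝓟 ≤ Var_𝔣 + 𝓔_t(u(t)). With Var_𝔣 ≤ A
all inequalities close to equalities: this is the balance, it identifies A with the 𝔣-variation, and
it forces convergence of the energies.

Two points are delicate. Fréchet subdifferentials have no exact sum rule with nonsmooth convex
functions, so the Euler–Lagrange equation is obtained by log-sum-exp smoothing and weak* limits
(`exists_smooth_approximation`, `exists_euler`). Along a transition the slope may be unbounded, so
the chain rule is first proved with crude constants, which gives an integrable majorant, and then
sharpened by differentiation almost everywhere. -/

set_option linter.unusedSectionVars false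

/-! ### Monotone functions, one-sided integral estimates and Helly selection. -/

namespace BalancedViscosity

section RealAnalysis

theorem deriv_nonneg_of_monotoneOn_Icc {H : ℝ → ℝ} {a b r : ℝ} (hH : MonotoneOn H (Icc a b))
    (hr : r ∈ Ioo a b) : 0 ≤ deriv H r := by
  by_cases hd : DifferentiableAt ℝ H r
  · have h1 := hd.hasDerivAt.hasDerivWithinAt (s := Ioi r)
    rw [hasDerivWithinAt_iff_tendsto_slope' (by simp)] at h1
    refine ge_of_tendsto h1 ?_
    filter_upwards [Ioo_mem_nhdsGT hr.2] with s hs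
    rw [slope_def_field]
    have : H r ≤ H s := hH ⟨hr.1.le, hr.2.le⟩ ⟨(hr.1.trans hs.1).le, hs.2.le⟩ hs.1.le
    exact div_nonneg (by linarith) (by linarith [hs.1])
  · rw [deriv_zero_of_not_differentiableAt hd]

theorem integral_deriv_le_of_monotoneOn {H : ℝ → ℝ} {a b : ℝ} (hab : a ≤ b)
    (hH : MonotoneOn H (Icc a b)) : ∫ r in a..b, deriv H r ≤ H b - H a := by
  have h := MonotoneOn.intervalIntegral_deriv_mem_uIcc (f := H) (a := a) (b := b)
    (by rwa [uIcc_of_le hab])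
  rw [uIcc_of_le (sub_nonneg.2 (hH ⟨le_rfl, hab⟩ ⟨hab, le_rfl⟩ hab))] at h
  exact h.2

theorem ae_differentiableAt_of_monotoneOn_Icc {H : ℝ → ℝ} {a b : ℝ}
    (hH : MonotoneOn H (Icc a b)) : ∀ᵐ r, r ∈ Ioo a b → DifferentiableAt ℝ H r := by
  filter_upwards [hH.ae_differentiableWithinAt_of_mem] with r hr hr'
  exact (hr (Ioo_subset_Icc_self hr')).differentiableAt (Icc_mem_nhds hr'.1 hr'.2)

theorem ofReal_integral_le_lintegral_ofReal {f : ℝ → ℝ} {a b : ℝ} (hab : a ≤ b)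
    (hf : IntervalIntegrable f volume a b) :
    ENNReal.ofReal (∫ r in a..b, f r) ≤ ∫⁻ r in Icc a b, ENNReal.ofReal (f r) := by
  rw [intervalIntegral.integral_of_le hab, ← integral_Icc_eq_integral_Ioc]
  have hf' : IntegrableOn f (Icc a b) := (intervalIntegrable_iff_integrableOn_Icc_of_le hab).1 hf
  rw [integral_eq_lintegral_pos_part_sub_lintegral_neg_part hf']
  refine ENNReal.ofReal_le_of_le_toReal ?_
  linarith [ENNReal.toReal_nonneg (a := ∫⁻ r in Icc a b, ENNReal.ofReal (-f r))]

/-- A function with `q t - q s ≤ ∫_s^t w` increases by at most the (lower) integral of any `ρ`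
which dominates the derivative of `q` almost everywhere. -/
theorem ofReal_sub_le_lintegral_of_deriv_le {q w : ℝ → ℝ} {ρ : ℝ → ℝ≥0∞} {a b : ℝ} (hab : a ≤ b)
    (hw : IntervalIntegrable w volume a b)
    (hq : ∀ s t, a ≤ s → s ≤ t → t ≤ b → q t - q s ≤ ∫ r in s..t, w r)
    (hρ : ∀ᵐ r, r ∈ Ioo a b → ∀ q', HasDerivAt q q' r → q' ≤ w r → ENNReal.ofReal q' ≤ ρ r) :
    ENNReal.ofReal (q b - q a) ≤ ∫⁻ r in Icc a b, ρ r := by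
  -- `H` is monotone, so it is differentiable almost everywhere and the integral of `H'` is at most
  -- its increment. The singular part of `H` has the favourable sign, hence `q b - q a ≤ ∫ (w - H')`
  -- with `w - H' = q'` a.e., although `q` need not be absolutely continuous.
  set H : ℝ → ℝ := fun r => (∫ x in a..r, w x) - q r with hHdef
  have hintegrable : ∀ s t, a ≤ s → s ≤ t → t ≤ b → IntervalIntegrable w volume s t := fun s t h1 h2 h3 =>
    hw.mono_set (by rw [uIcc_of_le h2, uIcc_of_le hab]; exact Icc_subset_Icc h1 h3)
  have hH : MonotoneOn H (Icc a b) := by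
    intro s hs t ht hst
    have := hq s t hs.1 hst ht.2
    have h2 := intervalIntegral.integral_add_adjacent_intervals (hintegrable a s le_rfl hs.1 hs.2)
      (hintegrable s t hs.1 hst ht.2)
    simp only [hHdef]; linarith
  have hHint : IntervalIntegrable (deriv H) volume a b :=
    MonotoneOn.intervalIntegrable_deriv (by rwa [uIcc_of_le hab])
  have h1 : q b - q a ≤ ∫ r in a..b, (w r - deriv H r) := by
    rw [intervalIntegral.integral_sub hw hHint]
    have := integral_deriv_le_of_monotoneOn hab hH
    simp only [hHdef, intervalIntegral.integral_same] at this ⊢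
    linarith
  refine (ENNReal.ofReal_le_ofReal h1).trans
    ((ofReal_integral_le_lintegral_ofReal hab (hw.sub hHint)).trans ?_)
  rw [← restrict_Ioo_eq_restrict_Icc]
  refine lintegral_mono_ae ?_
  rw [ae_restrict_iff' measurableSet_Ioo]
  filter_upwards [ae_differentiableAt_of_monotoneOn_Icc hH, hw.ae_hasDerivAt_integral, hρ]
    with r h2 h3 h4 hr
  have h5 := h3 (by rw [uIcc_of_le hab]; exact Ioo_subset_Icc_self hr) a (by simp)
  have h6 := h5.sub (h2 hr).hasDerivAt
  have h7 : HasDerivAt q (w r - deriv H r) r := by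
    refine h6.congr_of_eventuallyEq (Eventually.of_forall fun x => ?_)
    simp [hHdef]
  exact h4 hr _ h7 (by linarith [deriv_nonneg_of_monotoneOn_Icc hH hr])

/-- A supremum (connectedness) argument. No continuity of `f` is available in the applications, so
the local comparison is required on both sides of every point. -/
theorem le_of_locally_le {f : ℝ → ℝ} {a b : ℝ} (hab : a ≤ b)
    (h : ∀ r ∈ Icc a b, ∃ ρ > 0, (∀ t ∈ Icc a b, r < t → t < r + ρ → f r ≤ f t) ∧
      ∀ s ∈ Icc a b, s < r → r - ρ < s → f s ≤ f r) : f a ≤ f b := by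
  set S := {t ∈ Icc a b | f a ≤ f t} with hS
  have ha : a ∈ S := ⟨⟨le_rfl, hab⟩, le_rfl⟩
  have hbdd : BddAbove S := ⟨b, fun x hx => hx.1.2⟩
  set c := sSup S with hc
  have hac : a ≤ c := le_csSup hbdd ha
  have hcb : c ≤ b := csSup_le ⟨a, ha⟩ fun x hx => hx.1.2
  obtain ⟨ρ, hρ, h1, h2⟩ := h c ⟨hac, hcb⟩
  have hcS : c ∈ S := by
    obtain ⟨x, hx, hxc⟩ := exists_lt_of_lt_csSup ⟨a, ha⟩ (show c - ρ < c by linarith)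
    rcases (le_csSup hbdd hx).eq_or_lt with h3 | h3
    · rw [← hc] at h3; rwa [← h3]
    · exact ⟨⟨hac, hcb⟩, hx.2.trans (h2 x hx.1 h3 hxc)⟩
  rcases hcb.eq_or_lt with h3 | h3
  · rw [← h3]; exact hcS.2
  · exfalso
    set t := min b (c + ρ / 2)
    have ht : c < t := lt_min h3 (by linarith)
    have ht2 : t < c + ρ := (min_le_right _ _).trans_lt (by linarith)
    have htm : t ∈ Icc a b := ⟨hac.trans ht.le, min_le_left _ _⟩
    exact absurd (le_csSup hbdd ⟨htm, hcS.2.trans (h1 t htm ht ht2)⟩) (not_le.2 ht)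

/-- The diagonal argument, phrased as sequential compactness of a countable product of compact sets.
-/
theorem exists_subseq_tendsto_on_countable {X : Type*} [TopologicalSpace X]
    [FirstCountableTopology X] {C : Set X} (hC : IsCompact C) {D : Set ℝ} (hD : D.Countable)
    {f : ℕ → ℝ → X} (hf : ∀ k, ∀ t ∈ D, f k t ∈ C) :
    ∃ φ : ℕ → ℕ, StrictMono φ ∧ ∃ g : ℝ → X, ∀ t ∈ D,
      Tendsto (fun k => f (φ k) t) atTop (𝓝 (g t)) := by
  classical
  have := hD.to_subtype
  obtain ⟨g, -, φ, hφ, hg⟩ := (isCompact_univ_pi (fun _ : D => hC)).tendsto_subseq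
    (x := fun k (t : D) => f k t) (fun k t _ => hf k t t.2)
  refine ⟨φ, hφ, fun t => if h : t ∈ D then g ⟨t, h⟩ else f 0 t, fun t ht => ?_⟩
  simp only [ht, dif_pos]
  exact (tendsto_pi_nhds.1 hg) ⟨t, ht⟩

/-- Helly's selection principle for monotone functions `A k` together with curves `U k` in a
compact set whose `Ψ`-increments are controlled by those of `A k`. -/
theorem exists_subseq_tendsto_of_monotone {V : Type*} [NormedAddCommGroup V] [CompleteSpace V]
    {Ψ : V → ℝ} {K : Set V} (hK : IsCompact K)
    (hmod : ∀ δ > 0, ∃ ε > 0, ∀ x ∈ K, ∀ y ∈ K, Ψ (y - x) < ε → ‖y - x‖ < δ)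
    {a b M : ℝ} {U : ℕ → ℝ → V} {A : ℕ → ℝ → ℝ}
    (hU : ∀ k, ∀ t ∈ Icc a b, U k t ∈ K) (hA : ∀ k, MonotoneOn (A k) (Icc a b))
    (hM : ∀ k, ∀ t ∈ Icc a b, A k t ∈ Icc 0 M)
    (hUA : ∀ k s t, a ≤ s → s ≤ t → t ≤ b → Ψ (U k t - U k s) ≤ A k t - A k s) :
    ∃ φ : ℕ → ℕ, StrictMono φ ∧ ∃ u : ℝ → V, ∃ α : ℝ → ℝ, ∀ t ∈ Icc a b,
      Tendsto (fun k => U (φ k) t) atTop (𝓝 (u t)) ∧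
      Tendsto (fun k => A (φ k) t) atTop (𝓝 (α t)) := by
  classical
  -- The endpoint `a` is added so that the suprema defining `β` below range over nonempty sets.
  set Q : Set ℝ := (range ((↑) : ℚ → ℝ) ∪ {a}) ∩ Icc a b with hQ
  have hQc : Q.Countable := ((countable_range _).union (countable_singleton a)).mono
    inter_subset_left
  obtain ⟨φ₁, hφ₁, α, hα⟩ := exists_subseq_tendsto_on_countable (isCompact_Icc (a := (0 : ℝ))
    (b := M)) hQc (f := A) (fun k t ht => hM k t ht.2)
  have hαM : ∀ q ∈ Q, α q ∈ Icc 0 M := fun q hq =>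
    isClosed_Icc.mem_of_tendsto (hα q hq) (Eventually.of_forall fun k => hM _ q hq.2)
  have hαmono : ∀ p ∈ Q, ∀ q ∈ Q, p ≤ q → α p ≤ α q := fun p hp q hq hpq =>
    le_of_tendsto_of_tendsto' (hα p hp) (hα q hq) fun k => hA _ hp.2 hq.2 hpq
  set β : ℝ → ℝ := fun t => sSup (α '' {q ∈ Q | q ≤ t}) with hβ
  have hbdd : ∀ t, BddAbove (α '' {q ∈ Q | q ≤ t}) := fun t =>
    ⟨M, by rintro _ ⟨q, hq, rfl⟩; exact (hαM q hq.1).2⟩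
  have hβmono : MonotoneOn β (Icc a b) := by
    intro s hs t ht hst
    refine csSup_le_csSup (hbdd t) ?_ (image_mono fun q hq => ⟨hq.1, hq.2.trans hst⟩)
    exact ⟨α a, a, ⟨⟨Or.inr rfl, le_rfl, hs.1.trans hs.2⟩, hs.1⟩, rfl⟩
  have hβα : ∀ q ∈ Q, β q = α q := by
    intro q hq
    refine le_antisymm (csSup_le ⟨_, q, ⟨hq, le_rfl⟩, rfl⟩ ?_) (le_csSup (hbdd q)
      ⟨q, ⟨hq, le_rfl⟩, rfl⟩)
    rintro _ ⟨p, hp, rfl⟩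
    exact hαmono p hp.1 q hq hp.2
  -- The exceptional set is countable, so a second extraction makes both sequences converge on it;
  -- elsewhere convergence follows from continuity of `β`.
  set N : Set ℝ := {t | t ∈ Icc a b ∧ ¬ ContinuousWithinAt β (Icc a b) t}
  have hN : N.Countable := hβmono.countable_not_continuousWithinAt
  set D : Set ℝ := (Q ∪ N ∪ {a, b}) ∩ Icc a b with hD
  have hDc : D.Countable :=
    ((hQc.union hN).union ((countable_singleton b).insert a)).mono inter_subset_left
  obtain ⟨φ₂, hφ₂, g, hg⟩ := exists_subseq_tendsto_on_countable
    (hK.prod (isCompact_Icc (a := (0 : ℝ)) (b := M))) hDc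
    (f := fun k t => (U (φ₁ k) t, A (φ₁ k) t)) (fun k t ht => ⟨hU _ t ht.2, hM _ t ht.2⟩)
  set φ := φ₁ ∘ φ₂
  have hgQ : ∀ q ∈ Q, Tendsto (fun k => A (φ k) q) atTop (𝓝 (β q)) := by
    intro q hq
    rw [hβα q hq]
    exact (hα q hq).comp hφ₂.tendsto_atTop
  have key : ∀ t ∈ Icc a b, ∃ x : V × ℝ, Tendsto (fun k => U (φ k) t) atTop (𝓝 x.1) ∧
      Tendsto (fun k => A (φ k) t) atTop (𝓝 x.2) := by
    intro t ht
    by_cases htD : t ∈ D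
    · exact ⟨g t, (hg t htD).fst_nhds, (hg t htD).snd_nhds⟩
    have hta : t ≠ a := fun h => htD ⟨Or.inr (by simp [h]), ht⟩
    have htb : t ≠ b := fun h => htD ⟨Or.inr (by simp [h]), ht⟩
    have hat : a < t := lt_of_le_of_ne ht.1 (Ne.symm hta)
    have htb' : t < b := lt_of_le_of_ne ht.2 htb
    have hcont : ContinuousWithinAt β (Icc a b) t := by
      by_contra h
      exact htD ⟨Or.inl (Or.inr ⟨ht, h⟩), ht⟩
    have hnear : ∀ ε > 0, ∃ p ∈ Q, ∃ q ∈ Q, p < t ∧ t < q ∧ β t - ε < β p ∧ β q < β t + ε := by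
      intro ε hε
      obtain ⟨δ, hδ, hd⟩ := Metric.continuousWithinAt_iff.1 hcont ε hε
      obtain ⟨p, hp1, hp2⟩ := exists_rat_btwn (show max a (t - δ) < t from
        max_lt hat (by linarith))
      obtain ⟨q, hq1, hq2⟩ := exists_rat_btwn (show t < min b (t + δ) from
        lt_min htb' (by linarith))
      have hpQ : (p : ℝ) ∈ Icc a b := ⟨((le_max_left _ _).trans_lt hp1).le, (hp2.trans htb').le⟩
      have hqQ : (q : ℝ) ∈ Icc a b := ⟨(hat.trans hq1).le, (hq2.trans_le (min_le_left _ _)).le⟩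
      have hp3 := (le_max_right a (t - δ)).trans_lt hp1
      have hq3 := hq2.trans_le (min_le_right b (t + δ))
      have h1 := hd hpQ (by rw [Real.dist_eq, abs_lt]; constructor <;> linarith)
      have h2 := hd hqQ (by rw [Real.dist_eq, abs_lt]; constructor <;> linarith)
      rw [Real.dist_eq, abs_lt] at h1 h2
      exact ⟨p, ⟨Or.inl ⟨p, rfl⟩, hpQ⟩, q, ⟨Or.inl ⟨q, rfl⟩, hqQ⟩, hp2, hq1, by linarith,
        by linarith⟩
    have hAt : Tendsto (fun k => A (φ k) t) atTop (𝓝 (β t)) := by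
      rw [Metric.tendsto_atTop']
      intro ε hε
      obtain ⟨p, hp, q, hq, hpt, htq, h1, h2⟩ := hnear ε hε
      have e1 := (hgQ p hp).eventually (lt_mem_nhds h1)
      have e2 := (hgQ q hq).eventually (gt_mem_nhds h2)
      obtain ⟨n, hn⟩ := (e1.and e2).exists_forall_of_atTop
      refine ⟨n, fun k hk => ?_⟩
      obtain ⟨h3, h4⟩ := hn k hk.le
      have h5 := hA (φ k) hp.2 ht hpt.le
      have h6 := hA (φ k) ht hq.2 htq.le
      rw [Real.dist_eq, abs_lt]; constructor <;> linarith
    -- `A (φ k)` has a small increment on `[p, t]`, uniformly for large `k`; through `hmod` the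
    -- value at `t` stays close to the value at `p`, where convergence is already known.
    have hcau : CauchySeq (fun k => U (φ k) t) := by
      rw [Metric.cauchySeq_iff']
      intro δ hδ
      obtain ⟨ε, hε, hm⟩ := hmod (δ / 3) (by linarith)
      obtain ⟨p, hp, q, hq, hpt, htq, h1, h2⟩ := hnear (ε / 2) (by linarith)
      have hpD : p ∈ D := ⟨Or.inl (Or.inl hp), hp.2⟩
      have hUp : CauchySeq (fun k => U (φ k) p) := (hg p hpD).fst_nhds.cauchySeq
      obtain ⟨n₁, hn₁⟩ := Metric.cauchySeq_iff.1 hUp (δ / 3) (by linarith)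
      have e1 := (hgQ p hp).eventually (lt_mem_nhds h1)
      have e2 := hAt.eventually (gt_mem_nhds (show β t < β t + ε / 2 by linarith))
      obtain ⟨n₂, hn₂⟩ := (e1.and e2).exists_forall_of_atTop
      have hclose : ∀ k ≥ n₂, ‖U (φ k) t - U (φ k) p‖ < δ / 3 := by
        intro k hk
        obtain ⟨h3, h4⟩ := hn₂ k hk
        exact hm _ (hU _ p hp.2) _ (hU _ t ht)
          ((hUA (φ k) p t hp.2.1 hpt.le ht.2).trans_lt (by linarith))
      refine ⟨max n₁ n₂, fun k hk => ?_⟩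
      have h3 := hclose k ((le_max_right _ _).trans hk)
      have h4 := hclose (max n₁ n₂) (le_max_right _ _)
      have h5 := hn₁ k ((le_max_left _ _).trans hk) (max n₁ n₂) (le_max_left _ _)
      rw [dist_eq_norm] at h5 ⊢
      calc ‖U (φ k) t - U (φ (max n₁ n₂)) t‖
          = ‖(U (φ k) t - U (φ k) p) + (U (φ k) p - U (φ (max n₁ n₂)) p)
            - (U (φ (max n₁ n₂)) t - U (φ (max n₁ n₂)) p)‖ := by congr 1; abel
        _ ≤ ‖U (φ k) t - U (φ k) p‖ + ‖U (φ k) p - U (φ (max n₁ n₂)) p‖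
            + ‖U (φ (max n₁ n₂)) t - U (φ (max n₁ n₂)) p‖ :=
          (norm_sub_le _ _).trans (by gcongr; exact norm_add_le _ _)
        _ < δ := by linarith
    obtain ⟨x, hx⟩ := cauchySeq_tendsto_of_complete hcau
    exact ⟨(x, β t), hx, hAt⟩
  choose! x hx using key
  exact ⟨φ, hφ₁.comp hφ₂, fun t => (x t).1, fun t => (x t).2, hx⟩

end RealAnalysis

end BalancedViscosity

/-! ### The gauge Ψ, the slope, weak* limits and control of the energy in time. -/

namespace BalancedViscosity

namespace RIS

variable {V : Type*} [NormedAddCommGroup V] [NormedSpace ℝ V] {S : RIS V}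

namespace DissipationAssumptions

theorem psi_zero (hΨ : S.DissipationAssumptions) : S.Ψ 0 = 0 := by
  simpa using hΨ.psi_homogeneous 0 0 le_rfl

theorem psi_nonneg (hΨ : S.DissipationAssumptions) (v : V) : 0 ≤ S.Ψ v := by
  rcases eq_or_ne v 0 with rfl | h
  · exact hΨ.psi_zero.ge
  · exact (hΨ.psi_pos v h).le

theorem eq_of_psi_sub_le (hΨ : S.DissipationAssumptions) {x y : V} (h : S.Ψ (y - x) ≤ 0) :
    y = x := by
  by_contra hne
  exact absurd (hΨ.psi_pos (y - x) (sub_ne_zero.2 hne)) (not_lt.2 h)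

theorem psi_add_le (hΨ : S.DissipationAssumptions) (v w : V) :
    S.Ψ (v + w) ≤ S.Ψ v + S.Ψ w := by
  have h := hΨ.psi_convex.2 (mem_univ ((2 : ℝ) • v)) (mem_univ ((2 : ℝ) • w))
    (show (0 : ℝ) ≤ 1 / 2 by norm_num) (show (0 : ℝ) ≤ 1 / 2 by norm_num) (by norm_num)
  rw [smul_smul, smul_smul, hΨ.psi_homogeneous _ _ (by norm_num),
    hΨ.psi_homogeneous _ _ (by norm_num)] at h
  norm_num at h
  linarith

theorem psi_triangle (hΨ : S.DissipationAssumptions) (x y z : V) :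
    S.Ψ (z - x) ≤ S.Ψ (y - x) + S.Ψ (z - y) := by
  simpa using hΨ.psi_add_le (y - x) (z - y)

theorem exists_psi_le (hΨ : S.DissipationAssumptions) : ∃ C > 0, ∀ v, S.Ψ v ≤ C * ‖v‖ := by
  obtain ⟨δ, hδ, hd⟩ := Metric.continuous_iff.1 hΨ.psi_continuous 0 1 one_pos
  refine ⟨2 / δ, by positivity, fun v => ?_⟩
  rcases eq_or_ne v 0 with rfl | hv
  · simp [hΨ.psi_zero]
  have hn : 0 < ‖v‖ := norm_pos_iff.2 hv
  have h := hd ((δ / 2 / ‖v‖) • v) (by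
    rw [dist_zero_right, norm_smul, Real.norm_of_nonneg (by positivity),
      div_mul_cancel₀ _ hn.ne']
    linarith)
  rw [hΨ.psi_zero, Real.dist_eq, sub_zero, hΨ.psi_homogeneous _ _ (by positivity)] at h
  have h2 := (le_abs_self _).trans_lt h
  rw [div_mul_eq_mul_div, div_lt_one hn] at h2
  rw [div_mul_eq_mul_div, le_div_iff₀ hδ]
  linarith

/-- Ψ need not dominate a multiple of the norm, but on the compact set of pairs at distance at least
`δ` it attains a positive minimum. This turns Ψ-estimates into norm estimates throughout. -/
theorem psi_modulus (hΨ : S.DissipationAssumptions) {K : Set V} (hK : IsCompact K) :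
    ∀ δ > 0, ∃ ε > 0, ∀ x ∈ K, ∀ y ∈ K, S.Ψ (y - x) < ε → ‖y - x‖ < δ := by
  intro δ hδ
  set L : Set (V × V) := (K ×ˢ K) ∩ {p | δ ≤ ‖p.2 - p.1‖} with hL
  have hLc : IsCompact L := (hK.prod hK).inter_right
    (isClosed_le continuous_const (by fun_prop))
  rcases L.eq_empty_or_nonempty with h | h
  · refine ⟨1, one_pos, fun x hx y hy _ => ?_⟩
    by_contra hc
    have : (x, y) ∈ L := ⟨⟨hx, hy⟩, not_lt.1 hc⟩
    rw [h] at this; exact this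
  · have hc : Continuous fun p : V × V => S.Ψ (p.2 - p.1) :=
      hΨ.psi_continuous.comp (by fun_prop)
    obtain ⟨p, hp, hmin⟩ := hLc.exists_isMinOn h hc.continuousOn
    refine ⟨S.Ψ (p.2 - p.1), hΨ.psi_pos _ (norm_pos_iff.1 (hδ.trans_le hp.2)),
      fun x hx y hy hxy => ?_⟩
    by_contra hc
    exact absurd (hmin (show (x, y) ∈ L from ⟨⟨hx, hy⟩, not_lt.1 hc⟩)) (not_le.2 hxy)

theorem minGauge_nonneg (hΨ : S.DissipationAssumptions) (v : V) : 0 ≤ S.minGauge v :=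
  le_min (hΨ.psi_nonneg _) (hΨ.psi_nonneg _)

theorem continuous_minGauge (hΨ : S.DissipationAssumptions) : Continuous S.minGauge :=
  hΨ.psi_continuous.min (hΨ.psi_continuous.comp continuous_neg)

theorem norm_le_of_mem_Kstar {C : ℝ} (hC0 : 0 ≤ C) (hC : ∀ v, S.Ψ v ≤ C * ‖v‖)
    {z : StrongDual ℝ V} (hz : z ∈ S.Kstar) : ‖z‖ ≤ C := by
  refine z.opNorm_le_bound hC0 fun v => ?_
  rw [Real.norm_eq_abs, abs_le]
  have h1 := (hz v).trans (hC v)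
  have h2 := (hz (-v)).trans (hC (-v))
  rw [map_neg, norm_neg] at h2
  constructor <;> linarith

end DissipationAssumptions

theorem minGauge_le (v : V) : S.minGauge v ≤ S.Ψ v := min_le_left _ _

theorem minGauge_neg_le (v w : V) : S.minGauge (v - w) ≤ S.Ψ (w - v) := by
  simp [minGauge]

theorem sublevel_mono {E E' : ℝ} (h : E ≤ E') : S.sublevel E ⊆ S.sublevel E' :=
  fun _ hu => ⟨hu.1, fun t ht => (hu.2 t ht).trans h⟩

/-- The slope is defined with `-∂𝓔`; from here on `ξ ∈ ∂𝓔` is used, and the defect of stability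
reads `‖ξ + z‖`. -/
theorem slope_le_of_mem {t : ℝ} {x : V} {ξ z : StrongDual ℝ V} (hξ : ξ ∈ S.frechetSubdiff t x)
    (hz : z ∈ S.Kstar) {y : ℝ} (hy : ‖ξ + z‖ ≤ y) : S.slope t x ≤ ENNReal.ofReal y := by
  have h1 : -ξ ∈ -S.frechetSubdiff t x := by simpa using hξ
  refine (iInf₂_le_of_le (-ξ) h1 (iInf₂_le z hz)).trans (ENNReal.ofReal_le_ofReal ?_)
  rwa [← norm_neg, show -(-ξ - z) = ξ + z by abel]

theorem exists_mem_of_slope_lt {t : ℝ} {x : V} {y : ℝ} (h : S.slope t x < ENNReal.ofReal y) :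
    ∃ ξ ∈ S.frechetSubdiff t x, ∃ z ∈ S.Kstar, ‖ξ + z‖ ≤ y := by
  simp only [slope, iInf_lt_iff] at h
  obtain ⟨ξ, hξ, z, hz, h⟩ := h
  refine ⟨-ξ, by simpa using hξ, z, hz, ?_⟩
  rw [← norm_neg, show -(-ξ + z) = ξ - z by abel]
  exact (ENNReal.lt_ofReal_iff_toReal_lt (by simp)).1 h |>.le.trans' (by simp)

/-- Banach–Alaoglu along an ultrafilter, which dispenses with extracting weak* convergent
subsequences. -/
theorem exists_weakStar_limit {ι : Type*} (f : Ultrafilter ι) {ξ : ι → StrongDual ℝ V} {M : ℝ}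
    (h : ∀ᶠ i in f, ‖ξ i‖ ≤ M) :
    ∃ ξ₀ : StrongDual ℝ V, ‖ξ₀‖ ≤ M ∧ ∀ v, Tendsto (fun i => ξ i v) f (𝓝 (ξ₀ v)) := by
  have hc := WeakDual.isCompact_closedBall (𝕜 := ℝ) (E := V) 0 M
  obtain ⟨ζ, hζ, hle⟩ := hc.ultrafilter_le_nhds
    (f.map fun i => StrongDual.toWeakDual (ξ i)) (by
      simp only [le_principal_iff, Ultrafilter.mem_coe, Ultrafilter.mem_map]
      filter_upwards [h] with i hi
      simpa using hi)
  refine ⟨WeakDual.toStrongDual ζ, by simpa using hζ, fun v => ?_⟩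
  have hle' : Tendsto (fun i => StrongDual.toWeakDual (ξ i)) f (𝓝 ζ) := hle
  exact (WeakDual.eval_continuous v).continuousAt.tendsto.comp hle'

namespace EnergyAssumptions

theorem isCompact_sublevel (hE : S.EnergyAssumptions) {E : ℝ} (h : 0 < E) :
    IsCompact (S.sublevel E) := hE.coercive E h

theorem hasDerivAt_energy (hE : S.EnergyAssumptions) {u : V} (hu : u ∈ S.D) {t : ℝ}
    (ht : t ∈ Ioo 0 S.T) : HasDerivAt (fun s => S.energy s u) (S.power t u) t :=
  ((hE.differentiable u hu t (Ioo_subset_Icc_self ht)).hasDerivWithinAt).hasDerivAt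
    (Icc_mem_nhds ht.1 ht.2)

theorem continuousOn_energy (hE : S.EnergyAssumptions) {u : V} (hu : u ∈ S.D) :
    ContinuousOn (fun s => S.energy s u) (Icc 0 S.T) :=
  (hE.differentiable u hu).continuousOn

/-- By the power control, multiplying `Ψ u + 𝓔_r(u)` by `exp (C r)` gives an increasing function of
`r` and by `exp (-C r)` a decreasing one. -/
theorem gronwall (hE : S.EnergyAssumptions) {C : ℝ}
    (hC : ∀ t ∈ Ioo 0 S.T, ∀ u ∈ S.D, |S.power t u| ≤ C * (S.Ψ u + S.energy t u))
    {u : V} (hu : u ∈ S.D) {s t : ℝ} (hs : s ∈ Icc 0 S.T) (ht : t ∈ Icc 0 S.T) :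
    S.Ψ u + S.energy s u ≤ Real.exp (C * |s - t|) * (S.Ψ u + S.energy t u) := by
  have hcont : ContinuousOn (fun r => S.Ψ u + S.energy r u) (Icc 0 S.T) :=
    continuousOn_const.add (hE.continuousOn_energy hu)
  have hder : ∀ c : ℝ, ∀ r ∈ interior (Icc 0 S.T),
      HasDerivAt (fun r => Real.exp (c * r) * (S.Ψ u + S.energy r u))
        (Real.exp (c * r) * c * (S.Ψ u + S.energy r u) + Real.exp (c * r) * S.power r u) r := by
    intro c r hr
    rw [interior_Icc] at hr
    have h1 : HasDerivAt (fun r : ℝ => Real.exp (c * r)) (Real.exp (c * r) * c) r := by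
      simpa using ((hasDerivAt_id r).const_mul c).exp
    exact h1.mul ((hE.hasDerivAt_energy hu hr).const_add _)
  have hc' : ∀ c : ℝ, ContinuousOn (fun r => Real.exp (c * r) * (S.Ψ u + S.energy r u))
      (Icc 0 S.T) := fun c => ContinuousOn.mul (by fun_prop) hcont
  have hanti : AntitoneOn (fun r => Real.exp (-C * r) * (S.Ψ u + S.energy r u)) (Icc 0 S.T) := by
    refine antitoneOn_of_deriv_nonpos (convex_Icc _ _) (hc' _)
      (fun r hr => (hder _ r hr).differentiableAt.differentiableWithinAt) fun r hr => ?_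
    rw [(hder _ r hr).deriv]
    rw [interior_Icc] at hr
    have := (abs_le.1 (hC r hr u hu)).2
    nlinarith [Real.exp_pos (-C * r)]
  have hmono : MonotoneOn (fun r => Real.exp (C * r) * (S.Ψ u + S.energy r u)) (Icc 0 S.T) := by
    refine monotoneOn_of_deriv_nonneg (convex_Icc _ _) (hc' _)
      (fun r hr => (hder _ r hr).differentiableAt.differentiableWithinAt) fun r hr => ?_
    rw [(hder _ r hr).deriv]
    rw [interior_Icc] at hr
    have := (abs_le.1 (hC r hr u hu)).1
    nlinarith [Real.exp_pos (C * r)]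
  rcases le_total s t with h | h
  · have h1 := hmono hs ht h
    simp only at h1
    rw [abs_of_nonpos (by linarith), show C * -(s - t) = C * t - C * s by ring, Real.exp_sub,
      div_mul_eq_mul_div, le_div_iff₀ (Real.exp_pos _)]
    linarith
  · have h1 := hanti ht hs h
    simp only at h1
    rw [abs_of_nonneg (by linarith), show C * (s - t) = -C * t - -C * s by ring, Real.exp_sub,
      div_mul_eq_mul_div, le_div_iff₀ (Real.exp_pos _)]
    linarith

/-- The sublevels `D_E` involve a supremum over all times; by Gronwall a bound at a single time
suffices. -/
theorem mem_sublevel_of_le (hE : S.EnergyAssumptions) {C : ℝ} (hC0 : 0 ≤ C)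
    (hC : ∀ t ∈ Ioo 0 S.T, ∀ u ∈ S.D, |S.power t u| ≤ C * (S.Ψ u + S.energy t u))
    {u : V} (hu : u ∈ S.D) {t G E : ℝ} (ht : t ∈ Icc 0 S.T) (hG : S.Ψ u + S.energy t u ≤ G)
    (hG0 : 0 ≤ G) (hGE : Real.exp (C * S.T) * G ≤ E) : u ∈ S.sublevel E := by
  refine ⟨hu, fun s hs => (hE.gronwall hC hu hs ht).trans (le_trans ?_ hGE)⟩
  have h1 : Real.exp (C * |s - t|) ≤ Real.exp (C * S.T) := by
    refine Real.exp_le_exp.2 (mul_le_mul_of_nonneg_left ?_ hC0)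
    rw [abs_le]; constructor <;> linarith [hs.1, hs.2, ht.1, ht.2]
  calc Real.exp (C * |s - t|) * (S.Ψ u + S.energy t u)
      ≤ Real.exp (C * |s - t|) * G := by gcongr
    _ ≤ Real.exp (C * S.T) * G := by gcongr

theorem abs_energy_sub_le (hE : S.EnergyAssumptions) {C : ℝ} (hC0 : 0 ≤ C)
    (hC : ∀ t ∈ Ioo 0 S.T, ∀ u ∈ S.D, |S.power t u| ≤ C * (S.Ψ u + S.energy t u))
    {E : ℝ} {u : V} (hu : u ∈ S.sublevel E) {s t : ℝ} (hs : s ∈ Icc 0 S.T) (ht : t ∈ Icc 0 S.T) :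
    |S.energy t u - S.energy s u| ≤ C * E * |t - s| := by
  have hP : ∀ r ∈ Ioo 0 S.T, |S.power r u| ≤ C * E := fun r hr =>
    (hC r hr u hu.1).trans (mul_le_mul_of_nonneg_left (hu.2 r (Ioo_subset_Icc_self hr)) hC0)
  have hder : ∀ c : ℝ, ∀ r ∈ interior (Icc 0 S.T),
      HasDerivAt (fun r => S.energy r u + c * r) (S.power r u + c) r := by
    intro c r hr
    rw [interior_Icc] at hr
    exact (hE.hasDerivAt_energy hu.1 hr).add (by simpa using (hasDerivAt_id r).const_mul c)
  have hc' : ∀ c : ℝ, ContinuousOn (fun r => S.energy r u + c * r) (Icc 0 S.T) := fun c =>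
    (hE.continuousOn_energy hu.1).add (by fun_prop)
  have hanti : AntitoneOn (fun r => S.energy r u + -(C * E) * r) (Icc 0 S.T) := by
    refine antitoneOn_of_deriv_nonpos (convex_Icc _ _) (hc' _)
      (fun r hr => (hder _ r hr).differentiableAt.differentiableWithinAt) fun r hr => ?_
    rw [(hder _ r hr).deriv]
    rw [interior_Icc] at hr
    linarith [(abs_le.1 (hP r hr)).2]
  have hmono : MonotoneOn (fun r => S.energy r u + (C * E) * r) (Icc 0 S.T) := by
    refine monotoneOn_of_deriv_nonneg (convex_Icc _ _) (hc' _)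
      (fun r hr => (hder _ r hr).differentiableAt.differentiableWithinAt) fun r hr => ?_
    rw [(hder _ r hr).deriv]
    rw [interior_Icc] at hr
    linarith [(abs_le.1 (hP r hr)).1]
  rcases le_total s t with h | h
  · have h1 := hmono hs ht h
    have h2 := hanti hs ht h
    simp only at h1 h2
    rw [abs_of_nonneg (show 0 ≤ t - s by linarith), abs_le]
    constructor <;> linarith
  · have h1 := hmono ht hs h
    have h2 := hanti ht hs h
    simp only at h1 h2
    rw [abs_of_nonpos (show t - s ≤ 0 by linarith), abs_le]
    constructor <;> linarith

theorem exists_energy_ge (hE : S.EnergyAssumptions) {E : ℝ} (h : 0 < E) :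
    ∃ m : ℝ, ∀ t ∈ Icc 0 S.T, ∀ u ∈ S.sublevel E, m ≤ S.energy t u := by
  obtain ⟨m, hm⟩ := LowerSemicontinuousOn.bddBelow_of_isCompact
    (isCompact_Icc.prod (hE.isCompact_sublevel h))
    (hE.lsc.mono (prod_mono_right fun _ hu => hu.1))
  exact ⟨m, fun t ht u hu => hm ⟨(t, u), ⟨ht, hu⟩, rfl⟩⟩

end EnergyAssumptions

end RIS

end BalancedViscosity

/-! ### Uniform subdifferentiability, closedness of ∂𝓔 and lower semicontinuity of the slope. -/

namespace BalancedViscosity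

namespace RIS

variable {V : Type*} [NormedAddCommGroup V] [NormedSpace ℝ V] {S : RIS V}

/-- `ω` is a modulus of uniform subdifferentiability on `D_E`. -/
structure IsModulus (S : RIS V) (E : ℝ) (ω : ℝ → V → V → ℝ) : Prop where
  usc : UpperSemicontinuousOn (fun p : ℝ × V × V => ω p.1 p.2.1 p.2.2)
      (Icc 0 S.T ×ˢ (S.sublevel E ×ˢ S.sublevel E))
  diag : ∀ t ∈ Icc 0 S.T, ∀ u ∈ S.sublevel E, ω t u u = 0
  le : ∀ t ∈ Icc 0 S.T, ∀ u ∈ S.sublevel E, ∀ v ∈ S.sublevel E, ∀ ξ ∈ S.frechetSubdiff t u,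
      S.energy t u + ξ (v - u) - ω t u v * S.minGauge (v - u) ≤ S.energy t v

namespace EnergyAssumptions

theorem exists_isModulus (hE : S.EnergyAssumptions) {E : ℝ} (h : 0 < E) :
    ∃ ω, S.IsModulus E ω := by
  obtain ⟨ω, h1, h2, h3⟩ := hE.uniform_subdiff E h
  exact ⟨ω, h1, h2, h3⟩

end EnergyAssumptions

namespace IsModulus

variable {E : ℝ} {ω : ℝ → V → V → ℝ}

theorem exists_le (hω : S.IsModulus E ω) (hK : IsCompact (S.sublevel E)) :
    ∃ M ≥ 0, ∀ t ∈ Icc 0 S.T, ∀ x ∈ S.sublevel E, ∀ y ∈ S.sublevel E, ω t x y ≤ M := by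
  obtain ⟨M, hM⟩ := hω.usc.bddAbove_of_isCompact (isCompact_Icc.prod (hK.prod hK))
  exact ⟨max M 0, le_max_right _ _, fun t ht x hx y hy =>
    (hM ⟨(t, x, y), ⟨ht, hx, hy⟩, rfl⟩).trans (le_max_left _ _)⟩

/-- By upper semicontinuity the set `{ω ≥ κ}` is compact, and it misses the diagonal, where `ω = 0`;
so it has positive distance from it. -/
theorem exists_small (hω : S.IsModulus E ω) (hK : IsCompact (S.sublevel E)) {κ : ℝ} (hκ : 0 < κ) :
    ∃ ρ > 0, ∀ t ∈ Icc 0 S.T, ∀ x ∈ S.sublevel E, ∀ y ∈ S.sublevel E, ‖y - x‖ < ρ →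
      ω t x y ≤ κ := by
  have hc := hω.usc.isCompact_inter_preimage_Ici (isCompact_Icc.prod (hK.prod hK)) κ
  rcases Set.eq_empty_or_nonempty ((Icc 0 S.T ×ˢ (S.sublevel E ×ˢ S.sublevel E)) ∩
    (fun p : ℝ × V × V => ω p.1 p.2.1 p.2.2) ⁻¹' Ici κ) with h | h
  · refine ⟨1, one_pos, fun t ht x hx y hy _ => ?_⟩
    by_contra hc
    have hmem : (t, x, y) ∈ (Icc 0 S.T ×ˢ (S.sublevel E ×ˢ S.sublevel E)) ∩
        (fun p : ℝ × V × V => ω p.1 p.2.1 p.2.2) ⁻¹' Ici κ := ⟨⟨ht, hx, hy⟩, (not_le.1 hc).le⟩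
    rw [h] at hmem; exact hmem
  · obtain ⟨p, hp, hmin⟩ := hc.exists_isMinOn h
      (show Continuous fun p : ℝ × V × V => ‖p.2.2 - p.2.1‖ by fun_prop).continuousOn
    refine ⟨‖p.2.2 - p.2.1‖, ?_, fun t ht x hx y hy hxy => ?_⟩
    · rw [gt_iff_lt, norm_pos_iff]
      intro h0
      have h1 : ω p.1 p.2.1 p.2.2 = 0 := by
        rw [sub_eq_zero.1 h0]; exact hω.diag _ hp.1.1 _ hp.1.2.1
      exact absurd hp.2 (by simp [h1, hκ])
    · by_contra hc
      exact absurd (hmin (show (t, x, y) ∈ _ ∩ _ from ⟨⟨ht, hx, hy⟩, (not_le.1 hc).le⟩))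
        (not_le.2 hxy)

/-- Split `-ξ = z - (ξ + z)` in the subdifferential inequality: `z` is bounded by Ψ, the remainder
by its norm. Every later chain rule inequality rests on this estimate. -/
theorem energy_le_of_mem (hω : S.IsModulus E ω) (hΨ : S.DissipationAssumptions)
    {t y : ℝ} (ht : t ∈ Icc 0 S.T) {x v : V} (hx : x ∈ S.sublevel E) (hv : v ∈ S.sublevel E)
    {ξ z : StrongDual ℝ V} (hξ : ξ ∈ S.frechetSubdiff t x) (hz : z ∈ S.Kstar)
    (hy : ‖ξ + z‖ ≤ y) {κ : ℝ} (hκ0 : 0 ≤ κ) (hκ : ω t x v ≤ κ) :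
    S.energy t x ≤ S.energy t v + (1 + κ) * S.Ψ (v - x) + y * ‖v - x‖ := by
  have h1 := hω.le t ht x hx v hv ξ hξ
  have h2 := (abs_le.1 ((Real.norm_eq_abs _).symm.le.trans ((ξ + z).le_opNorm (v - x)))).1
  have h3 := hz (v - x)
  have h4 : ‖ξ + z‖ * ‖v - x‖ ≤ y * ‖v - x‖ := by gcongr
  have h5 : ω t x v * S.minGauge (v - x) ≤ κ * S.Ψ (v - x) := by
    calc ω t x v * S.minGauge (v - x) ≤ κ * S.minGauge (v - x) :=
          mul_le_mul_of_nonneg_right hκ (hΨ.minGauge_nonneg _)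
      _ ≤ κ * S.Ψ (v - x) := mul_le_mul_of_nonneg_left (minGauge_le _) hκ0
  rw [add_apply] at h2
  linarith

end IsModulus

namespace EnergyAssumptions

/-- To test Fréchet subdifferentiability at `x` one only needs to consider the points of a
sufficiently large sublevel. -/
theorem mem_frechetSubdiff_of_sublevel (hΨ : S.DissipationAssumptions) (hE : S.EnergyAssumptions)
    {C : ℝ} (hC0 : 0 ≤ C)
    (hC : ∀ t ∈ Ioo 0 S.T, ∀ u ∈ S.D, |S.power t u| ≤ C * (S.Ψ u + S.energy t u))
    {t : ℝ} (ht : t ∈ Icc 0 S.T) {x : V} (hx : x ∈ S.D) {ξ : StrongDual ℝ V} {E : ℝ}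
    (hEx : Real.exp (C * S.T) * max (S.Ψ x + S.energy t x + 3) 0 ≤ E)
    (h : ∀ c : ℝ, 0 < c → ∀ᶠ v in 𝓝 x, v ∈ S.sublevel E →
      -(c * ‖v - x‖) ≤ S.energy t v - S.energy t x - ξ (v - x)) :
    ξ ∈ S.frechetSubdiff t x := by
  refine ⟨hx, fun c hc => ?_⟩
  have h1 : ∀ᶠ v in 𝓝 x, S.Ψ v < S.Ψ x + 1 :=
    hΨ.psi_continuous.continuousAt.eventually (gt_mem_nhds (by linarith))
  have hcont : Continuous fun v => ξ (v - x) - c * ‖v - x‖ := by fun_prop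
  have h2 : ∀ᶠ v in 𝓝 x, ξ (v - x) - c * ‖v - x‖ < 1 :=
    hcont.continuousAt.eventually (gt_mem_nhds (by simp))
  filter_upwards [h c hc, h1, h2] with v hv1 hv2 hv3 hvD
  by_cases hvE : v ∈ S.sublevel E
  · exact hv1 hvE
  · have h3 : S.Ψ x + S.energy t x + 3 < S.Ψ v + S.energy t v := by
      by_contra hcon
      exact hvE (hE.mem_sublevel_of_le hC0 hC hvD ht ((not_lt.1 hcon).trans (le_max_left _ _))
        (le_max_right _ _) hEx)
    linarith

/-- Closedness of the graph of `∂𝓔` in the product of the strong and the weak* topology. -/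
theorem mem_frechetSubdiff_of_tendsto (hΨ : S.DissipationAssumptions) (hE : S.EnergyAssumptions)
    {ι : Type*} {l : Filter ι} [l.NeBot] {t : ι → ℝ} {x : ι → V} {ξ : ι → StrongDual ℝ V}
    {t₀ : ℝ} {x₀ : V} {ξ₀ : StrongDual ℝ V} {E M : ℝ} (hEpos : 0 < E)
    (ht : ∀ᶠ i in l, t i ∈ Icc 0 S.T) (hx : ∀ᶠ i in l, x i ∈ S.sublevel E)
    (hξ : ∀ᶠ i in l, ξ i ∈ S.frechetSubdiff (t i) (x i)) (hM : ∀ᶠ i in l, ‖ξ i‖ ≤ M)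
    (ht' : Tendsto t l (𝓝 t₀)) (hx' : Tendsto x l (𝓝 x₀))
    (hξ' : ∀ v, Tendsto (fun i => ξ i v) l (𝓝 (ξ₀ v))) :
    ξ₀ ∈ S.frechetSubdiff t₀ x₀ := by
  obtain ⟨C, hC0, hC⟩ := hE.power_control
  obtain ⟨CΨ, hCΨ0, hCΨ⟩ := hΨ.exists_psi_le
  have ht₀ : t₀ ∈ Icc 0 S.T := isClosed_Icc.mem_of_tendsto ht' ht
  have hx₀E : x₀ ∈ S.sublevel E := (hE.isCompact_sublevel hEpos).isClosed.mem_of_tendsto hx' hx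
  set E' := max E (Real.exp (C * S.T) * max (S.Ψ x₀ + S.energy t₀ x₀ + 3) 0) with hE'
  have hE'pos : 0 < E' := hEpos.trans_le (le_max_left _ _)
  have hsub : S.sublevel E ⊆ S.sublevel E' := sublevel_mono (le_max_left _ _)
  obtain ⟨ω, hω⟩ := hE.exists_isModulus hE'pos
  -- The plain Fréchet condition is not stable under limits, but the uniform inequality is: lower
  -- semicontinuity serves the moving point `x i`, continuity in time the fixed point `v`, and upper
  -- semicontinuity the modulus.
  have key : ∀ v ∈ S.sublevel E', S.energy t₀ x₀ + ξ₀ (v - x₀) - ω t₀ x₀ v * S.minGauge (v - x₀)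
      ≤ S.energy t₀ v := by
    intro v hv
    have l1 : Tendsto (fun i => S.energy (t i) v) l (𝓝 (S.energy t₀ v)) :=
      (hE.continuousOn_energy hv.1 t₀ ht₀).tendsto.comp (tendsto_nhdsWithin_iff.2 ⟨ht', ht⟩)
    have l2 : Tendsto (fun i => ξ i (v - x i)) l (𝓝 (ξ₀ (v - x₀))) := by
      have h1 : Tendsto (fun i => ξ i (x₀ - x i)) l (𝓝 0) := by
        refine squeeze_zero_norm' (a := fun i => M * ‖x₀ - x i‖) ?_ ?_
        · filter_upwards [hM] with i hi
          exact ((ξ i).le_opNorm _).trans (by gcongr)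
        · have : Tendsto (fun i => M * ‖x₀ - x i‖) l (𝓝 (M * ‖x₀ - x₀‖)) :=
            ((tendsto_const_nhds.sub hx').norm).const_mul M
          simpa using this
      have h2 := (hξ' (v - x₀)).add h1
      rw [add_zero] at h2
      refine h2.congr fun i => ?_
      rw [← map_add]; congr 1; abel
    have l3 : Tendsto (fun i => S.minGauge (v - x i)) l (𝓝 (S.minGauge (v - x₀))) :=
      (hΨ.continuous_minGauge.tendsto _).comp (tendsto_const_nhds.sub hx')
    have l4 : ∀ κ > 0, ∀ᶠ i in l, S.energy t₀ x₀ - κ < S.energy (t i) (x i) := by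
      intro κ hκ
      have h1 := hE.lsc (t₀, x₀) ⟨ht₀, hx₀E.1⟩ (S.energy t₀ x₀ - κ) (by simpa using hκ)
      refine (tendsto_nhdsWithin_iff.2 ⟨ht'.prodMk_nhds hx', ?_⟩ :
        Tendsto (fun i => (t i, x i)) l (𝓝[Icc 0 S.T ×ˢ S.D] (t₀, x₀))).eventually h1
      filter_upwards [ht, hx] with i h1 h2 using ⟨h1, h2.1⟩
    have l5 : ∀ κ > 0, ∀ᶠ i in l, ω (t i) (x i) v < ω t₀ x₀ v + κ := by
      intro κ hκ
      have h1 := hω.usc (t₀, x₀, v) ⟨ht₀, hsub hx₀E, hv⟩ (ω t₀ x₀ v + κ) (by simpa using hκ)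
      refine (tendsto_nhdsWithin_iff.2 ⟨ht'.prodMk_nhds (hx'.prodMk_nhds tendsto_const_nhds), ?_⟩ :
        Tendsto (fun i => (t i, x i, v)) l
          (𝓝[Icc 0 S.T ×ˢ (S.sublevel E' ×ˢ S.sublevel E')] (t₀, x₀, v))).eventually h1
      filter_upwards [ht, hx] with i h1 h2 using ⟨h1, hsub h2, hv⟩
    have l6 : ∀ κ > 0, S.energy t₀ x₀ - κ + ξ₀ (v - x₀) - (ω t₀ x₀ v + κ) * S.minGauge (v - x₀)
        ≤ S.energy t₀ v := by
      intro κ hκ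
      refine le_of_tendsto_of_tendsto ((l2.const_add _).sub (l3.const_mul _)) l1 ?_
      filter_upwards [l4 κ hκ, l5 κ hκ, ht, hx, hξ] with i h1 h2 h3 h4 h5
      have h6 := hω.le (t i) h3 (x i) (hsub h4) v hv (ξ i) h5
      have h7 := mul_le_mul_of_nonneg_right h2.le (hΨ.minGauge_nonneg (v - x i))
      linarith
    have l7 : Tendsto (fun κ : ℝ => S.energy t₀ x₀ - κ + ξ₀ (v - x₀)
        - (ω t₀ x₀ v + κ) * S.minGauge (v - x₀)) (𝓝[>] 0)
        (𝓝 (S.energy t₀ x₀ - 0 + ξ₀ (v - x₀) - (ω t₀ x₀ v + 0) * S.minGauge (v - x₀))) :=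
      (Continuous.tendsto (by fun_prop) 0).mono_left nhdsWithin_le_nhds
    rw [sub_zero, add_zero] at l7
    exact le_of_tendsto l7 (by filter_upwards [self_mem_nhdsWithin] with κ hκ using l6 κ hκ)
  -- Near `x₀` the modulus is at most `c / CΨ`, so its contribution is at most `c ‖v - x₀‖`: the
  -- Fréchet condition is recovered from `key`.
  refine hE.mem_frechetSubdiff_of_sublevel hΨ hC0 hC ht₀ hx₀E.1 (E := E') (le_max_right _ _)
    fun c hc => ?_
  obtain ⟨ρ, hρ, hsmall⟩ := hω.exists_small (hE.isCompact_sublevel hE'pos)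
    (κ := c / CΨ) (by positivity)
  filter_upwards [Metric.ball_mem_nhds x₀ hρ] with v hv hvE
  have h4 := key v hvE
  have h5 := hsmall t₀ ht₀ x₀ (hsub hx₀E) v hvE (by rwa [← dist_eq_norm])
  have h6 : ω t₀ x₀ v * S.minGauge (v - x₀) ≤ c * ‖v - x₀‖ := by
    calc ω t₀ x₀ v * S.minGauge (v - x₀) ≤ c / CΨ * S.minGauge (v - x₀) :=
          mul_le_mul_of_nonneg_right h5 (hΨ.minGauge_nonneg _)
      _ ≤ c / CΨ * (CΨ * ‖v - x₀‖) := by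
          gcongr; exact (minGauge_le _).trans (hCΨ _)
      _ = c * ‖v - x₀‖ := by field_simp
  linarith

/-- `K*` is bounded, hence a bound on `‖ξ + z‖` bounds `ξ` too. Both families have weak* limits, the
graph of ∂𝓔 and `K*` are closed for them, and the dual norm is weak* lower semicontinuous. -/
theorem exists_mem_of_tendsto (hΨ : S.DissipationAssumptions) (hE : S.EnergyAssumptions)
    {ι : Type*} {l : Filter ι} [l.NeBot] {t y : ι → ℝ} {x : ι → V}
    {t₀ y₀ : ℝ} {x₀ : V} {E : ℝ} (hEpos : 0 < E)
    (ht : ∀ᶠ i in l, t i ∈ Icc 0 S.T) (hx : ∀ᶠ i in l, x i ∈ S.sublevel E)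
    (hξ : ∀ᶠ i in l, ∃ ξ ∈ S.frechetSubdiff (t i) (x i), ∃ z ∈ S.Kstar, ‖ξ + z‖ ≤ y i)
    (ht' : Tendsto t l (𝓝 t₀)) (hx' : Tendsto x l (𝓝 x₀)) (hy' : Tendsto y l (𝓝 y₀)) :
    ∃ ξ ∈ S.frechetSubdiff t₀ x₀, ∃ z ∈ S.Kstar, ‖ξ + z‖ ≤ y₀ := by
  obtain ⟨CΨ, hCΨ0, hCΨ⟩ := hΨ.exists_psi_le
  obtain ⟨f, hf⟩ := Ultrafilter.exists_le l
  have hch : ∀ i, ∃ p : StrongDual ℝ V × StrongDual ℝ V,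
      (∃ ξ ∈ S.frechetSubdiff (t i) (x i), ∃ z ∈ S.Kstar, ‖ξ + z‖ ≤ y i) →
        p.1 ∈ S.frechetSubdiff (t i) (x i) ∧ p.2 ∈ S.Kstar ∧ ‖p.1 + p.2‖ ≤ y i := by
    intro i
    by_cases h : ∃ ξ ∈ S.frechetSubdiff (t i) (x i), ∃ z ∈ S.Kstar, ‖ξ + z‖ ≤ y i
    · obtain ⟨ξ, h1, z, h2, h3⟩ := h
      exact ⟨(ξ, z), fun _ => ⟨h1, h2, h3⟩⟩
    · exact ⟨0, fun h' => absurd h' h⟩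
  choose p hp using hch
  have hpf : ∀ᶠ i in (f : Filter ι), (p i).1 ∈ S.frechetSubdiff (t i) (x i) ∧
      (p i).2 ∈ S.Kstar ∧ ‖(p i).1 + (p i).2‖ ≤ y i :=
    (hξ.filter_mono hf).mono fun i hi => hp i hi
  have hzb : ∀ᶠ i in (f : Filter ι), ‖(p i).2‖ ≤ CΨ := hpf.mono fun i hi =>
    DissipationAssumptions.norm_le_of_mem_Kstar hCΨ0.le hCΨ hi.2.1
  have hξb : ∀ᶠ i in (f : Filter ι), ‖(p i).1‖ ≤ y₀ + 1 + CΨ := by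
    filter_upwards [hpf, hzb, (hy'.mono_left hf).eventually (gt_mem_nhds (lt_add_one y₀))]
      with i h1 h2 h3
    calc ‖(p i).1‖ = ‖((p i).1 + (p i).2) - (p i).2‖ := by congr 1; abel
      _ ≤ ‖(p i).1 + (p i).2‖ + ‖(p i).2‖ := norm_sub_le _ _
      _ ≤ _ := by linarith [h1.2.2]
  obtain ⟨ξ₀, -, hξ₀⟩ := exists_weakStar_limit f hξb
  obtain ⟨z₀, -, hz₀⟩ := exists_weakStar_limit f hzb
  have hy0 : 0 ≤ y₀ := ge_of_tendsto (hy'.mono_left hf)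
    (hpf.mono fun i hi => (norm_nonneg _).trans hi.2.2)
  refine ⟨ξ₀, hE.mem_frechetSubdiff_of_tendsto hΨ hEpos (ht.filter_mono hf) (hx.filter_mono hf)
    (hpf.mono fun i hi => hi.1) hξb (ht'.mono_left hf) (hx'.mono_left hf) hξ₀, z₀, fun w => ?_,
    ContinuousLinearMap.opNorm_le_bound _ hy0 fun w => ?_⟩
  · exact le_of_tendsto (hz₀ w) (hpf.mono fun i hi => hi.2.1 w)
  · refine le_of_tendsto_of_tendsto ((hξ₀ w).add (hz₀ w)).norm
      ((hy'.mono_left hf).mul_const ‖w‖) (hpf.mono fun i hi => ?_)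
    exact (((p i).1 + (p i).2).le_opNorm w).trans
      (mul_le_mul_of_nonneg_right hi.2.2 (norm_nonneg w))

/-- The infimum defining the slope is attained, by closedness along near-minimizers. In particular
zero slope provides an exact stability relation. -/
theorem exists_mem_of_slope_le (hΨ : S.DissipationAssumptions) (hE : S.EnergyAssumptions)
    {E t y : ℝ} {x : V} (hEpos : 0 < E) (ht : t ∈ Icc 0 S.T) (hx : x ∈ S.sublevel E) (hy : 0 ≤ y)
    (h : S.slope t x ≤ ENNReal.ofReal y) :
    ∃ ξ ∈ S.frechetSubdiff t x, ∃ z ∈ S.Kstar, ‖ξ + z‖ ≤ y := by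
  refine hE.exists_mem_of_tendsto hΨ (l := atTop) (t := fun _ : ℕ => t) (x := fun _ => x)
    (y := fun n : ℕ => y + 1 / ((n : ℝ) + 1)) hEpos (Eventually.of_forall fun _ => ht)
    (Eventually.of_forall fun _ => hx) (Eventually.of_forall fun n => ?_) tendsto_const_nhds
    tendsto_const_nhds ?_
  · exact exists_mem_of_slope_lt (h.trans_lt
      ((ENNReal.ofReal_lt_ofReal_iff (by positivity)).2 (lt_add_of_pos_right _ (by positivity))))
  · simpa using tendsto_const_nhds.add (tendsto_one_div_add_atTop_nhds_zero_nat (𝕜 := ℝ))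

/-- Sublevels of the slope are characterized by the existence of a pair `(ξ, z)`, and such pairs
pass to the limit. -/
theorem lowerSemicontinuousOn_slope (hΨ : S.DissipationAssumptions) (hE : S.EnergyAssumptions)
    {E : ℝ} (hEpos : 0 < E) :
    LowerSemicontinuousOn (fun p : ℝ × V => S.slope p.1 p.2) (Icc 0 S.T ×ˢ S.sublevel E) := by
  rintro ⟨t, x⟩ ⟨ht, hx⟩ b hb
  by_contra hcon
  have hfreq : ∃ᶠ p in 𝓝[Icc 0 S.T ×ˢ S.sublevel E] (t, x), S.slope p.1 p.2 ≤ b := by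
    refine (Filter.not_eventually.1 hcon).mono fun p hp => not_lt.1 hp
  set l := 𝓝[Icc 0 S.T ×ˢ S.sublevel E] (t, x) ⊓ 𝓟 {p | S.slope p.1 p.2 ≤ b}
  have : l.NeBot := frequently_iff_neBot.1 hfreq
  have hbt : b ≠ ⊤ := ne_top_of_lt hb
  have h1 : ∀ᶠ p in l, p ∈ Icc 0 S.T ×ˢ S.sublevel E :=
    (eventually_mem_nhdsWithin).filter_mono inf_le_left
  have h2 : ∀ᶠ p in l, S.slope p.1 p.2 ≤ b := eventually_inf_principal.2 (Eventually.of_forall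
    fun _ h => h)
  have h3 : Tendsto (fun p : ℝ × V => p) l (𝓝 (t, x)) := inf_le_left.trans nhdsWithin_le_nhds
  obtain ⟨ξ, hξ, z, hz, hn⟩ := hE.exists_mem_of_tendsto hΨ (l := l) (t := Prod.fst) (x := Prod.snd)
    (y := fun _ => b.toReal) hEpos (h1.mono fun p hp => hp.1) (h1.mono fun p hp => hp.2)
    ((h1.and h2).mono fun p hp => hE.exists_mem_of_slope_le hΨ hEpos hp.1.1 hp.1.2
      ENNReal.toReal_nonneg (by rw [ENNReal.ofReal_toReal hbt]; exact hp.2))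
    h3.fst_nhds h3.snd_nhds tendsto_const_nhds
  have := slope_le_of_mem hξ hz hn
  rw [ENNReal.ofReal_toReal hbt] at this
  exact absurd hb (not_lt.2 this)

end EnergyAssumptions

theorem IsModulus.energy_le_of_slope_le {E : ℝ} {ω : ℝ → V → V → ℝ} (hω : S.IsModulus E ω)
    (hΨ : S.DissipationAssumptions) (hE : S.EnergyAssumptions) (hEpos : 0 < E)
    {t y : ℝ} (ht : t ∈ Icc 0 S.T) {x v : V} (hx : x ∈ S.sublevel E) (hv : v ∈ S.sublevel E)
    (hy : 0 ≤ y) (hs : S.slope t x ≤ ENNReal.ofReal y) {κ : ℝ} (hκ0 : 0 ≤ κ) (hκ : ω t x v ≤ κ) :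
    S.energy t x ≤ S.energy t v + (1 + κ) * S.Ψ (v - x) + y * ‖v - x‖ := by
  obtain ⟨ξ, hξ, z, hz, h⟩ := hE.exists_mem_of_slope_le hΨ hEpos ht hx hy hs
  exact hω.energy_le_of_mem hΨ ht hx hv hξ hz h hκ0 hκ

end RIS
end BalancedViscosity

/-! ### Smooth approximation of continuous convex functions. -/

namespace BalancedViscosity

section Smoothing

variable {V : Type*} [NormedAddCommGroup V] [NormedSpace ℝ V]

theorem exists_affine_minorant {g : V → ℝ} (hg : ConvexOn ℝ univ g) (hc : Continuous g) (y : V)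
    {κ : ℝ} (hκ : 0 < κ) :
    ∃ (l : StrongDual ℝ V) (c : ℝ), (∀ x, l x + c ≤ g x) ∧ l y + c = g y - κ := by
  obtain ⟨l, c, h1, h2⟩ := ConvexOn.exists_affine_le_of_lt (𝕜 := ℝ) (mem_univ y)
    (show g y - κ < g y by linarith) isClosed_univ (hc.lowerSemicontinuous.lowerSemicontinuousOn _) hg
  exact ⟨l, c, fun x => by simpa using h1 ⟨x, mem_univ x⟩, by simpa using h2⟩

/-- A continuous convex function is approximated, uniformly on a compact set, by Fréchet
differentiable functions whose derivatives are approximate subgradients. -/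
theorem exists_smooth_approximation {g : V → ℝ} (hg : ConvexOn ℝ univ g) (hc : Continuous g)
    {K : Set V} (hK : IsCompact K) {κ : ℝ} (hκ : 0 < κ) :
    ∃ L : V → ℝ, Continuous L ∧ (∀ x ∈ K, |L x - g x| ≤ κ) ∧
      ∀ x ∈ K, ∃ η : StrongDual ℝ V, HasFDerivAt L η x ∧ ∀ v, g x + η (v - x) - κ ≤ g v := by
  rcases K.eq_empty_or_nonempty with rfl | hne
  · exact ⟨fun _ => 0, continuous_const, by simp, by simp⟩
  choose l c hlc hy using fun y => exists_affine_minorant hg hc y (κ := κ / 4) (by linarith)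
  -- Compactness leaves finitely many affine minorants whose maximum lies within `κ / 2` of `g` on
  -- `K`; the maximum is then smoothed by log-sum-exp.
  obtain ⟨s, -, hs⟩ := hK.elim_nhds_subcover (fun y => {x | g x - κ / 2 < l y x + c y})
    (fun y _ => by
      have h1 : Continuous fun x => l y x + c y - g x := by fun_prop
      have h2 : ∀ᶠ x in 𝓝 y, -(κ / 2) < l y x + c y - g x :=
        h1.continuousAt.eventually (lt_mem_nhds (by linarith [hy y]))
      filter_upwards [h2] with x hx
      show g x - κ / 2 < l y x + c y
      linarith)
  have hcov : ∀ x ∈ K, ∃ y ∈ s, g x - κ / 2 < l y x + c y := by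
    intro x hx
    simpa using hs hx
  have hsne : s.Nonempty := by
    obtain ⟨x, hx⟩ := hne
    obtain ⟨y, hy, -⟩ := hcov x hx
    exact ⟨y, hy⟩
  have hn : (0 : ℝ) < s.card := by exact_mod_cast hsne.card_pos
  -- Log-sum-exp at inverse temperature `β` exceeds the maximum by at most `log n / β ≤ n / β = κ /
  -- 4`, where `n = s.card`.
  set β : ℝ := 4 * s.card / κ with hβ
  have hβ0 : 0 < β := by positivity
  have hnβ : (s.card : ℝ) / β = κ / 4 := by rw [hβ]; field_simp
  set Z : V → ℝ := fun x => ∑ y ∈ s, Real.exp (β * (l y x + c y)) with hZ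
  have hZpos : ∀ x, 0 < Z x := fun x => Finset.sum_pos (fun y _ => Real.exp_pos _) hsne
  have hZcont : Continuous Z := continuous_finsetSum _ fun y _ => by fun_prop
  refine ⟨fun x => β⁻¹ * Real.log (Z x), continuous_const.mul (hZcont.log fun x => (hZpos x).ne'),
    fun x hx => ?_, fun x hx => ?_⟩
  · obtain ⟨y, hys, hyx⟩ := hcov x hx
    have h1 : β * (l y x + c y) ≤ Real.log (Z x) := by
      rw [Real.le_log_iff_exp_le (hZpos x)]
      exact Finset.single_le_sum (f := fun y => Real.exp (β * (l y x + c y)))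
        (fun _ _ => (Real.exp_pos _).le) hys
    have h2 : Real.log (Z x) ≤ s.card + β * g x := by
      rw [Real.log_le_iff_le_exp (hZpos x), Real.exp_add]
      calc Z x ≤ ∑ _y ∈ s, Real.exp (β * g x) := Finset.sum_le_sum fun y _ =>
            Real.exp_le_exp.2 (mul_le_mul_of_nonneg_left (hlc y x) hβ0.le)
        _ = s.card * Real.exp (β * g x) := by simp
        _ ≤ Real.exp s.card * Real.exp (β * g x) := by
            gcongr; linarith [Real.add_one_le_exp (s.card : ℝ)]
    have h3 : β⁻¹ * Real.log (Z x) = Real.log (Z x) / β := by ring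
    have h4 : l y x + c y ≤ Real.log (Z x) / β := by
      rw [le_div_iff₀ hβ0]; linarith
    have h5 : Real.log (Z x) / β ≤ κ / 4 + g x := by
      rw [← hnβ, div_add' _ _ _ hβ0.ne', div_le_div_iff_of_pos_right hβ0]; linarith
    rw [abs_le]; constructor <;> linarith
  -- The derivative is the average of the slopes `l y` with Gibbs weights `p`, and an average of
  -- minorants is again a minorant.
  · set p : V → ℝ := fun y => Real.exp (β * (l y x + c y)) / Z x with hp
    have hp0 : ∀ y, 0 ≤ p y := fun y => div_nonneg (Real.exp_pos _).le (hZpos x).le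
    have hp1 : ∑ y ∈ s, p y = 1 := by
      rw [hp, ← Finset.sum_div, div_self (hZpos x).ne']
    have hd : ∀ y, HasFDerivAt (fun x => Real.exp (β * (l y x + c y)))
        (Real.exp (β * (l y x + c y)) • (β • l y)) x := fun y =>
      ((((l y).hasFDerivAt).add_const (c y)).const_mul β).exp
    have hZd : HasFDerivAt Z (∑ y ∈ s, Real.exp (β * (l y x + c y)) • (β • l y)) x :=
      HasFDerivAt.fun_sum fun y _ => hd y
    refine ⟨∑ y ∈ s, p y • l y, ?_, fun v => ?_⟩
    · have h1 := (hZd.log (hZpos x).ne').const_mul β⁻¹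
      have h2 : ∑ y ∈ s, p y • l y
          = β⁻¹ • (Z x)⁻¹ • ∑ y ∈ s, Real.exp (β * (l y x + c y)) • β • l y := by
        rw [Finset.smul_sum, Finset.smul_sum]
        refine Finset.sum_congr rfl fun y _ => ?_
        simp only [smul_smul, hp]
        congr 1
        field_simp
      rw [h2]; exact h1
    · obtain ⟨y₀, hy₀s, hy₀⟩ := hcov x hx
      set m := l y₀ x + c y₀
      have h1 : ∑ y ∈ s, p y * (l y v + c y) ≤ g v := by
        calc ∑ y ∈ s, p y * (l y v + c y) ≤ ∑ y ∈ s, p y * g v :=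
              Finset.sum_le_sum fun y _ => mul_le_mul_of_nonneg_left (hlc y v) (hp0 y)
          _ = g v := by rw [← Finset.sum_mul, hp1, one_mul]
      -- The average of the minorants may lie below the best one at `x`; a minorant with gap `d > 0`
      -- has weight at most `exp (-β d)`, and `d * exp (-β d) ≤ 1 / β`.
      have h2 : ∑ y ∈ s, p y * (m - (l y x + c y)) ≤ s.card / β := by
        rw [div_eq_mul_inv, ← nsmul_eq_mul, ← Finset.sum_const]
        refine Finset.sum_le_sum fun y _ => ?_
        rcases le_or_gt (m - (l y x + c y)) 0 with h | h
        · exact (mul_nonpos_of_nonneg_of_nonpos (hp0 y) h).trans (inv_pos.2 hβ0).le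
        · have h3 : Real.exp (β * m) ≤ Z x :=
            Finset.single_le_sum (f := fun y => Real.exp (β * (l y x + c y)))
              (fun _ _ => (Real.exp_pos _).le) hy₀s
          have h4 : β * (m - (l y x + c y)) ≤ Real.exp (β * (m - (l y x + c y))) := by
            linarith [Real.add_one_le_exp (β * (m - (l y x + c y)))]
          have h5 : Real.exp (β * (l y x + c y)) * Real.exp (β * (m - (l y x + c y)))
              = Real.exp (β * m) := by rw [← Real.exp_add]; congr 1; ring
          rw [hp, div_mul_eq_mul_div, div_le_iff₀ (hZpos x), ← div_eq_inv_mul, le_div_iff₀ hβ0]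
          calc Real.exp (β * (l y x + c y)) * (m - (l y x + c y)) * β
              = Real.exp (β * (l y x + c y)) * (β * (m - (l y x + c y))) := by ring
            _ ≤ Real.exp (β * m) := by rw [← h5]; gcongr
            _ ≤ Z x := h3
      have h3 : ∑ y ∈ s, p y * (l y v + c y) = (∑ y ∈ s, p y • l y) (v - x) + m
          - ∑ y ∈ s, p y * (m - (l y x + c y)) := by
        have h6 : m = ∑ y ∈ s, p y * m := by rw [← Finset.sum_mul, hp1, one_mul]
        rw [FunLike.coe_sum, Finset.sum_apply]
        nth_rewrite 1 [h6]
        rw [← Finset.sum_add_distrib, ← Finset.sum_sub_distrib]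
        refine Finset.sum_congr rfl fun y _ => ?_
        simp only [FunLike.coe_smul, Pi.smul_apply, smul_eq_mul, map_sub]
        ring
      rw [hnβ] at h2
      linarith

end Smoothing

end BalancedViscosity

/-! ### The Euler–Lagrange equation by approximation. -/

namespace BalancedViscosity

namespace RIS

variable {V : Type*} [NormedAddCommGroup V] [NormedSpace ℝ V] {S : RIS V}

theorem norm_le_of_approx_subgradient {x : V} {η : StrongDual ℝ V} {ρ M : ℝ}
    (hρ : 0 < ρ) (h : ∀ v, ‖v - x‖ ≤ ρ → η (v - x) ≤ M) : ‖η‖ ≤ M / ρ := by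
  have hM : 0 ≤ M := by simpa using h x (by simpa using hρ.le)
  refine η.opNorm_le_bound (by positivity) fun w => ?_
  rcases eq_or_ne w 0 with rfl | hw
  · simp
  have hw' : 0 < ‖w‖ := norm_pos_iff.2 hw
  have key : ∀ w : V, 0 < ‖w‖ → η w ≤ M / ρ * ‖w‖ := by
    intro w hw
    have h1 := h (x + (ρ / ‖w‖) • w) (by
      rw [add_sub_cancel_left, norm_smul, Real.norm_of_nonneg (by positivity),
        div_mul_cancel₀ _ hw.ne'])
    rw [add_sub_cancel_left, map_smul, smul_eq_mul, div_mul_eq_mul_div, div_le_iff₀ hw] at h1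
    rw [div_mul_eq_mul_div, le_div_iff₀ hρ]
    linarith
  rw [Real.norm_eq_abs, abs_le]
  have h2 := key (-w) (by simpa using hw')
  rw [map_neg, norm_neg] at h2
  have hkey := key w hw'
  exact ⟨by linarith, hkey⟩

/-- Approximate Euler-Lagrange equation for a minimizer of `g₁ + g₂ + 𝓔_t`. -/
theorem EnergyAssumptions.exists_approx_euler (hE : S.EnergyAssumptions)
    {g₁ g₂ : V → ℝ} (hg₁ : ConvexOn ℝ univ g₁) (hc₁ : Continuous g₁)
    (hg₂ : ConvexOn ℝ univ g₂) (hc₂ : Continuous g₂) {t : ℝ} (ht : t ∈ Icc 0 S.T) {x : V} {E : ℝ}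
    (hEpos : 0 < E) (hx : x ∈ S.sublevel E)
    (hmin : ∀ v ∈ S.D, g₁ x + g₂ x + S.energy t x ≤ g₁ v + g₂ v + S.energy t v)
    {κ : ℝ} (hκ : 0 < κ) :
    ∃ x' ∈ S.sublevel E, ‖x' - x‖ ≤ κ ∧
      S.energy t x' ≤ S.energy t x + (g₁ x - g₁ x') + (g₂ x - g₂ x') + κ ∧
      ∃ z η ζ : StrongDual ℝ V, (∀ v, g₁ x' + z (v - x') - κ ≤ g₁ v) ∧
        (∀ v, g₂ x' + η (v - x') - κ ≤ g₂ v) ∧ ‖ζ‖ ≤ κ ∧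
        ∀ c : ℝ, 0 < c → ∀ᶠ v in 𝓝 x', v ∈ S.sublevel E →
          -(c * ‖v - x'‖) ≤ S.energy t v - S.energy t x' - (-(z + η + ζ)) (v - x') := by
  have hK := hE.isCompact_sublevel hEpos
  -- Comparing the perturbed minimizer with `x` involves three approximations at two points, six
  -- errors `σ` in all: the penalty obeys `κ ‖x' - x‖ ≤ 6σ ≤ κ²`, and the energy error is at most
  -- `6σ ≤ κ`.
  set σ := min (κ * κ / 6) (κ / 6) with hσ
  have hσ0 : 0 < σ := lt_min (by positivity) (by positivity)
  have hσ1 : 6 * σ ≤ κ * κ := by linarith [min_le_left (κ * κ / 6) (κ / 6)]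
  have hσ2 : 6 * σ ≤ κ := by linarith [min_le_right (κ * κ / 6) (κ / 6)]
  have hg₃ : ConvexOn ℝ univ (fun v => κ * ‖v - x‖) := by
    have h1 := (convexOn_univ_norm (E := V)).comp_affineMap (AffineMap.id ℝ V - AffineMap.const ℝ V x)
    exact (h1.smul hκ.le)
  have hc₃ : Continuous (fun v => κ * ‖v - x‖) := by fun_prop
  -- Replacing all convex terms, including the penalty `κ ‖v - x‖` that localizes the new minimizer,
  -- by differentiable ones makes the Fréchet sum rule exact.
  obtain ⟨L₁, hL₁c, hL₁, hd₁⟩ := exists_smooth_approximation hg₁ hc₁ hK hσ0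
  obtain ⟨L₂, hL₂c, hL₂, hd₂⟩ := exists_smooth_approximation hg₂ hc₂ hK hσ0
  obtain ⟨L₃, hL₃c, hL₃, hd₃⟩ := exists_smooth_approximation hg₃ hc₃ hK hσ0
  have hlsc : LowerSemicontinuousOn (fun v => S.energy t v + (L₁ v + L₂ v + L₃ v))
      (S.sublevel E) := by
    refine LowerSemicontinuousOn.add (fun v hv c hcv => ?_)
      (((hL₁c.add hL₂c).add hL₃c).lowerSemicontinuous.lowerSemicontinuousOn _)
    have h1 := hE.lsc (t, v) ⟨ht, hv.1⟩ c hcv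
    refine (tendsto_nhdsWithin_iff.2 ⟨?_, ?_⟩ :
      Tendsto (fun w => (t, w)) (𝓝[S.sublevel E] v) (𝓝[Icc 0 S.T ×ˢ S.D] (t, v))).eventually h1
    · exact (Continuous.tendsto (by fun_prop) v).mono_left nhdsWithin_le_nhds
    · filter_upwards [self_mem_nhdsWithin] with w hw using ⟨ht, hw.1⟩
  obtain ⟨x', hx', hmin'⟩ := hlsc.exists_isMinOn ⟨x, hx⟩ hK
  obtain ⟨z, hz, hz'⟩ := hd₁ x' hx'
  obtain ⟨η, hη, hη'⟩ := hd₂ x' hx'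
  obtain ⟨ζ, hζ, hζ'⟩ := hd₃ x' hx'
  have a1 := abs_le.1 (hL₁ x hx)
  have a2 := abs_le.1 (hL₂ x hx)
  have a3 := abs_le.1 (hL₃ x hx)
  have b1 := abs_le.1 (hL₁ x' hx')
  have b2 := abs_le.1 (hL₂ x' hx')
  have b3 := abs_le.1 (hL₃ x' hx')
  have hcmp : S.energy t x' + (L₁ x' + L₂ x' + L₃ x') ≤ S.energy t x + (L₁ x + L₂ x + L₃ x) :=
    hmin' hx
  simp only [sub_self, norm_zero, mul_zero] at a3
  have hnn : 0 ≤ κ * ‖x' - x‖ := by positivity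
  have hm := hmin x' hx'.1
  refine ⟨x', hx', ?_, by linarith, z, η, ζ, fun v => by linarith [hz' v],
    fun v => by linarith [hη' v], ?_, fun c hc => ?_⟩
  · have : κ * ‖x' - x‖ ≤ κ * κ := by linarith
    exact le_of_mul_le_mul_left this hκ
  · refine ζ.opNorm_le_bound hκ.le fun w => ?_
    have key : ∀ w, ζ w ≤ κ * ‖w‖ := by
      intro w
      by_contra hcon
      have hpos : 0 < ζ w - κ * ‖w‖ := by linarith
      -- `ζ` is only a `σ`-subgradient of `κ ‖· - x‖`, so it is tested far enough along `w` for the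
      -- excess slope to produce a gain `σ + 1`, larger than the error.
      have h1 := hζ' (x' + ((σ + 1) / (ζ w - κ * ‖w‖)) • w)
      have hs : 0 < (σ + 1) / (ζ w - κ * ‖w‖) := by positivity
      set s := (σ + 1) / (ζ w - κ * ‖w‖) with hsdef
      have h2 : s * (ζ w - κ * ‖w‖) = σ + 1 := by rw [hsdef]; field_simp
      rw [add_sub_cancel_left, map_smul, smul_eq_mul] at h1
      have h3 : ‖x' + s • w - x‖ ≤ ‖x' - x‖ + s * ‖w‖ := by
        calc ‖x' + s • w - x‖ = ‖(x' - x) + s • w‖ := by congr 1; abel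
          _ ≤ ‖x' - x‖ + ‖s • w‖ := norm_add_le _ _
          _ = _ := by rw [norm_smul, Real.norm_of_nonneg hs.le]
      have h4 := mul_le_mul_of_nonneg_left h3 hκ.le
      nlinarith
    rw [Real.norm_eq_abs, abs_le]
    have h2 := key (-w)
    rw [map_neg, norm_neg] at h2
    exact ⟨by linarith, key w⟩
  · have hd := ((hz.add hη).add hζ)
    have hd' := hd.isLittleO.def hc
    filter_upwards [hd'] with v hv hvE
    have h1 : S.energy t x' + (L₁ x' + L₂ x' + L₃ x') ≤ S.energy t v + (L₁ v + L₂ v + L₃ v) :=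
      hmin' hvE
    rw [Real.norm_eq_abs] at hv
    have h2 := (abs_le.1 hv).2
    simp only [Pi.add_apply, neg_apply] at h2 ⊢
    linarith

/-- Euler-Lagrange equation for a minimizer of `g₁ + g₂ + 𝓔_t`, with `g₁, g₂` convex. -/
theorem EnergyAssumptions.exists_euler (hΨ : S.DissipationAssumptions) (hE : S.EnergyAssumptions)
    {g₁ g₂ : V → ℝ} (hg₁ : ConvexOn ℝ univ g₁) (hc₁ : Continuous g₁)
    (hg₂ : ConvexOn ℝ univ g₂) (hc₂ : Continuous g₂) {t : ℝ} (ht : t ∈ Icc 0 S.T) {x : V}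
    (hx : x ∈ S.D)
    (hmin : ∀ v ∈ S.D, g₁ x + g₂ x + S.energy t x ≤ g₁ v + g₂ v + S.energy t v) :
    ∃ z η : StrongDual ℝ V, -(z + η) ∈ S.frechetSubdiff t x ∧
      (∀ v, g₁ x + z (v - x) ≤ g₁ v) ∧ ∀ v, g₂ x + η (v - x) ≤ g₂ v := by
  obtain ⟨C, hC0, hC⟩ := hE.power_control
  -- The margin 5 is the 3 required by `mem_frechetSubdiff_of_sublevel` plus 2 for the approximating
  -- minimizers, whose `Ψ + 𝓔_t` is eventually below that of `x` plus 2.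
  set E := max 1 (Real.exp (C * S.T) * max (S.Ψ x + S.energy t x + 5) 0) with hEdef
  have hEpos : 0 < E := one_pos.trans_le (le_max_left _ _)
  have hxE : x ∈ S.sublevel E := hE.mem_sublevel_of_le hC0 hC hx ht
    ((by linarith : S.Ψ x + S.energy t x ≤ S.Ψ x + S.energy t x + 5).trans (le_max_left _ 0))
    (le_max_right _ _) (le_max_right _ _)
  set κ : ℕ → ℝ := fun n => 1 / ((n : ℝ) + 1) with hκdef
  have hκ : ∀ n, 0 < κ n := fun n => by positivity
  have hκlim : Tendsto κ atTop (𝓝 0) := tendsto_one_div_add_atTop_nhds_zero_nat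
  choose x' hx' hxx' hen z η ζ hz hη hζ hfr using fun n =>
    hE.exists_approx_euler hg₁ hc₁ hg₂ hc₂ ht hEpos hxE hmin (hκ n)
  have hxlim : Tendsto x' atTop (𝓝 x) :=
    tendsto_iff_norm_sub_tendsto_zero.2 (squeeze_zero (fun _ => norm_nonneg _) hxx' hκlim)
  have l1 : Tendsto (fun n => g₁ (x' n)) atTop (𝓝 (g₁ x)) := (hc₁.tendsto x).comp hxlim
  have l2 : Tendsto (fun n => g₂ (x' n)) atTop (𝓝 (g₂ x)) := (hc₂.tendsto x).comp hxlim
  have l3 : Tendsto (fun n => S.Ψ (x' n)) atTop (𝓝 (S.Ψ x)) :=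
    (hΨ.psi_continuous.tendsto x).comp hxlim
  have hmem : ∀ᶠ n in atTop, -(z n + η n + ζ n) ∈ S.frechetSubdiff t (x' n) := by
    have h1 : Tendsto (fun n => S.Ψ (x' n) + (S.energy t x + (g₁ x - g₁ (x' n))
        + (g₂ x - g₂ (x' n)) + κ n)) atTop (𝓝 (S.Ψ x + (S.energy t x + (g₁ x - g₁ x)
        + (g₂ x - g₂ x) + 0))) :=
      l3.add (((l1.const_sub _).const_add _ |>.add (l2.const_sub _)).add hκlim)
    filter_upwards [h1.eventually (gt_mem_nhds (show _ < S.Ψ x + S.energy t x + 2 by linarith))]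
      with n hn
    refine hE.mem_frechetSubdiff_of_sublevel hΨ hC0 hC ht (hx' n).1 (E := E) ?_ (hfr n)
    refine le_trans ?_ (le_max_right _ _)
    have h2 : S.Ψ (x' n) + S.energy t (x' n) + 3 ≤ S.Ψ x + S.energy t x + 5 := by
      linarith [hen n]
    gcongr
  -- Approximate subgradients of a continuous function are bounded near `x`, because `g` oscillates
  -- by at most 2 on a small ball; the error `κ n < 1` gives the numerator 3.
  have hbd : ∀ g : V → ℝ, Continuous g → ∀ η : ℕ → StrongDual ℝ V,
      (∀ n v, g (x' n) + η n (v - x' n) - κ n ≤ g v) → ∃ M, ∀ᶠ n in atTop, ‖η n‖ ≤ M := by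
    intro g hg η hη
    obtain ⟨ρ, hρ, hd⟩ := Metric.continuous_iff.1 hg x 1 one_pos
    refine ⟨3 / (ρ / 2), ?_⟩
    filter_upwards [hxlim.eventually (Metric.ball_mem_nhds x (half_pos hρ)),
      hκlim.eventually (gt_mem_nhds one_pos)] with n h1 h2
    refine norm_le_of_approx_subgradient (x := x' n) (half_pos hρ) fun v hv => ?_
    have h3 : dist v x < ρ := by
      calc dist v x ≤ dist v (x' n) + dist (x' n) x := dist_triangle _ _ _
        _ < ρ := by rw [dist_eq_norm v]; linarith
    have h4 := abs_lt.1 (hd v h3)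
    have h5 := abs_lt.1 (hd (x' n) (by linarith))
    linarith [hη n v]
  obtain ⟨M₁, hM₁⟩ := hbd g₁ hc₁ z hz
  obtain ⟨M₂, hM₂⟩ := hbd g₂ hc₂ η hη
  set f : Ultrafilter ℕ := hyperfilter ℕ
  have hf : (f : Filter ℕ) ≤ atTop := Nat.hyperfilter_le_atTop
  obtain ⟨z₀, -, hz₀⟩ := exists_weakStar_limit f (hM₁.filter_mono hf)
  obtain ⟨η₀, -, hη₀⟩ := exists_weakStar_limit f (hM₂.filter_mono hf)
  have hζ₀ : ∀ v, Tendsto (fun n => ζ n v) f (𝓝 0) := fun v => by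
    refine squeeze_zero_norm (a := fun n => κ n * ‖v‖) (fun n => ((ζ n).le_opNorm v).trans
      (mul_le_mul_of_nonneg_right (hζ n) (norm_nonneg v))) ?_
    simpa using (hκlim.mono_left hf).mul_const ‖v‖
  have hlim : ∀ v, Tendsto (fun n => (-(z n + η n + ζ n)) v) f (𝓝 ((-(z₀ + η₀)) v)) := by
    intro v
    simpa [add_comm, add_left_comm] using (((hz₀ v).add (hη₀ v)).add (hζ₀ v)).neg
  have hsub : ∀ g : V → ℝ, Continuous g → ∀ (η : ℕ → StrongDual ℝ V) (M : ℝ)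
      (η₀ : StrongDual ℝ V), (∀ᶠ n in atTop, ‖η n‖ ≤ M) →
      (∀ n v, g (x' n) + η n (v - x' n) - κ n ≤ g v) →
      (∀ v, Tendsto (fun n => η n v) f (𝓝 (η₀ v))) → ∀ v, g x + η₀ (v - x) ≤ g v := by
    intro g hg η M η₀ hM hη hη₀ v
    have h1 : Tendsto (fun n => η n (x - x' n)) f (𝓝 0) := by
      refine squeeze_zero_norm' (a := fun n => M * ‖x - x' n‖) ?_ ?_
      · filter_upwards [hM.filter_mono hf] with n hn
        exact ((η n).le_opNorm _).trans (by gcongr)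
      · have : Tendsto (fun n => M * ‖x - x' n‖) f (𝓝 (M * ‖x - x‖)) :=
          ((tendsto_const_nhds.sub (hxlim.mono_left hf)).norm).const_mul M
        simpa using this
    have h2 := ((((hg.tendsto x).comp hxlim).mono_left hf).add ((hη₀ (v - x)).add h1)).sub
      (hκlim.mono_left hf)
    rw [add_zero, sub_zero] at h2
    refine le_of_tendsto h2 (Eventually.of_forall fun n => ?_)
    have h3 := hη n v
    simp only [Function.comp, map_sub] at h3 ⊢
    linarith
  refine ⟨z₀, η₀, hE.mem_frechetSubdiff_of_tendsto hΨ (l := f) (t := fun _ => t) (x := x')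
    (M := M₁ + M₂ + 1) hEpos (Eventually.of_forall fun _ => ht)
    (Eventually.of_forall hx') (hmem.filter_mono hf) ?_ tendsto_const_nhds (hxlim.mono_left hf) hlim,
    hsub g₁ hc₁ z M₁ z₀ hM₁ hz hz₀, hsub g₂ hc₂ η M₂ η₀ hM₂ hη hη₀⟩
  filter_upwards [hM₁.filter_mono hf, hM₂.filter_mono hf] with n h1 h2
  rw [norm_neg]
  have h3 : κ n ≤ 1 := by
    rw [hκdef]; exact div_le_one_of_le₀ (by linarith [n.cast_nonneg (α := ℝ)]) (by positivity)
  exact (norm_add_le _ _).trans (by linarith [norm_add_le (z n) (η n), hζ n])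

end RIS

end BalancedViscosity

/-! ### The viscous potential and the discrete Euler–Lagrange equation. -/

namespace BalancedViscosity

namespace RIS

variable {V : Type*} [NormedAddCommGroup V] [NormedSpace ℝ V] {S : RIS V}

namespace DissipationAssumptions

theorem F_nonneg (hΨ : S.DissipationAssumptions) {r : ℝ} (hr : 0 ≤ r) : 0 ≤ S.F r := by
  rcases hr.eq_or_lt with rfl | h
  · exact hΨ.F_zero.ge
  · exact (hΨ.F_pos r h).le

theorem F_mono (hΨ : S.DissipationAssumptions) {r s : ℝ} (hr : 0 ≤ r) (hrs : r ≤ s) :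
    S.F r ≤ S.F s := by
  rcases hr.eq_or_lt with rfl | h
  · rw [hΨ.F_zero]; exact hΨ.F_nonneg hrs
  have hs : 0 < s := h.trans_le hrs
  have h1 := hΨ.F_convex.2 (mem_Ici.2 le_rfl) (mem_Ici.2 hs.le)
    (show 0 ≤ 1 - r / s by rw [sub_nonneg, div_le_one hs]; exact hrs)
    (show 0 ≤ r / s by positivity) (by ring)
  rw [smul_zero, zero_add, smul_eq_mul, smul_eq_mul, smul_eq_mul, hΨ.F_zero, mul_zero, zero_add,
    div_mul_cancel₀ _ hs.ne'] at h1
  exact h1.trans (mul_le_of_le_one_left (hΨ.F_nonneg hs.le) ((div_le_one hs).2 hrs))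

theorem exists_F_le (hΨ : S.DissipationAssumptions) {c : ℝ} (hc : 0 < c) :
    ∃ b > 0, S.F b ≤ c * b := by
  have h1 : HasDerivWithinAt S.F 0 (Ici 0) 0 := by
    have := (hΨ.F_contDiff.differentiableOn one_ne_zero 0 (mem_Ici.2 le_rfl)).hasDerivWithinAt
    rwa [hΨ.F_deriv_zero] at this
  have h2 := (hasDerivWithinAt_iff_isLittleO.1 h1).def hc
  have h3 : ∀ᶠ b in 𝓝[>] (0 : ℝ), S.F b ≤ c * b := by
    filter_upwards [h2.filter_mono (nhdsWithin_mono 0 Ioi_subset_Ici_self), self_mem_nhdsWithin]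
      with b hb hb0
    have hb0' : (0 : ℝ) < b := hb0
    simp only [hΨ.F_zero, sub_zero, smul_zero, Real.norm_eq_abs, abs_of_pos hb0'] at hb
    exact (le_abs_self _).trans hb
  obtain ⟨b, hb, hb0⟩ := (h3.and self_mem_nhdsWithin).exists
  exact ⟨b, hb0, hb⟩

theorem exists_le_F (hΨ : S.DissipationAssumptions) (M : ℝ) :
    ∃ R > 0, ∀ r ≥ R, M * r ≤ S.F r := by
  obtain ⟨r₀, h1, h2⟩ := ((hΨ.F_superlinear.eventually_ge_atTop (2 * max M 0)).and
    (eventually_gt_atTop 0)).exists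
  refine ⟨2 * r₀, by linarith, fun r hr => ?_⟩
  have hM : 0 ≤ max M 0 := le_max_right _ _
  have hd : HasDerivAt S.F (derivWithin S.F (Ici 0) r₀) r₀ :=
    ((hΨ.F_contDiff.differentiableOn one_ne_zero r₀ h2.le).hasDerivWithinAt).hasDerivAt
      (Ici_mem_nhds h2)
  have h3 := hΨ.F_convex.le_slope_of_hasDerivAt (mem_Ici.2 h2.le)
    (mem_Ici.2 (by linarith : (0 : ℝ) ≤ r)) (by linarith) hd
  rw [slope_def_field, le_div_iff₀ (by linarith)] at h3
  have h4 := hΨ.F_nonneg h2.le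
  have h5 : 2 * max M 0 * (r / 2) ≤ derivWithin S.F (Ici 0) r₀ * (r - r₀) := by
    apply mul_le_mul h1 (by linarith) (by linarith) (by linarith)
  have h6 : M * r ≤ max M 0 * r := by
    apply mul_le_mul_of_nonneg_right (le_max_left _ _) (by linarith)
  linarith

/-- Here `y` is a subgradient of F at `a`. Since F(b) = o(b) at 0, choose `b` with `F b ≤ c b / 2`;
a subgradient of size at least `c` at some `a < b / 2` would lift the tangent above F at `b`. Thus a
non-negligible slope forces a non-negligible viscous speed. -/
theorem exists_lower_of_slope (hΨ : S.DissipationAssumptions) {c : ℝ} (hc : 0 < c) :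
    ∃ r > 0, ∀ a y : ℝ, 0 ≤ a → c ≤ y → (∀ b, 0 ≤ b → S.F a + y * (b - a) ≤ S.F b) → r ≤ a := by
  obtain ⟨b, hb, hF⟩ := hΨ.exists_F_le (half_pos hc)
  refine ⟨b / 2, half_pos hb, fun a y ha hy h => ?_⟩
  by_contra hcon
  have h1 := h b hb.le
  have h2 := hΨ.F_nonneg ha
  have h3 : c * (b - a) ≤ y * (b - a) := by
    apply mul_le_mul_of_nonneg_right hy; linarith
  nlinarith

theorem convexOn_viscous (hΨ : S.DissipationAssumptions) {l : ℝ} (hl : 0 < l) (w : V) :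
    ConvexOn ℝ univ (fun v => l * S.F (‖v - w‖ / l)) := by
  refine ⟨convex_univ, fun x _ y _ a b ha hb hab => ?_⟩
  have h1 : ‖a • x + b • y - w‖ ≤ a * ‖x - w‖ + b * ‖y - w‖ := by
    have : a • x + b • y - w = a • (x - w) + b • (y - w) := by
      have : w = (a + b) • w := by rw [hab, one_smul]
      nth_rewrite 1 [this]
      module
    rw [this]
    refine (norm_add_le _ _).trans ?_
    rw [norm_smul, norm_smul, Real.norm_of_nonneg ha, Real.norm_of_nonneg hb]
  have h2 : S.F (‖a • x + b • y - w‖ / l) ≤ S.F (a * (‖x - w‖ / l) + b * (‖y - w‖ / l)) := by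
    refine hΨ.F_mono (by positivity) ?_
    rw [mul_div_assoc', mul_div_assoc', ← add_div]
    gcongr
  have h3 := hΨ.F_convex.2 (mem_Ici.2 (show 0 ≤ ‖x - w‖ / l by positivity))
    (mem_Ici.2 (show 0 ≤ ‖y - w‖ / l by positivity)) ha hb hab
  simp only [smul_eq_mul] at h3 ⊢
  nlinarith

theorem continuous_viscous (hΨ : S.DissipationAssumptions) {l : ℝ} (hl : 0 < l) (w : V) :
    Continuous (fun v => l * S.F (‖v - w‖ / l)) := by
  refine continuous_const.mul (hΨ.F_contDiff.continuousOn.comp_continuous (by fun_prop)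
    fun v => mem_Ici.2 (by positivity))

theorem convexOn_psi_sub (hΨ : S.DissipationAssumptions) (w : V) :
    ConvexOn ℝ univ (fun v => S.Ψ (v - w)) :=
  hΨ.psi_convex.comp_affineMap (AffineMap.id ℝ V - AffineMap.const ℝ V w)

/-- By homogeneity of Ψ, the step problem depends on `τ` and `ε` only through `τ / ε`. -/
theorem mul_viscousPotential (hΨ : S.DissipationAssumptions) {τ ε : ℝ} (hτ : 0 < τ) (hε : 0 < ε)
    (v : V) : τ * S.viscousPotential ε (τ⁻¹ • v)
      = S.Ψ v + τ / ε * S.F (‖v‖ / (τ / ε)) := by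
  rw [viscousPotential, Φ, hΨ.psi_homogeneous _ _ (inv_pos.2 hτ).le, norm_smul, norm_smul,
    Real.norm_of_nonneg hε.le, Real.norm_of_nonneg (inv_pos.2 hτ).le, mul_add, ← mul_assoc,
    mul_inv_cancel₀ hτ.ne', one_mul, ← mul_assoc, ← div_eq_mul_inv]
  congr 3
  field_simp

end DissipationAssumptions

theorem IsDiscreteSolution.step {τ ε : ℝ} {U : ℕ → V} (hU : S.IsDiscreteSolution τ ε U)
    (hΨ : S.DissipationAssumptions) (hD : S.D.Nonempty) (hτ : 0 < τ) (hε : 0 < ε) {n : ℕ}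
    (hn : n < ⌈S.T / τ⌉₊) :
    U (n + 1) ∈ S.D ∧ ∀ v ∈ S.D,
      S.Ψ (U (n + 1) - U n) + τ / ε * S.F (‖U (n + 1) - U n‖ / (τ / ε))
        + S.energy (min (((n + 1 : ℕ) : ℝ) * τ) S.T) (U (n + 1))
      ≤ S.Ψ (v - U n) + τ / ε * S.F (‖v - U n‖ / (τ / ε))
        + S.energy (min (((n + 1 : ℕ) : ℝ) * τ) S.T) v := by
  have h := hU n hn
  simp only [isMinOn_univ_iff, hΨ.mul_viscousPotential hτ hε] at h
  have hmem : U (n + 1) ∈ S.D := by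
    obtain ⟨v, hv⟩ := hD
    by_contra hcon
    have h1 := h v
    rw [extEnergy, extEnergy, if_neg hcon, if_pos hv, EReal.coe_add_top, ← EReal.coe_add,
      top_le_iff] at h1
    exact EReal.coe_ne_top _ h1
  refine ⟨hmem, fun v hv => ?_⟩
  have h1 := h v
  rw [extEnergy, extEnergy, if_pos hmem, if_pos hv, ← EReal.coe_add, ← EReal.coe_add,
    EReal.coe_le_coe_iff] at h1
  exact h1

/-- The discrete Euler-Lagrange equation. The functional `ξ + z` is minus a subgradient of the
viscous potential at the increment. -/
theorem IsDiscreteSolution.exists_subdiff {τ ε : ℝ} {U : ℕ → V}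
    (hU : S.IsDiscreteSolution τ ε U) (hΨ : S.DissipationAssumptions) (hE : S.EnergyAssumptions)
    (hT : 0 < S.T) (hD : S.D.Nonempty) (hτ : 0 < τ) (hε : 0 < ε) {n : ℕ} (hn : n < ⌈S.T / τ⌉₊) :
    ∃ ξ ∈ S.frechetSubdiff (min (((n + 1 : ℕ) : ℝ) * τ) S.T) (U (n + 1)), ∃ z ∈ S.Kstar,
      S.Ψ (U (n + 1) - U n) + ‖ξ + z‖ * ‖U (n + 1) - U n‖ ≤ ξ (U n - U (n + 1)) ∧
      ∀ b, 0 ≤ b → S.F (‖U (n + 1) - U n‖ / (τ / ε))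
        + ‖ξ + z‖ * (b - ‖U (n + 1) - U n‖ / (τ / ε)) ≤ S.F b := by
  obtain ⟨hmem, hmin⟩ := hU.step hΨ hD hτ hε hn
  set x := U (n + 1)
  set w := U n
  set l := τ / ε with hl
  have hl0 : 0 < l := div_pos hτ hε
  have ht : min (((n + 1 : ℕ) : ℝ) * τ) S.T ∈ Icc 0 S.T :=
    ⟨le_min (by positivity) hT.le, min_le_right _ _⟩
  obtain ⟨z, η, hfr, hz, hη⟩ := hE.exists_euler hΨ (hΨ.convexOn_psi_sub w)
    (hΨ.psi_continuous.comp (by fun_prop)) (hΨ.convexOn_viscous hl0 w) (hΨ.continuous_viscous hl0 w)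
    ht hmem hmin
  have hzK : z ∈ S.Kstar := fun v => by
    have h1 := hz (x + v)
    rw [add_sub_cancel_left] at h1
    have h2 := hΨ.psi_add_le (x - w) v
    rw [show x + v - w = (x - w) + v by abel] at h1
    linarith
  -- A subgradient of a positively homogeneous function is exact at its base point; testing at `w`
  -- gives this half of the identity.
  have hz1 : S.Ψ (x - w) ≤ z (x - w) := by
    have h1 := hz w
    rw [sub_self, hΨ.psi_zero, ← neg_sub x w, map_neg] at h1
    linarith
  have hsum : -(z + η) + z = -η := by abel
  -- comparison with all points at a given distance from `w`
  have key : ∀ b, 0 ≤ b → l * S.F (‖x - w‖ / l) + ‖η‖ * (l * b) - η (x - w) ≤ l * S.F b := by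
    intro b hb
    rcases hb.eq_or_lt with rfl | hb
    · have h1 := hη w
      rw [sub_self, norm_zero, zero_div, ← neg_sub x w, map_neg] at h1
      rw [mul_zero, mul_zero]; linarith
    have h2 : ‖η‖ ≤ (l * S.F b - l * S.F (‖x - w‖ / l) + η (x - w)) / (l * b) := by
      refine norm_le_of_approx_subgradient (x := (0 : V)) (by positivity) fun v hv => ?_
      rw [sub_zero] at hv ⊢
      have h1 := hη (w + v)
      have h3 : l * S.F (‖w + v - w‖ / l) ≤ l * S.F b := by
        refine mul_le_mul_of_nonneg_left (hΨ.F_mono (by positivity) ?_) hl0.le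
        rw [add_sub_cancel_left, div_le_iff₀ hl0]; linarith
      rw [show w + v - x = v - (x - w) by abel, map_sub] at h1
      linarith
    rw [le_div_iff₀ (by positivity)] at h2
    linarith
  -- With `b` the actual speed the two F-terms cancel, so `η` attains its norm on the increment:
  -- radial functions have norming subgradients.
  have hηδ : ‖η‖ * ‖x - w‖ ≤ η (x - w) := by
    have h1 := key (‖x - w‖ / l) (by positivity)
    rw [mul_div_cancel₀ _ hl0.ne'] at h1
    linarith
  refine ⟨-(z + η), hfr, z, hzK, ?_, fun b hb => ?_⟩
  · rw [hsum, norm_neg, ← neg_sub x w, map_neg, neg_apply, neg_neg, add_apply]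
    linarith
  · rw [hsum, norm_neg]
    have h1 := key b hb
    have h2 : η (x - w) ≤ ‖η‖ * ‖x - w‖ := (le_abs_self _).trans (η.le_opNorm _)
    have h3 : l * (S.F (‖x - w‖ / l) + ‖η‖ * (b - ‖x - w‖ / l))
        = l * S.F (‖x - w‖ / l) + ‖η‖ * (l * b) - ‖η‖ * ‖x - w‖ := by
      field_simp
      ring
    have h4 : l * (S.F (‖x - w‖ / l) + ‖η‖ * (b - ‖x - w‖ / l)) ≤ l * S.F b := by
      rw [h3]; linarith
    exact le_of_mul_le_mul_left h4 hl0

end RIS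

end BalancedViscosity

/-! ### A crude chain rule on intervals of positive slope. -/

namespace BalancedViscosity

section ChainRuleTools

variable {V : Type*} [NormedAddCommGroup V] [NormedSpace ℝ V]

/-- If `e` exceeded `(∫ W + κ) / ∫ h` everywhere, integrating would contradict `e h ≤ W`. The
relation `e h ≤ W` is expressed through real thresholds, so `e` may take the value ∞ and no
measurability of it is needed. -/
theorem exists_small_of_weighted_integral {e : ℝ → ℝ≥0∞} {h W : ℝ → ℝ} {a b κ : ℝ} (hab : a < b)
    (hh : IntervalIntegrable h volume a b) (hW : IntervalIntegrable W volume a b)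
    (hW0 : ∀ r, 0 ≤ W r) (hpos : 0 < ∫ r in a..b, h r) (hκ : 0 < κ)
    (he : ∀ y : ℝ, 0 ≤ y → ∀ᵐ r, r ∈ Ioo a b → ENNReal.ofReal y ≤ e r → y * h r ≤ W r) :
    ∃ s ∈ Ioo a b, e s < ⊤ ∧ (e s).toReal * (∫ r in a..b, h r) ≤ (∫ r in a..b, W r) + κ := by
  set l := ∫ r in a..b, h r
  set I := ∫ r in a..b, W r
  have hI : 0 ≤ I := intervalIntegral.integral_nonneg hab.le fun r _ => hW0 r
  by_contra hcon
  push Not at hcon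
  set y := (I + κ) / l with hy
  have hy0 : 0 ≤ y := by positivity
  have h1 : ∀ s ∈ Ioo a b, ENNReal.ofReal y ≤ e s := by
    intro s hs
    rcases eq_or_ne (e s) ⊤ with h | h
    · rw [h]; exact le_top
    · refine (ENNReal.ofReal_le_iff_le_toReal h).2 ?_
      rw [hy, div_le_iff₀ hpos]
      exact (hcon s hs h.lt_top).le
  have h2 : ∫ r in a..b, y * h r ≤ I := by
    refine intervalIntegral.integral_mono_ae_restrict hab.le (hh.const_mul y) hW ?_
    rw [← restrict_Ioo_eq_restrict_Icc]
    refine (ae_restrict_iff' measurableSet_Ioo).2 ?_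
    filter_upwards [he y hy0] with r hr hr'
    exact hr hr' (h1 r hr')
  rw [intervalIntegral.integral_const_mul, hy, div_mul_cancel₀ _ hpos.ne'] at h2
  linarith

/-- If `e` is a one-sided slope of `f` along `θ`, then `f` decreases by at most twice the integral
of `e ‖θ'‖`. -/
theorem le_add_two_mul_integral_of_slope {θ : ℝ → V} {f Q : ℝ → ℝ} {e : ℝ → ℝ≥0∞} {h W : ℝ → ℝ}
    {c d : ℝ} (hcd : c ≤ d)
    (hh : IntervalIntegrable h volume c d) (hh0 : ∀ r, 0 ≤ h r)
    (hW : IntervalIntegrable W volume c d) (hW0 : ∀ r, 0 ≤ W r)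
    (he : ∀ y : ℝ, 0 ≤ y → ∀ᵐ r, r ∈ Ioo c d → ENNReal.ofReal y ≤ e r → y * h r ≤ W r)
    (hθ : ∀ s t, c ≤ s → s ≤ t → t ≤ d → ‖θ t - θ s‖ ≤ ∫ r in s..t, h r)
    (hQ : ∀ s t, c ≤ s → s ≤ t → t ≤ d → Q s ≤ Q t)
    (hf : ∀ s t, c ≤ s → s ≤ t → t ≤ d → e s < ⊤ →
      f s ≤ f t + (Q t - Q s) + (e s).toReal * ‖θ t - θ s‖)
    (hlsc : ∀ κ > 0, ∃ ρ > 0, ∀ s ∈ Icc c d, ‖θ s - θ c‖ < ρ → f c ≤ f s + κ) :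
    f c ≤ f d + (Q d - Q c) + 2 * ∫ r in c..d, W r := by
  have hintegrable : ∀ {g : ℝ → ℝ}, IntervalIntegrable g volume c d → ∀ s t, c ≤ s → s ≤ t → t ≤ d →
      IntervalIntegrable g volume s t := fun hg s t h1 h2 h3 =>
    hg.mono_set (by rw [uIcc_of_le h2, uIcc_of_le hcd]; exact Icc_subset_Icc h1 h3)
  have hWnn : ∀ s t, s ≤ t → 0 ≤ ∫ r in s..t, W r := fun s t hst =>
    intervalIntegral.integral_nonneg hst fun r _ => hW0 r
  refine le_of_forall_pos_le_add fun κ₀ hκ₀ => ?_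
  set κ := κ₀ / 3 with hκdef
  have hκ : 0 < κ := by positivity
  obtain ⟨ρ, hρ, hl⟩ := hlsc κ hκ
  set Λ := ∫ r in c..d, h r with hΛ
  have hΛ0 : 0 ≤ Λ := intervalIntegral.integral_nonneg hcd fun r _ => hh0 r
  -- With zero length the curve does not move in norm, and semicontinuity at `c` alone gives the
  -- bound.
  rcases hΛ0.eq_or_lt with hz | hΛpos
  · have h1 : ‖θ d - θ c‖ ≤ 0 := by rw [hz]; exact hθ c d le_rfl hcd le_rfl
    have h2 := hl d ⟨hcd, le_rfl⟩ (h1.trans_lt hρ)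
    have h3 := hQ c d le_rfl hcd le_rfl
    linarith [hWnn c d hcd]
  set lam : ℝ → ℝ := fun r => ∫ x in c..r, h x with hlam
  have hlamadd : ∀ s t, c ≤ s → s ≤ t → t ≤ d → ∫ r in s..t, h r = lam t - lam s := by
    intro s t h1 h2 h3
    have := intervalIntegral.integral_add_adjacent_intervals (hintegrable hh c s le_rfl h1 (h2.trans h3))
      (hintegrable hh s t h1 h2 h3)
    simp only [hlam]; linarith
  have hlamcont : ContinuousOn lam (Icc c d) := by
    rw [← uIcc_of_le hcd]
    exact intervalIntegral.continuousOn_primitive_interval'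
      hh (by simp)
  have hlammono : ∀ s t, c ≤ s → s ≤ t → t ≤ d → lam s ≤ lam t := by
    intro s t h1 h2 h3
    have := hlamadd s t h1 h2 h3
    have h4 : 0 ≤ ∫ r in s..t, h r := intervalIntegral.integral_nonneg h2 fun r _ => hh0 r
    linarith
  have hlamc : lam c = 0 := by simp [hlam]
  -- The interval is cut into `N` cells of equal `h`-length `l < ρ`; the nodes come from the
  -- intermediate value theorem for the primitive of `h`.
  obtain ⟨N, hN⟩ := exists_nat_gt (Λ / ρ)
  have hN0 : (0 : ℝ) < N := lt_of_le_of_lt (by positivity) hN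
  have hNnat : 0 < N := by exact_mod_cast hN0
  set l := Λ / N with hldef
  have hlpos : 0 < l := by positivity
  have hlρ : l < ρ := by
    rw [hldef, div_lt_iff₀ hN0]; rw [div_lt_iff₀ hρ] at hN; linarith
  have hnode : ∀ i : ℕ, ∃ r ∈ Icc c d, i ≤ N → lam r = i * l := by
    intro i
    by_cases hi : i ≤ N
    · have hmem : (i : ℝ) * l ∈ Icc (lam c) (lam d) := by
        rw [hlamc]
        refine ⟨by positivity, ?_⟩
        have : (i : ℝ) ≤ N := by exact_mod_cast hi
        calc (i : ℝ) * l ≤ N * l := by gcongr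
          _ = lam d := by rw [hldef, mul_div_cancel₀ _ hN0.ne']
      obtain ⟨r, hr, hr'⟩ := intermediate_value_Icc hcd hlamcont hmem
      exact ⟨r, hr, fun _ => hr'⟩
    · exact ⟨c, ⟨le_rfl, hcd⟩, fun h => absurd h hi⟩
  choose r hr hrl using hnode
  have hrlt : ∀ i, i + 1 ≤ N → r i < r (i + 1) := by
    intro i hi
    by_contra hcon
    have h1 := hlammono _ _ (hr (i + 1)).1 (not_lt.1 hcon) (hr i).2
    rw [hrl i (by omega), hrl (i + 1) hi] at h1
    push_cast at h1
    linarith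
  have hcell : ∀ i, i + 1 ≤ N → ∫ x in r i..r (i + 1), h x = l := by
    intro i hi
    rw [hlamadd _ _ (hr i).1 (hrlt i hi).le (hr _).2, hrl i (by omega), hrl (i + 1) hi]
    push_cast; ring
  -- In each cell a point is picked where the slope is finite and at most about its average, so that
  -- `e(s_i) l` is bounded by the cell integral of `W`.
  have hpick : ∀ i, ∃ s, i + 1 ≤ N → s ∈ Ioo (r i) (r (i + 1)) ∧ e s < ⊤ ∧
      (e s).toReal * l ≤ (∫ x in r i..r (i + 1), W x) + κ / N := by
    intro i
    by_cases hi : i + 1 ≤ N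
    · obtain ⟨s, hs, h1, h2⟩ := exists_small_of_weighted_integral (e := e) (hrlt i hi)
        (hintegrable hh _ _ (hr i).1 (hrlt i hi).le (hr _).2)
        (hintegrable hW _ _ (hr i).1 (hrlt i hi).le (hr _).2) hW0
        (by rw [hcell i hi]; exact hlpos) (show 0 < κ / N by positivity)
        (fun y hy => (he y hy).mono fun x hx hx' =>
          hx ⟨(hr i).1.trans_lt hx'.1, hx'.2.trans_le (hr _).2⟩)
      rw [hcell i hi] at h2
      exact ⟨s, fun _ => ⟨hs, h1, h2⟩⟩
    · exact ⟨c, fun h => absurd h hi⟩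
  choose s hs using hpick
  have hsmem : ∀ i, i + 1 ≤ N → s i ∈ Icc c d := fun i hi =>
    ⟨(hr i).1.trans (hs i hi).1.1.le, (hs i hi).1.2.le.trans (hr _).2⟩
  have hlam1 : ∀ i, i + 1 ≤ N → i * l ≤ lam (s i) ∧ lam (s i) ≤ (i + 1) * l := by
    intro i hi
    have h1 := hlammono _ _ (hr i).1 (hs i hi).1.1.le (hsmem i hi).2
    have h2 := hlammono _ _ (hsmem i hi).1 (hs i hi).1.2.le (hr _).2
    rw [hrl i (by omega)] at h1
    rw [hrl (i + 1) hi] at h2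
    push_cast at h2
    exact ⟨h1, h2⟩
  -- Consecutive picked points may be up to two cells apart, hence the factor 2. It is harmless,
  -- since the estimate only serves as an integrable majorant.
  have hchain : ∀ i, i + 1 ≤ N →
      f (s 0) ≤ f (s i) + (Q (s i) - Q (s 0)) + 2 * (∫ x in r 0..r i, W x) + 2 * κ * (i / N) := by
    intro i
    induction i with
    | zero => intro _; simp
    | succ i ih =>
      intro hi
      have h0 := ih (by omega)
      obtain ⟨hsi, hei, hei'⟩ := hs i (by omega)
      have hlt : s i ≤ s (i + 1) := (hsi.2.trans (hs (i + 1) hi).1.1).le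
      have h1 := hf (s i) (s (i + 1)) (hsmem i (by omega)).1 hlt (hsmem (i + 1) hi).2 hei
      have h2 := hθ (s i) (s (i + 1)) (hsmem i (by omega)).1 hlt (hsmem (i + 1) hi).2
      rw [hlamadd _ _ (hsmem i (by omega)).1 hlt (hsmem (i + 1) hi).2] at h2
      have h3 : ‖θ (s (i + 1)) - θ (s i)‖ ≤ 2 * l := by
        have h4 := (hlam1 (i + 1) hi).2
        have h5 := (hlam1 i (by omega)).1
        push_cast at h4
        linarith
      have h4 : (e (s i)).toReal * ‖θ (s (i + 1)) - θ (s i)‖ ≤ (e (s i)).toReal * (2 * l) :=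
        mul_le_mul_of_nonneg_left h3 ENNReal.toReal_nonneg
      have hr0 : r 0 ≤ r i := by
        by_contra hcon
        have h5 := hlammono _ _ (hr i).1 (not_le.1 hcon).le (hr 0).2
        rw [hrl i (by omega), hrl 0 (by omega)] at h5
        have h6 : (i : ℝ) * l ≤ 0 := by simpa using h5
        have h7 : i = 0 := by
          by_contra h8
          have : (0 : ℝ) < i := by exact_mod_cast Nat.pos_of_ne_zero h8
          nlinarith
        rw [h7] at hcon
        exact hcon le_rfl
      have h5 := intervalIntegral.integral_add_adjacent_intervals
        (hintegrable hW (r 0) (r i) (hr 0).1 hr0 (hr i).2)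
        (hintegrable hW (r i) (r (i + 1)) (hr i).1 (hrlt i (by omega)).le (hr _).2)
      have h6 : 2 * κ * (((i + 1 : ℕ) : ℝ) / N) = 2 * κ * (i / N) + 2 * (κ / N) := by
        push_cast; ring
      rw [h6, ← h5]
      linarith
  obtain ⟨M, rfl⟩ : ∃ M, N = M + 1 := ⟨N - 1, by omega⟩
  have hM := hchain M le_rfl
  obtain ⟨hsM, heM, heM'⟩ := hs M le_rfl
  have h1 := hf (s M) d (hsmem M le_rfl).1 (hsmem M le_rfl).2 le_rfl heM
  have h2 := hθ (s M) d (hsmem M le_rfl).1 (hsmem M le_rfl).2 le_rfl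
  rw [hlamadd _ _ (hsmem M le_rfl).1 (hsmem M le_rfl).2 le_rfl] at h2
  have h3 : ‖θ d - θ (s M)‖ ≤ l := by
    have h4 := (hlam1 M le_rfl).1
    have h5 : lam d = ((M + 1 : ℕ) : ℝ) * l := by rw [hldef, mul_div_cancel₀ _ hN0.ne']
    push_cast at h5
    linarith
  have h4 : (e (s M)).toReal * ‖θ d - θ (s M)‖ ≤ (e (s M)).toReal * l :=
    mul_le_mul_of_nonneg_left h3 ENNReal.toReal_nonneg
  -- The slope at `c` itself may be infinite, so `c` is joined to the first picked point by lower
  -- semicontinuity of `f`.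
  have h5 := hl (s 0) (hsmem 0 (by omega)) (by
    refine lt_of_le_of_lt ?_ hlρ
    have h6 := hθ c (s 0) le_rfl (hsmem 0 (by omega)).1 (hsmem 0 (by omega)).2
    rw [hlamadd _ _ le_rfl (hsmem 0 (by omega)).1 (hsmem 0 (by omega)).2, hlamc] at h6
    have h7 := (hlam1 0 (by omega)).2
    simp only [Nat.cast_zero, zero_add, one_mul] at h7
    linarith)
  have hr0M : r 0 ≤ r M := by
    by_contra hcon
    have h5 := hlammono _ _ (hr M).1 (not_le.1 hcon).le (hr 0).2
    rw [hrl M (by omega), hrl 0 (by omega)] at h5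
    have h6 : (M : ℝ) * l ≤ 0 := by simpa using h5
    have h7 : M = 0 := by
      by_contra h8
      have : (0 : ℝ) < M := by exact_mod_cast Nat.pos_of_ne_zero h8
      nlinarith
    rw [h7] at hcon
    exact hcon le_rfl
  have h6 := intervalIntegral.integral_add_adjacent_intervals
    (hintegrable hW (r 0) (r M) (hr 0).1 hr0M (hr M).2)
    (hintegrable hW (r M) (r (M + 1)) (hr M).1 (hrlt M le_rfl).le (hr _).2)
  have h7 := intervalIntegral.integral_add_adjacent_intervals
    (hintegrable hW c (r 0) le_rfl (hr 0).1 (hr 0).2)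
    (hintegrable hW (r 0) (r (M + 1)) (hr 0).1 (hr0M.trans (hrlt M le_rfl).le) (hr _).2)
  have h8 := intervalIntegral.integral_add_adjacent_intervals
    (hintegrable hW c (r (M + 1)) le_rfl (hr _).1 (hr _).2)
    (hintegrable hW (r (M + 1)) d (hr _).1 (hr _).2 le_rfl)
  have h9 := hWnn c (r 0) (hr 0).1
  have h10 := hWnn (r (M + 1)) d (hr _).2
  have h11 := hWnn (r M) (r (M + 1)) (hrlt M le_rfl).le
  have h12 := hQ c (s 0) le_rfl (hsmem 0 (by omega)).1 (hsmem 0 (by omega)).2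
  have h13 : 2 * κ * ((M : ℝ) / ((M + 1 : ℕ) : ℝ)) + κ / ((M + 1 : ℕ) : ℝ) ≤ 2 * κ := by
    have hM1 : (0 : ℝ) < ((M + 1 : ℕ) : ℝ) := by positivity
    rw [mul_div_assoc', ← add_div, div_le_iff₀ hM1]
    push_cast
    nlinarith
  linarith

end ChainRuleTools

end BalancedViscosity

/-! ### Derivatives of gauges and regularity of transition curves. -/

namespace BalancedViscosity

section DerivativeTools

variable {V : Type*} [NormedAddCommGroup V] [NormedSpace ℝ V]

theorem deriv_le_of_eventually_slope_le {q B : ℝ → ℝ} {q' b r : ℝ} (hq : HasDerivAt q q' r)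
    (hB : Tendsto B (𝓝[>] r) (𝓝 b)) (h : ∀ᶠ s in 𝓝[>] r, q s - q r ≤ (s - r) * B s) : q' ≤ b := by
  have h1 := hq.hasDerivWithinAt (s := Ioi r)
  rw [hasDerivWithinAt_iff_tendsto_slope' (by simp)] at h1
  refine le_of_tendsto_of_tendsto h1 hB ?_
  filter_upwards [h, self_mem_nhdsWithin] with s hs hsr
  rw [slope_def_field, div_le_iff₀ (sub_pos.2 hsr)]
  linarith

theorem tendsto_gauge_slope {N : V → ℝ} (hN : Continuous N) {θ : ℝ → V} {r : ℝ}
    (hθ : DifferentiableAt ℝ θ r) :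
    Tendsto (fun s => N ((s - r)⁻¹ • (θ s - θ r))) (𝓝[>] r) (𝓝 (N (deriv θ r))) := by
  have h1 := hθ.hasDerivAt.hasDerivWithinAt (s := Ioi r)
  rw [hasDerivWithinAt_iff_tendsto_slope' (by simp)] at h1
  exact (hN.tendsto _).comp h1

theorem ofReal_le_metricDeriv {Ψ : V → ℝ} {θ : ℝ → V} {q κ : ℝ → ℝ} {q' r : ℝ}
    (hq : HasDerivAt q q' r) (hκ : Tendsto κ (𝓝[>] r) (𝓝 0)) (hκ0 : ∀ s, 0 ≤ κ s)
    (h : ∀ᶠ s in 𝓝[>] r, q s - q r ≤ (s - r) * ((1 + κ s) * Ψ ((s - r)⁻¹ • (θ s - θ r)))) :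
    ENNReal.ofReal q' ≤ metricDeriv Ψ θ r := by
  refine le_of_forall_gt fun M hM => ?_
  rcases eq_or_ne M ⊤ with rfl | hMt
  · exact ENNReal.ofReal_lt_top
  obtain ⟨M', hM1, hM2⟩ := exists_between hM
  have hM't : M' ≠ ⊤ := ne_top_of_lt hM2
  have h1 : ∀ᶠ x : ℝ in 𝓝[≠] 0, ENNReal.ofReal (Ψ (x⁻¹ • (θ (r + x) - θ r))) < M' :=
    eventually_lt_of_limsup_lt hM1
  have h2 : Tendsto (fun s => s - r) (𝓝[>] r) (𝓝[≠] 0) := by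
    refine tendsto_nhdsWithin_iff.2 ⟨?_, ?_⟩
    · have : Tendsto (fun s => s - r) (𝓝 r) (𝓝 (r - r)) := Continuous.tendsto (by fun_prop) r
      rw [sub_self] at this
      exact this.mono_left nhdsWithin_le_nhds
    · filter_upwards [self_mem_nhdsWithin] with s hs
      simpa [sub_eq_zero] using (ne_of_gt hs)
  have h3 := h2.eventually h1
  refine lt_of_le_of_lt ?_ hM2
  refine ENNReal.ofReal_le_of_le_toReal ?_
  have h4 : Tendsto (fun s => (1 + κ s) * M'.toReal) (𝓝[>] r) (𝓝 ((1 + 0) * M'.toReal)) :=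
    (hκ.const_add 1).mul_const _
  rw [add_zero, one_mul] at h4
  refine deriv_le_of_eventually_slope_le hq h4 ?_
  filter_upwards [h, h3, self_mem_nhdsWithin] with s hs1 hs2 hs3
  rw [add_sub_cancel] at hs2
  have h5 : Ψ ((s - r)⁻¹ • (θ s - θ r)) ≤ M'.toReal :=
    (ENNReal.ofReal_le_iff_le_toReal hM't).1 hs2.le
  refine hs1.trans (mul_le_mul_of_nonneg_left ?_ (sub_pos.2 hs3).le)
  exact mul_le_mul_of_nonneg_left h5 (by linarith [hκ0 s])

/-- Semicontinuity is only relative to `K`: a superlevel set in `K` is the trace on `K` of an open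
set. -/
theorem measurable_indicator_of_lowerSemicontinuousOn {X : Type*} [TopologicalSpace X]
    [MeasurableSpace X] [OpensMeasurableSpace X] {K : Set X} (hK : MeasurableSet K) {e : X → ℝ≥0∞}
    (he : LowerSemicontinuousOn e K) : Measurable (K.indicator e) := by
  refine measurable_of_Ioi fun c => ?_
  have : K.indicator e ⁻¹' Ioi c = K ∩ interior ({x | c < e x} ∪ Kᶜ) := by
    ext x
    by_cases hx : x ∈ K
    · simp only [mem_preimage, indicator_of_mem hx, mem_Ioi, mem_inter_iff, hx, true_and]
      constructor
      · intro h
        rw [mem_interior_iff_mem_nhds]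
        have h1 := he x hx c h
        rw [eventually_nhdsWithin_iff] at h1
        filter_upwards [h1] with y hy
        by_cases hyK : y ∈ K
        · exact Or.inl (hy hyK)
        · exact Or.inr hyK
      · intro h
        rcases interior_subset h with h | h
        · exact h
        · exact absurd hx h
    · simp [hx]
  rw [this]
  exact hK.inter isOpen_interior.measurableSet

end DerivativeTools

namespace RIS

variable {V : Type*} [NormedAddCommGroup V] [NormedSpace ℝ V] {S : RIS V}

/-- A transition curve at time `t` in `D_E`, with `m` controlling its `Ψ`-increments. -/
structure IsTransitionCurve (S : RIS V) (t E : ℝ) (m : ℝ → ℝ) (θ : ℝ → V) : Prop where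
  time : t ∈ Icc 0 S.T
  pos : 0 < E
  mem : ∀ r ∈ Icc (0 : ℝ) 1, θ r ∈ S.sublevel E
  nonneg : ∀ r, 0 ≤ m r
  integrable : IntervalIntegrable m volume 0 1
  le : ∀ s r, 0 ≤ s → s ≤ r → r ≤ 1 → S.Ψ (θ r - θ s) ≤ ∫ x in s..r, m x
  loc : IsACLocOn (S.unstableSet t θ) θ

theorem exists_isTransitionCurve (hΨ : S.DissipationAssumptions) {t : ℝ} (ht : t ∈ Icc 0 S.T)
    {x y : V} {θ : ℝ → V} (hθ : θ ∈ S.transitions t x y) :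
    ∃ E m, S.IsTransitionCurve t E m θ := by
  obtain ⟨⟨E, hE, hmem, m, h0, hintegrable, hle⟩, hloc, -, -⟩ := hθ
  refine ⟨E, m, ht, hE, hmem, h0,
    (intervalIntegrable_iff_integrableOn_Icc_of_le zero_le_one).2 hintegrable, fun s r h1 h2 h3 => ?_, hloc⟩
  rcases h2.eq_or_lt with rfl | h2
  · simp [hΨ.psi_zero]
  · exact hle s r h1 h2 h3

namespace IsTransitionCurve

variable {t E : ℝ} {m : ℝ → ℝ} {θ : ℝ → V}

theorem intervalIntegrable_of_le {g : ℝ → ℝ} (hg : IntervalIntegrable g volume 0 1) {s r : ℝ}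
    (h1 : 0 ≤ s) (h2 : s ≤ r) (h3 : r ≤ 1) : IntervalIntegrable g volume s r :=
  hg.mono_set (by rw [uIcc_of_le h2, uIcc_of_le zero_le_one]; exact Icc_subset_Icc h1 h3)

/-- Only Ψ-increments are controlled by `m`; norm continuity comes from `psi_modulus` on the compact
sublevel. -/
theorem continuousOn (h : S.IsTransitionCurve t E m θ) (hΨ : S.DissipationAssumptions)
    (hE : S.EnergyAssumptions) : ContinuousOn θ (Icc 0 1) := by
  have hcont : ContinuousOn (fun r => ∫ x in (0 : ℝ)..r, m x) (Icc 0 1) := by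
    rw [← uIcc_of_le (zero_le_one (α := ℝ))]
    exact intervalIntegral.continuousOn_primitive_interval' h.integrable (by simp)
  have hadd : ∀ s r, 0 ≤ s → s ≤ r → r ≤ 1 → S.Ψ (θ r - θ s) ≤
      (∫ x in (0 : ℝ)..r, m x) - ∫ x in (0 : ℝ)..s, m x := by
    intro s r h1 h2 h3
    have := intervalIntegral.integral_add_adjacent_intervals
      (intervalIntegrable_of_le h.integrable le_rfl h1 (h2.trans h3))
      (intervalIntegrable_of_le h.integrable h1 h2 h3)
    linarith [h.le s r h1 h2 h3]
  intro r hr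
  rw [Metric.continuousWithinAt_iff]
  intro δ hδ
  obtain ⟨ε, hε, hmod⟩ := hΨ.psi_modulus (hE.isCompact_sublevel h.pos) δ hδ
  obtain ⟨ρ, hρ, hd⟩ := Metric.continuousWithinAt_iff.1 (hcont r hr) ε hε
  refine ⟨ρ, hρ, fun s hs hsr => ?_⟩
  have h1 := abs_lt.1 (hd hs hsr)
  rcases le_total s r with h2 | h2
  · rw [dist_comm, dist_eq_norm]
    exact hmod _ (h.mem s hs) _ (h.mem r hr) (by linarith [hadd s r hs.1 h2 hr.2])
  · rw [dist_eq_norm]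
    exact hmod _ (h.mem r hr) _ (h.mem s hs) (by linarith [hadd r s hr.1 h2 hs.2])

theorem lowerSemicontinuousOn_slope (h : S.IsTransitionCurve t E m θ)
    (hΨ : S.DissipationAssumptions) (hE : S.EnergyAssumptions) :
    LowerSemicontinuousOn (fun r => S.slope t (θ r)) (Icc 0 1) := by
  intro r hr c hc
  have h1 := hE.lowerSemicontinuousOn_slope hΨ h.pos (t, θ r) ⟨h.time, h.mem r hr⟩ c hc
  refine (tendsto_nhdsWithin_iff.2 ⟨?_, ?_⟩ : Tendsto (fun s => (t, θ s)) (𝓝[Icc 0 1] r)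
    (𝓝[Icc 0 S.T ×ˢ S.sublevel E] (t, θ r))).eventually h1
  · exact tendsto_const_nhds.prodMk_nhds (h.continuousOn hΨ hE r hr)
  · filter_upwards [self_mem_nhdsWithin] with s hs using ⟨h.time, h.mem s hs⟩

theorem unstableSet_mem_nhdsWithin (h : S.IsTransitionCurve t E m θ)
    (hΨ : S.DissipationAssumptions) (hE : S.EnergyAssumptions) {r : ℝ}
    (hr : r ∈ S.unstableSet t θ) : ∃ ρ > 0, ∀ s ∈ Icc (0 : ℝ) 1, |s - r| < ρ →
      s ∈ S.unstableSet t θ := by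
  have h1 := h.lowerSemicontinuousOn_slope hΨ hE r hr.1 0 hr.2
  obtain ⟨ρ, hρ, hd⟩ := Metric.mem_nhdsWithin_iff.1 h1
  exact ⟨ρ, hρ, fun s hs hsr => ⟨hs, hd ⟨by rwa [Metric.mem_ball, Real.dist_eq], hs⟩⟩⟩

theorem measurable_slope (h : S.IsTransitionCurve t E m θ)
    (hΨ : S.DissipationAssumptions) (hE : S.EnergyAssumptions) :
    Measurable ((Icc (0 : ℝ) 1).indicator fun r => S.slope t (θ r)) :=
  measurable_indicator_of_lowerSemicontinuousOn measurableSet_Icc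
    (h.lowerSemicontinuousOn_slope hΨ hE)

theorem measurableSet_unstableSet (h : S.IsTransitionCurve t E m θ)
    (hΨ : S.DissipationAssumptions) (hE : S.EnergyAssumptions) :
    MeasurableSet (S.unstableSet t θ) := by
  have h1 := h.measurable_slope hΨ hE (measurableSet_Ioi (a := (0 : ℝ≥0∞)))
  convert h1 using 1
  ext r
  by_cases hr : r ∈ Icc (0 : ℝ) 1
  · rw [mem_preimage, indicator_of_mem hr]
    exact and_iff_right hr
  · rw [mem_preimage, indicator_of_notMem hr]
    simpa using fun h2 : r ∈ S.unstableSet t θ => hr h2.1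

/-- The unstable set is relatively open in `[0,1]`, so its interior points lie in countably many
rational intervals contained in it, and the Radon–Nikodým property applies on each. -/
theorem ae_differentiableAt (h : S.IsTransitionCurve t E m θ) (hRN : HasRadonNikodymProperty V)
    (hΨ : S.DissipationAssumptions) (hE : S.EnergyAssumptions) :
    ∀ᵐ r, r ∈ Ioo (0 : ℝ) 1 → r ∈ S.unstableSet t θ → DifferentiableAt ℝ θ r := by
  have h1 : ∀ p : ℚ × ℚ, ∀ᵐ r, Icc (p.1 : ℝ) p.2 ⊆ S.unstableSet t θ → r ∈ Ioo (p.1 : ℝ) p.2 →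
      DifferentiableAt ℝ θ r := by
    intro p
    by_cases hp : Icc (p.1 : ℝ) p.2 ⊆ S.unstableSet t θ ∧ (p.1 : ℝ) ≤ p.2
    · have h2 := hRN _ _ θ (h.loc p.1 p.2 hp.2 hp.1)
      rw [ae_restrict_iff' measurableSet_Ioo] at h2
      filter_upwards [h2] with r hr _ hr' using hr hr'
    · refine Eventually.of_forall fun r h2 hr => absurd ⟨h2, (hr.1.trans hr.2).le⟩ hp
  filter_upwards [ae_all_iff.2 h1] with r hr hr01 hrG
  obtain ⟨ρ, hρ, hd⟩ := h.unstableSet_mem_nhdsWithin hΨ hE hrG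
  obtain ⟨p, hp1, hp2⟩ := exists_rat_btwn (show max 0 (r - ρ) < r from
    max_lt hr01.1 (by linarith))
  obtain ⟨q, hq1, hq2⟩ := exists_rat_btwn (show r < min 1 (r + ρ) from
    lt_min hr01.2 (by linarith))
  refine hr (p, q) (fun s hs => hd s ⟨?_, ?_⟩ ?_) ⟨hp2, hq1⟩
  · exact (((le_max_left _ _).trans_lt hp1).le.trans hs.1)
  · exact hs.2.trans (hq2.le.trans (min_le_left _ _))
  · rw [abs_lt]
    have h3 := (le_max_right 0 (r - ρ)).trans_lt hp1
    have h4 := hq2.trans_le (min_le_right 1 (r + ρ))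
    simp only [mem_Icc] at hs
    constructor <;> linarith [hs.1, hs.2]

/-- The `Ψ`-length of a transition is bounded by its Finsler length. -/
theorem ofReal_psi_le (h : S.IsTransitionCurve t E m θ) (hRN : HasRadonNikodymProperty V)
    (hΨ : S.DissipationAssumptions) (hE : S.EnergyAssumptions) :
    ENNReal.ofReal (S.Ψ (θ 1 - θ 0)) ≤ ∫⁻ r in Icc (0 : ℝ) 1, S.finslerDensity t θ r := by
  have h1 := ofReal_sub_le_lintegral_of_deriv_le (q := fun r => S.Ψ (θ r - θ 0)) (w := m)
    (ρ := S.finslerDensity t θ) (zero_le_one) h.integrable (fun s r h1 h2 h3 => by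
      have := hΨ.psi_triangle (θ 0) (θ s) (θ r)
      linarith [h.le s r h1 h2 h3]) ?_
  · simpa [hΨ.psi_zero] using h1
  filter_upwards [h.ae_differentiableAt hRN hΨ hE] with r hr hr01 q' hq' _
  have key : ∀ᶠ s in 𝓝[>] r, S.Ψ (θ s - θ 0) - S.Ψ (θ r - θ 0)
      ≤ (s - r) * S.Ψ ((s - r)⁻¹ • (θ s - θ r)) := by
    filter_upwards [self_mem_nhdsWithin] with s hs
    have hs' : 0 < s - r := sub_pos.2 hs
    rw [hΨ.psi_homogeneous _ _ (inv_pos.2 hs').le, ← mul_assoc, mul_inv_cancel₀ hs'.ne', one_mul]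
    linarith [hΨ.psi_triangle (θ 0) (θ r) (θ s)]
  by_cases hG : r ∈ S.unstableSet t θ
  · rw [finslerDensity, if_pos hG, finsler]
    refine le_trans (ENNReal.ofReal_le_ofReal ?_) le_self_add
    exact deriv_le_of_eventually_slope_le hq' (tendsto_gauge_slope hΨ.psi_continuous (hr hr01 hG))
      key
  · rw [finslerDensity, if_neg hG]
    refine ofReal_le_metricDeriv (κ := fun _ => 0) hq' tendsto_const_nhds (fun _ => le_rfl) ?_
    simpa using key

end IsTransitionCurve

end RIS

end BalancedViscosity

/-! ### Gluing the crude chain rule across the stable set. -/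

namespace BalancedViscosity

section ChainRuleGlobal

variable {V : Type*} [NormedAddCommGroup V] [NormedSpace ℝ V]

/-- Decrease of `f` along a curve whose slope `e` is lower semicontinuous: on the set where `e`
vanishes the decrease is controlled by `Q`, elsewhere by `Q` and `e ‖θ'‖`. -/
theorem le_add_of_lowerSemicontinuousOn_slope {θ : ℝ → V} {f Q : ℝ → ℝ} {e : ℝ → ℝ≥0∞}
    {h W : ℝ → ℝ}
    (hθc : ContinuousOn θ (Icc 0 1)) (hQm : MonotoneOn Q (Icc 0 1))
    (hlsce : LowerSemicontinuousOn e (Icc 0 1))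
    (hW : IntervalIntegrable W volume 0 1) (hW0 : ∀ r, 0 ≤ W r)
    (hhm : AEStronglyMeasurable h) (hh0 : ∀ r, 0 ≤ h r)
    (he : ∀ y : ℝ, 0 ≤ y → ∀ᵐ r, r ∈ Ioo (0 : ℝ) 1 → ENNReal.ofReal y ≤ e r → y * h r ≤ W r)
    (hspeed : ∀ c d, c ≤ d → Icc c d ⊆ {r ∈ Icc (0 : ℝ) 1 | 0 < e r} →
      IntervalIntegrable h volume c d → ‖θ d - θ c‖ ≤ ∫ r in c..d, h r)
    (hf : ∀ s t, 0 ≤ s → s ≤ t → t ≤ 1 → e s < ⊤ →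
      f s ≤ f t + (Q t - Q s) + (e s).toReal * ‖θ t - θ s‖)
    (hlsc : ∀ c ∈ Icc (0 : ℝ) 1, ∀ κ > 0, ∃ ρ > 0, ∀ s ∈ Icc (0 : ℝ) 1, ‖θ s - θ c‖ < ρ →
      f c ≤ f s + κ)
    {s s' : ℝ} (hs : 0 ≤ s) (hss' : s ≤ s') (hs' : s' ≤ 1) :
    f s ≤ f s' + (Q s' - Q s) + 2 * ∫ r in s..s', W r := by
  set G := {r ∈ Icc (0 : ℝ) 1 | 0 < e r} with hG
  have hWsub : ∀ {c d : ℝ}, 0 ≤ c → c ≤ d → d ≤ 1 → IntervalIntegrable W volume c d :=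
    fun h1 h2 h3 => RIS.IsTransitionCurve.intervalIntegrable_of_le hW h1 h2 h3
  have hWnn : ∀ c d, c ≤ d → 0 ≤ ∫ r in c..d, W r := fun c d hcd =>
    intervalIntegral.integral_nonneg hcd fun r _ => hW0 r
  -- Where the slope is at least `y > 0`, the speed is bounded by `W / y` and hence integrable; as
  -- the slope degenerates this control is lost.
  have hint_of_ge : ∀ {c d y : ℝ}, 0 ≤ c → c ≤ d → d ≤ 1 → 0 < y →
      (∀ r ∈ Ioo c d, ENNReal.ofReal y ≤ e r) → IntervalIntegrable h volume c d := by
    intro c d y h1 h2 h3 hy h4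
    refine ((hWsub h1 h2 h3).const_mul y⁻¹).mono_fun' hhm.restrict ?_
    rw [uIoc_of_le h2, ← restrict_Ioo_eq_restrict_Ioc]
    refine (ae_restrict_iff' measurableSet_Ioo).2 ?_
    filter_upwards [he y hy.le] with r hr hr'
    have h5 := hr ⟨h1.trans_lt hr'.1, hr'.2.trans_le h3⟩ (h4 r hr')
    rw [Real.norm_of_nonneg (hh0 r), inv_mul_eq_div, le_div_iff₀ hy]
    linarith
  have hintegrable : ∀ {c d : ℝ}, c ≤ d → Icc c d ⊆ G → IntervalIntegrable h volume c d := by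
    intro c d hcd hsub
    obtain ⟨r, hr, hmin⟩ := LowerSemicontinuousOn.exists_isMinOn ⟨c, left_mem_Icc.2 hcd⟩
      isCompact_Icc (hlsce.mono fun x hx => (hsub hx).1)
    have h1 : 0 < e r := (hsub hr).2
    obtain ⟨y, hy, hy'⟩ := ENNReal.lt_iff_exists_real_btwn.1 h1
    have hy1 : 0 < y := by simpa using hy'.1
    exact hint_of_ge (hsub (left_mem_Icc.2 hcd)).1.1 hcd (hsub (right_mem_Icc.2 hcd)).1.2 hy1
      fun x hx => hy'.2.le.trans (hmin ⟨hx.1.le, hx.2.le⟩)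
  -- The right endpoint may be stable; the speed estimate reaches it by continuity of the curve and
  -- of the primitive.
  have hcell : ∀ {c d : ℝ}, 0 ≤ c → c ≤ d → d ≤ 1 → Ico c d ⊆ G → IntervalIntegrable h volume c d →
      f c ≤ f d + (Q d - Q c) + 2 * ∫ r in c..d, W r := by
    intro c d hc hcd hd hsub hhi
    refine le_add_two_mul_integral_of_slope (θ := θ) (e := e) (h := h) hcd hhi hh0
      (hWsub hc hcd hd) hW0 ?_ ?_ ?_ ?_ ?_
    · intro y hy
      filter_upwards [he y hy] with r hr hr'
      exact hr ⟨hc.trans_lt hr'.1, hr'.2.trans_le hd⟩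
    · intro s t h1 h2 h3
      have hsubi : ∀ {p q : ℝ}, c ≤ p → p ≤ q → q ≤ d → IntervalIntegrable h volume p q :=
        fun a1 a2 a3 => hhi.mono_set (by
          rw [uIcc_of_le a2, uIcc_of_le hcd]; exact Icc_subset_Icc a1 a3)
      rcases h3.lt_or_eq with h3 | rfl
      · exact hspeed s t h2 (fun r hr => hsub ⟨h1.trans hr.1, hr.2.trans_lt h3⟩) (hsubi h1 h2 h3.le)
      rcases h2.eq_or_lt with rfl | h2
      · simp
      have hne : (𝓝[Ico s t] t).NeBot := by
        rw [← mem_closure_iff_nhdsWithin_neBot, closure_Ico h2.ne]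
        exact right_mem_Icc.2 h2.le
      have k1 : Tendsto (fun x => ‖θ x - θ s‖) (𝓝[Ico s t] t) (𝓝 ‖θ t - θ s‖) := by
        have := (hθc t ⟨(hc.trans h1).trans h2.le, hd⟩).mono
          (fun x hx => ⟨(hc.trans h1).trans hx.1, hx.2.le.trans hd⟩ : Ico s t ⊆ Icc 0 1)
        exact (this.tendsto.sub_const _).norm
      have k2 : Tendsto (fun x => ∫ r in s..x, h r) (𝓝[Ico s t] t) (𝓝 (∫ r in s..t, h r)) := by
        have : ContinuousOn (fun x => ∫ r in s..x, h r) (uIcc s t) :=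
          intervalIntegral.continuousOn_primitive_interval' (hsubi h1 h2.le le_rfl) (by simp)
        rw [uIcc_of_le h2.le] at this
        exact (this t (right_mem_Icc.2 h2.le)).mono Ico_subset_Icc_self
      refine le_of_tendsto_of_tendsto k1 k2 ?_
      filter_upwards [self_mem_nhdsWithin] with x hx
      exact hspeed s x hx.1 (fun r hr => hsub ⟨h1.trans hr.1, hr.2.trans_lt hx.2⟩)
        (hsubi h1 hx.1 hx.2.le)
    · intro s t h1 h2 h3
      exact hQm ⟨hc.trans h1, (h2.trans h3).trans hd⟩ ⟨(hc.trans h1).trans h2, h3.trans hd⟩ h2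
    · intro s t h1 h2 h3 h4
      exact hf s t (hc.trans h1) h2 (h3.trans hd) h4
    · intro κ hκ
      obtain ⟨ρ, hρ, hl⟩ := hlsc c ⟨hc, hcd.trans hd⟩ κ hκ
      exact ⟨ρ, hρ, fun x hx => hl x ⟨hc.trans hx.1, hx.2.trans hd⟩⟩
  have hstab : ∀ {c d : ℝ}, 0 ≤ c → c ≤ d → d ≤ 1 → e c = 0 → f c ≤ f d + (Q d - Q c) := by
    intro c d h1 h2 h3 h4
    simpa [h4] using hf c d h1 h2 h3 (by simp [h4])
  have hopen : ∀ r ∈ G, ∃ ρ > 0, ∀ x ∈ Icc (0 : ℝ) 1, |x - r| < ρ → x ∈ G := by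
    intro r hr
    obtain ⟨ρ, hρ, hd⟩ := Metric.mem_nhdsWithin_iff.1 (hlsce r hr.1 0 hr.2)
    exact ⟨ρ, hρ, fun x hx hxr => ⟨hx, hd ⟨by rwa [Metric.mem_ball, Real.dist_eq], hx⟩⟩⟩
  have hmem : ∀ {x : ℝ}, s ≤ x → x ≤ s' → x ∈ Icc (0 : ℝ) 1 := fun h1 h2 =>
    ⟨hs.trans h1, h2.trans hs'⟩
  by_cases hsG : s ∈ G
  swap
  · have : e s = 0 := by
      by_contra h0
      exact hsG ⟨hmem le_rfl hss', pos_iff_ne_zero.2 h0⟩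
    linarith [hstab hs hss' hs' this, hWnn s s' hss']
  -- `b` is the first exit from the unstable set. If `b` is stable, a single comparison from `b` to
  -- `s'` suffices, since at zero slope `hf` has no norm term and holds at any distance.
  set A := {r ∈ Icc s s' | Icc s r ⊆ G} with hA
  have hsA : s ∈ A := ⟨left_mem_Icc.2 hss', by simpa using hsG⟩
  have hAb : BddAbove A := ⟨s', fun r hr => hr.1.2⟩
  set b := sSup A with hb
  have hsb : s ≤ b := le_csSup hAb hsA
  have hbs' : b ≤ s' := csSup_le ⟨s, hsA⟩ fun r hr => hr.1.2
  have hsub : Ico s b ⊆ G := by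
    intro x hx
    obtain ⟨r, hr, hxr⟩ := exists_lt_of_lt_csSup ⟨s, hsA⟩ hx.2
    exact hr.2 ⟨hx.1, hxr.le⟩
  by_cases hbG : b ∈ G
  · have hsubc : Icc s b ⊆ G := by
      intro x hx
      rcases hx.2.lt_or_eq with h1 | h1
      · exact hsub ⟨hx.1, h1⟩
      · rwa [h1]
    have hbeq : b = s' := by
      by_contra hne
      have hlt : b < s' := lt_of_le_of_ne hbs' hne
      obtain ⟨ρ, hρ, hd⟩ := hopen b hbG
      have h1 : min s' (b + ρ / 2) ∈ A := by
        refine ⟨⟨hsb.trans (le_min hbs' (by linarith)), min_le_left _ _⟩, fun x hx => ?_⟩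
        rcases le_total x b with h2 | h2
        · exact hsubc ⟨hx.1, h2⟩
        · refine hd x (hmem hx.1 (hx.2.trans (min_le_left _ _))) ?_
          rw [abs_of_nonneg (by linarith)]
          linarith [hx.2.trans (min_le_right _ _)]
      have h2 := le_csSup hAb h1
      have h3 : b < min s' (b + ρ / 2) := lt_min hlt (by linarith)
      linarith
    rw [← hbeq]
    exact hcell hs hsb (hbs'.trans hs') hsub (hintegrable hsb hsubc)
  have hsltb : s < b := lt_of_le_of_ne hsb fun h => hbG (h ▸ hsG)
  have heb : e b = 0 := by
    by_contra h0
    exact hbG ⟨hmem hsb hbs', pos_iff_ne_zero.2 h0⟩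
  suffices hmain : f s ≤ f b + (Q b - Q s) + 2 * ∫ r in s..b, W r by
    have h1 := hstab (hs.trans hsb) hbs' hs' heb
    have h2 := intervalIntegral.integral_add_adjacent_intervals
      (hWsub hs hsb (hbs'.trans hs')) (hWsub (hs.trans hsb) hbs' hs')
    linarith [hWnn b s' hbs']
  -- Either the slope stays at least 1 before `b`, and the speed is integrable up to `b`, or there
  -- are points `r → b` with slope below 1, from which one comparison to `b` costs at most `‖θ b - θ
  -- r‖ ≤ κ`.
  by_cases hcase : ∃ c ∈ Ico s b, ∀ r ∈ Ioo c b, 1 ≤ e r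
  · obtain ⟨c, hc, hc1⟩ := hcase
    refine hcell hs hsb (hbs'.trans hs') hsub ?_
    refine IntervalIntegrable.trans (b := c) (hintegrable hc.1 fun x hx => hsub ⟨hx.1, hx.2.trans_lt hc.2⟩) ?_
    exact hint_of_ge (hs.trans hc.1) hc.2.le (hbs'.trans hs') one_pos (by simpa using hc1)
  push Not at hcase
  refine le_of_forall_pos_le_add fun κ hκ => ?_
  have hbmem : b ∈ Icc (0 : ℝ) 1 := hmem hsb hbs'
  obtain ⟨ρ₁, hρ₁, hd₁⟩ := Metric.continuousWithinAt_iff.1 (hθc b hbmem) κ hκ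
  obtain ⟨r, hr, hr1⟩ := hcase (max s (b - ρ₁)) ⟨le_max_left _ _, max_lt hsltb (by linarith)⟩
  have hsr : s < r := (le_max_left _ _).trans_lt hr.1
  have hrmem : r ∈ Icc (0 : ℝ) 1 := hmem hsr.le (hr.2.le.trans hbs')
  have k1 := hcell hs hsr.le hrmem.2 (fun x hx => hsub ⟨hx.1, hx.2.trans hr.2⟩)
    (hintegrable hsr.le fun x hx => hsub ⟨hx.1, hx.2.trans_lt hr.2⟩)
  have k2 := hf r b hrmem.1 hr.2.le hbmem.2 (hr1.trans ENNReal.one_lt_top)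
  have k3 : ‖θ b - θ r‖ ≤ κ := by
    rw [← dist_eq_norm, dist_comm]
    refine (hd₁ hrmem ?_).le
    rw [Real.dist_eq, abs_of_neg (by linarith [hr.2])]
    linarith [(le_max_right s (b - ρ₁)).trans_lt hr.1]
  have k4 : (e r).toReal ≤ 1 := by
    have := ENNReal.toReal_mono ENNReal.one_ne_top hr1.le
    simpa using this
  have k5 : (e r).toReal * ‖θ b - θ r‖ ≤ 1 * κ :=
    mul_le_mul k4 k3 (norm_nonneg _) zero_le_one
  have k6 := intervalIntegral.integral_add_adjacent_intervals
      (hWsub hs hsr.le hrmem.2) (hWsub hrmem.1 hr.2.le hbmem.2)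
  linarith [hWnn r b hr.2.le]

end ChainRuleGlobal

end BalancedViscosity

/-! ### The chain rule inequality for admissible transitions. -/

namespace BalancedViscosity

theorem le_integral_of_ofReal_le_lintegral {g : ℝ → ℝ} {a b x : ℝ} (hab : a ≤ b)
    (hg : IntervalIntegrable g volume a b) (hg0 : ∀ r, 0 ≤ g r)
    (h : ENNReal.ofReal x ≤ ∫⁻ r in Icc a b, ENNReal.ofReal (g r)) : x ≤ ∫ r in a..b, g r := by
  rw [← ofReal_integral_eq_lintegral_ofReal
    ((intervalIntegrable_iff_integrableOn_Icc_of_le hab).1 hg) (Eventually.of_forall hg0),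
    integral_Icc_eq_integral_Ioc, ← intervalIntegral.integral_of_le hab] at h
  exact (ENNReal.ofReal_le_ofReal_iff
    (intervalIntegral.integral_nonneg hab fun r _ => hg0 r)).1 h

namespace RIS

variable {V : Type*} [NormedAddCommGroup V] [NormedSpace ℝ V] [CompleteSpace V] {S : RIS V}

namespace IsTransitionCurve

variable {t E : ℝ} {m : ℝ → ℝ} {θ : ℝ → V}

theorem exists_lsc_energy (h : S.IsTransitionCurve t E m θ) (hE : S.EnergyAssumptions) :
    ∀ c ∈ Icc (0 : ℝ) 1, ∀ κ > 0, ∃ ρ > 0, ∀ s ∈ Icc (0 : ℝ) 1, ‖θ s - θ c‖ < ρ →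
      S.energy t (θ c) ≤ S.energy t (θ s) + κ := by
  intro c hc κ hκ
  have h1 := hE.lsc (t, θ c) ⟨h.time, (h.mem c hc).1⟩ (S.energy t (θ c) - κ) (by simp [hκ])
  obtain ⟨ρ, hρ, hd⟩ := Metric.mem_nhdsWithin_iff.1 h1
  refine ⟨ρ, hρ, fun s hs hsc => ?_⟩
  have h2 : S.energy t (θ c) - κ < S.energy t (θ s) := @hd (t, θ s)
    ⟨by rw [Metric.mem_ball, Prod.dist_eq]; simpa [dist_eq_norm, hρ] using hsc,
      h.time, (h.mem s hs).1⟩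
  linarith

/-- Absolute continuity comes with an arbitrary majorant `n`; the scalar function `‖θ · - θ c‖` has
derivative at most `‖θ'‖`, so the majorant can be replaced by the speed. -/
theorem norm_sub_le_integral (h : S.IsTransitionCurve t E m θ) (hRN : HasRadonNikodymProperty V)
    (hΨ : S.DissipationAssumptions) (hE : S.EnergyAssumptions) {c d : ℝ} (hcd : c ≤ d)
    (hG : Icc c d ⊆ S.unstableSet t θ)
    (hi : IntervalIntegrable (fun r => ‖deriv θ r‖) volume c d) :
    ‖θ d - θ c‖ ≤ ∫ r in c..d, ‖deriv θ r‖ := by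
  obtain ⟨-, n, hn0, hn, hnle⟩ := h.loc c d hcd hG
  refine le_integral_of_ofReal_le_lintegral hcd hi (fun _ => norm_nonneg _) ?_
  have h1 := ofReal_sub_le_lintegral_of_deriv_le (q := fun r => ‖θ r - θ c‖) (w := n)
    (ρ := fun r => ENNReal.ofReal ‖deriv θ r‖) hcd
    ((intervalIntegrable_iff_integrableOn_Icc_of_le hcd).2 hn) (fun s r h1 h2 h3 => by
      rcases h2.eq_or_lt with rfl | h2
      · simp
      have h4 := hnle s r h1 h2 h3
      have h5 := norm_sub_le_norm_sub_add_norm_sub (θ r) (θ s) (θ c)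
      simp only at h4
      linarith) ?_
  · simpa using h1
  filter_upwards [h.ae_differentiableAt hRN hΨ hE] with r hr hrcd q' hq' _
  have hrG := hG (Ioo_subset_Icc_self hrcd)
  have hr01 : r ∈ Ioo (0 : ℝ) 1 := ⟨(hG (left_mem_Icc.2 hcd)).1.1.trans_lt hrcd.1,
    hrcd.2.trans_le (hG (right_mem_Icc.2 hcd)).1.2⟩
  refine ENNReal.ofReal_le_ofReal ?_
  refine deriv_le_of_eventually_slope_le hq' (tendsto_gauge_slope continuous_norm (hr hr01 hrG)) ?_
  filter_upwards [self_mem_nhdsWithin] with s hs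
  have hs' : 0 < s - r := sub_pos.2 hs
  rw [norm_smul, Real.norm_of_nonneg (inv_pos.2 hs').le, ← mul_assoc, mul_inv_cancel₀ hs'.ne',
    one_mul]
  linarith [norm_sub_le_norm_sub_add_norm_sub (θ s) (θ r) (θ c)]

/-- The chain rule inequality: the energy released along a transition is bounded by its Finsler
length. -/
theorem ofReal_energy_sub_le (h : S.IsTransitionCurve t E m θ) (hRN : HasRadonNikodymProperty V)
    (hΨ : S.DissipationAssumptions) (hE : S.EnergyAssumptions) :
    ENNReal.ofReal (S.energy t (θ 0) - S.energy t (θ 1)) ≤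
      ∫⁻ r in Icc (0 : ℝ) 1, S.finslerDensity t θ r := by
  rcases eq_or_ne (∫⁻ r in Icc (0 : ℝ) 1, S.finslerDensity t θ r) ⊤ with htop | hfin
  · rw [htop]; exact le_top
  borelize V
  have hK := hE.isCompact_sublevel h.pos
  obtain ⟨ω, hω⟩ := hE.exists_isModulus h.pos
  -- Two stages: with the crude bound `M` on ω, the energy drop has an integrable majorant; this
  -- allows differentiation almost everywhere, where `ω → 0` restores the sharp constant.
  obtain ⟨M, hM0, hM⟩ := hω.exists_le hK
  set G := S.unstableSet t θ with hGdef
  have hGm : MeasurableSet G := h.measurableSet_unstableSet hΨ hE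
  have hGsub : G ⊆ Icc 0 1 := fun r hr => hr.1
  set wE : ℝ → ℝ≥0∞ := G.indicator fun r =>
    (Icc (0 : ℝ) 1).indicator (fun r => S.slope t (θ r)) r * ENNReal.ofReal ‖deriv θ r‖ with hwE
  set pE : ℝ → ℝ≥0∞ := G.indicator fun r => ENNReal.ofReal (S.Ψ (deriv θ r)) with hpE
  have hwEG : ∀ r ∈ G, wE r = S.slope t (θ r) * ENNReal.ofReal ‖deriv θ r‖ := by
    intro r hr
    rw [hwE, indicator_of_mem hr, indicator_of_mem (hGsub hr)]
  have hpEG : ∀ r ∈ G, pE r = ENNReal.ofReal (S.Ψ (deriv θ r)) := by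
    intro r hr
    rw [hpE, indicator_of_mem hr]
  have hpE0 : ∀ r ∉ G, pE r = 0 := fun r hr => by rw [hpE, indicator_of_notMem hr]
  have hwE0 : ∀ r ∉ G, wE r = 0 := fun r hr => by rw [hwE, indicator_of_notMem hr]
  have hwEm : Measurable wE := ((h.measurable_slope hΨ hE).mul
    (measurable_deriv θ).norm.ennreal_ofReal).indicator hGm
  have hpEm : Measurable pE := (hΨ.psi_continuous.measurable.comp
    (measurable_deriv θ)).ennreal_ofReal.indicator hGm
  have hdens : ∀ r, pE r + wE r ≤ S.finslerDensity t θ r := by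
    intro r
    by_cases hr : r ∈ G
    · rw [hpEG r hr, hwEG r hr, finslerDensity, if_pos hr, finsler]
    · simp [hpE0 r hr, hwE0 r hr]
  have hwEfin : ∫⁻ r in Icc (0 : ℝ) 1, wE r ≠ ⊤ := ne_top_of_le_ne_top hfin
    (lintegral_mono fun r => le_add_self.trans (hdens r))
  have hpEfin : ∫⁻ r in Icc (0 : ℝ) 1, pE r ≠ ⊤ := ne_top_of_le_ne_top hfin
    (lintegral_mono fun r => le_self_add.trans (hdens r))
  set W : ℝ → ℝ := fun r => (wE r).toReal with hWdef
  have hW : IntervalIntegrable W volume 0 1 :=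
    (intervalIntegrable_iff_integrableOn_Icc_of_le zero_le_one).2
      (integrable_toReal_of_lintegral_ne_top hwEm.aemeasurable hwEfin)
  have hW0 : ∀ r, 0 ≤ W r := fun r => ENNReal.toReal_nonneg
  have hwEtop : ∀ᵐ r, r ∈ Icc (0 : ℝ) 1 → wE r < ⊤ :=
    (ae_restrict_iff' measurableSet_Icc).1 (ae_lt_top hwEm hwEfin)
  -- On the unstable set the majorant `m` is replaced by `Ψ(θ')`. The final majorant then vanishes
  -- wherever `θ' = 0` there, which is needed at points of infinite slope.
  set mt : ℝ → ℝ := fun r => (pE r).toReal + Gᶜ.indicator m r with hmt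
  have hmti : IntervalIntegrable mt volume 0 1 := by
    refine IntervalIntegrable.add ((intervalIntegrable_iff_integrableOn_Icc_of_le zero_le_one).2
      (integrable_toReal_of_lintegral_ne_top hpEm.aemeasurable hpEfin)) ?_
    rw [intervalIntegrable_iff_integrableOn_Icc_of_le zero_le_one]
    exact ((intervalIntegrable_iff_integrableOn_Icc_of_le zero_le_one).1 h.integrable).indicator
      hGm.compl
  have hmt0 : ∀ r, 0 ≤ mt r := fun r => add_nonneg ENNReal.toReal_nonneg
    (indicator_nonneg (fun x _ => h.nonneg x) r)
  have hmtG : ∀ r ∈ G, mt r = S.Ψ (deriv θ r) := by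
    intro r hr
    simp only [hmt, hpEG r hr, ENNReal.toReal_ofReal (hΨ.psi_nonneg _)]
    rw [indicator_of_notMem (by simpa using hr), add_zero]
  have hmtnG : ∀ r ∉ G, mt r = m r := by
    intro r hr
    simp only [hmt, hpE0 r hr]
    rw [indicator_of_mem (by simpa using hr)]; simp
  have hdiff := h.ae_differentiableAt hRN hΨ hE
  have hcont := h.continuousOn hΨ hE
  have hspeedΨ : ∀ s s', 0 ≤ s → s ≤ s' → s' ≤ 1 → S.Ψ (θ s' - θ s) ≤ ∫ r in s..s', mt r := by
    intro s s' h1 h2 h3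
    refine le_integral_of_ofReal_le_lintegral h2 (intervalIntegrable_of_le hmti h1 h2 h3) hmt0 ?_
    have k1 := ofReal_sub_le_lintegral_of_deriv_le (q := fun r => S.Ψ (θ r - θ s)) (w := m)
      (ρ := fun r => ENNReal.ofReal (mt r)) h2 (intervalIntegrable_of_le h.integrable h1 h2 h3)
      (fun a b a1 a2 a3 => by
        have := hΨ.psi_triangle (θ s) (θ a) (θ b)
        linarith [h.le a b (h1.trans a1) a2 (a3.trans h3)]) ?_
    · simpa [hΨ.psi_zero] using k1
    filter_upwards [hdiff] with r hr hrs q' hq' hq'm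
    refine ENNReal.ofReal_le_ofReal ?_
    by_cases hrG : r ∈ G
    · rw [hmtG r hrG]
      refine deriv_le_of_eventually_slope_le hq' (tendsto_gauge_slope hΨ.psi_continuous
        (hr ⟨h1.trans_lt hrs.1, hrs.2.trans_le h3⟩ hrG)) ?_
      filter_upwards [self_mem_nhdsWithin] with x hx
      have hx' : 0 < x - r := sub_pos.2 hx
      rw [hΨ.psi_homogeneous _ _ (inv_pos.2 hx').le, ← mul_assoc, mul_inv_cancel₀ hx'.ne', one_mul]
      linarith [hΨ.psi_triangle (θ s) (θ r) (θ x)]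
    · rwa [hmtnG r hrG]
  set Q : ℝ → ℝ := fun r => (1 + M) * ∫ x in (0 : ℝ)..r, mt x with hQ
  have hQsub : ∀ s s', 0 ≤ s → s ≤ s' → s' ≤ 1 → Q s' - Q s = (1 + M) * ∫ x in s..s', mt x := by
    intro s s' h1 h2 h3
    have := intervalIntegral.integral_add_adjacent_intervals
      (intervalIntegrable_of_le hmti le_rfl h1 (h2.trans h3))
      (intervalIntegrable_of_le hmti h1 h2 h3)
    simp only [hQ, ← this]; ring
  have hI3 : ∀ s s', 0 ≤ s → s ≤ s' → s' ≤ 1 → S.energy t (θ s) ≤ S.energy t (θ s') +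
      (Q s' - Q s) + 2 * ∫ r in s..s', W r := by
    intro s s' h1 h2 h3
    refine le_add_of_lowerSemicontinuousOn_slope (θ := θ) (f := fun r => S.energy t (θ r))
      (e := fun r => S.slope t (θ r)) (h := fun r => ‖deriv θ r‖) hcont ?_
      (h.lowerSemicontinuousOn_slope hΨ hE) hW hW0 (measurable_deriv θ).norm.aestronglyMeasurable
      (fun _ => norm_nonneg _) ?_ ?_ ?_ (h.exists_lsc_energy hE) h1 h2 h3
    · intro a ha b hb hab
      have := hQsub a b ha.1 hab hb.2
      have h4 : 0 ≤ (1 + M) * ∫ x in a..b, mt x := mul_nonneg (by linarith)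
        (intervalIntegral.integral_nonneg hab fun r _ => hmt0 r)
      linarith
    · intro y hy
      filter_upwards [hwEtop] with r hr hr01 hye
      rcases hy.eq_or_lt with rfl | hy
      · simpa using hW0 r
      have hrG : r ∈ G := ⟨Ioo_subset_Icc_self hr01, (ENNReal.ofReal_pos.2 hy).trans_le hye⟩
      have hlt := hr (Ioo_subset_Icc_self hr01)
      refine (ENNReal.ofReal_le_iff_le_toReal hlt.ne).1 ?_
      rw [hwEG r hrG, ENNReal.ofReal_mul hy.le]
      gcongr
    · intro c d hcd hsub hi
      exact h.norm_sub_le_integral hRN hΨ hE hcd hsub hi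
    · intro a b a1 a2 a3 he
      have ha : a ∈ Icc (0 : ℝ) 1 := ⟨a1, a2.trans a3⟩
      have hb : b ∈ Icc (0 : ℝ) 1 := ⟨a1.trans a2, a3⟩
      have k1 := hω.energy_le_of_slope_le hΨ hE h.pos h.time (h.mem a ha) (h.mem b hb)
        ENNReal.toReal_nonneg (ENNReal.ofReal_toReal he.ne).ge hM0
        (hM t h.time _ (h.mem a ha) _ (h.mem b hb))
      have k2 := mul_le_mul_of_nonneg_left (hspeedΨ a b a1 a2 a3) (show 0 ≤ 1 + M by linarith)
      rw [hQsub a b a1 a2 a3]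
      linarith
  -- Second stage: it remains to bound the derivative of the released energy pointwise by the
  -- Finsler density.
  have hfinal := ofReal_sub_le_lintegral_of_deriv_le (q := fun r => -S.energy t (θ r))
    (w := fun r => (1 + M) * mt r + 2 * W r) (ρ := S.finslerDensity t θ) zero_le_one
    ((hmti.const_mul _).add (hW.const_mul _)) (fun s s' h1 h2 h3 => by
      rw [intervalIntegral.integral_add ((intervalIntegrable_of_le hmti h1 h2 h3).const_mul _)
        ((intervalIntegrable_of_le hW h1 h2 h3).const_mul _), intervalIntegral.integral_const_mul,
        intervalIntegral.integral_const_mul]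
      have := hI3 s s' h1 h2 h3
      rw [hQsub s s' h1 h2 h3] at this
      linarith) ?_
  · rwa [show -S.energy t (θ 1) - -S.energy t (θ 0) = S.energy t (θ 0) - S.energy t (θ 1) by ring]
      at hfinal
  filter_upwards [hdiff] with r hr hr01 q' hq' hq'w
  have hrI := Ioo_subset_Icc_self hr01
  have hnear : ∀ᶠ s in 𝓝[>] r, s ∈ Icc (0 : ℝ) 1 := by
    filter_upwards [Ioo_mem_nhdsGT hr01.2] with s hs using ⟨hrI.1.trans hs.1.le, hs.2.le⟩
  set κ : ℝ → ℝ := fun s => max (ω t (θ r) (θ s)) 0 with hκ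
  have hκ0 : ∀ s, 0 ≤ κ s := fun s => le_max_right _ _
  have hθr : Tendsto θ (𝓝[>] r) (𝓝 (θ r)) :=
    ((hcont.continuousAt (Icc_mem_nhds hr01.1 hr01.2)).tendsto).mono_left nhdsWithin_le_nhds
  have hκlim : Tendsto κ (𝓝[>] r) (𝓝 0) := by
    rw [Metric.tendsto_nhds]
    intro δ hδ
    obtain ⟨ρ, hρ, hd⟩ := hω.exists_small hK (half_pos hδ)
    filter_upwards [hnear, Metric.tendsto_nhds.1 hθr ρ hρ] with s hs hs'
    rw [Real.dist_eq, sub_zero, abs_of_nonneg (hκ0 s)]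
    rw [dist_eq_norm] at hs'
    exact (max_le (hd t h.time _ (h.mem r hrI) _ (h.mem s hs) hs') (half_pos hδ).le).trans_lt
      (half_lt_self hδ)
  have hslope : ∀ y : ℝ, 0 ≤ y → S.slope t (θ r) ≤ ENNReal.ofReal y → ∀ᶠ s in 𝓝[>] r,
      -S.energy t (θ s) - -S.energy t (θ r) ≤ (s - r) * ((1 + κ s) *
        S.Ψ ((s - r)⁻¹ • (θ s - θ r)) + y * ‖(s - r)⁻¹ • (θ s - θ r)‖) := by
    intro y hy hy'
    filter_upwards [hnear, self_mem_nhdsWithin] with s hs hsr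
    have hs' : 0 < s - r := sub_pos.2 hsr
    have k1 := hω.energy_le_of_slope_le hΨ hE h.pos h.time (h.mem r hrI) (h.mem s hs)
      hy hy' (hκ0 s) (le_max_left _ _)
    rw [hΨ.psi_homogeneous _ _ (inv_pos.2 hs').le, norm_smul,
      Real.norm_of_nonneg (inv_pos.2 hs').le]
    have : (s - r) * ((1 + κ s) * ((s - r)⁻¹ * S.Ψ (θ s - θ r)) +
        y * ((s - r)⁻¹ * ‖θ s - θ r‖)) = (1 + κ s) * S.Ψ (θ s - θ r) + y * ‖θ s - θ r‖ := by
      field_simp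
    rw [this]
    linarith
  by_cases hrG : r ∈ G
  · have hd := hr hr01 hrG
    rw [finslerDensity, if_pos hrG, finsler]
    rcases eq_or_ne (S.slope t (θ r)) ⊤ with hetop | hefin
    · rw [hetop]
      -- At infinite slope the density is 0 if `θ' = 0` (as `∞ · 0 = 0`), where no subgradient is
      -- available and the crude majorant, here 0, must do; otherwise the density is infinite.
      rcases eq_or_ne (deriv θ r) 0 with h0 | h0
      · have k1 : (1 + M) * mt r + 2 * W r = 0 := by
          simp [hmtG r hrG, hWdef, hwEG r hrG, h0, hΨ.psi_zero]
        rw [k1] at hq'w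
        simp [ENNReal.ofReal_of_nonpos hq'w]
      · rw [ENNReal.top_mul (by simpa using h0)]
        simp
    · have k1 := deriv_le_of_eventually_slope_le hq'
        ((((hκlim.const_add 1).mul (tendsto_gauge_slope hΨ.psi_continuous hd)).add
          ((tendsto_gauge_slope continuous_norm hd).const_mul (S.slope t (θ r)).toReal)))
        (hslope _ ENNReal.toReal_nonneg (ENNReal.ofReal_toReal hefin).ge)
      refine (ENNReal.ofReal_le_ofReal k1).trans ?_
      rw [add_zero, one_mul, ENNReal.ofReal_add (hΨ.psi_nonneg _)
        (mul_nonneg ENNReal.toReal_nonneg (norm_nonneg _)),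
        ENNReal.ofReal_mul ENNReal.toReal_nonneg, ENNReal.ofReal_toReal hefin]
  · have he0 : S.slope t (θ r) = 0 := by
      by_contra h0
      exact hrG ⟨hrI, pos_iff_ne_zero.2 h0⟩
    rw [finslerDensity, if_neg hrG]
    refine ofReal_le_metricDeriv hq' hκlim hκ0 ?_
    simpa using hslope 0 le_rfl (by simp [he0])

end IsTransitionCurve

theorem ofReal_psi_le_finslerCost (hRN : HasRadonNikodymProperty V)
    (hΨ : S.DissipationAssumptions) (hE : S.EnergyAssumptions) {t : ℝ} (ht : t ∈ Icc 0 S.T)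
    (x y : V) : ENNReal.ofReal (S.Ψ (y - x)) ≤ S.finslerCost t x y := by
  refine le_iInf₂ fun θ hθ => ?_
  obtain ⟨E, m, h⟩ := exists_isTransitionCurve hΨ ht hθ
  have := h.ofReal_psi_le hRN hΨ hE
  rwa [hθ.2.2.1, hθ.2.2.2] at this

theorem ofReal_energy_sub_le_finslerCost (hRN : HasRadonNikodymProperty V)
    (hΨ : S.DissipationAssumptions) (hE : S.EnergyAssumptions) {t : ℝ} (ht : t ∈ Icc 0 S.T)
    (x y : V) : ENNReal.ofReal (S.energy t x - S.energy t y) ≤ S.finslerCost t x y := by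
  refine le_iInf₂ fun θ hθ => ?_
  obtain ⟨E, m, h⟩ := exists_isTransitionCurve hΨ ht hθ
  have := h.ofReal_energy_sub_le hRN hΨ hE
  rwa [hθ.2.2.1, hθ.2.2.2] at this

end RIS

end BalancedViscosity

/-! ### Upper bounds for the Finsler cost. -/

namespace BalancedViscosity

theorem lintegral_ofReal_deriv_le_of_monotoneOn {B : ℝ → ℝ} {a b : ℝ} (hab : a ≤ b)
    (hB : MonotoneOn B (Icc a b)) :
    ∫⁻ r in Icc a b, ENNReal.ofReal (deriv B r) ≤ ENNReal.ofReal (B b - B a) := by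
  have hi : IntervalIntegrable (deriv B) volume a b :=
    MonotoneOn.intervalIntegrable_deriv (by rwa [uIcc_of_le hab])
  have h0 : 0 ≤ᵐ[volume.restrict (Icc a b)] deriv B := by
    rw [← restrict_Ioo_eq_restrict_Icc]
    exact (ae_restrict_iff' measurableSet_Ioo).2
      (Eventually.of_forall fun r hr => deriv_nonneg_of_monotoneOn_Icc hB hr)
  rw [← ofReal_integral_eq_lintegral_ofReal
    ((intervalIntegrable_iff_integrableOn_Icc_of_le hab).1 hi) h0, integral_Icc_eq_integral_Ioc,
    ← intervalIntegral.integral_of_le hab]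
  exact ENNReal.ofReal_le_ofReal (integral_deriv_le_of_monotoneOn hab hB)

namespace RIS

variable {V : Type*} [NormedAddCommGroup V] [NormedSpace ℝ V] [CompleteSpace V] {S : RIS V}

theorem metricDeriv_le_of_increments_le (hΨ : S.DissipationAssumptions) {θ : ℝ → V} {B : ℝ → ℝ}
    {r B' : ℝ} (hr : r ∈ Ioo (0 : ℝ) 1) (hB : HasDerivAt B B' r)
    (hle : ∀ s s', 0 ≤ s → s ≤ s' → s' ≤ 1 → S.Ψ (θ s' - θ s) ≤ B s' - B s) :
    metricDeriv S.Ψ θ r ≤ ENNReal.ofReal B' := by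
  have h1 : Tendsto (fun h : ℝ => ENNReal.ofReal (h⁻¹ * (B (r + h) - B r))) (𝓝[≠] 0)
      (𝓝 (ENNReal.ofReal B')) :=
    (ENNReal.continuous_ofReal.tendsto _).comp (hasDerivAt_iff_tendsto_slope_zero.1 hB)
  rw [← h1.limsup_eq]
  refine limsup_le_limsup ?_
  have hnear : ∀ᶠ h : ℝ in 𝓝[≠] 0, r + h ∈ Icc (0 : ℝ) 1 := by
    refine nhdsWithin_le_nhds ?_
    have : Tendsto (fun h : ℝ => r + h) (𝓝 0) (𝓝 (r + 0)) := Continuous.tendsto (by fun_prop) 0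
    rw [add_zero] at this
    exact this.eventually (Icc_mem_nhds hr.1 hr.2)
  filter_upwards [hnear, self_mem_nhdsWithin] with h hh hne
  refine ENNReal.ofReal_le_ofReal ?_
  rcases lt_or_gt_of_ne (show h ≠ 0 from hne) with hneg | hpos
  · have h2 := hle (r + h) r hh.1 (by linarith) hr.2.le
    have h3 : h⁻¹ • (θ (r + h) - θ r) = (-h)⁻¹ • (θ r - θ (r + h)) := by
      rw [inv_neg, neg_smul, ← smul_neg, neg_sub]
    have h4 : 0 ≤ (-h)⁻¹ := (inv_pos.2 (by linarith)).le
    rw [h3, hΨ.psi_homogeneous _ _ h4]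
    calc (-h)⁻¹ * S.Ψ (θ r - θ (r + h)) ≤ (-h)⁻¹ * (B r - B (r + h)) :=
          mul_le_mul_of_nonneg_left h2 h4
      _ = h⁻¹ * (B (r + h) - B r) := by rw [inv_neg]; ring
  · have h2 := hle r (r + h) hr.1.le (by linarith) hh.2
    rw [hΨ.psi_homogeneous _ _ (inv_pos.2 hpos).le]
    exact mul_le_mul_of_nonneg_left h2 (inv_pos.2 hpos).le

/-- The slope may be infinite, so the estimate is tested with every finite `m` below it; for
infinite slope this forces a vanishing derivative. -/
theorem finsler_le_of_increments_le (hΨ : S.DissipationAssumptions) {t : ℝ} {θ : ℝ → V} {B : ℝ → ℝ}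
    {r B' : ℝ} (hθ : DifferentiableAt ℝ θ r) (hpos : 0 < S.slope t (θ r)) (hB : HasDerivAt B B' r)
    (hloc : ∀ m : ℝ, 0 ≤ m → ENNReal.ofReal m < S.slope t (θ r) → ∀ᶠ s in 𝓝[>] r,
      S.Ψ (θ s - θ r) + m * ‖θ s - θ r‖ ≤ B s - B r) :
    S.finsler t (θ r) (deriv θ r) ≤ ENNReal.ofReal B' := by
  have key : ∀ m : ℝ, 0 ≤ m → ENNReal.ofReal m < S.slope t (θ r) →
      S.Ψ (deriv θ r) + m * ‖deriv θ r‖ ≤ B' := by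
    intro m hm hlt
    have h1 := hB.hasDerivWithinAt (s := Ioi r)
    rw [hasDerivWithinAt_iff_tendsto_slope' (by simp)] at h1
    refine le_of_tendsto_of_tendsto ((tendsto_gauge_slope hΨ.psi_continuous hθ).add
      ((tendsto_gauge_slope continuous_norm hθ).const_mul m)) h1 ?_
    filter_upwards [hloc m hm hlt, self_mem_nhdsWithin] with s hs hsr
    have hs' : 0 < s - r := sub_pos.2 hsr
    rw [slope_def_field, hΨ.psi_homogeneous _ _ (inv_pos.2 hs').le, norm_smul,
      Real.norm_of_nonneg (inv_pos.2 hs').le, div_eq_inv_mul]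
    calc _ = (s - r)⁻¹ * (S.Ψ (θ s - θ r) + m * ‖θ s - θ r‖) := by ring
      _ ≤ _ := mul_le_mul_of_nonneg_left hs (inv_pos.2 hs').le
  have hB0 : S.Ψ (deriv θ r) ≤ B' := by simpa using key 0 le_rfl (by simpa using hpos)
  have h2 : S.slope t (θ r) * ENNReal.ofReal ‖deriv θ r‖ ≤ ENNReal.ofReal (B' - S.Ψ (deriv θ r)) := by
    rcases (norm_nonneg (deriv θ r)).eq_or_lt with h0 | h0
    · simp [← h0]
    refine ENNReal.mul_le_of_le_div (le_of_forall_lt fun a ha => ?_)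
    obtain ⟨m, hm, hm1, hm2⟩ := ENNReal.lt_iff_exists_real_btwn.1 ha
    refine hm1.trans_le ?_
    rw [ENNReal.le_div_iff_mul_le (Or.inl (by simpa using h0)) (Or.inl ENNReal.ofReal_ne_top),
      ← ENNReal.ofReal_mul hm]
    exact ENNReal.ofReal_le_ofReal (by linarith [key m hm hm2])
  rw [finsler]
  calc _ ≤ ENNReal.ofReal (S.Ψ (deriv θ r)) + ENNReal.ofReal (B' - S.Ψ (deriv θ r)) := by gcongr
    _ = ENNReal.ofReal B' := by
      rw [← ENNReal.ofReal_add (hΨ.psi_nonneg _) (by linarith)]; congr 1; ring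

/-- A curve whose increments are controlled by `B`, with the local control of the norm prescribed
by the slope, has Finsler cost at most `B 1 - B 0`. -/
theorem finslerCost_le_of_increments_le (hRN : HasRadonNikodymProperty V)
    (hΨ : S.DissipationAssumptions) (hE : S.EnergyAssumptions) {t E Λ : ℝ} (ht : t ∈ Icc 0 S.T)
    (hEpos : 0 < E) (hΛ : 0 ≤ Λ) {θ : ℝ → V} {B : ℝ → ℝ}
    (hmem : ∀ r ∈ Icc (0 : ℝ) 1, θ r ∈ S.sublevel E) (hcont : ContinuousOn θ (Icc 0 1))
    (hlip : ∀ s s', 0 ≤ s → s ≤ s' → s' ≤ 1 → S.Ψ (θ s' - θ s) ≤ Λ * (s' - s))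
    (hle : ∀ s s', 0 ≤ s → s ≤ s' → s' ≤ 1 → S.Ψ (θ s' - θ s) ≤ B s' - B s)
    (hloc : ∀ r ∈ Icc (0 : ℝ) 1, ∀ m : ℝ, 0 ≤ m → ENNReal.ofReal m < S.slope t (θ r) →
      ∃ ρ > 0, ∀ s s', 0 ≤ s → s ≤ s' → s' ≤ 1 → |s - r| < ρ → |s' - r| < ρ →
        S.Ψ (θ s' - θ s) + m * ‖θ s' - θ s‖ ≤ B s' - B s ∧
        min m 1 * ‖θ s' - θ s‖ ≤ Λ * (s' - s)) :
    S.finslerCost t (θ 0) (θ 1) ≤ ENNReal.ofReal (B 1 - B 0) := by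
  have hlsc : LowerSemicontinuousOn (fun r => S.slope t (θ r)) (Icc 0 1) := by
    intro r hr c hc
    have h1 := hE.lowerSemicontinuousOn_slope hΨ hEpos (t, θ r) ⟨ht, hmem r hr⟩ c hc
    refine (tendsto_nhdsWithin_iff.2 ⟨?_, ?_⟩ : Tendsto (fun s => (t, θ s)) (𝓝[Icc 0 1] r)
      (𝓝[Icc 0 S.T ×ˢ S.sublevel E] (t, θ r))).eventually h1
    · exact tendsto_const_nhds.prodMk_nhds (hcont r hr)
    · filter_upwards [self_mem_nhdsWithin] with s hs using ⟨ht, hmem s hs⟩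
  have hBm : MonotoneOn B (Icc 0 1) := fun s hs s' hs' hss' => by
    linarith [hle s s' hs.1 hss' hs'.2, hΨ.psi_nonneg (θ s' - θ s)]
  have hACloc : IsACLocOn (S.unstableSet t θ) θ := by
    intro c d hcd hsub
    -- On a compact interval of unstable points the lower semicontinuous slope has a positive
    -- minimum, so `hloc` gives one local Lipschitz constant `Λ / μ`, and `le_of_locally_le` makes
    -- it global.
    obtain ⟨r, hr, hmin⟩ := LowerSemicontinuousOn.exists_isMinOn ⟨c, left_mem_Icc.2 hcd⟩
      isCompact_Icc (hlsc.mono fun x hx => (hsub hx).1)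
    obtain ⟨m, hm, hm1, hm2⟩ := ENNReal.lt_iff_exists_real_btwn.1 (hsub hr).2
    have hm0 : 0 < m := by simpa using hm1
    set μ := min m 1
    have hμ : 0 < μ := lt_min hm0 one_pos
    refine ⟨fun _ _ => mem_univ _, fun _ => Λ / μ, fun _ => by positivity, by simp, ?_⟩
    intro s s' h1 h2 h3
    have hsub' : ∀ x ∈ Icc s s', x ∈ Icc c d := fun x hx => ⟨h1.trans hx.1, hx.2.trans h3⟩
    have hinc : ∀ x ∈ Icc s s', ∃ ρ > 0, ∀ p q, p ∈ Icc s s' → q ∈ Icc s s' → p ≤ q →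
        |p - x| < ρ → |q - x| < ρ → ‖θ q - θ p‖ ≤ Λ / μ * (q - p) := by
      intro x hx
      have hx01 := (hsub (hsub' x hx)).1
      obtain ⟨ρ, hρ, hd⟩ := hloc x hx01 m hm (hm2.trans_le (hmin (hsub' x hx)))
      refine ⟨ρ, hρ, fun p q hp hq hpq h4 h5 => ?_⟩
      have h6 := (hd p q (hsub (hsub' p hp)).1.1 hpq (hsub (hsub' q hq)).1.2 h4 h5).2
      rw [div_mul_eq_mul_div, le_div_iff₀ hμ]
      linarith
    have h4 := le_of_locally_le (f := fun x => Λ / μ * x - ‖θ x - θ s‖) h2.le fun x hx => by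
      obtain ⟨ρ, hρ, hd⟩ := hinc x hx
      refine ⟨ρ, hρ, fun q hq hxq hqρ => ?_, fun p hp hpx hpρ => ?_⟩
      · have h5 := hd x q hx hq hxq.le (by simpa using hρ) (by rw [abs_of_pos] <;> linarith)
        have h6 := norm_sub_le_norm_sub_add_norm_sub (θ q) (θ x) (θ s)
        linarith
      · have h5 := hd p x hp hx hpx.le (by rw [abs_of_neg] <;> linarith) (by simpa using hρ)
        have h6 := norm_sub_le_norm_sub_add_norm_sub (θ x) (θ p) (θ s)
        linarith
    simp only [sub_self, norm_zero, sub_zero] at h4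
    rw [intervalIntegral.integral_const, smul_eq_mul]
    linarith
  have hT : θ ∈ S.transitions t (θ 0) (θ 1) := by
    refine ⟨⟨E, hEpos, hmem, fun _ => Λ, fun _ => hΛ, by simp, fun s s' h1 h2 h3 => ?_⟩, hACloc,
      rfl, rfl⟩
    rw [intervalIntegral.integral_const, smul_eq_mul, mul_comm]
    exact hlip s s' h1 h2.le h3
  have hTC : S.IsTransitionCurve t E (fun _ => Λ) θ := ⟨ht, hEpos, hmem, fun _ => hΛ, by simp,
    fun s s' h1 h2 h3 => by
      rw [intervalIntegral.integral_const, smul_eq_mul, mul_comm]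
      exact hlip s s' h1 h2 h3, hACloc⟩
  refine (iInf₂_le θ hT).trans (le_trans ?_ (lintegral_ofReal_deriv_le_of_monotoneOn zero_le_one hBm))
  rw [← restrict_Ioo_eq_restrict_Icc]
  refine lintegral_mono_ae ((ae_restrict_iff' measurableSet_Ioo).2 ?_)
  filter_upwards [hTC.ae_differentiableAt hRN hΨ hE, ae_differentiableAt_of_monotoneOn_Icc hBm] with
    r hr hrB hr01
  have hB' := (hrB hr01).hasDerivAt
  by_cases hG : r ∈ S.unstableSet t θ
  · rw [finslerDensity, if_pos hG]
    refine finsler_le_of_increments_le hΨ (hr hr01 hG) hG.2 hB' fun m hm hlt => ?_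
    obtain ⟨ρ, hρ, hd⟩ := hloc r hG.1 m hm hlt
    filter_upwards [Ioo_mem_nhdsGT (show r < min 1 (r + ρ) from lt_min hr01.2 (by linarith))]
      with s hs
    have h1 := hs.2.trans_le (min_le_left _ _)
    have h2 := hs.2.trans_le (min_le_right _ _)
    exact (hd r s hr01.1.le hs.1.le h1.le (by simpa using hρ)
      (by rw [abs_of_pos] <;> linarith [hs.1])).1
  · rw [finslerDensity, if_neg hG]
    exact metricDeriv_le_of_increments_le hΨ hr01 hB' hle

end RIS

end BalancedViscosity

/-! ### Limits of discrete chains are admissible transitions. -/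

namespace BalancedViscosity

theorem sub_le_sum_Ico_of_subadditive {V : Type*} [AddCommGroup V] {g : V → ℝ} (h0 : g 0 = 0)
    (hadd : ∀ v w, g (v + w) ≤ g v + g w) (x : ℕ → V) {p q : ℕ} (hpq : p ≤ q) :
    g (x q - x p) ≤ ∑ i ∈ Finset.Ico p q, g (x (i + 1) - x i) := by
  induction q, hpq using Nat.le_induction with
  | base => simp [h0]
  | succ q hpq ih =>
    rw [Finset.sum_Ico_succ_top hpq]
    have h1 := hadd (x (q + 1) - x q) (x q - x p)
    rw [sub_add_sub_cancel] at h1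
    linarith

/-- Reparametrization by arclength: `n r` is the last index whose arclength is at most `r`. -/
theorem exists_arclength_index {d : ℕ → ℝ} {N : ℕ} {κ : ℝ} (hd0 : ∀ i, 0 ≤ d i)
    (hdκ : ∀ i < N, d i ≤ κ) (hκ : 0 ≤ κ) (hN : ∑ i ∈ Finset.range N, d i ≤ 1) :
    ∃ n : ℝ → ℕ, Monotone n ∧ (∀ r, n r ≤ N) ∧ n 1 = N ∧ ∑ i ∈ Finset.range (n 0), d i = 0 ∧
      ∀ s s', 0 ≤ s → s ≤ s' → ∑ i ∈ Finset.Ico (n s) (n s'), d i ≤ s' - s + κ := by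
  classical
  set L : ℕ → ℝ := fun k => ∑ i ∈ Finset.range k, d i with hL
  have hLm : Monotone L := fun a b hab =>
    Finset.sum_le_sum_of_subset_of_nonneg (Finset.range_mono hab) fun i _ _ => hd0 i
  set n : ℝ → ℕ := fun r => Nat.findGreatest (fun k => L k ≤ r) N with hn
  have hspec : ∀ r, 0 ≤ r → L (n r) ≤ r := fun r hr =>
    Nat.findGreatest_spec (P := fun k => L k ≤ r) (Nat.zero_le N) (by simpa [hL] using hr)
  have hmono : Monotone n := fun a b hab =>
    Nat.findGreatest_mono_left (fun k hk => le_trans hk hab) N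
  refine ⟨n, hmono, fun r => Nat.findGreatest_le N, ?_, ?_, ?_⟩
  · exact le_antisymm (Nat.findGreatest_le N) (Nat.le_findGreatest le_rfl hN)
  · exact le_antisymm (hspec 0 le_rfl) (Finset.sum_nonneg fun i _ => hd0 i)
  · intro s s' hs hss'
    rw [Finset.sum_Ico_eq_sub _ (hmono hss')]
    rcases (Nat.findGreatest_le N : n s ≤ N).eq_or_lt with h1 | h1
    · have h2 : n s' = n s := le_antisymm ((Nat.findGreatest_le N).trans h1.ge) (hmono hss')
      rw [h2]
      linarith
    -- By maximality of `n s` one more step passes `s`; that step has length at most `κ`, which is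
    -- the only loss.
    · have h2 : s < L (n s + 1) := by
        have := Nat.findGreatest_is_greatest (P := fun k => L k ≤ s) (Nat.lt_succ_self (n s)) h1
        simpa using this
      have h3 : L (n s + 1) = L (n s) + d (n s) := Finset.sum_range_succ _ _
      have h4 := hspec s' (hs.trans hss')
      have h5 := hdκ _ h1
      simp only [hL] at h2 h3 h4
      linarith

namespace RIS

variable {V : Type*} [NormedAddCommGroup V] [NormedSpace ℝ V] [CompleteSpace V] {S : RIS V}

/-- Finite chains with small steps along which the slope is controlled converge to admissible
transitions, and the Finsler cost is lower semicontinuous in this limit. -/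
theorem finslerCost_le_of_chains (hRN : HasRadonNikodymProperty V)
    (hΨ : S.DissipationAssumptions) (hE : S.EnergyAssumptions) {t E ℓ : ℝ} (ht : t ∈ Icc 0 S.T)
    (hEpos : 0 < E) {N : ℕ → ℕ} {x : ℕ → ℕ → V} {σ y : ℕ → ℕ → ℝ} {a b : V}
    (hx : ∀ j, ∀ n ≤ N j, x j n ∈ S.sublevel E) (hσ : ∀ j, ∀ n < N j, σ j n ∈ Icc 0 S.T)
    (hσt : ∀ δ > 0, ∀ᶠ j in atTop, ∀ n < N j, |σ j n - t| < δ) (hy0 : ∀ j n, 0 ≤ y j n)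
    (hslope : ∀ j, ∀ n < N j, S.slope (σ j n) (x j (n + 1)) ≤ ENNReal.ofReal (y j n))
    (hstep : ∀ δ > 0, ∀ᶠ j in atTop, ∀ n < N j, ‖x j (n + 1) - x j n‖ < δ)
    (ha : Tendsto (fun j => x j 0) atTop (𝓝 a)) (hb : Tendsto (fun j => x j (N j)) atTop (𝓝 b))
    (hcost : Tendsto (fun j => ∑ n ∈ Finset.range (N j),
      (S.Ψ (x j (n + 1) - x j n) + y j n * ‖x j (n + 1) - x j n‖)) atTop (𝓝 ℓ)) :
    S.finslerCost t a b ≤ ENNReal.ofReal ℓ := by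
  have hK := hE.isCompact_sublevel hEpos
  have hmod := hΨ.psi_modulus hK
  obtain ⟨C, hC, hCle⟩ := hΨ.exists_psi_le
  set c : ℕ → ℕ → ℝ := fun j n => S.Ψ (x j (n + 1) - x j n) + y j n * ‖x j (n + 1) - x j n‖ with hc
  have hc0 : ∀ j n, 0 ≤ c j n := fun j n => add_nonneg (hΨ.psi_nonneg _)
    (mul_nonneg (hy0 j n) (norm_nonneg _))
  obtain ⟨Λ₀, hΛ₀⟩ := hcost.bddAbove_range
  set Λ := max Λ₀ 1 with hΛdef
  have hΛ : 0 < Λ := lt_of_lt_of_le one_pos (le_max_right _ _)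
  have hcΛ : ∀ j, ∑ n ∈ Finset.range (N j), c j n ≤ Λ := fun j =>
    (hΛ₀ ⟨j, rfl⟩).trans (le_max_left _ _)
  -- The slope bound is truncated at 1: `y` may be unbounded, so `y ‖δ‖` need not be small for small
  -- steps, whereas the truncated length is at most `(C + 1) ‖δ‖ / Λ`. Truncation still controls the
  -- norm where the slope is positive.
  set d : ℕ → ℕ → ℝ := fun j n =>
    (S.Ψ (x j (n + 1) - x j n) + min (y j n) 1 * ‖x j (n + 1) - x j n‖) / Λ with hd
  have hd0 : ∀ j n, 0 ≤ d j n := fun j n => div_nonneg (add_nonneg (hΨ.psi_nonneg _)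
    (mul_nonneg (le_min (hy0 j n) zero_le_one) (norm_nonneg _))) hΛ.le
  have hdc : ∀ j n, Λ * d j n ≤ c j n := by
    intro j n
    simp only [hd, hc]
    rw [mul_div_cancel₀ _ hΛ.ne']
    have := mul_le_mul_of_nonneg_right (min_le_left (y j n) 1) (norm_nonneg (x j (n + 1) - x j n))
    linarith
  have hΨd : ∀ j n, S.Ψ (x j (n + 1) - x j n) ≤ Λ * d j n := by
    intro j n
    simp only [hd]
    rw [mul_div_cancel₀ _ hΛ.ne']
    have := mul_nonneg (le_min (hy0 j n) zero_le_one) (norm_nonneg (x j (n + 1) - x j n))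
    linarith
  have hdN : ∀ j, ∑ i ∈ Finset.range (N j), d j i ≤ 1 := by
    intro j
    have h1 : Λ * ∑ i ∈ Finset.range (N j), d j i ≤ Λ * 1 := by
      rw [Finset.mul_sum, mul_one]
      exact (Finset.sum_le_sum fun i _ => hdc j i).trans (hcΛ j)
    exact le_of_mul_le_mul_left h1 hΛ
  have hκex : ∃ κ : ℕ → ℝ, (∀ j, 0 ≤ κ j) ∧ (∀ j, ∀ i < N j, d j i ≤ κ j) ∧
      Tendsto κ atTop (𝓝 0) := by
    refine ⟨fun j => (((Finset.range (N j)).sup fun i => (d j i).toNNReal : NNReal) : ℝ),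
      fun j => NNReal.coe_nonneg _, fun j i hi => ?_, ?_⟩
    · exact (Real.le_coe_toNNReal _).trans (NNReal.coe_le_coe.2
        (Finset.le_sup (f := fun i => (d j i).toNNReal) (Finset.mem_range.2 hi)))
    · rw [Metric.tendsto_nhds]
      intro δ hδ
      filter_upwards [hstep (δ * Λ / (C + 1)) (by positivity)] with j hj
      rw [Real.dist_eq, sub_zero, abs_of_nonneg (NNReal.coe_nonneg _)]
      lift δ to NNReal using hδ.le
      refine NNReal.coe_lt_coe.2 ((Finset.sup_lt_iff (by exact_mod_cast hδ)).2 fun i hi => ?_)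
      rw [Real.toNNReal_lt_iff_lt_coe (hd0 j i)]
      simp only [hd]
      rw [div_lt_iff₀ hΛ]
      have h1 := hj i (Finset.mem_range.1 hi)
      rw [lt_div_iff₀ (by positivity)] at h1
      have h2 := mul_le_mul_of_nonneg_right (min_le_right (y j i) 1)
        (norm_nonneg (x j (i + 1) - x j i))
      linarith [hCle (x j (i + 1) - x j i)]
  obtain ⟨κ, hκ0, hκ, hκlim⟩ := hκex
  choose n hnm hnN hn1 hn0 hnd using fun j => exists_arclength_index (hd0 j) (hκ j) (hκ0 j) (hdN j)
  set X : ℕ → ℝ → V := fun j r => x j (n j r) with hX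
  set A : ℕ → ℝ → ℝ := fun j r => ∑ i ∈ Finset.range (n j r), c j i with hA
  have hAsub : ∀ j s s', s ≤ s' → A j s' - A j s = ∑ i ∈ Finset.Ico (n j s) (n j s'), c j i :=
    fun j s s' h => (Finset.sum_Ico_eq_sub _ (hnm j h)).symm
  have hΨadd := hΨ.psi_add_le
  have hXmem : ∀ j r, X j r ∈ S.sublevel E := fun j r => hx j _ (hnN j r)
  have hXA : ∀ j s s', s ≤ s' → S.Ψ (X j s' - X j s) ≤ A j s' - A j s := by
    intro j s s' h
    rw [hAsub j s s' h]
    refine (sub_le_sum_Ico_of_subadditive hΨ.psi_zero hΨadd (x j) (hnm j h)).trans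
      (Finset.sum_le_sum fun i _ => (hΨd j i).trans (hdc j i))
  have hAm : ∀ j, Monotone (A j) := fun j s s' h => by
    have := hXA j s s' h
    linarith [hΨ.psi_nonneg (X j s' - X j s)]
  have hAbound : ∀ j, ∀ r ∈ Icc (0 : ℝ) 1, A j r ∈ Icc 0 Λ := fun j r hr =>
    ⟨Finset.sum_nonneg fun i _ => hc0 j i, ((hAm j hr.2).trans (by simp only [hA, hn1]; exact hcΛ j))⟩
  obtain ⟨φ, hφ, θ, B, hlim⟩ := exists_subseq_tendsto_of_monotone hK hmod
    (fun j r _ => hXmem j r) (fun j => (hAm j).monotoneOn _) hAbound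
    (fun j s s' _ h _ => hXA j s s' h)
  have hθ : ∀ r ∈ Icc (0 : ℝ) 1, Tendsto (fun k => X (φ k) r) atTop (𝓝 (θ r)) :=
    fun r hr => (hlim r hr).1
  have hB : ∀ r ∈ Icc (0 : ℝ) 1, Tendsto (fun k => A (φ k) r) atTop (𝓝 (B r)) :=
    fun r hr => (hlim r hr).2
  have hφt := hφ.tendsto_atTop
  have hκφ : Tendsto (fun k => κ (φ k)) atTop (𝓝 0) := hκlim.comp hφt
  have hmem : ∀ r ∈ Icc (0 : ℝ) 1, θ r ∈ S.sublevel E := fun r hr =>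
    hK.isClosed.mem_of_tendsto (hθ r hr) (Eventually.of_forall fun k => hXmem _ _)
  have hdiff : ∀ s ∈ Icc (0 : ℝ) 1, ∀ s' ∈ Icc (0 : ℝ) 1,
      Tendsto (fun k => X (φ k) s' - X (φ k) s) atTop (𝓝 (θ s' - θ s)) := fun s hs s' hs' =>
    (hθ s' hs').sub (hθ s hs)
  have hlimΛ : ∀ s s' : ℝ, Tendsto (fun k => Λ * (s' - s + κ (φ k))) atTop (𝓝 (Λ * (s' - s))) := by
    intro s s'
    have := (hκφ.const_add (s' - s)).const_mul Λ
    rwa [add_zero] at this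
  have hΛd : ∀ j s s', 0 ≤ s → s ≤ s' →
      ∑ i ∈ Finset.Ico (n j s) (n j s'), Λ * d j i ≤ Λ * (s' - s + κ j) := by
    intro j s s' hs hss'
    rw [← Finset.mul_sum]
    exact mul_le_mul_of_nonneg_left (hnd j s s' hs hss') hΛ.le
  have hlip : ∀ s s', 0 ≤ s → s ≤ s' → s' ≤ 1 → S.Ψ (θ s' - θ s) ≤ Λ * (s' - s) := by
    intro s s' h1 h2 h3
    refine le_of_tendsto_of_tendsto' ((hΨ.psi_continuous.tendsto _).comp
      (hdiff s ⟨h1, h2.trans h3⟩ s' ⟨h1.trans h2, h3⟩)) (hlimΛ s s') fun k => ?_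
    exact ((sub_le_sum_Ico_of_subadditive hΨ.psi_zero hΨadd _ (hnm _ h2)).trans
      (Finset.sum_le_sum fun i _ => hΨd _ i)).trans (hΛd _ s s' h1 h2)
  have hle : ∀ s s', 0 ≤ s → s ≤ s' → s' ≤ 1 → S.Ψ (θ s' - θ s) ≤ B s' - B s := by
    intro s s' h1 h2 h3
    have hs : s ∈ Icc (0 : ℝ) 1 := ⟨h1, h2.trans h3⟩
    have hs' : s' ∈ Icc (0 : ℝ) 1 := ⟨h1.trans h2, h3⟩
    exact le_of_tendsto_of_tendsto' ((hΨ.psi_continuous.tendsto _).comp (hdiff s hs s' hs'))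
      ((hB s' hs').sub (hB s hs)) fun k => hXA _ s s' h2
  have hcont : ContinuousOn θ (Icc 0 1) := by
    intro r hr
    rw [Metric.continuousWithinAt_iff]
    intro δ hδ
    obtain ⟨ε, hε, hd⟩ := hmod δ hδ
    refine ⟨ε / Λ, by positivity, fun s hs hsr => ?_⟩
    rw [Real.dist_eq, lt_div_iff₀ hΛ] at hsr
    rcases le_total s r with h2 | h2
    · rw [abs_of_nonpos (by linarith)] at hsr
      rw [dist_comm, dist_eq_norm]
      exact hd _ (hmem s hs) _ (hmem r hr) (by linarith [hlip s r hs.1 h2 hr.2])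
    · rw [abs_of_nonneg (by linarith)] at hsr
      rw [dist_eq_norm]
      exact hd _ (hmem r hr) _ (hmem s hs) (by linarith [hlip r s hr.1 h2 hs.2])
  have hloc : ∀ r ∈ Icc (0 : ℝ) 1, ∀ m : ℝ, 0 ≤ m → ENNReal.ofReal m < S.slope t (θ r) →
      ∃ ρ > 0, ∀ s s', 0 ≤ s → s ≤ s' → s' ≤ 1 → |s - r| < ρ → |s' - r| < ρ →
        S.Ψ (θ s' - θ s) + m * ‖θ s' - θ s‖ ≤ B s' - B s ∧
        min m 1 * ‖θ s' - θ s‖ ≤ Λ * (s' - s) := by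
    intro r hr m hm hmlt
    obtain ⟨η, hη, hball⟩ := Metric.mem_nhdsWithin_iff.1
      (hE.lowerSemicontinuousOn_slope hΨ hEpos (t, θ r) ⟨ht, hmem r hr⟩ _ hmlt)
    obtain ⟨ε, hε, hmodε⟩ := hmod (η / 2) (half_pos hη)
    obtain ⟨ρ₁, hρ₁, hdρ⟩ := Metric.continuousWithinAt_iff.1 (hcont r hr) (η / 4) (by positivity)
    refine ⟨min ρ₁ (ε / (4 * Λ)), lt_min hρ₁ (by positivity), fun s s' h1 h2 h3 h4 h5 => ?_⟩
    have hs : s ∈ Icc (0 : ℝ) 1 := ⟨h1, h2.trans h3⟩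
    have hs' : s' ∈ Icc (0 : ℝ) 1 := ⟨h1.trans h2, h3⟩
    have hss : Λ * (s' - s) < ε / 2 := by
      have h6 := abs_lt.1 (h4.trans_le (min_le_right _ _))
      have h7 := abs_lt.1 (h5.trans_le (min_le_right _ _))
      have h8 : s' - s < 2 * (ε / (4 * Λ)) := by linarith [h6.1, h7.2]
      calc Λ * (s' - s) < Λ * (2 * (ε / (4 * Λ))) := mul_lt_mul_of_pos_left h8 hΛ
        _ = ε / 2 := by field_simp; ring
    have hθs : ‖θ s - θ r‖ < η / 4 := by
      rw [← dist_eq_norm]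
      exact hdρ hs (by rw [Real.dist_eq]; exact h4.trans_le (min_le_left _ _))
    -- All intermediate chain points are Ψ-close, hence norm-close, to the value at `s`, so they lie
    -- in the neighbourhood of `(t, θ r)` where the slope exceeds `m`; the bounds `y` then exceed
    -- `m` as well.
    have hev : ∀ᶠ k in atTop, ∀ i ∈ Finset.Ico (n (φ k) s) (n (φ k) s'), m ≤ y (φ k) i := by
      filter_upwards [hφt.eventually (hσt η hη),
        (hlimΛ s s').eventually_lt_const (show Λ * (s' - s) < ε by linarith),
        Metric.tendsto_nhds.1 (hθ s hs) (η / 4) (by positivity)] with k hk1 hk2 hk3 i hi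
      rw [Finset.mem_Ico] at hi
      have hiN : i < N (φ k) := hi.2.trans_le (hnN _ _)
      have h6 : S.Ψ (x (φ k) (i + 1) - X (φ k) s) < ε := by
        refine lt_of_le_of_lt ?_ hk2
        refine (sub_le_sum_Ico_of_subadditive hΨ.psi_zero hΨadd _ (by omega)).trans
          (le_trans ?_ (hΛd _ s s' h1 h2))
        refine (Finset.sum_le_sum fun i _ => hΨd _ i).trans ?_
        exact Finset.sum_le_sum_of_subset_of_nonneg (Finset.Ico_subset_Ico le_rfl (by omega))
          fun i _ _ => mul_nonneg hΛ.le (hd0 _ _)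
      have hxi := hx (φ k) (i + 1) (by omega)
      have h7 := hmodε _ (hXmem (φ k) s) _ hxi h6
      rw [dist_eq_norm] at hk3
      have h8 : dist (x (φ k) (i + 1)) (θ r) < η := by
        rw [dist_eq_norm]
        have h9 := norm_sub_le_norm_sub_add_norm_sub (x (φ k) (i + 1)) (X (φ k) s) (θ r)
        have h10 := norm_sub_le_norm_sub_add_norm_sub (X (φ k) s) (θ s) (θ r)
        linarith
      have h9 : ENNReal.ofReal m < S.slope (σ (φ k) i) (x (φ k) (i + 1)) :=
        @hball (σ (φ k) i, x (φ k) (i + 1)) ⟨by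
          rw [Metric.mem_ball, Prod.dist_eq]
          exact max_lt (by rw [Real.dist_eq]; exact hk1 i hiN) h8, hσ _ i hiN, hxi⟩
      have h10 := h9.trans_le (hslope _ i hiN)
      exact (ENNReal.ofReal_lt_ofReal_iff'.1 h10).1.le
    have hn := hdiff s hs s' hs'
    constructor
    · refine le_of_tendsto_of_tendsto (((hΨ.psi_continuous.tendsto _).comp hn).add
        (hn.norm.const_mul m)) ((hB s' hs').sub (hB s hs)) ?_
      filter_upwards [hev] with k hk
      rw [hAsub _ s s' h2]
      refine (sub_le_sum_Ico_of_subadditive (g := fun v => S.Ψ v + m * ‖v‖) (by simp [hΨ.psi_zero])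
        (fun v w => ?_) (x (φ k)) (hnm (φ k) h2)).trans (Finset.sum_le_sum fun i hi => ?_)
      · have := mul_le_mul_of_nonneg_left (norm_add_le v w) hm
        linarith [hΨadd v w]
      · have := mul_le_mul_of_nonneg_right (hk i hi) (norm_nonneg (x (φ k) (i + 1) - x (φ k) i))
        simp only [hc]
        linarith
    · refine le_of_tendsto_of_tendsto (hn.norm.const_mul (min m 1)) (hlimΛ s s') ?_
      filter_upwards [hev] with k hk
      refine le_trans ?_ (hΛd _ s s' h1 h2)
      have hm1 : 0 ≤ min m 1 := le_min hm zero_le_one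
      refine (sub_le_sum_Ico_of_subadditive (g := fun v => min m 1 * ‖v‖) (by simp)
        (fun v w => ?_) (x (φ k)) (hnm (φ k) h2)).trans (Finset.sum_le_sum fun i hi => ?_)
      · have := mul_le_mul_of_nonneg_left (norm_add_le v w) hm1
        linarith
      · have := mul_le_mul_of_nonneg_right (min_le_min_right 1 (hk i hi))
          (norm_nonneg (x (φ k) (i + 1) - x (φ k) i))
        simp only [hd]
        rw [mul_div_cancel₀ _ hΛ.ne']
        linarith [hΨ.psi_nonneg (x (φ k) (i + 1) - x (φ k) i)]
  have hend := finslerCost_le_of_increments_le hRN hΨ hE ht hEpos hΛ.le hmem hcont hlip hle hloc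
  -- The index `n 0` need not be 0, but the steps before it have zero length, and positivity of Ψ
  -- identifies the points.
  have hθ0 : θ 0 = a := by
    refine tendsto_nhds_unique (hθ 0 (by simp)) ((ha.comp hφt).congr fun k => ?_)
    refine (hΨ.eq_of_psi_sub_le ?_).symm
    refine (sub_le_sum_Ico_of_subadditive hΨ.psi_zero hΨadd _ (Nat.zero_le _)).trans ?_
    refine (Finset.sum_le_sum fun i _ => hΨd _ i).trans ?_
    rw [← Finset.mul_sum, Nat.Ico_zero_eq_range, hn0, mul_zero]
  have hθ1 : θ 1 = b := by
    refine tendsto_nhds_unique (hθ 1 (by simp)) ((hb.comp hφt).congr fun k => ?_)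
    simp [hX, hn1]
  have hB1 : B 1 = ℓ := by
    refine tendsto_nhds_unique (hB 1 (by simp)) ((hcost.comp hφt).congr fun k => ?_)
    simp [hA, hn1, hc]
  have hB0 : 0 ≤ B 0 := ge_of_tendsto' (hB 0 (by simp)) fun k =>
    Finset.sum_nonneg fun i _ => hc0 _ i
  rw [hθ0, hθ1, hB1] at hend
  exact hend.trans (ENNReal.ofReal_le_ofReal (by linarith))

end RIS

end BalancedViscosity

/-! ### Controlled curves and their one-sided limits. -/

namespace BalancedViscosity

theorem exists_tendsto_of_control {V : Type*} [NormedAddCommGroup V] [CompleteSpace V]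
    {Ψ : V → ℝ} {K : Set V}
    (hmod : ∀ δ > 0, ∃ ε > 0, ∀ x ∈ K, ∀ y ∈ K, Ψ (y - x) < ε → ‖y - x‖ < δ)
    {I : Set ℝ} {u : ℝ → V} {A : ℝ → ℝ} (hu : ∀ t ∈ I, u t ∈ K)
    (hle : ∀ s ∈ I, ∀ t ∈ I, s ≤ t → Ψ (u t - u s) ≤ A t - A s) {l : Filter ℝ} [l.NeBot]
    (hl : ∀ᶠ s in l, s ∈ I) {α : ℝ} (hA : Tendsto A l (𝓝 α)) : ∃ x, Tendsto u l (𝓝 x) := by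
  rw [← cauchy_map_iff_exists_tendsto, Metric.cauchy_iff]
  refine ⟨inferInstance, fun δ hδ => ?_⟩
  obtain ⟨ε, hε, hd⟩ := hmod δ hδ
  have h1 := Metric.tendsto_nhds.1 hA (ε / 2) (half_pos hε)
  refine ⟨u '' {s | s ∈ I ∧ dist (A s) α < ε / 2}, ?_, ?_⟩
  · rw [mem_map]
    filter_upwards [hl, h1] with s hs hs' using mem_image_of_mem u ⟨hs, hs'⟩
  · rintro _ ⟨s, ⟨hs, hsα⟩, rfl⟩ _ ⟨t, ⟨ht, htα⟩, rfl⟩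
    rw [Real.dist_eq, abs_lt] at hsα htα
    rcases le_total s t with hst | hst
    · rw [dist_comm, dist_eq_norm]
      exact hd _ (hu s hs) _ (hu t ht) (by linarith [hle s hs t ht hst])
    · rw [dist_eq_norm]
      exact hd _ (hu t ht) _ (hu s hs) (by linarith [hle t ht s hs hst])

namespace RIS

variable {V : Type*} [NormedAddCommGroup V] [NormedSpace ℝ V] [CompleteSpace V] {S : RIS V}

/-- Curves in `D_E` whose `Ψ`-increments are controlled by those of `A`. -/
structure IsControlled (S : RIS V) (E : ℝ) (A : ℝ → ℝ) (u : ℝ → V) : Prop where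
  pos : 0 < E
  mem : ∀ t ∈ Icc 0 S.T, u t ∈ S.sublevel E
  le : ∀ s t, 0 ≤ s → s ≤ t → t ≤ S.T → S.Ψ (u t - u s) ≤ A t - A s

namespace IsControlled

variable {E : ℝ} {A : ℝ → ℝ} {u : ℝ → V}

theorem monotoneOn (h : S.IsControlled E A u) (hΨ : S.DissipationAssumptions) :
    MonotoneOn A (Icc 0 S.T) := fun s hs t ht hst => by
  linarith [h.le s t hs.1 hst ht.2, hΨ.psi_nonneg (u t - u s)]

theorem exists_tendsto_left (h : S.IsControlled E A u) (hΨ : S.DissipationAssumptions)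
    {t : ℝ} (ht : t ∈ Ioc 0 S.T) : ∃ α, Tendsto A (𝓝[<] t) (𝓝 α) := by
  have hm := h.monotoneOn hΨ
  have hT : t ∈ Icc 0 S.T := ⟨ht.1.le, ht.2⟩
  have hsub : Ioo 0 t ⊆ Icc 0 S.T := fun x hx => ⟨hx.1.le, hx.2.le.trans ht.2⟩
  refine ⟨_, MonotoneOn.tendsto_nhdsWithin_Ioo_left (y := 0) (nonempty_Ioo.2 ht.1)
    (hm.mono hsub) ⟨A t, ?_⟩⟩
  rintro _ ⟨x, hx, rfl⟩
  exact hm (hsub hx) hT hx.2.le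

theorem exists_tendsto_right (h : S.IsControlled E A u) (hΨ : S.DissipationAssumptions)
    {t : ℝ} (ht : t ∈ Ico 0 S.T) : ∃ α, Tendsto A (𝓝[>] t) (𝓝 α) := by
  have hm := h.monotoneOn hΨ
  have hT : t ∈ Icc 0 S.T := ⟨ht.1, ht.2.le⟩
  have hsub : Ioo t S.T ⊆ Icc 0 S.T := fun x hx => ⟨ht.1.trans hx.1.le, hx.2.le⟩
  refine ⟨_, MonotoneOn.tendsto_nhdsWithin_Ioo_right (y := S.T) (nonempty_Ioo.2 ht.2)
    (hm.mono hsub) ⟨A t, ?_⟩⟩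
  rintro _ ⟨x, hx, rfl⟩
  exact hm hT (hsub hx) hx.1.le

theorem eventually_left {T t : ℝ} (ht : t ∈ Ioc 0 T) : ∀ᶠ s in 𝓝[<] t, s ∈ Icc 0 T := by
  filter_upwards [Ioo_mem_nhdsLT ht.1] with s hs using ⟨hs.1.le, hs.2.le.trans ht.2⟩

theorem eventually_right {T t : ℝ} (ht : t ∈ Ico 0 T) : ∀ᶠ s in 𝓝[>] t, s ∈ Icc 0 T := by
  filter_upwards [Ioo_mem_nhdsGT ht.2] with s hs using ⟨ht.1.trans hs.1.le, hs.2.le⟩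

theorem tendsto_leftValue (h : S.IsControlled E A u) (hΨ : S.DissipationAssumptions)
    (hE : S.EnergyAssumptions) {t : ℝ} (ht : t ∈ Ioc 0 S.T) :
    Tendsto u (𝓝[<] t) (𝓝 (leftValue u t)) := by
  obtain ⟨α, hα⟩ := h.exists_tendsto_left hΨ ht
  have h1 := exists_tendsto_of_control (hΨ.psi_modulus (hE.isCompact_sublevel h.pos)) h.mem
    (fun s hs t ht hst => h.le s t hs.1 hst ht.2) (eventually_left ht) hα
  rw [leftValue, if_neg (not_le.2 ht.1)]
  exact tendsto_leftLim_of_tendsto h1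

theorem tendsto_rightValue (h : S.IsControlled E A u) (hΨ : S.DissipationAssumptions)
    (hE : S.EnergyAssumptions) {t : ℝ} (ht : t ∈ Ico 0 S.T) :
    Tendsto u (𝓝[>] t) (𝓝 (rightValue S.T u t)) := by
  obtain ⟨α, hα⟩ := h.exists_tendsto_right hΨ ht
  have h1 := exists_tendsto_of_control (hΨ.psi_modulus (hE.isCompact_sublevel h.pos)) h.mem
    (fun s hs t ht hst => h.le s t hs.1 hst ht.2) (eventually_right ht) hα
  rw [rightValue, if_neg (not_le.2 ht.2)]
  exact tendsto_rightLim_of_tendsto h1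

theorem leftValue_mem (h : S.IsControlled E A u) (hΨ : S.DissipationAssumptions)
    (hE : S.EnergyAssumptions) {t : ℝ} (ht : t ∈ Icc 0 S.T) : leftValue u t ∈ S.sublevel E := by
  rcases ht.1.eq_or_lt with h0 | h0
  · rw [leftValue, if_pos h0.ge]; exact h.mem t ht
  · exact (hE.isCompact_sublevel h.pos).isClosed.mem_of_tendsto (h.tendsto_leftValue hΨ hE ⟨h0, ht.2⟩)
      ((eventually_left ⟨h0, ht.2⟩).mono h.mem)

theorem rightValue_mem (h : S.IsControlled E A u) (hΨ : S.DissipationAssumptions)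
    (hE : S.EnergyAssumptions) {t : ℝ} (ht : t ∈ Icc 0 S.T) :
    rightValue S.T u t ∈ S.sublevel E := by
  rcases ht.2.eq_or_lt with h0 | h0
  · rw [rightValue, if_pos h0.ge]; exact h.mem t ht
  · exact (hE.isCompact_sublevel h.pos).isClosed.mem_of_tendsto
      (h.tendsto_rightValue hΨ hE ⟨ht.1, h0⟩) ((eventually_right ⟨ht.1, h0⟩).mono h.mem)

/-- The increment of `A` over `[s,t]` splits into the jump at `s`, the jump at `t`, and the
increment of `u` between the one-sided limits. -/
theorem add_psi_add_le (h : S.IsControlled E A u) (hΨ : S.DissipationAssumptions)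
    (hE : S.EnergyAssumptions) {s t p q : ℝ} (hs : 0 ≤ s) (hst : s < t) (ht : t ≤ S.T)
    (hp : ∀ r, s < r → r ≤ S.T → p ≤ A r - A s) (hq : ∀ r, 0 ≤ r → r < t → q ≤ A t - A r) :
    p + S.Ψ (leftValue u t - rightValue S.T u s) + q ≤ A t - A s := by
  have h1 : ∀ s' t', s < s' → s' < t' → t' < t → p + S.Ψ (u t' - u s') + q ≤ A t - A s := by
    intro s' t' h1 h2 h3
    linarith [hp s' h1 (by linarith), hq t' (by linarith) h3,
      h.le s' t' (by linarith) h2.le (by linarith)]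
  have h2 : ∀ s', s < s' → s' < t → p + S.Ψ (leftValue u t - u s') + q ≤ A t - A s := by
    intro s' h2 h3
    have k1 := ((hΨ.psi_continuous.tendsto _).comp
      ((h.tendsto_leftValue hΨ hE ⟨hs.trans_lt hst, ht⟩).sub_const (u s')))
    refine le_of_tendsto ((k1.const_add p).add_const q) ?_
    filter_upwards [Ioo_mem_nhdsLT h3] with t' ht'
    exact h1 s' t' h2 ht'.1 ht'.2
  have k1 := ((hΨ.psi_continuous.tendsto _).comp
      ((h.tendsto_rightValue hΨ hE ⟨hs, hst.trans_le ht⟩).const_sub (leftValue u t)))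
  refine le_of_tendsto ((k1.const_add p).add_const q) ?_
  filter_upwards [Ioo_mem_nhdsGT hst] with s' hs'
  exact h2 s' hs'.1 hs'.2

theorem psi_left_le (h : S.IsControlled E A u) (hΨ : S.DissipationAssumptions)
    (hE : S.EnergyAssumptions) {t : ℝ} (ht : t ≤ S.T) :
    ∀ r, 0 ≤ r → r < t → S.Ψ (u t - leftValue u t) ≤ A t - A r := by
  intro r hr hrt
  have k1 := ((hΨ.psi_continuous.tendsto _).comp
      ((h.tendsto_leftValue hΨ hE ⟨hr.trans_lt hrt, ht⟩).const_sub (u t)))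
  refine le_of_tendsto k1 ?_
  filter_upwards [Ioo_mem_nhdsLT hrt] with x hx
  have h2 := h.le x t (hr.trans hx.1.le) hx.2.le ht
  have h3 := h.monotoneOn hΨ ⟨hr, by linarith⟩ ⟨hr.trans hx.1.le, hx.2.le.trans ht⟩ hx.1.le
  simp only [Function.comp_apply]
  linarith

theorem psi_right_le (h : S.IsControlled E A u) (hΨ : S.DissipationAssumptions)
    (hE : S.EnergyAssumptions) {s : ℝ} (hs : 0 ≤ s) :
    ∀ r, s < r → r ≤ S.T → S.Ψ (rightValue S.T u s - u s) ≤ A r - A s := by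
  intro r hsr hr
  have k1 := ((hΨ.psi_continuous.tendsto _).comp
      ((h.tendsto_rightValue hΨ hE ⟨hs, hsr.trans_le hr⟩).sub_const (u s)))
  refine le_of_tendsto k1 ?_
  filter_upwards [Ioo_mem_nhdsGT hsr] with x hx
  have h2 := h.le s x hs hx.1.le (hx.2.le.trans hr)
  have h3 := h.monotoneOn hΨ ⟨hs.trans hx.1.le, hx.2.le.trans hr⟩ ⟨by linarith, hr⟩ hx.2.le
  simp only [Function.comp_apply]
  linarith

end IsControlled

theorem finslerCost_self (hΨ : S.DissipationAssumptions) {t E : ℝ} (hE : 0 < E) {x : V}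
    (hx : x ∈ S.sublevel E) : S.finslerCost t x x = 0 := by
  refine le_antisymm ?_ zero_le
  have hmem : (fun _ : ℝ => x) ∈ S.transitions t x x := by
    refine ⟨⟨E, hE, fun _ _ => hx, fun _ => 0, fun _ => le_rfl, by simp, fun s r _ _ _ => by
      simp [hΨ.psi_zero]⟩, fun c d _ _ => ⟨fun _ _ => mem_univ _, fun _ => 0, fun _ => le_rfl,
        by simp, fun s r _ _ _ => by simp⟩, rfl, rfl⟩
  refine (iInf₂_le _ hmem).trans (le_of_eq ?_)
  have : ∀ r, S.finslerDensity t (fun _ => x) r = 0 := by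
    intro r
    by_cases hr : r ∈ S.unstableSet t fun _ => x
    · simp [finslerDensity, if_pos hr, finsler, hΨ.psi_zero]
    · simp [finslerDensity, if_neg hr, metricDeriv, hΨ.psi_zero]
  simp [this]

end RIS

end BalancedViscosity

/-! ### Total variation and sums over jumps. -/

namespace BalancedViscosity

section Variation

variable {V : Type*} [NormedAddCommGroup V] [NormedSpace ℝ V]

theorem gaugeVar_add_le (Ψ : V → ℝ) (u : ℝ → V) {a s t : ℝ} (has : a ≤ s) (hst : s ≤ t) :
    gaugeVar Ψ u a s + ENNReal.ofReal (Ψ (u t - u s)) ≤ gaugeVar Ψ u a t := by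
  have : Nonempty (ℕ × { t : ℕ → ℝ // Monotone t ∧ ∀ i, t i ∈ Icc a s }) :=
    ⟨0, fun _ => a, monotone_const, fun _ => ⟨le_rfl, has⟩⟩
  rw [gaugeVar, ENNReal.iSup_add]
  refine iSup_le fun ⟨N, x, hx, hmem⟩ => ?_
  set z : ℕ → ℝ := fun i => if i ≤ N then x i else if i = N + 1 then s else t with hz
  have hz1 : ∀ i ≤ N, z i = x i := fun i hi => if_pos hi
  have hz2 : z (N + 1) = s := by simp [hz]
  have hz3 : z (N + 2) = t := by simp [hz]
  have hzm : Monotone z := by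
    refine monotone_nat_of_le_succ fun i => ?_
    rcases lt_trichotomy i N with h | rfl | h
    · rw [hz1 i h.le, hz1 (i + 1) h]; exact hx (Nat.le_succ i)
    · rw [hz1 i le_rfl, hz2]; exact (hmem i).2
    · have h1 : z (i + 1) = t := by simp only [hz]; rw [if_neg (by omega), if_neg (by omega)]
      rw [h1]
      simp only [hz]
      rw [if_neg (by omega)]
      split_ifs
      · exact hst
      · exact le_rfl
  have hzmem : ∀ i, z i ∈ Icc a t := by
    intro i
    simp only [hz]
    split_ifs
    · exact ⟨(hmem i).1, (hmem i).2.trans hst⟩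
    · exact ⟨has, hst⟩
    · exact ⟨has.trans hst, le_rfl⟩
  refine le_trans ?_ (le_iSup _ (⟨N + 2, z, hzm, hzmem⟩ :
    ℕ × { r : ℕ → ℝ // Monotone r ∧ ∀ i, r i ∈ Icc a t }))
  simp only
  rw [Finset.sum_range_succ, Finset.sum_range_succ, hz2, hz3]
  refine add_le_add (le_trans (le_of_eq (Finset.sum_congr rfl fun i hi => ?_)) le_self_add) le_rfl
  have hi' := Finset.mem_range.1 hi
  rw [hz1 i hi'.le, hz1 (i + 1) hi']

theorem gaugeVar_le_ofReal {Ψ : V → ℝ} {u : ℝ → V} (h0 : ∀ v, 0 ≤ Ψ v) {A : ℝ → ℝ} {a b : ℝ}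
    (h : ∀ s t, a ≤ s → s ≤ t → t ≤ b → Ψ (u t - u s) ≤ A t - A s) :
    gaugeVar Ψ u a b ≤ ENNReal.ofReal (A b - A a) := by
  refine iSup_le fun ⟨N, x, hx, hmem⟩ => ?_
  simp only
  rw [← ENNReal.ofReal_sum_of_nonneg fun i _ => h0 _]
  refine ENNReal.ofReal_le_ofReal ?_
  have h1 : ∑ i ∈ Finset.range N, Ψ (u (x (i + 1)) - u (x i)) ≤ A (x N) - A (x 0) := by
    rw [← Finset.sum_range_sub (fun i => A (x i))]
    exact Finset.sum_le_sum fun i _ => h _ _ (hmem i).1 (hx (Nat.le_succ i)) (hmem (i + 1)).2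
  have h2 := h a (x 0) le_rfl (hmem 0).1 (hmem 0).2
  have h3 := h (x N) b (hmem N).1 (hmem N).2 le_rfl
  linarith [h0 (u (x 0) - u a), h0 (u b - u (x N))]

theorem gaugeVar_self {Ψ : V → ℝ} (h0 : Ψ 0 = 0) (u : ℝ → V) (a : ℝ) : gaugeVar Ψ u a a = 0 := by
  refine le_antisymm (iSup_le fun ⟨N, x, hx, hmem⟩ => ?_) zero_le
  have : ∀ i, x i = a := fun i => by simpa using hmem i
  simp [this, h0]

/-- Superadditive set functions dominate the sum of the point masses they dominate. -/
theorem add_sum_Ioo_le {A p q : ℝ → ℝ} {c : ℝ → ℝ → ℝ} {T : ℝ}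
    (hc : ∀ r s t, c r t ≤ c r s + c s t)
    (h : ∀ s t, 0 ≤ s → s < t → t ≤ T → c s t + p s + q t ≤ A t - A s) (F : Finset ℝ) :
    ∀ s t, 0 ≤ s → s < t → t ≤ T → (∀ r ∈ F, r ∈ Ioo s t) →
      c s t + p s + q t + ∑ r ∈ F, (p r + q r) ≤ A t - A s := by
  -- Splitting at the largest point `m` leaves the other points to its left and a final interval
  -- `[m, t]` without interior points of `F`.
  induction F using Finset.induction_on_max with
  | empty => intro s t h1 h2 h3 _; simpa using h s t h1 h2 h3
  | insert m F hm ih =>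
    intro s t h1 h2 h3 hF
    have hmst := hF m (Finset.mem_insert_self _ _)
    rw [Finset.sum_insert fun hmem => (hm m hmem).false]
    have k1 := ih s m h1 hmst.1 (hmst.2.le.trans h3)
      fun r hr => ⟨(hF r (Finset.mem_insert_of_mem hr)).1, hm r hr⟩
    have k2 := h m t (h1.trans hmst.1.le) hmst.2 h3
    linarith [hc s m t]

/-- Each endpoint keeps only its inward mass. With this half-open bookkeeping the sums are additive
over adjacent intervals, which `totalVar_le` uses. -/
theorem add_sum_indicator_le {A p q : ℝ → ℝ} {c : ℝ → ℝ → ℝ} {T : ℝ}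
    (hc : ∀ r s t, c r t ≤ c r s + c s t) (hc0 : ∀ s, c s s = 0)
    (hp : ∀ r, 0 ≤ p r) (hq : ∀ r, 0 ≤ q r)
    (h : ∀ s t, 0 ≤ s → s < t → t ≤ T → c s t + p s + q t ≤ A t - A s) (F : Finset ℝ)
    {s t : ℝ} (hs : 0 ≤ s) (hst : s ≤ t) (ht : t ≤ T) :
    c s t + ∑ r ∈ F, ((Ico s t).indicator p r + (Ioc s t).indicator q r) ≤ A t - A s := by
  classical
  rcases hst.eq_or_lt with rfl | hst
  · simp [hc0]
  have h1 := add_sum_Ioo_le hc h (F.filter (· ∈ Ioo s t)) s t hs hst ht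
    fun r hr => (Finset.mem_filter.1 hr).2
  have h2 : ∑ r ∈ F, ((Ico s t).indicator p r + (Ioc s t).indicator q r) ≤
      p s + q t + ∑ r ∈ F.filter (· ∈ Ioo s t), (p r + q r) := by
    have h3 : ∀ r ∈ F, (Ico s t).indicator p r + (Ioc s t).indicator q r ≤
        ((if r = s then p s else 0) + (if r = t then q t else 0)) +
          if r ∈ Ioo s t then p r + q r else 0 := by
      intro r _
      by_cases hrs : r = s
      · subst hrs; simp [hst, hst.ne]
      by_cases hrt : r = t
      · subst hrt; simp [hst, hst.ne']
      by_cases hr : r ∈ Ioo s t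
      · rw [indicator_of_mem (Ioo_subset_Ico_self hr), indicator_of_mem (Ioo_subset_Ioc_self hr)]
        simp [hrs, hrt, hr]
      · rw [indicator_of_notMem, indicator_of_notMem]
        · simp [hrs, hrt, hr]
        · exact fun h => hr ⟨h.1, lt_of_le_of_ne h.2 hrt⟩
        · exact fun h => hr ⟨lt_of_le_of_ne h.1 (Ne.symm hrs), h.2⟩
    refine (Finset.sum_le_sum h3).trans ?_
    rw [Finset.sum_add_distrib, Finset.sum_add_distrib, Finset.sum_filter]
    have h4 : ∑ r ∈ F, (if r = s then p s else 0) ≤ p s := by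
      rw [Finset.sum_ite_eq']; split_ifs <;> simp [hp]
    have h5 : ∑ r ∈ F, (if r = t then q t else 0) ≤ q t := by
      rw [Finset.sum_ite_eq']; split_ifs <;> simp [hq]
    linarith
  linarith

/-- The sum of the masses `p` over `[0,t)` and `q` over `(0,t]`. -/
noncomputable def jumpSum (p q : ℝ → ℝ≥0∞) (t : ℝ) : ℝ≥0∞ :=
  ∑' r : ℝ, ((Ico 0 t).indicator p r + (Ioc 0 t).indicator q r)

theorem jumpSum_zero (p q : ℝ → ℝ≥0∞) : jumpSum p q 0 = 0 := by simp [jumpSum]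

theorem jumpSum_add (p q p' q' : ℝ → ℝ≥0∞) (t : ℝ) :
    jumpSum (fun r => p r + p' r) (fun r => q r + q' r) t = jumpSum p q t + jumpSum p' q' t := by
  rw [jumpSum, jumpSum, jumpSum, ← ENNReal.tsum_add]
  refine tsum_congr fun r => ?_
  by_cases h1 : r ∈ Ico 0 t <;> by_cases h2 : r ∈ Ioc 0 t <;>
    simp only [indicator_of_mem, indicator_of_notMem, h1, h2, not_false_eq_true] <;> ring

theorem jumpSum_congr {p q p' q' : ℝ → ℝ≥0∞} {t : ℝ} (hp : ∀ r ∈ Icc 0 t, p r = p' r)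
    (hq : ∀ r ∈ Icc 0 t, q r = q' r) : jumpSum p q t = jumpSum p' q' t := by
  refine tsum_congr fun r => ?_
  congr 1
  · by_cases h1 : r ∈ Ico 0 t
    · rw [indicator_of_mem h1, indicator_of_mem h1, hp r (Ico_subset_Icc_self h1)]
    · rw [indicator_of_notMem h1, indicator_of_notMem h1]
  · by_cases h1 : r ∈ Ioc 0 t
    · rw [indicator_of_mem h1, indicator_of_mem h1, hq r (Ioc_subset_Icc_self h1)]
    · rw [indicator_of_notMem h1, indicator_of_notMem h1]

theorem jumpSum_add_le (p q : ℝ → ℝ≥0∞) {s t : ℝ} (hs : 0 ≤ s) (hst : s < t) :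
    jumpSum p q s + p s + q t ≤ jumpSum p q t := by
  classical
  have h1 : p s = ∑' r : ℝ, if r = s then p s else 0 := by rw [tsum_ite_eq]
  have h2 : q t = ∑' r : ℝ, if r = t then q t else 0 := by rw [tsum_ite_eq]
  rw [h1, h2, jumpSum, ← ENNReal.tsum_add, ← ENNReal.tsum_add, jumpSum]
  refine ENNReal.tsum_le_tsum fun r => ?_
  rcases lt_trichotomy r s with h | rfl | h
  · have hi : ∀ {g : ℝ → ℝ≥0∞}, (Ioc 0 s).indicator g r = (Ioc 0 t).indicator g r := by
      intro g
      by_cases h0 : 0 < r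
      · rw [indicator_of_mem (show r ∈ Ioc 0 s from ⟨h0, h.le⟩),
          indicator_of_mem (show r ∈ Ioc 0 t from ⟨h0, (h.trans hst).le⟩)]
      · rw [indicator_of_notMem fun h' => h0 h'.1, indicator_of_notMem fun h' => h0 h'.1]
    have hj : ∀ {g : ℝ → ℝ≥0∞}, (Ico 0 s).indicator g r = (Ico 0 t).indicator g r := by
      intro g
      by_cases h0 : 0 ≤ r
      · rw [indicator_of_mem (show r ∈ Ico 0 s from ⟨h0, h⟩),
          indicator_of_mem (show r ∈ Ico 0 t from ⟨h0, h.trans hst⟩)]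
      · rw [indicator_of_notMem fun h' => h0 h'.1, indicator_of_notMem fun h' => h0 h'.1]
    rw [if_neg h.ne, if_neg (h.trans hst).ne, hi, hj]
    simp
  · rw [if_pos rfl, if_neg hst.ne, indicator_of_notMem (by simp),
      indicator_of_mem (show r ∈ Ico 0 t from ⟨hs, hst⟩),
      zero_add, add_zero, add_comm]
    gcongr
  · rw [indicator_of_notMem fun h' => h.not_gt h'.2, indicator_of_notMem fun h' => h.not_ge h'.2,
      if_neg h.ne']
    by_cases hrt : r = t
    · subst hrt
      rw [if_pos rfl, indicator_of_mem (show r ∈ Ioc 0 r from ⟨hs.trans_lt h, le_rfl⟩)]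
      simp
    · simp [hrt]

/-- `jumpSum` is bounded by any function that dominates the finite partial sums. -/
theorem add_jumpSum_le {p q : ℝ → ℝ≥0∞} {t : ℝ} {g X : ℝ≥0∞}
    (h : ∀ F : Finset ℝ, g + ∑ r ∈ F, ((Ico 0 t).indicator p r + (Ioc 0 t).indicator q r) ≤ X) :
    g + jumpSum p q t ≤ X := by
  rw [jumpSum, ENNReal.tsum_eq_iSup_sum, ENNReal.add_iSup]
  exact iSup_le h

/-- Times without a jump cost nothing, so the sum may run over all reals and the jump set drops out;
the two boundary terms are the inward masses at 0 and `t`. -/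
theorem jumpVar_eq_jumpSum {T : ℝ} {c : ℝ → V → V → ℝ≥0∞} {u : ℝ → V}
    (hc : ∀ r ∈ Icc 0 T, c r (u r) (u r) = 0) {t : ℝ} (ht : t ∈ Ioc 0 T) :
    jumpVar T c u 0 t = jumpSum (fun r => c r (u r) (rightValue T u r))
      (fun r => c r (leftValue u r) (u r)) t := by
  classical
  rw [jumpVar, jumpSum]
  have h1 : c 0 (u 0) (rightValue T u 0) =
      ∑' r : ℝ, if r = 0 then c 0 (u 0) (rightValue T u 0) else 0 := by rw [tsum_ite_eq]
  have h2 : c t (leftValue u t) (u t) =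
      ∑' r : ℝ, if r = t then c t (leftValue u t) (u t) else 0 := by rw [tsum_ite_eq]
  rw [h1, h2, ← ENNReal.tsum_add]
  rw [tsum_subtype (jumpSet T u ∩ Ioo 0 t)
    (fun r => c r (leftValue u r) (u r) + c r (u r) (rightValue T u r)), ← ENNReal.tsum_add]
  refine tsum_congr fun r => ?_
  by_cases hr0 : r = 0
  · subst hr0
    rw [if_pos rfl, if_neg ht.1.ne, indicator_of_notMem (by simp),
      indicator_of_mem (show (0 : ℝ) ∈ Ico 0 t from ⟨le_rfl, ht.1⟩),
      indicator_of_notMem (by simp)]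
    simp
  by_cases hrt : r = t
  · subst hrt
    rw [if_neg hr0, if_pos rfl, indicator_of_notMem (by simp), indicator_of_notMem (by simp),
      indicator_of_mem (show r ∈ Ioc 0 r from ⟨ht.1, le_rfl⟩)]
    simp
  rw [if_neg hr0, if_neg hrt, add_zero, zero_add]
  by_cases hr : r ∈ Ioo 0 t
  · rw [indicator_of_mem (Ioo_subset_Ico_self hr), indicator_of_mem (Ioo_subset_Ioc_self hr)]
    by_cases hJ : r ∈ jumpSet T u
    · rw [indicator_of_mem (show r ∈ jumpSet T u ∩ Ioo 0 t from ⟨hJ, hr⟩), add_comm]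
    · have hrT : r ∈ Icc 0 T := ⟨hr.1.le, hr.2.le.trans ht.2⟩
      have h3 : leftValue u r = u r ∧ u r = rightValue T u r := by
        by_contra hcon
        rw [not_and_or] at hcon
        exact hJ ⟨hrT, hcon⟩
      rw [indicator_of_notMem fun h => hJ h.1, h3.1, ← h3.2, hc r hrT, add_zero]
  · rw [indicator_of_notMem fun h => hr h.2, indicator_of_notMem, indicator_of_notMem, add_zero]
    · exact fun h => hr ⟨h.1, lt_of_le_of_ne h.2 hrt⟩
    · exact fun h => hr ⟨lt_of_le_of_ne h.1 (Ne.symm hr0), h.2⟩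

end Variation

end BalancedViscosity

/-! ### The 𝔣-variation as Ψ-variation plus excess jump cost. -/

namespace BalancedViscosity

namespace RIS

variable {V : Type*} [NormedAddCommGroup V] [NormedSpace ℝ V] [CompleteSpace V] (S : RIS V)

/-- `Δ_r(u(r), u(r₊)) - Ψ(u(r₊) - u(r))`. -/
noncomputable def rightExcess (u : ℝ → V) (r : ℝ) : ℝ≥0∞ :=
  S.finslerCost r (u r) (rightValue S.T u r) - ENNReal.ofReal (S.Ψ (rightValue S.T u r - u r))

/-- `Δ_r(u(r₋), u(r)) - Ψ(u(r) - u(r₋))`. -/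
noncomputable def leftExcess (u : ℝ → V) (r : ℝ) : ℝ≥0∞ :=
  S.finslerCost r (leftValue u r) (u r) - ENNReal.ofReal (S.Ψ (u r - leftValue u r))

/-- The `𝔣`-variation on `[0,t]`, as the `Ψ`-variation plus the excess cost of the jumps. -/
noncomputable def totalVar (u : ℝ → V) (t : ℝ) : ℝ≥0∞ :=
  gaugeVar S.Ψ u 0 t + jumpSum (S.rightExcess u) (S.leftExcess u) t

variable {S}

theorem totalVar_zero (hΨ : S.DissipationAssumptions) (u : ℝ → V) : S.totalVar u 0 = 0 := by
  rw [totalVar, gaugeVar_self hΨ.psi_zero, jumpSum_zero, add_zero]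

theorem ofReal_add_rightExcess (hRN : HasRadonNikodymProperty V)
    (hΨ : S.DissipationAssumptions) (hE : S.EnergyAssumptions) {t : ℝ} (ht : t ∈ Icc 0 S.T)
    (u : ℝ → V) : ENNReal.ofReal (S.Ψ (rightValue S.T u t - u t)) + S.rightExcess u t =
      S.finslerCost t (u t) (rightValue S.T u t) :=
  add_tsub_cancel_of_le (ofReal_psi_le_finslerCost hRN hΨ hE ht _ _)

theorem ofReal_add_leftExcess (hRN : HasRadonNikodymProperty V)
    (hΨ : S.DissipationAssumptions) (hE : S.EnergyAssumptions) {t : ℝ} (ht : t ∈ Icc 0 S.T)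
    (u : ℝ → V) : ENNReal.ofReal (S.Ψ (u t - leftValue u t)) + S.leftExcess u t =
      S.finslerCost t (leftValue u t) (u t) :=
  add_tsub_cancel_of_le (ofReal_psi_le_finslerCost hRN hΨ hE ht _ _)

namespace IsControlled

variable {E : ℝ} {A : ℝ → ℝ} {u : ℝ → V}

theorem gaugeVar_le (h : S.IsControlled E A u) (hΨ : S.DissipationAssumptions) {t : ℝ}
    (ht : t ≤ S.T) : gaugeVar S.Ψ u 0 t ≤ ENNReal.ofReal (A t - A 0) :=
  gaugeVar_le_ofReal hΨ.psi_nonneg fun s r h1 h2 h3 => h.le s r h1 h2 (h3.trans ht)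

theorem gaugeVar_ne_top (h : S.IsControlled E A u) (hΨ : S.DissipationAssumptions) {t : ℝ}
    (ht : t ≤ S.T) : gaugeVar S.Ψ u 0 t ≠ ⊤ :=
  ne_top_of_le_ne_top ENNReal.ofReal_ne_top (h.gaugeVar_le hΨ ht)

/-- A controlled curve is controlled by its own variation. -/
theorem gaugeVar_control (h : S.IsControlled E A u) (hΨ : S.DissipationAssumptions) :
    S.IsControlled E (fun t => (gaugeVar S.Ψ u 0 t).toReal) u := by
  refine ⟨h.pos, h.mem, fun s t h1 h2 h3 => ?_⟩
  have h4 := ENNReal.toReal_mono (h.gaugeVar_ne_top hΨ h3) (gaugeVar_add_le S.Ψ u h1 h2)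
  rw [ENNReal.toReal_add (h.gaugeVar_ne_top hΨ (h2.trans h3)) ENNReal.ofReal_ne_top,
    ENNReal.toReal_ofReal (hΨ.psi_nonneg _)] at h4
  linarith

theorem gaugeVar_add_psi_le (h : S.IsControlled E A u) (hΨ : S.DissipationAssumptions)
    (hE : S.EnergyAssumptions) {s t : ℝ} (hs : 0 ≤ s) (hst : s < t) (ht : t ≤ S.T) :
    gaugeVar S.Ψ u 0 s + (ENNReal.ofReal (S.Ψ (rightValue S.T u s - u s)) +
      ENNReal.ofReal (S.Ψ (leftValue u t - rightValue S.T u s)) +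
      ENNReal.ofReal (S.Ψ (u t - leftValue u t))) ≤ gaugeVar S.Ψ u 0 t := by
  have h' := h.gaugeVar_control hΨ
  have h1 := h'.add_psi_add_le hΨ hE hs hst ht (h'.psi_right_le hΨ hE hs) (h'.psi_left_le hΨ hE ht)
  have hn := fun v => hΨ.psi_nonneg v
  rw [← ENNReal.ofReal_add (hn _) (hn _), ← ENNReal.ofReal_add (add_nonneg (hn _) (hn _)) (hn _),
    ← ENNReal.ofReal_toReal (h.gaugeVar_ne_top hΨ (hst.le.trans ht)),
    ← ENNReal.ofReal_toReal (h.gaugeVar_ne_top hΨ ht),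
    ← ENNReal.ofReal_add ENNReal.toReal_nonneg (add_nonneg (add_nonneg (hn _) (hn _)) (hn _))]
  exact ENNReal.ofReal_le_ofReal (by linarith)

/-- Superadditivity of the `𝔣`-variation. -/
theorem totalVar_add_le (h : S.IsControlled E A u) (hRN : HasRadonNikodymProperty V)
    (hΨ : S.DissipationAssumptions)
    (hE : S.EnergyAssumptions) {s t : ℝ} (hs : 0 ≤ s) (hst : s < t) (ht : t ≤ S.T) :
    S.totalVar u s + (S.finslerCost s (u s) (rightValue S.T u s) +
      ENNReal.ofReal (S.Ψ (leftValue u t - rightValue S.T u s)) +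
      S.finslerCost t (leftValue u t) (u t)) ≤ S.totalVar u t := by
  have h1 := h.gaugeVar_add_psi_le hΨ hE hs hst ht
  have h2 := jumpSum_add_le (S.rightExcess u) (S.leftExcess u) hs hst
  rw [← ofReal_add_rightExcess hRN hΨ hE ⟨hs, hst.le.trans ht⟩,
    ← ofReal_add_leftExcess hRN hΨ hE ⟨hs.trans hst.le, ht⟩, totalVar, totalVar]
  refine le_trans (le_of_eq ?_) (add_le_add h1 h2)
  ring

theorem ofReal_sum_indicator {p q : ℝ → ℝ≥0∞} {t : ℝ} (F : Finset ℝ)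
    (hp : ∀ r ∈ Ico 0 t, p r ≠ ⊤) (hq : ∀ r ∈ Ioc 0 t, q r ≠ ⊤) :
    ∑ r ∈ F, ((Ico 0 t).indicator p r + (Ioc 0 t).indicator q r) =
      ENNReal.ofReal (∑ r ∈ F, ((Ico 0 t).indicator (fun r => (p r).toReal) r +
        (Ioc 0 t).indicator (fun r => (q r).toReal) r)) := by
  have h1 : ∀ r, 0 ≤ (Ico 0 t).indicator (fun r => (p r).toReal) r :=
    indicator_nonneg fun _ _ => ENNReal.toReal_nonneg
  have h2 : ∀ r, 0 ≤ (Ioc 0 t).indicator (fun r => (q r).toReal) r :=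
    indicator_nonneg fun _ _ => ENNReal.toReal_nonneg
  rw [ENNReal.ofReal_sum_of_nonneg fun r _ => add_nonneg (h1 r) (h2 r)]
  refine Finset.sum_congr rfl fun r _ => ?_
  rw [ENNReal.ofReal_add (h1 r) (h2 r)]
  congr 1
  · by_cases hr : r ∈ Ico 0 t
    · rw [indicator_of_mem hr, indicator_of_mem hr, ENNReal.ofReal_toReal (hp r hr)]
    · rw [indicator_of_notMem hr, indicator_of_notMem hr, ENNReal.ofReal_zero]
  · by_cases hr : r ∈ Ioc 0 t
    · rw [indicator_of_mem hr, indicator_of_mem hr, ENNReal.ofReal_toReal (hq r hr)]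
    · rw [indicator_of_notMem hr, indicator_of_notMem hr, ENNReal.ofReal_zero]

/-- This makes the truncated subtraction in `finslerVar` a genuine one. The jump parts of the
variation are disjoint contributions to it, summed over finite sets first. -/
theorem jumpVar_psi_le (h : S.IsControlled E A u) (hΨ : S.DissipationAssumptions)
    (hE : S.EnergyAssumptions) {t : ℝ} (ht : t ∈ Ioc 0 S.T) :
    jumpVar S.T (fun _ x y => ENNReal.ofReal (S.Ψ (y - x))) u 0 t ≤ gaugeVar S.Ψ u 0 t := by
  rw [jumpVar_eq_jumpSum (fun r _ => by simp [hΨ.psi_zero]) ht, ← zero_add (jumpSum _ _ _)]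
  refine add_jumpSum_le fun F => ?_
  have h' := h.gaugeVar_control hΨ
  rw [zero_add, ofReal_sum_indicator F (fun _ _ => by simp) (fun _ _ => by simp)]
  refine ENNReal.ofReal_le_of_le_toReal ?_
  have h1 := add_sum_indicator_le (c := fun _ _ => 0) (T := S.T)
    (A := fun t => (gaugeVar S.Ψ u 0 t).toReal)
    (p := fun r => (ENNReal.ofReal (S.Ψ (rightValue S.T u r - u r))).toReal)
    (q := fun r => (ENNReal.ofReal (S.Ψ (u r - leftValue u r))).toReal) (by simp) (by simp)
    (fun _ => ENNReal.toReal_nonneg) (fun _ => ENNReal.toReal_nonneg) (fun s r h1 h2 h3 => by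
      have h4 := h'.add_psi_add_le hΨ hE h1 h2 h3 (h'.psi_right_le hΨ hE h1)
        (h'.psi_left_le hΨ hE h3)
      rw [ENNReal.toReal_ofReal (hΨ.psi_nonneg _), ENNReal.toReal_ofReal (hΨ.psi_nonneg _)]
      linarith [hΨ.psi_nonneg (leftValue u r - rightValue S.T u s)]) F le_rfl ht.1.le ht.2
  simp only [gaugeVar_self hΨ.psi_zero, ENNReal.toReal_zero, sub_zero, zero_add] at h1
  exact h1

/-- Each Finsler jump cost is the Ψ-cost plus the excess, so the Ψ-jump part cancels and only the
excess remains. -/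
theorem finslerVar_eq_totalVar (h : S.IsControlled E A u) (hRN : HasRadonNikodymProperty V)
    (hΨ : S.DissipationAssumptions) (hE : S.EnergyAssumptions) {t : ℝ} (ht : t ∈ Ioc 0 S.T) :
    S.finslerVar u 0 t = S.totalVar u t := by
  have h1 := h.jumpVar_psi_le hΨ hE ht
  have h2 : jumpVar S.T S.finslerCost u 0 t =
      jumpVar S.T (fun _ x y => ENNReal.ofReal (S.Ψ (y - x))) u 0 t +
        jumpSum (S.rightExcess u) (S.leftExcess u) t := by
    rw [jumpVar_eq_jumpSum (fun r hr => finslerCost_self hΨ h.pos (h.mem r hr)) ht,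
      jumpVar_eq_jumpSum (fun r _ => by simp [hΨ.psi_zero]) ht, ← jumpSum_add]
    refine jumpSum_congr (fun r hr => ?_) fun r hr => ?_
    · exact (ofReal_add_rightExcess hRN hΨ hE ⟨hr.1, hr.2.trans ht.2⟩ u).symm
    · exact (ofReal_add_leftExcess hRN hΨ hE ⟨hr.1, hr.2.trans ht.2⟩ u).symm
  rw [finslerVar, h2, ← add_assoc, tsub_add_cancel_of_le h1, totalVar]

/-- The `𝔣`-variation is the smallest function that controls the increments and the jumps. -/
theorem totalVar_le (h : S.IsControlled E A u) (hRN : HasRadonNikodymProperty V)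
    (hΨ : S.DissipationAssumptions) (hE : S.EnergyAssumptions)
    (hright : ∀ s t, 0 ≤ s → s < t → t ≤ S.T →
      S.finslerCost s (u s) (rightValue S.T u s) ≤ ENNReal.ofReal (A t - A s))
    (hleft : ∀ s t, 0 ≤ s → s < t → t ≤ S.T →
      S.finslerCost t (leftValue u t) (u t) ≤ ENNReal.ofReal (A t - A s))
    {t : ℝ} (ht : t ∈ Icc 0 S.T) : S.totalVar u t ≤ ENNReal.ofReal (A t - A 0) := by
  have hm := h.monotoneOn hΨ
  have hA0 : ∀ s t, 0 ≤ s → s ≤ t → t ≤ S.T → 0 ≤ A t - A s := fun s t h1 h2 h3 =>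
    sub_nonneg.2 (hm ⟨h1, h2.trans h3⟩ ⟨h1.trans h2, h3⟩ h2)
  set p : ℝ → ℝ := fun r => (S.rightExcess u r).toReal with hp
  set q : ℝ → ℝ := fun r => (S.leftExcess u r).toReal with hq
  have hR : ∀ s t, 0 ≤ s → s < t → t ≤ S.T → S.rightExcess u s ≠ ⊤ ∧
      S.Ψ (rightValue S.T u s - u s) + p s ≤ A t - A s := by
    intro s t h1 h2 h3
    have h4 := hright s t h1 h2 h3
    rw [← ofReal_add_rightExcess hRN hΨ hE ⟨h1, h2.le.trans h3⟩] at h4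
    have h5 : S.rightExcess u s ≠ ⊤ := ne_top_of_le_ne_top ENNReal.ofReal_ne_top
      (le_add_self.trans h4)
    refine ⟨h5, ?_⟩
    have h6 := ENNReal.toReal_mono ENNReal.ofReal_ne_top h4
    rwa [ENNReal.toReal_add ENNReal.ofReal_ne_top h5, ENNReal.toReal_ofReal (hΨ.psi_nonneg _),
      ENNReal.toReal_ofReal (hA0 s t h1 h2.le h3)] at h6
  have hL : ∀ s t, 0 ≤ s → s < t → t ≤ S.T → S.leftExcess u t ≠ ⊤ ∧
      S.Ψ (u t - leftValue u t) + q t ≤ A t - A s := by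
    intro s t h1 h2 h3
    have h4 := hleft s t h1 h2 h3
    rw [← ofReal_add_leftExcess hRN hΨ hE ⟨h1.trans h2.le, h3⟩] at h4
    have h5 : S.leftExcess u t ≠ ⊤ := ne_top_of_le_ne_top ENNReal.ofReal_ne_top
      (le_add_self.trans h4)
    refine ⟨h5, ?_⟩
    have h6 := ENNReal.toReal_mono ENNReal.ofReal_ne_top h4
    rwa [ENNReal.toReal_add ENNReal.ofReal_ne_top h5, ENNReal.toReal_ofReal (hΨ.psi_nonneg _),
      ENNReal.toReal_ofReal (hA0 s t h1 h2.le h3)] at h6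
  have hbase : ∀ s t, 0 ≤ s → s < t → t ≤ S.T → S.Ψ (u t - u s) + p s + q t ≤ A t - A s := by
    intro s t h1 h2 h3
    have h4 := h.add_psi_add_le hΨ hE h1 h2 h3 (fun r hr hr' => (hR s r h1 hr hr').2)
      (fun r hr hr' => (hL r t hr hr' h3).2)
    have h5 := hΨ.psi_triangle (u s) (rightValue S.T u s) (u t)
    have h6 := hΨ.psi_triangle (rightValue S.T u s) (leftValue u t) (u t)
    linarith
  refine add_jumpSum_le fun F => ?_
  -- For a finite set `F` of times, subtract its excess masses from `A`: the remainder still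
  -- controls the Ψ-increments, hence dominates the Ψ-variation. The supremum over `F` follows.
  set σ : ℝ → ℝ → ℝ := fun s t => ∑ r ∈ F, ((Ico s t).indicator p r + (Ioc s t).indicator q r) with hσ
  have hσ0 : ∀ s t, 0 ≤ σ s t := fun s t => Finset.sum_nonneg fun r _ =>
    add_nonneg (indicator_nonneg (fun _ _ => ENNReal.toReal_nonneg) r)
      (indicator_nonneg (fun _ _ => ENNReal.toReal_nonneg) r)
  have hσadd : ∀ s t, 0 ≤ s → s ≤ t → σ 0 t = σ 0 s + σ s t := by
    intro s t h1 h2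
    simp only [hσ]
    rw [← Finset.sum_add_distrib]
    refine Finset.sum_congr rfl fun r _ => ?_
    rw [← Ico_union_Ico_eq_Ico h1 h2, ← Ioc_union_Ioc_eq_Ioc h1 h2,
      indicator_union_of_disjoint (Ico_disjoint_Ico_same),
      indicator_union_of_disjoint (Ioc_disjoint_Ioc_of_le le_rfl)]
    ring
  have hkey : ∀ s t, 0 ≤ s → s ≤ t → t ≤ S.T → S.Ψ (u t - u s) + σ s t ≤ A t - A s :=
    fun s t h1 h2 h3 => add_sum_indicator_le (c := fun s t => S.Ψ (u t - u s))
      (fun r s t => hΨ.psi_triangle _ _ _) (by simp [hΨ.psi_zero])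
      (fun _ => ENNReal.toReal_nonneg) (fun _ => ENNReal.toReal_nonneg) hbase F h1 h2 h3
  have hg : gaugeVar S.Ψ u 0 t ≤ ENNReal.ofReal ((A t - σ 0 t) - (A 0 - σ 0 0)) :=
    gaugeVar_le_ofReal (A := fun r => A r - σ 0 r) hΨ.psi_nonneg fun s r h1 h2 h3 => by
      have h4 := hkey s r h1 h2 (h3.trans ht.2)
      have h5 := hσadd s r h1 h2
      linarith
  have hσ00 : σ 0 0 = 0 := by simp [hσ]
  rw [ofReal_sum_indicator F (fun r hr => (hR r t hr.1 hr.2 ht.2).1)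
    (fun r hr => (hL 0 r le_rfl hr.1 (hr.2.trans ht.2)).1)]
  refine (add_le_add_left hg _).trans ?_
  have h3 := hkey 0 t le_rfl ht.1 ht.2
  have h4 := hΨ.psi_nonneg (u t - u 0)
  rw [← ENNReal.ofReal_add (by linarith) (hσ0 0 t)]
  exact ENNReal.ofReal_le_ofReal (by simp only [hσ] at *; linarith)

end IsControlled

end RIS

end BalancedViscosity

/-! ### A priori estimates for the discrete scheme. -/

namespace BalancedViscosity

namespace RIS

variable {V : Type*} [NormedAddCommGroup V] [NormedSpace ℝ V] [CompleteSpace V]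

/-- The time `min (nτ) T` at which the energy enters the `n`-th minimization problem. -/
noncomputable def node (S : RIS V) (τ : ℝ) (n : ℕ) : ℝ := min ((n : ℝ) * τ) S.T

variable {S : RIS V}

theorem node_mem (hT : 0 < S.T) {τ : ℝ} (hτ : 0 < τ) (n : ℕ) : S.node τ n ∈ Icc 0 S.T :=
  ⟨le_min (by positivity) hT.le, min_le_right _ _⟩

theorem node_zero (hT : 0 < S.T) (τ : ℝ) : S.node τ 0 = 0 := by simp [node, hT.le]

theorem node_mono {τ : ℝ} (hτ : 0 < τ) : Monotone (S.node τ) := fun m n hmn =>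
  min_le_min_right _ (mul_le_mul_of_nonneg_right (by exact_mod_cast hmn) hτ.le)

/-- A priori information on a discrete solution: it stays in `D_E`, and `y n` bounds the slope at
the `(n+1)`-st step and is conjugate to the viscous speed. -/
structure IsDiscreteChain (S : RIS V) (E C τ ε : ℝ) (U : ℕ → V) (y : ℕ → ℝ) : Prop where
  mem : ∀ n ≤ ⌈S.T / τ⌉₊, U n ∈ S.sublevel E
  nonneg : ∀ n, 0 ≤ y n
  slope_le : ∀ n < ⌈S.T / τ⌉₊, S.slope (S.node τ (n + 1)) (U (n + 1)) ≤ ENNReal.ofReal (y n)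
  conj : ∀ n < ⌈S.T / τ⌉₊, ∀ b, 0 ≤ b → S.F (‖U (n + 1) - U n‖ / (τ / ε)) +
    y n * (b - ‖U (n + 1) - U n‖ / (τ / ε)) ≤ S.F b
  sum_le : ∑ n ∈ Finset.range ⌈S.T / τ⌉₊,
    (S.Ψ (U (n + 1) - U n) + τ / ε * S.F (‖U (n + 1) - U n‖ / (τ / ε))) ≤ C
  dissipation : ∀ ω κ, S.IsModulus E ω → 0 ≤ κ → ∀ n < ⌈S.T / τ⌉₊,
    ω (S.node τ (n + 1)) (U (n + 1)) (U n) ≤ κ →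
    S.Ψ (U (n + 1) - U n) + y n * ‖U (n + 1) - U n‖ + S.energy (S.node τ (n + 1)) (U (n + 1)) ≤
      S.energy (S.node τ (n + 1)) (U n) + κ * S.Ψ (U (n + 1) - U n)

theorem exists_isDiscreteChain (hT : 0 < S.T) (hΨ : S.DissipationAssumptions)
    (hE : S.EnergyAssumptions) (hD : S.D.Nonempty) {G : ℝ} (hG : 0 ≤ G) :
    ∃ E > 0, ∃ C ≥ 0, ∀ (τ ε : ℝ) (U : ℕ → V), 0 < τ → 0 < ε → S.IsDiscreteSolution τ ε U →
      U 0 ∈ S.D → S.Ψ (U 0) + S.energy 0 (U 0) ≤ G → ∃ y, S.IsDiscreteChain E C τ ε U y := by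
  obtain ⟨C, hC0, hC⟩ := hE.power_control
  -- One exponential bounds `Ψ + 𝓔` along the nodes, the other passes from the node time to all
  -- times; the 1 only ensures positivity.
  set E := Real.exp (C * S.T) * (Real.exp (C * S.T) * G) + 1 with hEdef
  have hEpos : 0 < E := by positivity
  obtain ⟨m, hm⟩ := hE.exists_energy_ge hEpos
  refine ⟨E, hEpos, max 0 (E - m + C * E * S.T), le_max_left _ _, ?_⟩
  intro τ ε U hτ hε hU hU0 hUG
  have hDn : ∀ n ≤ ⌈S.T / τ⌉₊, U n ∈ S.D := by
    intro n hn
    cases n with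
    | zero => exact hU0
    | succ n => exact (hU.step hΨ hD hτ hε (by omega)).1
  have hstep : ∀ n < ⌈S.T / τ⌉₊, S.Ψ (U (n + 1) - U n) +
      τ / ε * S.F (‖U (n + 1) - U n‖ / (τ / ε)) + S.energy (S.node τ (n + 1)) (U (n + 1)) ≤
        S.energy (S.node τ (n + 1)) (U n) := by
    intro n hn
    have h1 := (hU.step hΨ hD hτ hε hn).2 (U n) (hDn n hn.le)
    simpa [hΨ.psi_zero, hΨ.F_zero, node] using h1
  -- Comparison with `U n` itself pays for the increment `Ψ (U (n+1) - U n)` by the drop of energy,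
  -- so `Ψ + 𝓔` grows only through the change of time.
  have hGn : ∀ n ≤ ⌈S.T / τ⌉₊, S.Ψ (U n) + S.energy (S.node τ n) (U n) ≤
      Real.exp (C * S.node τ n) * G := by
    intro n
    induction n with
    | zero => intro _; simpa [node_zero hT] using hUG
    | succ n ih =>
      intro hn
      have h1 := ih (by omega)
      have h2 := hstep n (by omega)
      have h3 := hΨ.psi_triangle 0 (U n) (U (n + 1))
      rw [sub_zero, sub_zero] at h3
      have h4 := hE.gronwall hC (hDn n (by omega)) (node_mem hT hτ (n + 1)) (node_mem hT hτ n)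
      rw [abs_of_nonneg (sub_nonneg.2 (node_mono hτ (Nat.le_succ n)))] at h4
      have h5 := mul_le_mul_of_nonneg_left h1 (Real.exp_pos (C * (S.node τ (n + 1) - S.node τ n))).le
      rw [← mul_assoc, ← Real.exp_add, show C * (S.node τ (n + 1) - S.node τ n) + C * S.node τ n =
        C * S.node τ (n + 1) by ring] at h5
      have h6 : 0 ≤ τ / ε * S.F (‖U (n + 1) - U n‖ / (τ / ε)) :=
        mul_nonneg (div_pos hτ hε).le (hΨ.F_nonneg (by positivity))
      linarith
  have hmem : ∀ n ≤ ⌈S.T / τ⌉₊, U n ∈ S.sublevel E := by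
    intro n hn
    have hn' := node_mem hT hτ n
    refine hE.mem_sublevel_of_le hC0 hC (hDn n hn) hn' (hGn n hn) (by positivity) ?_
    have h1 : Real.exp (C * S.node τ n) ≤ Real.exp (C * S.T) :=
      Real.exp_le_exp.2 (mul_le_mul_of_nonneg_left hn'.2 hC0)
    have h2 := mul_le_mul_of_nonneg_left (mul_le_mul_of_nonneg_right h1 hG)
      (Real.exp_pos (C * S.T)).le
    linarith
  have hsum : ∀ n ≤ ⌈S.T / τ⌉₊, ∑ i ∈ Finset.range n, (S.Ψ (U (i + 1) - U i) +
      τ / ε * S.F (‖U (i + 1) - U i‖ / (τ / ε))) ≤ S.energy 0 (U 0) -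
        S.energy (S.node τ n) (U n) + C * E * S.node τ n := by
    intro n
    induction n with
    | zero => intro _; simp [node_zero hT]
    | succ n ih =>
      intro hn
      rw [Finset.sum_range_succ]
      have h1 := ih (by omega)
      have h2 := hstep n (by omega)
      have h3 := (abs_le.1 (hE.abs_energy_sub_le hC0 hC (hmem n (by omega))
        (node_mem hT hτ n) (node_mem hT hτ (n + 1)))).2
      rw [abs_of_nonneg (sub_nonneg.2 (node_mono hτ (Nat.le_succ n)))] at h3
      linarith
  choose! ξ hξ z hz hdiss hconj using fun n (hn : n < ⌈S.T / τ⌉₊) =>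
    hU.exists_subdiff hΨ hE hT hD hτ hε hn
  refine ⟨fun n => ‖ξ n + z n‖, hmem, fun n => norm_nonneg _,
    fun n hn => slope_le_of_mem (hξ n hn) (hz n hn) le_rfl, hconj, ?_, ?_⟩
  · refine (hsum _ le_rfl).trans (le_trans ?_ (le_max_right _ _))
    have h1 := hm _ (node_mem hT hτ ⌈S.T / τ⌉₊) _ (hmem _ le_rfl)
    have h2 := (hmem 0 (Nat.zero_le _)).2 0 ⟨le_rfl, hT.le⟩
    have h3 := hΨ.psi_nonneg (U 0)
    have h4 := mul_le_mul_of_nonneg_left (node_mem hT hτ ⌈S.T / τ⌉₊).2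
      (show 0 ≤ C * E by positivity)
    linarith
  · intro ω κ hω hκ n hn hωκ
    have h1 := hω.le _ (node_mem hT hτ (n + 1)) _ (hmem (n + 1) hn) _ (hmem n hn.le) _ (hξ n hn)
    have h2 : ω (S.node τ (n + 1)) (U (n + 1)) (U n) * S.minGauge (U n - U (n + 1)) ≤
        κ * S.Ψ (U (n + 1) - U n) :=
      (mul_le_mul_of_nonneg_right hωκ (hΨ.minGauge_nonneg _)).trans
        (mul_le_mul_of_nonneg_left (minGauge_neg_le _ _) hκ)
    have h3 := hdiss n hn
    linarith

namespace IsDiscreteChain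

variable {E C : ℝ}

/-- A step of size at least `η` with small `τ / ε` has a speed in the range where F(r) ≥ (C+1) r /
η, and would cost at least `C + 1`. -/
theorem exists_small_steps (hΨ : S.DissipationAssumptions) (hC : 0 ≤ C) {η : ℝ} (hη : 0 < η) :
    ∃ l > 0, ∀ (τ ε : ℝ) (U : ℕ → V) (y : ℕ → ℝ), 0 < τ → 0 < ε → S.IsDiscreteChain E C τ ε U y →
      τ / ε < l → ∀ n < ⌈S.T / τ⌉₊, ‖U (n + 1) - U n‖ < η := by
  obtain ⟨R, hR, hF⟩ := hΨ.exists_le_F ((C + 1) / η)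
  refine ⟨η / R, by positivity, fun τ ε U y hτ hε h hl n hn => ?_⟩
  by_contra hcon
  rw [not_lt] at hcon
  have hle : 0 < τ / ε := div_pos hτ hε
  have h1 : R ≤ ‖U (n + 1) - U n‖ / (τ / ε) := by
    rw [le_div_iff₀ hle]
    rw [lt_div_iff₀ hR] at hl
    linarith
  have h2 := hF _ h1
  have h3 : S.Ψ (U (n + 1) - U n) + τ / ε * S.F (‖U (n + 1) - U n‖ / (τ / ε)) ≤ C := by
    refine le_trans ?_ h.sum_le
    exact Finset.single_le_sum (f := fun n => S.Ψ (U (n + 1) - U n) +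
      τ / ε * S.F (‖U (n + 1) - U n‖ / (τ / ε)))
      (fun i _ => add_nonneg (hΨ.psi_nonneg _) (mul_nonneg hle.le (hΨ.F_nonneg (by positivity))))
      (Finset.mem_range.2 hn)
  have h4 := mul_le_mul_of_nonneg_left h2 hle.le
  have h5 : τ / ε * ((C + 1) / η * (‖U (n + 1) - U n‖ / (τ / ε))) =
      (C + 1) / η * ‖U (n + 1) - U n‖ := by field_simp
  have h6 : C + 1 ≤ (C + 1) / η * ‖U (n + 1) - U n‖ := by
    rw [div_mul_eq_mul_div, le_div_iff₀ hη]
    exact mul_le_mul_of_nonneg_left hcon (by linarith)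
  linarith [hΨ.psi_nonneg (U (n + 1) - U n)]

/-- The number of steps at which the slope exceeds `c` is at most of order `ε / τ`. -/
theorem exists_card_le (hΨ : S.DissipationAssumptions) {c : ℝ} (hc : 0 < c) :
    ∃ r > 0, ∀ (τ ε : ℝ) (U : ℕ → V) (y : ℕ → ℝ), 0 < τ → 0 < ε → S.IsDiscreteChain E C τ ε U y →
      ∀ F ⊆ Finset.range ⌈S.T / τ⌉₊, (∀ n ∈ F, c ≤ y n) → (F.card : ℝ) * τ * r ≤ C * ε := by
  obtain ⟨a, ha, hlow⟩ := hΨ.exists_lower_of_slope hc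
  refine ⟨S.F a, hΨ.F_pos a ha, fun τ ε U y hτ hε h F hF hy => ?_⟩
  have hle : 0 < τ / ε := div_pos hτ hε
  have h1 : ∑ n ∈ F, τ / ε * S.F a ≤ C := by
    refine le_trans (le_trans (Finset.sum_le_sum fun n hn => ?_)
      (Finset.sum_le_sum_of_subset_of_nonneg hF fun i _ _ => ?_)) h.sum_le
    · have hn' := Finset.mem_range.1 (hF hn)
      have h2 := hlow (‖U (n + 1) - U n‖ / (τ / ε)) (y n) (by positivity) (hy n hn) (h.conj n hn')
      have h3 := mul_le_mul_of_nonneg_left (hΨ.F_mono ha.le h2) hle.le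
      linarith [hΨ.psi_nonneg (U (n + 1) - U n)]
    · exact add_nonneg (hΨ.psi_nonneg _) (mul_nonneg hle.le (hΨ.F_nonneg (by positivity)))
  rw [Finset.sum_const, nsmul_eq_mul] at h1
  have h2 := mul_le_mul_of_nonneg_right h1 hε.le
  calc (F.card : ℝ) * τ * S.F a = F.card * (τ / ε * S.F a) * ε := by field_simp
    _ ≤ C * ε := h2

/-- Telescoping of the one-step inequality; the modulus errors sum to at most `κ` times the
Ψ-variation, which is bounded by `C`. -/
theorem cost_le {τ ε κ : ℝ} {U : ℕ → V} {y : ℕ → ℝ} (h : S.IsDiscreteChain E C τ ε U y)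
    (hT : 0 < S.T) (hΨ : S.DissipationAssumptions) (hτ : 0 < τ) (hε : 0 < ε)
    {ω : ℝ → V → V → ℝ} (hω : S.IsModulus E ω) (hκ : 0 ≤ κ)
    (hωκ : ∀ n < ⌈S.T / τ⌉₊, ω (S.node τ (n + 1)) (U (n + 1)) (U n) ≤ κ) :
    ∀ n ≤ ⌈S.T / τ⌉₊, ∑ i ∈ Finset.range n,
      (S.Ψ (U (i + 1) - U i) + y i * ‖U (i + 1) - U i‖) + S.energy (S.node τ n) (U n) ≤
      S.energy 0 (U 0) + ∑ i ∈ Finset.range n,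
        (S.energy (S.node τ (i + 1)) (U i) - S.energy (S.node τ i) (U i)) + κ * C := by
  have hle : 0 < τ / ε := div_pos hτ hε
  have key : ∀ n ≤ ⌈S.T / τ⌉₊, ∑ i ∈ Finset.range n,
      (S.Ψ (U (i + 1) - U i) + y i * ‖U (i + 1) - U i‖) + S.energy (S.node τ n) (U n) ≤
      S.energy 0 (U 0) + ∑ i ∈ Finset.range n,
        (S.energy (S.node τ (i + 1)) (U i) - S.energy (S.node τ i) (U i)) +
        κ * ∑ i ∈ Finset.range n, S.Ψ (U (i + 1) - U i) := by
    intro n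
    induction n with
    | zero => intro _; simp [node_zero hT]
    | succ n ih =>
      intro hn
      rw [Finset.sum_range_succ, Finset.sum_range_succ, Finset.sum_range_succ]
      have h1 := ih (by omega)
      have h2 := h.dissipation ω κ hω hκ n (by omega) (hωκ n (by omega))
      rw [mul_add]
      linarith
  intro n hn
  refine (key n hn).trans ?_
  have h1 : ∑ i ∈ Finset.range n, S.Ψ (U (i + 1) - U i) ≤ C := by
    refine le_trans ?_ h.sum_le
    refine (Finset.sum_le_sum_of_subset_of_nonneg (Finset.range_mono hn)
      fun i _ _ => hΨ.psi_nonneg _).trans (Finset.sum_le_sum fun i _ => ?_)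
    have := mul_nonneg hle.le (hΨ.F_nonneg (show 0 ≤ ‖U (i + 1) - U i‖ / (τ / ε) by positivity))
    linarith
  have := mul_le_mul_of_nonneg_left h1 hκ
  linarith

/-- A global bound of ω on the compact sublevel suffices here, without smallness of the steps. It
provides the uniform bound for Helly's principle. -/
theorem exists_cost_bound (hT : 0 < S.T) (hΨ : S.DissipationAssumptions)
    (hE : S.EnergyAssumptions) (hEpos : 0 < E) :
    ∃ M ≥ 0, ∀ (τ ε : ℝ) (U : ℕ → V) (y : ℕ → ℝ), 0 < τ → 0 < ε → S.IsDiscreteChain E C τ ε U y →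
      ∑ i ∈ Finset.range ⌈S.T / τ⌉₊, (S.Ψ (U (i + 1) - U i) + y i * ‖U (i + 1) - U i‖) ≤ M := by
  obtain ⟨P, hP0, hP⟩ := hE.power_control
  obtain ⟨ω, hω⟩ := hE.exists_isModulus hEpos
  obtain ⟨κ, hκ0, hκ⟩ := hω.exists_le (hE.isCompact_sublevel hEpos)
  obtain ⟨m, hm⟩ := hE.exists_energy_ge hEpos
  refine ⟨max 0 (E - m + P * E * S.T + κ * C), le_max_left _ _, ?_⟩
  intro τ ε U y hτ hε h
  refine le_trans ?_ (le_max_right _ _)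
  have h1 := h.cost_le hT hΨ hτ hε hω hκ0 (fun n hn => hκ _ (node_mem hT hτ _) _
    (h.mem (n + 1) hn) _ (h.mem n hn.le)) _ le_rfl
  have h2 := hm _ (node_mem hT hτ ⌈S.T / τ⌉₊) _ (h.mem _ le_rfl)
  have h3 := (h.mem 0 (Nat.zero_le _)).2 0 ⟨le_rfl, hT.le⟩
  have h4 := hΨ.psi_nonneg (U 0)
  have h5 : ∑ i ∈ Finset.range ⌈S.T / τ⌉₊,
      (S.energy (S.node τ (i + 1)) (U i) - S.energy (S.node τ i) (U i)) ≤
      ∑ i ∈ Finset.range ⌈S.T / τ⌉₊, (P * E * S.node τ (i + 1) - P * E * S.node τ i) := by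
    refine Finset.sum_le_sum fun i hi => ?_
    have h6 := (abs_le.1 (hE.abs_energy_sub_le hP0 hP (h.mem i (Finset.mem_range.1 hi).le)
      (node_mem hT hτ i) (node_mem hT hτ (i + 1)))).2
    rw [abs_of_nonneg (sub_nonneg.2 (node_mono hτ (Nat.le_succ i)))] at h6
    linarith
  rw [Finset.sum_range_sub (fun i => P * E * S.node τ i), node_zero hT, mul_zero, sub_zero] at h5
  have h6 := mul_le_mul_of_nonneg_left (node_mem hT hτ ⌈S.T / τ⌉₊).2
      (show 0 ≤ P * E by positivity)
  linarith

end IsDiscreteChain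

end RIS

end BalancedViscosity

/-! ### Limits of the discrete chains and the cost of their jumps. -/

namespace BalancedViscosity

namespace RIS

variable {V : Type*} [NormedAddCommGroup V] [NormedSpace ℝ V] [CompleteSpace V] {S : RIS V}

/-- The dissipated energy of a discrete chain up to time `t`. -/
noncomputable def discreteCost (S : RIS V) (τ : ℝ) (U : ℕ → V) (y : ℕ → ℝ) (t : ℝ) : ℝ :=
  ∑ i ∈ Finset.range ⌈t / τ⌉₊, (S.Ψ (U (i + 1) - U i) + y i * ‖U (i + 1) - U i‖)

theorem discreteCost_sub (S : RIS V) {τ : ℝ} (hτ : 0 < τ) (U : ℕ → V) (y : ℕ → ℝ) {s t : ℝ}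
    (hst : s ≤ t) : S.discreteCost τ U y t - S.discreteCost τ U y s =
      ∑ i ∈ Finset.Ico ⌈s / τ⌉₊ ⌈t / τ⌉₊,
        (S.Ψ (U (i + 1) - U i) + y i * ‖U (i + 1) - U i‖) :=
  (Finset.sum_Ico_eq_sub _ (Nat.ceil_mono (by gcongr))).symm

theorem psi_pwConst_le (hΨ : S.DissipationAssumptions) {τ : ℝ} (hτ : 0 < τ) (U : ℕ → V) {y : ℕ → ℝ}
    (hy : ∀ n, 0 ≤ y n) {s t : ℝ} (hst : s ≤ t) : S.Ψ (pwConst τ U t - pwConst τ U s) ≤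
      S.discreteCost τ U y t - S.discreteCost τ U y s := by
  rw [discreteCost_sub S hτ U y hst]
  refine (sub_le_sum_Ico_of_subadditive hΨ.psi_zero hΨ.psi_add_le U
    (Nat.ceil_mono (by gcongr))).trans (Finset.sum_le_sum fun i _ => ?_)
  linarith [mul_nonneg (hy i) (norm_nonneg (U (i + 1) - U i))]

theorem discreteCost_mono (hΨ : S.DissipationAssumptions) {τ : ℝ} (hτ : 0 < τ) (U : ℕ → V)
    {y : ℕ → ℝ} (hy : ∀ n, 0 ≤ y n) : Monotone (S.discreteCost τ U y) := fun s t hst => by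
  linarith [psi_pwConst_le hΨ hτ U hy hst, hΨ.psi_nonneg (pwConst τ U t - pwConst τ U s)]

theorem ceil_le_ceil {τ T t : ℝ} (hτ : 0 < τ) (ht : t ≤ T) : ⌈t / τ⌉₊ ≤ ⌈T / τ⌉₊ :=
  Nat.ceil_mono (by gcongr)

/-- The curve `u` and the function `A` are the pointwise limits of a sequence of discrete chains
and of their dissipated energies. -/
structure IsViscosityLimit (S : RIS V) (E C : ℝ) (τ ε : ℕ → ℝ) (U : ℕ → ℕ → V) (y : ℕ → ℕ → ℝ)
    (u : ℝ → V) (A : ℝ → ℝ) : Prop where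
  pos : 0 < E
  nonneg : 0 ≤ C
  tau_pos : ∀ k, 0 < τ k
  eps_pos : ∀ k, 0 < ε k
  chain : ∀ k, S.IsDiscreteChain E C (τ k) (ε k) (U k) (y k)
  tendsto_eps : Tendsto ε atTop (𝓝 0)
  tendsto_ratio : Tendsto (fun k => τ k / ε k) atTop (𝓝 0)
  tendsto_curve : ∀ t ∈ Icc 0 S.T, Tendsto (fun k => pwConst (τ k) (U k) t) atTop (𝓝 (u t))
  tendsto_cost : ∀ t ∈ Icc 0 S.T,
    Tendsto (fun k => S.discreteCost (τ k) (U k) (y k) t) atTop (𝓝 (A t))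
  tendsto_energy : Tendsto (fun k => S.energy 0 (U k 0)) atTop (𝓝 (S.energy 0 (u 0)))

namespace IsViscosityLimit

variable {E C : ℝ} {τ ε : ℕ → ℝ} {U : ℕ → ℕ → V} {y : ℕ → ℕ → ℝ} {u : ℝ → V} {A : ℝ → ℝ}

theorem tendsto_tau (h : S.IsViscosityLimit E C τ ε U y u A) : Tendsto τ atTop (𝓝 0) := by
  have := h.tendsto_ratio.mul h.tendsto_eps
  rw [zero_mul] at this
  refine this.congr fun k => ?_
  rw [div_mul_cancel₀ _ (h.eps_pos k).ne']

theorem pwConst_mem (h : S.IsViscosityLimit E C τ ε U y u A) (k : ℕ) {t : ℝ} (ht : t ≤ S.T) :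
    pwConst (τ k) (U k) t ∈ S.sublevel E :=
  (h.chain k).mem _ (ceil_le_ceil (h.tau_pos k) ht)

theorem isControlled (h : S.IsViscosityLimit E C τ ε U y u A) (hΨ : S.DissipationAssumptions)
    (hE : S.EnergyAssumptions) : S.IsControlled E A u := by
  refine ⟨h.pos, fun t ht => ?_, fun s t h1 h2 h3 => ?_⟩
  · exact (hE.isCompact_sublevel h.pos).isClosed.mem_of_tendsto (h.tendsto_curve t ht)
      (Eventually.of_forall fun k => h.pwConst_mem k ht.2)
  · have hs : s ∈ Icc 0 S.T := ⟨h1, h2.trans h3⟩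
    have ht : t ∈ Icc 0 S.T := ⟨h1.trans h2, h3⟩
    exact le_of_tendsto_of_tendsto' ((hΨ.psi_continuous.tendsto _).comp
      ((h.tendsto_curve t ht).sub (h.tendsto_curve s hs)))
      ((h.tendsto_cost t ht).sub (h.tendsto_cost s hs))
      fun k => psi_pwConst_le hΨ (h.tau_pos k) (U k) (h.chain k).nonneg h2

theorem cost_zero (h : S.IsViscosityLimit E C τ ε U y u A) (hT : 0 < S.T) : A 0 = 0 :=
  tendsto_nhds_unique (h.tendsto_cost 0 ⟨le_rfl, hT.le⟩)
    (by simp only [discreteCost, zero_div, Nat.ceil_zero, Finset.range_zero, Finset.sum_empty]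
        exact tendsto_const_nhds)

theorem eventually_small_steps (h : S.IsViscosityLimit E C τ ε U y u A)
    (hΨ : S.DissipationAssumptions) {η : ℝ} (hη : 0 < η) :
    ∀ᶠ k in atTop, ∀ n < ⌈S.T / τ k⌉₊, ‖U k (n + 1) - U k n‖ < η := by
  obtain ⟨l, hl, hd⟩ := IsDiscreteChain.exists_small_steps (S := S) (E := E) hΨ h.nonneg hη
  filter_upwards [h.tendsto_ratio.eventually_lt_const hl] with k hk
  exact hd _ _ _ _ (h.tau_pos k) (h.eps_pos k) (h.chain k) hk

/-- The cost of the transitions that appear in the limit is bounded by the increments of `A`. -/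
theorem finslerCost_le (h : S.IsViscosityLimit E C τ ε U y u A) (hRN : HasRadonNikodymProperty V)
    (hT : 0 < S.T) (hΨ : S.DissipationAssumptions) (hE : S.EnergyAssumptions)
    {t ℓ : ℝ} (ht : t ∈ Icc 0 S.T) {x x' : V} {a b : ℕ → ℝ}
    (hab : ∀ i, a i ≤ b i) (ha0 : ∀ i, 0 ≤ a i) (hbT : ∀ i, b i ≤ S.T)
    (ha : Tendsto a atTop (𝓝 t)) (hb : Tendsto b atTop (𝓝 t))
    (hx : Tendsto (fun i => u (a i)) atTop (𝓝 x)) (hx' : Tendsto (fun i => u (b i)) atTop (𝓝 x'))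
    (hℓ : Tendsto (fun i => A (b i) - A (a i)) atTop (𝓝 ℓ)) :
    S.finslerCost t x x' ≤ ENNReal.ofReal ℓ := by
  have haI : ∀ i, a i ∈ Icc 0 S.T := fun i => ⟨ha0 i, (hab i).trans (hbT i)⟩
  have hbI : ∀ i, b i ∈ Icc 0 S.T := fun i => ⟨(ha0 i).trans (hab i), hbT i⟩
  set δ : ℕ → ℝ := fun i => 1 / ((i : ℝ) + 1) with hδ
  have hδ0 : ∀ i, 0 < δ i := fun i => by positivity
  have hδlim : Tendsto δ atTop (𝓝 0) := tendsto_one_div_add_atTop_nhds_zero_nat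
  -- Diagonal choice: for the `i`-th interval `[a i, b i]`, shrinking to `t`, take a discrete
  -- solution so fine that its piece over this interval has the right endpoints, cost and mesh up to
  -- `δ i`.
  have hex : ∀ i, ∃ k, ‖pwConst (τ k) (U k) (a i) - u (a i)‖ < δ i ∧
      ‖pwConst (τ k) (U k) (b i) - u (b i)‖ < δ i ∧
      |(S.discreteCost (τ k) (U k) (y k) (b i) - S.discreteCost (τ k) (U k) (y k) (a i)) -
        (A (b i) - A (a i))| < δ i ∧ τ k < δ i ∧
      ∀ n < ⌈S.T / τ k⌉₊, ‖U k (n + 1) - U k n‖ < δ i := by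
    intro i
    have h1 := Metric.tendsto_nhds.1 (h.tendsto_curve _ (haI i)) _ (hδ0 i)
    have h2 := Metric.tendsto_nhds.1 (h.tendsto_curve _ (hbI i)) _ (hδ0 i)
    have h3 := Metric.tendsto_nhds.1 ((h.tendsto_cost _ (hbI i)).sub (h.tendsto_cost _ (haI i)))
      _ (hδ0 i)
    simp only [dist_eq_norm, Real.norm_eq_abs] at h1 h2 h3
    exact (h1.and (h2.and (h3.and ((h.tendsto_tau.eventually_lt_const (hδ0 i)).and
      (h.eventually_small_steps hΨ (hδ0 i)))))).exists
  choose k hk1 hk2 hk3 hk4 hk5 using hex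
  have hp : ∀ i, ⌈a i / τ (k i)⌉₊ ≤ ⌈b i / τ (k i)⌉₊ := fun i =>
    ceil_le_ceil (h.tau_pos _) (hab i)
  have hq : ∀ i, ⌈b i / τ (k i)⌉₊ ≤ ⌈S.T / τ (k i)⌉₊ := fun i =>
    ceil_le_ceil (h.tau_pos _) (hbT i)
  refine finslerCost_le_of_chains hRN hΨ hE ht h.pos
    (N := fun i => ⌈b i / τ (k i)⌉₊ - ⌈a i / τ (k i)⌉₊)
    (x := fun i n => U (k i) (⌈a i / τ (k i)⌉₊ + n))
    (σ := fun i n => S.node (τ (k i)) (⌈a i / τ (k i)⌉₊ + n + 1))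
    (y := fun i n => y (k i) (⌈a i / τ (k i)⌉₊ + n)) ?_ ?_ ?_ ?_ ?_ ?_ ?_ ?_ ?_
  · intro i n hn
    exact (h.chain _).mem _ (by have := hp i; have := hq i; omega)
  · exact fun i n _ => node_mem hT (h.tau_pos _) _
  · intro η hη
    filter_upwards [Metric.tendsto_nhds.1 ha (η / 2) (half_pos hη),
      Metric.tendsto_nhds.1 hb (η / 2) (half_pos hη),
      hδlim.eventually_lt_const (half_pos hη)] with i h1 h2 h3 n hn
    rw [Real.dist_eq, abs_lt] at h1 h2
    have hτ := h.tau_pos (k i)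
    have h4 : a i ≤ ((⌈a i / τ (k i)⌉₊ + n + 1 : ℕ) : ℝ) * τ (k i) := by
      have h5 : a i / τ (k i) ≤ ⌈a i / τ (k i)⌉₊ := Nat.le_ceil _
      rw [div_le_iff₀ hτ] at h5
      push_cast
      nlinarith [Nat.cast_nonneg (α := ℝ) n]
    have h5 : ((⌈a i / τ (k i)⌉₊ + n + 1 : ℕ) : ℝ) * τ (k i) ≤ b i + τ (k i) := by
      have h6 : (⌈b i / τ (k i)⌉₊ : ℝ) < b i / τ (k i) + 1 :=
        Nat.ceil_lt_add_one (div_nonneg ((ha0 i).trans (hab i)) hτ.le)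
      have h7 : ((⌈a i / τ (k i)⌉₊ + n + 1 : ℕ) : ℝ) ≤ (⌈b i / τ (k i)⌉₊ : ℝ) := by
        exact_mod_cast (by have := hp i; omega)
      calc ((⌈a i / τ (k i)⌉₊ + n + 1 : ℕ) : ℝ) * τ (k i) ≤ (b i / τ (k i) + 1) * τ (k i) := by
            gcongr; linarith
        _ = b i + τ (k i) := by field_simp
    have h6 : a i ≤ S.node (τ (k i)) (⌈a i / τ (k i)⌉₊ + n + 1) := le_min h4 (haI i).2
    have h7 : S.node (τ (k i)) (⌈a i / τ (k i)⌉₊ + n + 1) ≤ b i + τ (k i) :=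
      (min_le_left _ _).trans h5
    rw [abs_lt]
    constructor <;> linarith [hk4 i]
  · exact fun i n => (h.chain _).nonneg _
  · intro i n hn
    exact (h.chain _).slope_le _ (by have := hp i; have := hq i; omega)
  · intro η hη
    filter_upwards [hδlim.eventually_lt_const hη] with i hi n hn
    exact (hk5 i (⌈a i / τ (k i)⌉₊ + n) (by have := hp i; have := hq i; omega)).trans hi
  · have h1 : Tendsto (fun i => pwConst (τ (k i)) (U (k i)) (a i) - u (a i)) atTop (𝓝 0) :=
      squeeze_zero_norm (fun i => (hk1 i).le) hδlim
    simpa [pwConst] using h1.add hx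
  · have h1 : Tendsto (fun i => pwConst (τ (k i)) (U (k i)) (b i) - u (b i)) atTop (𝓝 0) :=
      squeeze_zero_norm (fun i => (hk2 i).le) hδlim
    have h2 := h1.add hx'
    simp only [sub_add_cancel, zero_add] at h2
    refine h2.congr fun i => ?_
    rw [pwConst, Nat.add_sub_cancel' (hp i)]
  · have h1 : Tendsto (fun i => (S.discreteCost (τ (k i)) (U (k i)) (y (k i)) (b i) -
        S.discreteCost (τ (k i)) (U (k i)) (y (k i)) (a i)) - (A (b i) - A (a i))) atTop (𝓝 0) :=
      squeeze_zero_norm (fun i => (hk3 i).le) hδlim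
    have h2 := h1.add hℓ
    simp only [sub_add_cancel, zero_add] at h2
    refine h2.congr fun i => ?_
    rw [discreteCost_sub S (h.tau_pos _) _ _ (hab i), Finset.sum_Ico_eq_sum_range]
    rfl

/-- The cost is bounded by the right jump of `A` at `s`, obtained from intervals `[s, b]` with `b`
decreasing to `s`; monotonicity of `A` allows any later `t`. -/
theorem finslerCost_right_le (h : S.IsViscosityLimit E C τ ε U y u A)
    (hRN : HasRadonNikodymProperty V) (hT : 0 < S.T) (hΨ : S.DissipationAssumptions)
    (hE : S.EnergyAssumptions) (s t : ℝ) (hs : 0 ≤ s) (hst : s < t) (ht : t ≤ S.T) :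
    S.finslerCost s (u s) (rightValue S.T u s) ≤ ENNReal.ofReal (A t - A s) := by
  have hc := h.isControlled hΨ hE
  have hsI : s ∈ Ico 0 S.T := ⟨hs, hst.trans_le ht⟩
  obtain ⟨α, hα⟩ := hc.exists_tendsto_right hΨ hsI
  obtain ⟨b, hb⟩ := exists_seq_tendsto (𝓝[>] s)
  obtain ⟨i₀, hi₀⟩ := eventually_atTop.1 (hb.eventually (Ioo_mem_nhdsGT hst))
  have hb' : Tendsto (fun i => b (i + i₀)) atTop (𝓝[>] s) := hb.comp (tendsto_add_atTop_nat i₀)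
  have hbm : ∀ i, b (i + i₀) ∈ Ioo s t := fun i => hi₀ _ (Nat.le_add_left _ _)
  have h1 := h.finslerCost_le hRN hT hΨ hE (t := s) (a := fun _ => s) (b := fun i => b (i + i₀))
    ⟨hs, hsI.2.le⟩ (fun i => (hbm i).1.le) (fun _ => hs) (fun i => (hbm i).2.le.trans ht)
    tendsto_const_nhds (hb'.mono_right nhdsWithin_le_nhds) tendsto_const_nhds
    ((hc.tendsto_rightValue hΨ hE hsI).comp hb') ((hα.comp hb').sub_const (A s))
  refine h1.trans (ENNReal.ofReal_le_ofReal (sub_le_sub_right ?_ _))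
  refine le_of_tendsto' (hα.comp hb') fun i => ?_
  exact hc.monotoneOn hΨ ⟨hs.trans (hbm i).1.le, (hbm i).2.le.trans ht⟩
    ⟨hs.trans hst.le, ht⟩ (hbm i).2.le

theorem finslerCost_left_le (h : S.IsViscosityLimit E C τ ε U y u A)
    (hRN : HasRadonNikodymProperty V) (hT : 0 < S.T) (hΨ : S.DissipationAssumptions)
    (hE : S.EnergyAssumptions) (s t : ℝ) (hs : 0 ≤ s) (hst : s < t) (ht : t ≤ S.T) :
    S.finslerCost t (leftValue u t) (u t) ≤ ENNReal.ofReal (A t - A s) := by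
  have hc := h.isControlled hΨ hE
  have htI : t ∈ Ioc 0 S.T := ⟨hs.trans_lt hst, ht⟩
  obtain ⟨α, hα⟩ := hc.exists_tendsto_left hΨ htI
  obtain ⟨b, hb⟩ := exists_seq_tendsto (𝓝[<] t)
  obtain ⟨i₀, hi₀⟩ := eventually_atTop.1 (hb.eventually (Ioo_mem_nhdsLT hst))
  have hb' : Tendsto (fun i => b (i + i₀)) atTop (𝓝[<] t) := hb.comp (tendsto_add_atTop_nat i₀)
  have hbm : ∀ i, b (i + i₀) ∈ Ioo s t := fun i => hi₀ _ (Nat.le_add_left _ _)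
  have h1 := h.finslerCost_le hRN hT hΨ hE (t := t) (b := fun _ => t) (a := fun i => b (i + i₀))
    ⟨htI.1.le, ht⟩ (fun i => (hbm i).2.le) (fun i => hs.trans (hbm i).1.le) (fun i => ht)
    (hb'.mono_right nhdsWithin_le_nhds) tendsto_const_nhds
    ((hc.tendsto_leftValue hΨ hE htI).comp hb') tendsto_const_nhds ((hα.comp hb').const_sub (A t))
  refine h1.trans (ENNReal.ofReal_le_ofReal (sub_le_sub_left ?_ _))
  refine ge_of_tendsto' (hα.comp hb') fun i => ?_
  exact hc.monotoneOn hΨ ⟨hs, hst.le.trans ht⟩ ⟨hs.trans (hbm i).1.le, (hbm i).2.le.trans ht⟩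
    (hbm i).1.le

theorem totalVar_le (h : S.IsViscosityLimit E C τ ε U y u A)
    (hRN : HasRadonNikodymProperty V) (hT : 0 < S.T) (hΨ : S.DissipationAssumptions)
    (hE : S.EnergyAssumptions) {t : ℝ} (ht : t ∈ Icc 0 S.T) :
    S.totalVar u t ≤ ENNReal.ofReal (A t) := by
  have h1 := (h.isControlled hΨ hE).totalVar_le hRN hΨ hE (h.finslerCost_right_le hRN hT hΨ hE)
    (h.finslerCost_left_le hRN hT hΨ hE) ht
  rwa [h.cost_zero hT, sub_zero] at h1

end IsViscosityLimit

end RIS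

end BalancedViscosity

/-! ### Stability of one-sided limits. -/

namespace BalancedViscosity

namespace RIS

variable {V : Type*} [NormedAddCommGroup V] [NormedSpace ℝ V] [CompleteSpace V] {S : RIS V}

namespace IsViscosityLimit

variable {E C : ℝ} {τ ε : ℕ → ℝ} {U : ℕ → ℕ → V} {y : ℕ → ℕ → ℝ} {u : ℝ → V} {A : ℝ → ℝ}

/-- Every time interval eventually contains a node with small slope. -/
theorem eventually_exists_node (h : S.IsViscosityLimit E C τ ε U y u A)
    (hΨ : S.DissipationAssumptions) {a b c : ℝ} (ha : 0 ≤ a) (hab : a < b)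
    (hb : b ≤ S.T) (hc : 0 < c) : ∀ᶠ k in atTop, ∃ n < ⌈S.T / τ k⌉₊,
      ((n + 1 : ℕ) : ℝ) * τ k ∈ Icc a b ∧ y k n < c := by
  obtain ⟨r, hr, hcard⟩ := IsDiscreteChain.exists_card_le (S := S) (E := E) (C := C) hΨ hc
  have hlim : Tendsto (fun k => (b - a - 2 * τ k) * r - C * ε k) atTop
      (𝓝 ((b - a - 2 * 0) * r - C * 0)) :=
    (((h.tendsto_tau.const_mul 2).const_sub (b - a)).mul_const r).sub
      (h.tendsto_eps.const_mul C)
  have hpos : 0 < (b - a - 2 * 0) * r - C * 0 := by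
    have := mul_pos (sub_pos.2 hab) hr
    simpa using this
  filter_upwards [hlim.eventually_const_lt hpos] with k hk
  by_contra hcon
  push Not at hcon
  have hτ := h.tau_pos k
  set p := ⌈a / τ k⌉₊
  set q := ⌊b / τ k⌋₊
  have hqN : q ≤ ⌈S.T / τ k⌉₊ :=
    (Nat.floor_mono (show b / τ k ≤ S.T / τ k by gcongr)).trans (Nat.floor_le_ceil _)
  have hp : a ≤ p * τ k := by
    have := Nat.le_ceil (a / τ k)
    rwa [div_le_iff₀ hτ] at this
  have hq : (q : ℝ) * τ k ≤ b := by
    have := Nat.floor_le (div_nonneg (ha.trans hab.le) hτ.le)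
    rwa [le_div_iff₀ hτ] at this
  -- If every node in `[a, b]` had slope bound at least `c`, about `(b - a) / τ` steps would be bad,
  -- whereas `card * τ * r ≤ C * ε → 0`.
  have h1 := hcard _ _ _ _ hτ (h.eps_pos k) (h.chain k) (Finset.Ico p q)
    (fun n hn => Finset.mem_range.2 ((Finset.mem_Ico.1 hn).2.trans_le hqN)) fun n hn => by
      rw [Finset.mem_Ico] at hn
      have h2 : (p : ℝ) ≤ n := by exact_mod_cast hn.1
      have h3 : ((n + 1 : ℕ) : ℝ) ≤ q := by exact_mod_cast hn.2
      refine hcon n (hn.2.trans_le hqN) ⟨?_, ?_⟩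
      · push_cast; nlinarith
      · exact (mul_le_mul_of_nonneg_right h3 hτ.le).trans hq
  rw [Nat.card_Ico] at h1
  have h2 : b / τ k - 1 < q := by linarith [Nat.lt_floor_add_one (b / τ k)]
  have h3 : (p : ℝ) < a / τ k + 1 := Nat.ceil_lt_add_one (div_nonneg ha hτ.le)
  have h4 : (q : ℝ) - p ≤ ((q - p : ℕ) : ℝ) := by
    rw [sub_le_iff_le_add]; exact_mod_cast (by omega)
  have h5 : b - a - 2 * τ k ≤ ((q - p : ℕ) : ℝ) * τ k := by
    have h6 : (b / τ k - 1 - (a / τ k + 1)) * τ k ≤ ((q - p : ℕ) : ℝ) * τ k :=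
      mul_le_mul_of_nonneg_right (by linarith) hτ.le
    have h7 : (b / τ k - 1 - (a / τ k + 1)) * τ k = b - a - 2 * τ k := by field_simp; ring
    linarith
  have h6 := mul_le_mul_of_nonneg_right h5 hr.le
  linarith

/-- Limit point of almost stable nodes in `[a, b]`. The point `x` need not be a value of `u`; only
its Ψ-distance from `u a` is controlled, by the increment of `A`. -/
theorem exists_slope_le (h : S.IsViscosityLimit E C τ ε U y u A)
    (hΨ : S.DissipationAssumptions) (hE : S.EnergyAssumptions) {a b c : ℝ} (ha : 0 ≤ a)
    (hab : a < b) (hb : b ≤ S.T) (hc : 0 < c) : ∃ r ∈ Icc a b, ∃ x ∈ S.sublevel E,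
      S.slope r x ≤ ENNReal.ofReal c ∧ S.Ψ (x - u a) ≤ A b - A a := by
  have hK := hE.isCompact_sublevel h.pos
  obtain ⟨k₀, hk₀⟩ := eventually_atTop.1 (h.eventually_exists_node hΨ ha hab hb hc)
  choose n hnN hnI hny using fun j => hk₀ (j + k₀) (Nat.le_add_left _ _)
  set r : ℕ → ℝ := fun j => ((n j + 1 : ℕ) : ℝ) * τ (j + k₀) with hr
  have hnode : ∀ j, S.node (τ (j + k₀)) (n j + 1) = r j := fun j => min_eq_left ((hnI j).2.trans hb)
  have hpw : ∀ j, pwConst (τ (j + k₀)) (U (j + k₀)) (r j) = U (j + k₀) (n j + 1) := by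
    intro j
    simp only [pwConst, hr]
    rw [mul_div_cancel_right₀ _ (h.tau_pos _).ne', Nat.ceil_natCast]
  have hmem : ∀ j, U (j + k₀) (n j + 1) ∈ S.sublevel E := fun j => (h.chain _).mem _ (hnN j)
  obtain ⟨⟨r', x⟩, hrx, φ, hφ, hlim⟩ := (isCompact_Icc.prod hK).tendsto_subseq
    (x := fun j => (r j, U (j + k₀) (n j + 1))) fun j => ⟨hnI j, hmem j⟩
  have hlimx : Tendsto (fun j => U (φ j + k₀) (n (φ j) + 1)) atTop (𝓝 x) :=
    (continuous_snd.tendsto _).comp hlim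
  refine ⟨r', hrx.1, x, hrx.2, ?_, ?_⟩
  · by_contra hcon
    rw [not_le] at hcon
    have h1 := hE.lowerSemicontinuousOn_slope hΨ h.pos (r', x)
      ⟨⟨ha.trans hrx.1.1, hrx.1.2.trans hb⟩, hrx.2⟩ _ hcon
    have h2 := (tendsto_nhdsWithin_iff.2 ⟨hlim, Eventually.of_forall fun j =>
      (⟨⟨ha.trans (hnI _).1, (hnI _).2.trans hb⟩, hmem _⟩ :
        _ ∈ Icc 0 S.T ×ˢ S.sublevel E)⟩).eventually h1
    obtain ⟨j, hj⟩ := h2.exists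
    have h3 := (h.chain (φ j + k₀)).slope_le _ (hnN (φ j))
    rw [hnode] at h3
    exact absurd (hj.trans_le (h3.trans (ENNReal.ofReal_le_ofReal (hny _).le))) (lt_irrefl _)
  · have hsh : Tendsto (fun j => φ j + k₀) atTop atTop :=
      (tendsto_add_atTop_nat k₀).comp hφ.tendsto_atTop
    have haI : a ∈ Icc 0 S.T := ⟨ha, hab.le.trans hb⟩
    have hbI : b ∈ Icc 0 S.T := ⟨ha.trans hab.le, hb⟩
    refine le_of_tendsto_of_tendsto' ((hΨ.psi_continuous.tendsto _).comp
      (hlimx.sub ((h.tendsto_curve a haI).comp hsh)))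
      (((h.tendsto_cost b hbI).comp hsh).sub ((h.tendsto_cost a haI).comp hsh)) fun j => ?_
    have h1 := psi_pwConst_le hΨ (h.tau_pos (φ j + k₀)) (U (φ j + k₀)) (h.chain (φ j + k₀)).nonneg
      (hnI (φ j)).1
    have h2 := discreteCost_mono hΨ (h.tau_pos (φ j + k₀)) (U (φ j + k₀)) (h.chain (φ j + k₀)).nonneg
      (hnI (φ j)).2
    change S.Ψ (pwConst (τ (φ j + k₀)) (U (φ j + k₀)) (r (φ j)) - _) ≤ _ at h1
    rw [hpw] at h1
    simp only [Function.comp_apply]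
    linarith

/-- One-sided limits of `u` are stable. -/
theorem slope_eq_zero_of_tendsto (h : S.IsViscosityLimit E C τ ε U y u A)
    (hΨ : S.DissipationAssumptions) (hE : S.EnergyAssumptions) {l : Filter ℝ} {t α : ℝ} {x : V}
    (ht : t ∈ Icc 0 S.T) (hx : x ∈ S.sublevel E) (hl : ∀ s ∈ l, ∃ a ∈ s, ∃ b ∈ s, a < b)
    (hlI : ∀ᶠ s in l, s ∈ Icc 0 S.T) (hlt : l ≤ 𝓝 t) (hlu : Tendsto u l (𝓝 x))
    (hlA : Tendsto A l (𝓝 α)) : S.slope t x = 0 := by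
  by_contra hne
  obtain ⟨c, hc, hc1, hc2⟩ := ENNReal.lt_iff_exists_real_btwn.1 (pos_iff_ne_zero.2 hne)
  have hc0 : 0 < c := by simpa using hc1
  have hcu := h.isControlled hΨ hE
  obtain ⟨η, hη, hball⟩ := Metric.mem_nhdsWithin_iff.1
    (hE.lowerSemicontinuousOn_slope hΨ h.pos (t, x) ⟨ht, hx⟩ _ hc2)
  obtain ⟨δ, hδ, hmod⟩ := hΨ.psi_modulus (hE.isCompact_sublevel h.pos) (η / 2) (half_pos hη)
  have hlt' : ∀ᶠ s in l, dist s t < η := hlt (Metric.ball_mem_nhds t hη)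
  have h1 := hlI.and (hlt'.and
    ((Metric.tendsto_nhds.1 hlu (η / 2) (half_pos hη)).and
      (Metric.tendsto_nhds.1 hlA (δ / 2) (half_pos hδ))))
  -- Choose `a < b` so close to the limit that `A` hardly changes on `[a, b]`; the almost stable
  -- point found there lies near `(t, x)`, against lower semicontinuity of the slope.
  obtain ⟨a, ⟨haI, hat, hau, haA⟩, b, ⟨hbI, hbt, -, hbA⟩, hab⟩ := hl _ h1
  obtain ⟨r, hr, x', hx', hs, hΨx⟩ := h.exists_slope_le hΨ hE haI.1 hab hbI.2 hc0
  rw [Real.dist_eq, abs_lt] at haA hbA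
  have hrI : r ∈ Icc 0 S.T := ⟨haI.1.trans hr.1, hr.2.trans hbI.2⟩
  have h2 := hmod _ (hcu.mem a haI) _ hx' (by linarith)
  have h3 : dist x' x < η := by
    have := dist_triangle x' (u a) x
    rw [dist_eq_norm x' (u a)] at this
    linarith
  have h4 : |r - t| < η := by
    rw [Real.dist_eq, abs_lt] at hat hbt
    rw [abs_lt]
    constructor <;> linarith [hr.1, hr.2, hat.1, hbt.2]
  have h5 : ENNReal.ofReal c < S.slope r x' := @hball (r, x')
    ⟨by rw [Metric.mem_ball, Prod.dist_eq]; exact max_lt (by rwa [Real.dist_eq]) h3, hrI, hx'⟩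
  exact absurd (h5.trans_le hs) (lt_irrefl _)

theorem slope_rightValue (h : S.IsViscosityLimit E C τ ε U y u A)
    (hΨ : S.DissipationAssumptions) (hE : S.EnergyAssumptions) {t : ℝ} (ht : t ∈ Ico 0 S.T) :
    S.slope t (rightValue S.T u t) = 0 := by
  have hc := h.isControlled hΨ hE
  obtain ⟨α, hα⟩ := hc.exists_tendsto_right hΨ ht
  refine h.slope_eq_zero_of_tendsto hΨ hE ⟨ht.1, ht.2.le⟩
    (hc.rightValue_mem hΨ hE ⟨ht.1, ht.2.le⟩) (fun s hs => ?_) (IsControlled.eventually_right ht)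
    nhdsWithin_le_nhds (hc.tendsto_rightValue hΨ hE ht) hα
  obtain ⟨z, hz, hsub⟩ := mem_nhdsGT_iff_exists_Ioo_subset.1 hs
  have hz' : t < z := hz
  exact ⟨t + (z - t) / 3, hsub ⟨by linarith, by linarith⟩, t + (z - t) / 2,
    hsub ⟨by linarith, by linarith⟩, by linarith⟩

theorem slope_leftValue (h : S.IsViscosityLimit E C τ ε U y u A)
    (hΨ : S.DissipationAssumptions) (hE : S.EnergyAssumptions) {t : ℝ} (ht : t ∈ Ioc 0 S.T) :
    S.slope t (leftValue u t) = 0 := by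
  have hc := h.isControlled hΨ hE
  obtain ⟨α, hα⟩ := hc.exists_tendsto_left hΨ ht
  refine h.slope_eq_zero_of_tendsto hΨ hE ⟨ht.1.le, ht.2⟩
    (hc.leftValue_mem hΨ hE ⟨ht.1.le, ht.2⟩) (fun s hs => ?_) (IsControlled.eventually_left ht)
    nhdsWithin_le_nhds (hc.tendsto_leftValue hΨ hE ht) hα
  obtain ⟨z, hz, hsub⟩ := mem_nhdsLT_iff_exists_Ioo_subset.1 hs
  have hz' : z < t := hz
  exact ⟨t - (t - z) / 2, hsub ⟨by linarith, by linarith⟩, t - (t - z) / 3,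
    hsub ⟨by linarith, by linarith⟩, by linarith⟩

theorem stable (h : S.IsViscosityLimit E C τ ε U y u A) (hT : 0 < S.T)
    (hΨ : S.DissipationAssumptions) (hE : S.EnergyAssumptions) :
    ∀ t ∈ Icc 0 S.T \ jumpSet S.T u, 0 ∈ S.Kstar + S.frechetSubdiff t (u t) := by
  rintro t ⟨ht, htJ⟩
  have h3 : leftValue u t = u t ∧ u t = rightValue S.T u t := by
    by_contra hcon
    rw [not_and_or] at hcon
    exact htJ ⟨ht, hcon⟩
  have h0 : S.slope t (u t) = 0 := by
    -- At the final time the right value is `u(T)` by convention and carries no information, so the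
    -- left limit is used.
    rcases ht.2.eq_or_lt with h1 | h1
    · rw [← h3.1]
      exact h.slope_leftValue hΨ hE ⟨by rw [h1]; exact hT, ht.2⟩
    · rw [h3.2]
      exact h.slope_rightValue hΨ hE ⟨ht.1, h1⟩
  obtain ⟨ξ, hξ, z, hz, hn⟩ := hE.exists_mem_of_slope_le hΨ h.pos ht
    ((h.isControlled hΨ hE).mem t ht) le_rfl (by simp [h0])
  have : ξ + z = 0 := norm_le_zero_iff.1 hn
  exact ⟨z, hz, ξ, hξ, by simpa [add_comm] using this⟩

end IsViscosityLimit

end RIS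

end BalancedViscosity

/-! ### Measurability and integration of the power. -/

namespace BalancedViscosity

namespace RIS

variable {V : Type*} [NormedAddCommGroup V] [NormedSpace ℝ V] [CompleteSpace V] {S : RIS V}

namespace EnergyAssumptions

section Measurability

variable [MeasurableSpace V] [BorelSpace V]

/-- On `[0,T] × D_E` the energy is bounded below by `m` and lower semicontinuous; shifting by `m`
allows the measurability criterion for nonnegative extended values. -/
theorem exists_measurable_energy (hE : S.EnergyAssumptions) {E : ℝ} (hEpos : 0 < E) {w : ℝ → V}
    (hw : Measurable w) (hwm : ∀ s ∈ Icc 0 S.T, w s ∈ S.sublevel E) {σ : ℝ → ℝ} (hσ : Measurable σ)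
    (hσm : ∀ s ∈ Icc 0 S.T, σ s ∈ Icc 0 S.T) :
    ∃ g : ℝ → ℝ, Measurable g ∧ ∀ s ∈ Icc 0 S.T, g s = S.energy (σ s) (w s) := by
  obtain ⟨m, hm⟩ := hE.exists_energy_ge hEpos
  have hK : MeasurableSet (Icc 0 S.T ×ˢ S.sublevel E) :=
    measurableSet_Icc.prod (hE.isCompact_sublevel hEpos).measurableSet
  have hlsc : LowerSemicontinuousOn (fun p : ℝ × V => ENNReal.ofReal (S.energy p.1 p.2 - m))
      (Icc 0 S.T ×ˢ S.sublevel E) := by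
    intro p hp c hc
    have hct : c ≠ ⊤ := ne_top_of_lt hc
    have hc' : c.toReal < S.energy p.1 p.2 - m := (ENNReal.lt_ofReal_iff_toReal_lt hct).1 hc
    have h1 := (hE.lsc.mono (prod_mono_right fun _ hu => hu.1 :
      Icc 0 S.T ×ˢ S.sublevel E ⊆ Icc 0 S.T ×ˢ S.D)) p hp (c.toReal + m)
      (show c.toReal + m < S.energy p.1 p.2 by linarith)
    filter_upwards [h1] with q hq
    have hq' : c.toReal + m < S.energy q.1 q.2 := hq
    exact (ENNReal.lt_ofReal_iff_toReal_lt hct).2 (by linarith)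
  have h1 := measurable_indicator_of_lowerSemicontinuousOn hK hlsc
  refine ⟨fun s => ((Icc 0 S.T ×ˢ S.sublevel E).indicator
    (fun p : ℝ × V => ENNReal.ofReal (S.energy p.1 p.2 - m)) (σ s, w s)).toReal + m,
    ((h1.comp (hσ.prodMk hw)).ennreal_toReal).add_const m, fun s hs => ?_⟩
  have hmem : (σ s, w s) ∈ Icc 0 S.T ×ˢ S.sublevel E := ⟨hσm s hs, hwm s hs⟩
  simp only
  rw [indicator_of_mem hmem, ENNReal.toReal_ofReal (sub_nonneg.2 (hm _ hmem.1 _ hmem.2))]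
  ring

/-- The power is the limit of difference quotients in time with the state `w s` frozen; each
quotient is a measurable function of `s`. -/
theorem measurable_power (hE : S.EnergyAssumptions) {E : ℝ} (hEpos : 0 < E) {w : ℝ → V}
    (hw : Measurable w) (hwm : ∀ s ∈ Icc 0 S.T, w s ∈ S.sublevel E) :
    Measurable ((Ioo 0 S.T).indicator fun s => S.power s (w s)) := by
  have hex : ∀ n : ℕ, ∃ g : ℝ → ℝ, Measurable g ∧ ∀ s ∈ Icc 0 S.T,
      g s = S.energy (min (s + 1 / ((n : ℝ) + 1)) S.T) (w s) := fun n =>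
    hE.exists_measurable_energy hEpos hw hwm (by fun_prop) fun s hs =>
      ⟨le_min (add_nonneg hs.1 (by positivity)) (hs.1.trans hs.2), min_le_right _ _⟩
  choose g hg hgs using hex
  obtain ⟨g₀, hg₀, hg₀s⟩ := hE.exists_measurable_energy hEpos hw hwm measurable_id
    fun s hs => hs
  refine measurable_of_tendsto_metrizable (f := fun (n : ℕ) => (Ioo 0 S.T).indicator fun s =>
    (1 / ((n : ℝ) + 1))⁻¹ * (g n s - g₀ s))
    (fun n => (((hg n).sub hg₀).const_mul _).indicator measurableSet_Ioo) ?_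
  rw [tendsto_pi_nhds]
  intro s
  by_cases hs : s ∈ Ioo 0 S.T
  swap
  · simp only [indicator_of_notMem hs]; exact tendsto_const_nhds
  simp only [indicator_of_mem hs]
  have hsI := Ioo_subset_Icc_self hs
  have h1 := hasDerivAt_iff_tendsto_slope_zero.1 (hE.hasDerivAt_energy (hwm s hsI).1 hs)
  have h2 : Tendsto (fun n : ℕ => 1 / ((n : ℝ) + 1)) atTop (𝓝[≠] 0) :=
    tendsto_nhdsWithin_iff.2 ⟨tendsto_one_div_add_atTop_nhds_zero_nat,
      Eventually.of_forall fun n => by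
        have : (0 : ℝ) < 1 / ((n : ℝ) + 1) := by positivity
        exact this.ne'⟩
  refine (h1.comp h2).congr' ?_
  filter_upwards [tendsto_one_div_add_atTop_nhds_zero_nat.eventually_lt_const
    (sub_pos.2 hs.2)] with n hn
  simp only [Function.comp_apply, smul_eq_mul]
  rw [hgs n s hsI, hg₀s s hsI, min_eq_left (by linarith)]
  rfl

theorem abs_power_le {C : ℝ} (hC0 : 0 ≤ C)
    (hC : ∀ t ∈ Ioo 0 S.T, ∀ u ∈ S.D, |S.power t u| ≤ C * (S.Ψ u + S.energy t u)) {E s : ℝ}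
    (hs : s ∈ Ioo 0 S.T) {x : V} (hx : x ∈ S.sublevel E) : |S.power s x| ≤ C * E :=
  (hC s hs x hx.1).trans (mul_le_mul_of_nonneg_left (hx.2 s (Ioo_subset_Icc_self hs)) hC0)

theorem intervalIntegrable_power (hE : S.EnergyAssumptions) {E : ℝ} (hEpos : 0 < E) {w : ℝ → V}
    (hw : Measurable w) (hwm : ∀ s ∈ Icc 0 S.T, w s ∈ S.sublevel E) {a b : ℝ} (ha : 0 ≤ a)
    (hab : a ≤ b) (hb : b ≤ S.T) :
    IntervalIntegrable (fun s => S.power s (w s)) volume a b := by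
  obtain ⟨C, hC0, hC⟩ := hE.power_control
  rw [intervalIntegrable_iff_integrableOn_Ioo_of_le hab]
  have hsub : Ioo a b ⊆ Ioo 0 S.T := Ioo_subset_Ioo ha hb
  have hmeas : AEStronglyMeasurable (fun s => S.power s (w s)) (volume.restrict (Ioo a b)) := by
    refine (hE.measurable_power hEpos hw hwm).aestronglyMeasurable.congr ?_
    refine (ae_restrict_iff' measurableSet_Ioo).2 (Eventually.of_forall fun s hs => ?_)
    rw [indicator_of_mem (hsub hs)]
  refine Integrable.of_bound hmeas (C * E) ?_
  refine (ae_restrict_iff' measurableSet_Ioo).2 (Eventually.of_forall fun s hs => ?_)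
  exact abs_power_le hC0 hC (hsub hs) (hwm s (Ioo_subset_Icc_self (hsub hs)))

theorem integral_power (hE : S.EnergyAssumptions) {E : ℝ} (hEpos : 0 < E) {x : V}
    (hx : x ∈ S.sublevel E) {a b : ℝ} (ha : 0 ≤ a) (hab : a ≤ b) (hb : b ≤ S.T) :
    ∫ s in a..b, S.power s x = S.energy b x - S.energy a x :=
  intervalIntegral.integral_eq_sub_of_hasDerivAt_of_le hab
    ((hE.continuousOn_energy hx.1).mono (Icc_subset_Icc ha hb))
    (fun _ hs => hE.hasDerivAt_energy hx.1 (Ioo_subset_Ioo ha hb hs))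
    (hE.intervalIntegrable_power hEpos measurable_const (fun _ _ => hx) ha hab hb)

end Measurability

end EnergyAssumptions

section Delayed

/-- The delayed piecewise constant interpolant, equal to `Uⁿ` on `(nτ, (n+1)τ]`. -/
noncomputable def pwDelayed (τ : ℝ) (U : ℕ → V) (s : ℝ) : V := U (⌈s / τ⌉₊ - 1)

variable [MeasurableSpace V] [BorelSpace V]

theorem measurable_pwConst (τ : ℝ) (U : ℕ → V) : Measurable (pwConst τ U) :=
  (measurable_from_nat (f := U)).comp (Nat.measurable_ceil.comp (measurable_id.div_const τ))

theorem measurable_pwDelayed (τ : ℝ) (U : ℕ → V) : Measurable (pwDelayed τ U) :=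
  (measurable_from_nat (f := fun n => U (n - 1))).comp
    (Nat.measurable_ceil.comp (measurable_id.div_const τ))

/-- On `(t_i, t_{i+1}]` the state frozen in the energy difference is `U i`, the value before the
step; this is why the delayed interpolant appears. -/
theorem sum_energy_eq_integral (hT : 0 < S.T) (hE : S.EnergyAssumptions) {E τ : ℝ} (hEpos : 0 < E)
    (hτ : 0 < τ) {U : ℕ → V} (hU : ∀ n ≤ ⌈S.T / τ⌉₊, U n ∈ S.sublevel E) {n : ℕ}
    (hn : n ≤ ⌈S.T / τ⌉₊) :
    ∑ i ∈ Finset.range n, (S.energy (S.node τ (i + 1)) (U i) - S.energy (S.node τ i) (U i)) =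
      ∫ s in (0 : ℝ)..S.node τ n, S.power s (pwDelayed τ U s) := by
  have hmem : ∀ s ∈ Icc 0 S.T, pwDelayed τ U s ∈ S.sublevel E := fun s hs =>
    hU _ ((Nat.sub_le _ _).trans (ceil_le_ceil hτ hs.2))
  have hnode := node_mem (S := S) hT hτ
  have h1 := intervalIntegral.sum_integral_adjacent_intervals (μ := volume)
    (f := fun s => S.power s (pwDelayed τ U s)) (a := S.node τ) (n := n) fun i _ =>
      hE.intervalIntegrable_power hEpos (measurable_pwDelayed τ U) hmem (hnode i).1
        (node_mono hτ (Nat.le_succ i)) (hnode (i + 1)).2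
  rw [node_zero hT] at h1
  rw [← h1]
  refine Finset.sum_congr rfl fun i hi => ?_
  have hle := node_mono (S := S) hτ (Nat.le_succ i)
  rw [← hE.integral_power hEpos (hU i ((Finset.mem_range.1 hi).le.trans hn)) (hnode i).1 hle
    (hnode (i + 1)).2]
  refine intervalIntegral.integral_congr_ae (Eventually.of_forall fun s hs => ?_)
  rw [uIoc_of_le hle] at hs
  have hsT : s ≤ S.T := hs.2.trans (hnode (i + 1)).2
  have h2 : (i : ℝ) * τ < s := by
    rcases min_lt_iff.1 hs.1 with h | h
    · exact h
    · exact absurd hsT (not_le.2 h)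
  have h3 : s ≤ ((i + 1 : ℕ) : ℝ) * τ := hs.2.trans (min_le_left _ _)
  have h4 : ⌈s / τ⌉₊ = i + 1 := by
    rw [Nat.ceil_eq_iff (by omega)]
    refine ⟨?_, ?_⟩
    · rw [lt_div_iff₀ hτ]; simpa using h2
    · rwa [div_le_iff₀ hτ]
  rw [pwDelayed, h4, Nat.add_sub_cancel]

end Delayed

end RIS

end BalancedViscosity

/-! ### The energy inequality in the limit. -/

namespace BalancedViscosity

namespace RIS

variable {V : Type*} [NormedAddCommGroup V] [NormedSpace ℝ V] [CompleteSpace V] {S : RIS V}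

namespace IsViscosityLimit

variable {E C : ℝ} {τ ε : ℕ → ℝ} {U : ℕ → ℕ → V} {y : ℕ → ℕ → ℝ} {u : ℝ → V} {A : ℝ → ℝ}

theorem pwDelayed_mem (h : S.IsViscosityLimit E C τ ε U y u A) (k : ℕ) {s : ℝ} (hs : s ≤ S.T) :
    pwDelayed (τ k) (U k) s ∈ S.sublevel E :=
  (h.chain k).mem _ ((Nat.sub_le _ _).trans (ceil_le_ceil (h.tau_pos k) hs))

theorem norm_pwDelayed_sub_lt (h : S.IsViscosityLimit E C τ ε U y u A)
    (hΨ : S.DissipationAssumptions) {η : ℝ} (hη : 0 < η) : ∀ᶠ k in atTop, ∀ s ≤ S.T,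
      ‖pwDelayed (τ k) (U k) s - pwConst (τ k) (U k) s‖ < η := by
  filter_upwards [h.eventually_small_steps hΨ hη] with k hk s hs
  rw [pwDelayed, pwConst]
  rcases Nat.eq_zero_or_pos ⌈s / τ k⌉₊ with h0 | h0
  · simp [h0, hη]
  · have h1 := ceil_le_ceil (h.tau_pos k) hs
    have h2 := hk (⌈s / τ k⌉₊ - 1) (by omega)
    rwa [Nat.sub_add_cancel h0, norm_sub_rev] at h2

theorem tendsto_pwDelayed (h : S.IsViscosityLimit E C τ ε U y u A)
    (hΨ : S.DissipationAssumptions) {s : ℝ} (hs : s ∈ Icc 0 S.T) :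
    Tendsto (fun k => pwDelayed (τ k) (U k) s) atTop (𝓝 (u s)) := by
  have h1 : Tendsto (fun k => pwDelayed (τ k) (U k) s - pwConst (τ k) (U k) s) atTop (𝓝 0) := by
    rw [Metric.tendsto_nhds]
    intro η hη
    filter_upwards [h.norm_pwDelayed_sub_lt hΨ hη] with k hk
    rw [dist_zero_right]
    exact hk s hs.2
  simpa using h1.add (h.tendsto_curve s hs)

theorem tendsto_pwAffine (h : S.IsViscosityLimit E C τ ε U y u A)
    (hΨ : S.DissipationAssumptions) {t : ℝ} (ht : t ∈ Icc 0 S.T) :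
    Tendsto (fun k => pwAffine (τ k) (U k) t) atTop (𝓝 (u t)) := by
  have h1 : Tendsto (fun k => pwAffine (τ k) (U k) t - pwConst (τ k) (U k) t) atTop (𝓝 0) := by
    rw [Metric.tendsto_nhds]
    intro η hη
    filter_upwards [h.norm_pwDelayed_sub_lt hΨ hη] with k hk
    have hτ := h.tau_pos k
    set n := ⌈t / τ k⌉₊ with hn
    have h2 : pwAffine (τ k) (U k) t - pwConst (τ k) (U k) t =
        (((n : ℝ) * τ k - t) / τ k) • (pwDelayed (τ k) (U k) t - pwConst (τ k) (U k) t) := by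
      rw [pwAffine, pwDelayed, pwConst, ← hn]
      have h3 : (t - ((n : ℝ) - 1) * τ k) / τ k = 1 - ((n : ℝ) * τ k - t) / τ k := by
        field_simp; ring
      rw [h3]
      module
    rw [dist_zero_right, h2, norm_smul]
    have h3 : t ≤ n * τ k := by
      have := Nat.le_ceil (t / τ k)
      rwa [div_le_iff₀ hτ] at this
    have h4 : (n : ℝ) * τ k < t + τ k := by
      have := Nat.ceil_lt_add_one (div_nonneg ht.1 hτ.le)
      rw [← hn] at this
      calc (n : ℝ) * τ k < (t / τ k + 1) * τ k := mul_lt_mul_of_pos_right this hτ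
        _ = t + τ k := by field_simp
    have h5 : ‖((n : ℝ) * τ k - t) / τ k‖ ≤ 1 := by
      rw [Real.norm_of_nonneg (div_nonneg (by linarith) hτ.le), div_le_one hτ]
      linarith
    exact (mul_le_of_le_one_left (norm_nonneg _) h5).trans_lt (hk t ht.2)
  simpa using h1.add (h.tendsto_curve t ht)

section Measurability

variable [MeasurableSpace V] [BorelSpace V]

theorem measurable_indicator (h : S.IsViscosityLimit E C τ ε U y u A) :
    Measurable ((Icc 0 S.T).indicator u) := by
  refine measurable_of_tendsto_metrizable (f := fun k => (Icc 0 S.T).indicator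
    (pwConst (τ k) (U k))) (fun k => (measurable_pwConst _ _).indicator measurableSet_Icc) ?_
  rw [tendsto_pi_nhds]
  intro s
  by_cases hs : s ∈ Icc 0 S.T
  · simpa only [indicator_of_mem hs] using h.tendsto_curve s hs
  · simp only [indicator_of_notMem hs]; exact tendsto_const_nhds

end Measurability

theorem intervalIntegrable_power (h : S.IsViscosityLimit E C τ ε U y u A)
    (hΨ : S.DissipationAssumptions) (hE : S.EnergyAssumptions) {a b : ℝ} (ha : 0 ≤ a)
    (hab : a ≤ b) (hb : b ≤ S.T) :
    IntervalIntegrable (fun s => S.power s (u s)) volume a b := by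
  borelize V
  have h1 := hE.intervalIntegrable_power h.pos h.measurable_indicator (fun s hs => by
    rw [indicator_of_mem hs]; exact (h.isControlled hΨ hE).mem s hs) ha hab hb
  refine h1.congr_ae ?_
  refine (ae_restrict_iff' measurableSet_uIoc).2 (Eventually.of_forall fun s hs => ?_)
  rw [uIoc_of_le hab] at hs
  simp only [indicator_of_mem (show s ∈ Icc 0 S.T from ⟨ha.trans hs.1.le, hs.2.trans hb⟩)]

/-- The power terms of the discrete solutions are asymptotically bounded by that of the limit. -/
theorem eventually_integral_power_le (h : S.IsViscosityLimit E C τ ε U y u A)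
    (hΨ : S.DissipationAssumptions) (hE : S.EnergyAssumptions) {t : ℝ} (ht : t ∈ Icc 0 S.T) {η : ℝ}
    (hη : 0 < η) : ∀ᶠ k in atTop, ∫ s in (0 : ℝ)..t, S.power s (pwDelayed (τ k) (U k) s) ≤
      (∫ s in (0 : ℝ)..t, S.power s (u s)) + η := by
  borelize V
  obtain ⟨P, hP0, hP⟩ := hE.power_control
  have hcu := h.isControlled hΨ hE
  have hiu := h.intervalIntegrable_power hΨ hE le_rfl ht.1 ht.2
  have hik : ∀ k, IntervalIntegrable (fun s => S.power s (pwDelayed (τ k) (U k) s)) volume 0 t :=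
    fun k => hE.intervalIntegrable_power h.pos (measurable_pwDelayed _ _)
      (fun s hs => h.pwDelayed_mem k hs.2) le_rfl ht.1 ht.2
  -- The power is only upper semicontinuous, so just the positive part of the difference tends to
  -- zero; dominated convergence for it gives the one-sided bound.
  set f : ℕ → ℝ → ℝ := fun k s => max (S.power s (pwDelayed (τ k) (U k) s) - S.power s (u s)) 0
  have hae : ∀ᵐ s, s ∈ uIoc 0 t → s ∈ Ioo 0 S.T := by
    have : ∀ᵐ s : ℝ, s ≠ S.T := by simp [ae_iff]
    filter_upwards [this] with s hs hst
    rw [uIoc_of_le ht.1] at hst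
    exact ⟨hst.1, lt_of_le_of_ne (hst.2.trans ht.2) hs⟩
  have hlim : Tendsto (fun k => ∫ s in (0 : ℝ)..t, f k s) atTop (𝓝 (∫ s in (0 : ℝ)..t, (0 : ℝ))) := by
    refine intervalIntegral.tendsto_integral_filter_of_dominated_convergence
      (fun _ => 2 * (P * E)) ?_ ?_ (by simp) ?_
    · refine Eventually.of_forall fun k => ?_
      exact ((hik k).sub hiu).def'.aestronglyMeasurable.sup aestronglyMeasurable_const
    · refine Eventually.of_forall fun k => ?_
      filter_upwards [hae] with s hs hst
      have hs' := hs hst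
      have h1 := EnergyAssumptions.abs_power_le hP0 hP hs' (h.pwDelayed_mem k hs'.2.le)
      have h2 := EnergyAssumptions.abs_power_le hP0 hP hs' (hcu.mem s (Ioo_subset_Icc_self hs'))
      rw [Real.norm_of_nonneg (le_max_right _ _)]
      rw [abs_le] at h1 h2
      exact max_le (by linarith [h1.1, h1.2, h2.1, h2.2]) (by linarith [h1.1, h1.2])
    · filter_upwards [hae] with s hs hst
      have hs' := hs hst
      have hsI := Ioo_subset_Icc_self hs'
      rw [Metric.tendsto_nhds]
      intro δ hδ
      have h1 := hE.power_usc s hs' (u s) (hcu.mem s hsI).1 E h.pos (S.power s (u s) + δ)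
        (by linarith)
      have h2 := (tendsto_nhdsWithin_iff.2 ⟨h.tendsto_pwDelayed hΨ hsI,
        Eventually.of_forall fun k => h.pwDelayed_mem k hsI.2⟩).eventually h1
      filter_upwards [h2] with k hk
      rw [Real.dist_eq, sub_zero, abs_of_nonneg (le_max_right _ _)]
      exact max_lt (by linarith) hδ
  rw [intervalIntegral.integral_zero] at hlim
  filter_upwards [hlim.eventually_lt_const hη] with k hk
  have h1 : ∫ s in (0 : ℝ)..t, (S.power s (pwDelayed (τ k) (U k) s) - S.power s (u s)) ≤
      ∫ s in (0 : ℝ)..t, f k s :=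
    intervalIntegral.integral_mono_on ht.1 ((hik k).sub hiu)
      (intervalIntegrable_iff.2 ((hik k).sub hiu).def'.pos_part) fun s _ => le_max_left _ _
  rw [intervalIntegral.integral_sub (hik k) hiu] at h1
  linarith

/-- The discrete energy inequality in the limit. -/
theorem eventually_energy_le (h : S.IsViscosityLimit E C τ ε U y u A) (hT : 0 < S.T)
    (hΨ : S.DissipationAssumptions) (hE : S.EnergyAssumptions) {t : ℝ} (ht : t ∈ Icc 0 S.T) {η : ℝ}
    (hη : 0 < η) : ∀ᶠ k in atTop, S.discreteCost (τ k) (U k) (y k) t +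
      S.energy t (pwConst (τ k) (U k) t) ≤
        S.energy 0 (u 0) + (∫ s in (0 : ℝ)..t, S.power s (u s)) + η := by
  borelize V
  obtain ⟨P, hP0, hP⟩ := hE.power_control
  have hK := hE.isCompact_sublevel h.pos
  obtain ⟨ω, hω⟩ := hE.exists_isModulus h.pos
  have hC1 : 0 < C + 1 := by linarith [h.nonneg]
  -- Five errors of size `η / 5`: the modulus term `κ C`, the power integral on `[0,t]`, the initial
  -- energy, and two from the last node exceeding `t` by at most `τ`, one in the energy and one in
  -- the power integral.
  set κ := η / 5 / (C + 1) with hκ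
  have hκ0 : 0 < κ := by positivity
  have hκC : κ * C ≤ η / 5 := by
    calc κ * C ≤ κ * (C + 1) := mul_le_mul_of_nonneg_left (by linarith) hκ0.le
      _ = η / 5 := by rw [hκ]; field_simp
  obtain ⟨ρ, hρ, hωρ⟩ := hω.exists_small hK hκ0
  have hτlim : Tendsto (fun k => P * E * τ k) atTop (𝓝 (P * E * 0)) := h.tendsto_tau.const_mul _
  rw [mul_zero] at hτlim
  have hη5 : 0 < η / 5 := by positivity
  filter_upwards [h.eventually_integral_power_le hΨ hE ht hη5,
    h.eventually_small_steps hΨ hρ, hτlim.eventually_lt_const hη5,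
    h.tendsto_energy.eventually_lt_const (show S.energy 0 (u 0) < S.energy 0 (u 0) + η / 5 by
      linarith)] with k hk1 hk2 hk3 hk4
  have hτ := h.tau_pos k
  have hch := h.chain k
  set n := ⌈t / τ k⌉₊ with hn
  have hnN : n ≤ ⌈S.T / τ k⌉₊ := ceil_le_ceil hτ ht.2
  have hnode := node_mem (S := S) hT hτ n
  have h3 : t ≤ S.node (τ k) n := by
    refine le_min ?_ ht.2
    have := Nat.le_ceil (t / τ k)
    rwa [div_le_iff₀ hτ] at this
  have h4 : S.node (τ k) n ≤ t + τ k := by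
    refine (min_le_left _ _).trans ?_
    have := Nat.ceil_lt_add_one (div_nonneg ht.1 hτ.le)
    rw [← hn] at this
    calc (n : ℝ) * τ k ≤ (t / τ k + 1) * τ k := mul_le_mul_of_nonneg_right this.le hτ.le
      _ = t + τ k := by field_simp
  have h5 := hch.cost_le hT hΨ hτ (h.eps_pos k) hω hκ0.le (fun i hi => hωρ _ (node_mem hT hτ _) _
    (hch.mem (i + 1) hi) _ (hch.mem i hi.le) (by rw [norm_sub_rev]; exact hk2 i hi)) n hnN
  rw [sum_energy_eq_integral hT hE h.pos hτ hch.mem hnN] at h5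
  have hPE : 0 ≤ P * E := mul_nonneg hP0 h.pos.le
  have h6 : P * E * |S.node (τ k) n - t| ≤ P * E * τ k := by
    refine mul_le_mul_of_nonneg_left ?_ hPE
    rw [abs_of_nonneg (by linarith)]
    linarith
  have h7 := (abs_le.1 (hE.abs_energy_sub_le hP0 hP (hch.mem n hnN) ht hnode)).1
  have hii : ∀ {a b : ℝ}, 0 ≤ a → a ≤ b → b ≤ S.T → IntervalIntegrable
      (fun s => S.power s (pwDelayed (τ k) (U k) s)) volume a b := fun h1 h2 h3 =>
    hE.intervalIntegrable_power h.pos (measurable_pwDelayed _ _)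
      (fun s hs => h.pwDelayed_mem k hs.2) h1 h2 h3
  have h8 := intervalIntegral.integral_add_adjacent_intervals (hii le_rfl ht.1 ht.2)
    (hii ht.1 h3 hnode.2)
  have h9 : ∫ s in t..S.node (τ k) n, S.power s (pwDelayed (τ k) (U k) s) ≤
      P * E * |S.node (τ k) n - t| := by
    have h10 : ∀ᵐ s : ℝ, s ≠ S.T := by simp [ae_iff]
    refine (Real.le_norm_self _).trans (intervalIntegral.norm_integral_le_of_norm_le_const_ae ?_)
    filter_upwards [h10] with s hs hst
    rw [uIoc_of_le h3] at hst
    have hs' : s ∈ Ioo 0 S.T := ⟨ht.1.trans_lt hst.1, lt_of_le_of_ne (hst.2.trans hnode.2) hs⟩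
    exact EnergyAssumptions.abs_power_le hP0 hP hs' (h.pwDelayed_mem k hs'.2.le)
  rw [discreteCost, pwConst, ← hn]
  linarith

theorem cost_add_energy_le (h : S.IsViscosityLimit E C τ ε U y u A) (hT : 0 < S.T)
    (hΨ : S.DissipationAssumptions) (hE : S.EnergyAssumptions) {t : ℝ} (ht : t ∈ Icc 0 S.T) :
    A t + S.energy t (u t) ≤ S.energy 0 (u 0) + ∫ s in (0 : ℝ)..t, S.power s (u s) := by
  refine le_of_forall_pos_le_add fun η hη => ?_
  have hcu := h.isControlled hΨ hE
  have h1 := hE.lsc (t, u t) ⟨ht, (hcu.mem t ht).1⟩ (S.energy t (u t) - η / 3)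
    (show S.energy t (u t) - η / 3 < S.energy t (u t) by linarith)
  have h2 := (tendsto_nhdsWithin_iff.2 ⟨(tendsto_const_nhds (x := t)).prodMk_nhds
    (h.tendsto_curve t ht), Eventually.of_forall fun k =>
      (⟨ht, (h.pwConst_mem k ht.2).1⟩ : _ ∈ Icc 0 S.T ×ˢ S.D)⟩).eventually h1
  have hη3 : 0 < η / 3 := by positivity
  obtain ⟨k, hk1, hk2, hk3⟩ := (h2.and ((h.eventually_energy_le hT hΨ hE ht hη3).and
    ((h.tendsto_cost t ht).eventually_const_lt (show A t - η / 3 < A t by linarith)))).exists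
  have hk1' : S.energy t (u t) - η / 3 < S.energy t (pwConst (τ k) (U k) t) := hk1
  linarith

end IsViscosityLimit

end RIS

end BalancedViscosity

/-! ### The chain rule inequality for stable controlled curves. -/

namespace BalancedViscosity

namespace RIS

variable {V : Type*} [NormedAddCommGroup V] [NormedSpace ℝ V] [CompleteSpace V] {S : RIS V}

namespace IsControlled

variable {E : ℝ} {A : ℝ → ℝ} {u : ℝ → V}

/-- Both one-sided values at times just after `r` are near `u(r₊)`, and just before `r` near
`u(r₋)`. So across short intervals adjacent to `r` the part of `u` between the endpoint jumps is
small and ω is small there. -/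
theorem norm_leftValue_sub_rightValue_lt (h : S.IsControlled E A u)
    (hΨ : S.DissipationAssumptions) (hE : S.EnergyAssumptions) {r : ℝ} (hr : r ∈ Icc 0 S.T) {δ : ℝ}
    (hδ : 0 < δ) : ∃ ρ > 0, (∀ t ∈ Icc 0 S.T, r < t → t < r + ρ →
      ‖leftValue u t - rightValue S.T u r‖ < δ) ∧
      ∀ s ∈ Icc 0 S.T, s < r → r - ρ < s → ‖leftValue u r - rightValue S.T u s‖ < δ := by
  have hδ2 := half_pos hδ
  have h1 : ∃ ρ > 0, ∀ t ∈ Icc 0 S.T, r < t → t < r + ρ →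
      ‖leftValue u t - rightValue S.T u r‖ < δ := by
    rcases hr.2.eq_or_lt with h0 | h0
    · exact ⟨1, one_pos, fun t ht h1 => absurd ht.2 (by linarith)⟩
    obtain ⟨b, hb, hb'⟩ := (mem_nhdsGT_iff_exists_Ioo_subset).1
      (Metric.tendsto_nhds.1 (h.tendsto_rightValue hΨ hE ⟨hr.1, h0⟩) (δ / 2) hδ2)
    refine ⟨b - r, sub_pos.2 hb, fun t ht h1 h2 => ?_⟩
    refine lt_of_le_of_lt (le_of_tendsto ((h.tendsto_leftValue hΨ hE
      ⟨hr.1.trans_lt h1, ht.2⟩).sub_const _).norm ?_) (half_lt_self hδ)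
    filter_upwards [Ioo_mem_nhdsLT h1] with x hx
    have := hb' (show x ∈ Ioo r b from ⟨hx.1, by linarith [hx.2]⟩)
    rw [mem_ofPred_eq, dist_eq_norm] at this
    exact this.le
  have h2 : ∃ ρ > 0, ∀ s ∈ Icc 0 S.T, s < r → r - ρ < s →
      ‖leftValue u r - rightValue S.T u s‖ < δ := by
    rcases hr.1.eq_or_lt with h0 | h0
    · exact ⟨1, one_pos, fun t ht h1 => absurd ht.1 (by linarith)⟩
    obtain ⟨a, ha, ha'⟩ := (mem_nhdsLT_iff_exists_Ioo_subset).1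
      (Metric.tendsto_nhds.1 (h.tendsto_leftValue hΨ hE ⟨h0, hr.2⟩) (δ / 2) hδ2)
    refine ⟨r - a, sub_pos.2 ha, fun s hs h1 h2 => ?_⟩
    refine lt_of_le_of_lt (le_of_tendsto ((h.tendsto_rightValue hΨ hE
      ⟨hs.1, h1.trans_le hr.2⟩).const_sub _).norm ?_) (half_lt_self hδ)
    filter_upwards [Ioo_mem_nhdsGT h1] with x hx
    have := ha' (show x ∈ Ioo a r from ⟨by linarith [hx.1], hx.2⟩)
    rw [mem_ofPred_eq, dist_eq_norm, norm_sub_rev] at this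
    exact this.le
  obtain ⟨ρ₁, hρ₁, h1⟩ := h1
  obtain ⟨ρ₂, hρ₂, h2⟩ := h2
  exact ⟨min ρ₁ ρ₂, lt_min hρ₁ hρ₂,
    fun t ht h3 h4 => h1 t ht h3 (by linarith [min_le_left ρ₁ ρ₂]),
    fun s hs h3 h4 => h2 s hs h3 (by linarith [min_le_right ρ₁ ρ₂])⟩

theorem leftValue_eq (h : S.IsControlled E A u) (hΨ : S.DissipationAssumptions)
    (hE : S.EnergyAssumptions) {r : ℝ} (hr : r ∈ Ioo 0 S.T) (hA : ContinuousAt A r) :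
    leftValue u r = u r := by
  refine (hΨ.eq_of_psi_sub_le ?_).symm
  have h1 : Tendsto (fun s => A r - A s) (𝓝[<] r) (𝓝 (A r - A r)) :=
    (hA.tendsto.mono_left nhdsWithin_le_nhds).const_sub _
  rw [sub_self] at h1
  refine ge_of_tendsto h1 ?_
  filter_upwards [Ioo_mem_nhdsLT hr.1] with s hs
  exact h.psi_left_le hΨ hE hr.2.le s hs.1.le hs.2

/-- The energy release over `[s,t]` is bounded by the dissipation, up to a small relative error. -/
theorem energy_sub_le (h : S.IsControlled E A u) (hRN : HasRadonNikodymProperty V)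
    (hΨ : S.DissipationAssumptions) (hE : S.EnergyAssumptions) {ω : ℝ → V → V → ℝ}
    (hω : S.IsModulus E ω) {s t κ : ℝ} (hs : 0 ≤ s) (hst : s < t) (ht : t ≤ S.T)
    (hfin : S.totalVar u t ≠ ⊤) (hslope : S.slope s (rightValue S.T u s) = 0) (hκ0 : 0 ≤ κ)
    (hκ : ω s (rightValue S.T u s) (leftValue u t) ≤ κ) :
    S.energy s (u s) - S.energy t (u t) +
      (S.energy t (leftValue u t) - S.energy s (leftValue u t)) ≤
        (1 + κ) * ((S.totalVar u t).toReal - (S.totalVar u s).toReal) := by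
  have hsI : s ∈ Icc 0 S.T := ⟨hs, hst.le.trans ht⟩
  have htI : t ∈ Icc 0 S.T := ⟨hs.trans hst.le, ht⟩
  have h1 := h.totalVar_add_le hRN hΨ hE hs hst ht
  -- The path splits into the right jump at `s` and the left jump at `t`, paid by Finsler costs, and
  -- the stretch in between, paid by Ψ because `u(s₊)` has zero slope. Time changes only at the
  -- frozen state `u(t₋)`.
  have h2 := ofReal_energy_sub_le_finslerCost hRN hΨ hE hsI (u s) (rightValue S.T u s)
  have h3 := ofReal_energy_sub_le_finslerCost hRN hΨ hE htI (leftValue u t) (u t)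
  have h4 := hω.energy_le_of_slope_le hΨ hE h.pos hsI (h.rightValue_mem hΨ hE hsI)
    (h.leftValue_mem hΨ hE htI) le_rfl (by simp [hslope]) hκ0 hκ
  generalize S.finslerCost s (u s) (rightValue S.T u s) = a at *
  generalize S.finslerCost t (leftValue u t) (u t) = b at *
  have hp0 := hΨ.psi_nonneg (leftValue u t - rightValue S.T u s)
  have hfin' := ne_top_of_le_ne_top hfin h1
  simp only [ne_eq, ENNReal.add_eq_top, not_or] at hfin'
  obtain ⟨hf1, ⟨hf2, hf3⟩, hf4⟩ := hfin'
  have h5 := ENNReal.toReal_mono hfin h1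
  rw [ENNReal.toReal_add hf1 (by simp [hf2, hf4]), ENNReal.toReal_add (by simp [hf2]) hf4,
    ENNReal.toReal_add hf2 hf3, ENNReal.toReal_ofReal hp0] at h5
  rw [ENNReal.ofReal_le_iff_le_toReal hf2] at h2
  rw [ENNReal.ofReal_le_iff_le_toReal hf4] at h3
  have ha := a.toReal_nonneg
  have hb := b.toReal_nonneg
  nlinarith [mul_le_mul_of_nonneg_left h5 hκ0, mul_nonneg hκ0 ha, mul_nonneg hκ0 hb]

/-- The chain rule inequality for controlled curves that are stable from the right. -/
theorem energy_add_integral_le (h : S.IsControlled E A u) (hRN : HasRadonNikodymProperty V)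
    (hΨ : S.DissipationAssumptions) (hE : S.EnergyAssumptions)
    (hfin : ∀ t ∈ Icc 0 S.T, S.totalVar u t ≠ ⊤)
    (hslope : ∀ t ∈ Ico 0 S.T, S.slope t (rightValue S.T u t) = 0) {t : ℝ} (ht : t ∈ Icc 0 S.T)
    (hintegrable : IntervalIntegrable (fun s => S.power s (u s)) volume 0 t) :
    S.energy 0 (u 0) + (∫ s in (0 : ℝ)..t, S.power s (u s)) ≤
      (S.totalVar u t).toReal + S.energy t (u t) := by
  obtain ⟨P, hP0, hP⟩ := hE.power_control
  obtain ⟨ω, hω⟩ := hE.exists_isModulus h.pos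
  have hK := hE.isCompact_sublevel h.pos
  set W : ℝ → ℝ := fun r => (S.totalVar u r).toReal with hW
  have key : ∀ η > 0, S.energy 0 (u 0) + (∫ s in (0 : ℝ)..t, S.power s (u s)) ≤
      (1 + η) * W t + S.energy t (u t) := by
    intro η hη
    obtain ⟨δ, hδ, hωδ⟩ := hω.exists_small hK hη
    have hloc : ∀ s r, 0 ≤ s → s < r → r ≤ S.T →
        ‖leftValue u r - rightValue S.T u s‖ < δ → S.energy s (u s) - S.energy r (u r) +
        (S.energy r (leftValue u r) - S.energy s (leftValue u r)) ≤ (1 + η) * (W r - W s) := by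
      intro s r hs hsr hr hlt
      have hsI : s ∈ Icc 0 S.T := ⟨hs, hsr.le.trans hr⟩
      have hrI : r ∈ Icc 0 S.T := ⟨hs.trans hsr.le, hr⟩
      exact h.energy_sub_le hRN hΨ hE hω hs hsr hr (hfin r hrI) (hslope s ⟨hs, hsr.trans_le hr⟩)
        hη.le (hωδ s hsI _ (h.rightValue_mem hΨ hE hsI) _ (h.leftValue_mem hΨ hE hrI) hlt)
    -- The linear term outweighs the power, so `H` is monotone; the integral of `H'` is then at most
    -- its increment, and the claim reduces to a lower bound for `H'` a.e.
    set H : ℝ → ℝ := fun r => S.energy r (u r) + (1 + η) * W r + P * E * r with hH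
    have hstep : ∀ s r, 0 ≤ s → s < r → r ≤ S.T →
        ‖leftValue u r - rightValue S.T u s‖ < δ → H s ≤ H r := by
      intro s r hs hsr hr hlt
      have h1 := hloc s r hs hsr hr hlt
      have h2 := (abs_le.1 (hE.abs_energy_sub_le hP0 hP (h.leftValue_mem hΨ hE
        ⟨hs.trans hsr.le, hr⟩) ⟨hs, hsr.le.trans hr⟩ ⟨hs.trans hsr.le, hr⟩)).1
      rw [abs_of_pos (sub_pos.2 hsr)] at h2
      simp only [hH]
      linarith
    have hmono : MonotoneOn H (Icc 0 S.T) := by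
      intro a ha b hb hab
      refine le_of_locally_le hab fun r hr => ?_
      obtain ⟨ρ, hρ, h1, h2⟩ := h.norm_leftValue_sub_rightValue_lt hΨ hE
        (r := r) ⟨ha.1.trans hr.1, hr.2.trans hb.2⟩ hδ
      refine ⟨ρ, hρ, fun x hx h3 h4 => ?_, fun x hx h3 h4 => ?_⟩
      · exact hstep r x (ha.1.trans hr.1) h3 (hx.2.trans hb.2)
          (h1 x ⟨ha.1.trans hx.1, hx.2.trans hb.2⟩ h3 h4)
      · exact hstep x r (ha.1.trans hx.1) h3 (hr.2.trans hb.2)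
          (h2 x ⟨ha.1.trans hx.1, hx.2.trans hb.2⟩ h3 h4)
    -- Left difference quotients are used because the frozen state is the left limit at `r`. Where
    -- `A` is continuous it equals `u r` and does not depend on `s`, so the quotients of the energy
    -- converge to the power.
    have hder : ∀ r ∈ Ioo 0 S.T, DifferentiableAt ℝ A r → DifferentiableAt ℝ H r →
        S.power r (u r) + P * E ≤ deriv H r := by
      intro r hr hAr hHr
      have hl := h.leftValue_eq hΨ hE hr hAr.continuousAt
      have hg : HasDerivAt (fun s => S.energy s (u r) + P * E * s) (S.power r (u r) + P * E) r := by
        simpa using (hE.hasDerivAt_energy (h.mem r (Ioo_subset_Icc_self hr)).1 hr).fun_add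
          ((hasDerivAt_id r).const_mul (P * E))
      have h1 := (hHr.hasDerivAt.sub hg).hasDerivWithinAt (s := Iio r)
      rw [hasDerivWithinAt_iff_tendsto_slope' (by simp)] at h1
      refine sub_nonneg.1 (ge_of_tendsto h1 ?_)
      obtain ⟨ρ, hρ, -, h2⟩ := h.norm_leftValue_sub_rightValue_lt hΨ hE
        (Ioo_subset_Icc_self hr) hδ
      filter_upwards [Ioo_mem_nhdsLT (show max 0 (r - ρ) < r from max_lt hr.1 (by linarith))]
        with s hs
      have hs0 : 0 ≤ s := (le_max_left _ _).trans hs.1.le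
      have h3 := hloc s r hs0 hs.2 hr.2.le (h2 s ⟨hs0, hs.2.le.trans hr.2.le⟩ hs.2
        ((le_max_right _ _).trans_lt hs.1))
      rw [hl] at h3
      rw [slope_def_field]
      refine div_nonneg_of_nonpos ?_ (sub_nonpos.2 hs.2.le)
      simp only [hH, Pi.sub_apply]
      linarith
    have hmt : MonotoneOn H (Icc 0 t) := hmono.mono (Icc_subset_Icc_right ht.2)
    have h1 := integral_deriv_le_of_monotoneOn ht.1 hmt
    have h2 : ∫ s in (0 : ℝ)..t, (S.power s (u s) + P * E) ≤ ∫ s in (0 : ℝ)..t, deriv H s := by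
      refine intervalIntegral.integral_mono_ae_restrict ht.1 (hintegrable.add (by simp))
        (MonotoneOn.intervalIntegrable_deriv (by rwa [uIcc_of_le ht.1])) ?_
      rw [EventuallyLE, ae_restrict_iff' measurableSet_Icc]
      have h3 : ∀ᵐ s : ℝ, s ≠ 0 := by simp [ae_iff]
      have h4 : ∀ᵐ s : ℝ, s ≠ S.T := by simp [ae_iff]
      filter_upwards [h3, h4, ae_differentiableAt_of_monotoneOn_Icc hmono,
        ae_differentiableAt_of_monotoneOn_Icc (h.monotoneOn hΨ)] with s hs0 hsT hs1 hs2 hs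
      have hs' : s ∈ Ioo 0 S.T :=
        ⟨lt_of_le_of_ne hs.1 (Ne.symm hs0), lt_of_le_of_ne (hs.2.trans ht.2) hsT⟩
      exact hder s hs' (hs2 hs') (hs1 hs')
    rw [intervalIntegral.integral_add hintegrable (by simp), intervalIntegral.integral_const] at h2
    simp only [hH, smul_eq_mul, sub_zero, mul_zero, add_zero] at h1 h2
    have h3 : W 0 = 0 := by simp [hW, totalVar_zero hΨ]
    rw [h3] at h1
    linarith
  have hlim : Tendsto (fun η => (1 + η) * W t + S.energy t (u t)) (𝓝[>] 0)
      (𝓝 ((1 + 0) * W t + S.energy t (u t))) :=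
    ((((continuous_const.add continuous_id).mul continuous_const).add
      continuous_const).tendsto 0).mono_left nhdsWithin_le_nhds
  rw [add_zero, one_mul] at hlim
  exact ge_of_tendsto hlim (eventually_mem_nhdsWithin.mono key)

end IsControlled

end RIS

end BalancedViscosity

/-! ### Energy balance and convergence of energies. -/

namespace BalancedViscosity

namespace RIS

variable {V : Type*} [NormedAddCommGroup V] [NormedSpace ℝ V] [CompleteSpace V] {S : RIS V}

theorem extEnergy_of_mem {t : ℝ} {x : V} (hx : x ∈ S.D) :
    S.extEnergy t x = (S.energy t x : EReal) := if_pos hx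

theorem mem_of_extEnergy_ne_top {t : ℝ} {x : V} (hx : S.extEnergy t x ≠ ⊤) : x ∈ S.D := by
  by_contra h
  exact hx (if_neg h)

namespace IsViscosityLimit

variable {E C : ℝ} {τ ε : ℕ → ℝ} {U : ℕ → ℕ → V} {y : ℕ → ℕ → ℝ} {u : ℝ → V} {A : ℝ → ℝ}

theorem cost_nonneg (h : S.IsViscosityLimit E C τ ε U y u A) (hT : 0 < S.T)
    (hΨ : S.DissipationAssumptions) (hE : S.EnergyAssumptions) {t : ℝ} (ht : t ∈ Icc 0 S.T) :
    0 ≤ A t := by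
  have := (h.isControlled hΨ hE).monotoneOn hΨ ⟨le_rfl, hT.le⟩ ht ht.1
  rwa [h.cost_zero hT] at this

/-- The limit cost is the `𝔣`-variation of the limit curve, and the energy balance holds. -/
theorem totalVar_eq_and_balance (h : S.IsViscosityLimit E C τ ε U y u A)
    (hRN : HasRadonNikodymProperty V) (hT : 0 < S.T) (hΨ : S.DissipationAssumptions)
    (hE : S.EnergyAssumptions) {t : ℝ} (ht : t ∈ Icc 0 S.T) :
    S.totalVar u t = ENNReal.ofReal (A t) ∧
      A t + S.energy t (u t) = S.energy 0 (u 0) + ∫ s in (0 : ℝ)..t, S.power s (u s) := by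
  have hc := h.isControlled hΨ hE
  have hfin : ∀ t ∈ Icc 0 S.T, S.totalVar u t ≠ ⊤ := fun t ht =>
    ne_top_of_le_ne_top ENNReal.ofReal_ne_top (h.totalVar_le hRN hT hΨ hE ht)
  have h1 := hc.energy_add_integral_le hRN hΨ hE hfin (fun t ht => h.slope_rightValue hΨ hE ht) ht
    (h.intervalIntegrable_power hΨ hE le_rfl ht.1 ht.2)
  have h2 := h.cost_add_energy_le hT hΨ hE ht
  have h3 := ENNReal.toReal_mono ENNReal.ofReal_ne_top (h.totalVar_le hRN hT hΨ hE ht)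
  rw [ENNReal.toReal_ofReal (h.cost_nonneg hT hΨ hE ht)] at h3
  -- The circle closes: `A + 𝓔_t ≤ 𝓔_0 + ∫𝓟 ≤ Var_𝔣 + 𝓔_t ≤ A + 𝓔_t`, so all are equal.
  refine ⟨?_, by linarith⟩
  rw [← ENNReal.ofReal_toReal (hfin t ht)]
  congr 1
  linarith

/-- Lower semicontinuity bounds the energies from below. From above, cost plus energy is
asymptotically at most the right side of the balance, while the costs alone converge to `A t`. -/
theorem tendsto_energy_pwConst (h : S.IsViscosityLimit E C τ ε U y u A)
    (hRN : HasRadonNikodymProperty V) (hT : 0 < S.T) (hΨ : S.DissipationAssumptions)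
    (hE : S.EnergyAssumptions) {t : ℝ} (ht : t ∈ Icc 0 S.T) :
    Tendsto (fun k => S.energy t (pwConst (τ k) (U k) t)) atTop (𝓝 (S.energy t (u t))) := by
  have hcu := h.isControlled hΨ hE
  refine tendsto_order.2 ⟨fun a ha => ?_, fun a ha => ?_⟩
  · exact (tendsto_nhdsWithin_iff.2 ⟨(tendsto_const_nhds (x := t)).prodMk_nhds
      (h.tendsto_curve t ht), Eventually.of_forall fun k =>
        (⟨ht, (h.pwConst_mem k ht.2).1⟩ : _ ∈ Icc 0 S.T ×ˢ S.D)⟩).eventually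
        (hE.lsc (t, u t) ⟨ht, (hcu.mem t ht).1⟩ a ha)
  · have hη : 0 < (a - S.energy t (u t)) / 2 := by linarith
    have h1 := (h.totalVar_eq_and_balance hRN hT hΨ hE ht).2
    filter_upwards [h.eventually_energy_le hT hΨ hE ht hη,
      (h.tendsto_cost t ht).eventually_const_lt (sub_lt_self (A t) hη)] with k hk1 hk2
    linarith

theorem isBVSolution (h : S.IsViscosityLimit E C τ ε U y u A)
    (hRN : HasRadonNikodymProperty V) (hT : 0 < S.T) (hΨ : S.DissipationAssumptions)
    (hE : S.EnergyAssumptions) : S.IsBVSolution u := by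
  have hcu := h.isControlled hΨ hE
  refine ⟨⟨fun t ht => (hcu.mem t ht).1, (hcu.gaugeVar_ne_top hΨ le_rfl).lt_top⟩,
    h.stable hT hΨ hE, h.intervalIntegrable_power hΨ hE le_rfl hT.le le_rfl, fun t ht => ?_⟩
  have htI := Ioc_subset_Icc_self ht
  obtain ⟨h1, h2⟩ := h.totalVar_eq_and_balance hRN hT hΨ hE htI
  rw [hcu.finslerVar_eq_totalVar hRN hΨ hE ht, h1, EReal.coe_ennreal_ofReal,
    max_eq_left (h.cost_nonneg hT hΨ hE htI), ← h2, EReal.coe_add]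

end IsViscosityLimit

end RIS

end BalancedViscosity

/-! ### Compactness and conclusion. -/

namespace BalancedViscosity

namespace RIS

variable {V : Type*} [NormedAddCommGroup V] [NormedSpace ℝ V] [CompleteSpace V] {S : RIS V}

/-- Compactness of discrete solutions with convergent initial data and initial energies. -/
theorem exists_isViscosityLimit (hT : 0 < S.T) (hΨ : S.DissipationAssumptions)
    (hE : S.EnergyAssumptions) {u₀ : V} (hu₀ : u₀ ∈ S.D) {τ ε : ℕ → ℝ} {U : ℕ → ℕ → V}
    (hτ : ∀ k, 0 < τ k) (hε : ∀ k, 0 < ε k) (hε₀ : Tendsto ε atTop (𝓝 0))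
    (hτε : Tendsto (fun k => τ k / ε k) atTop (𝓝 0))
    (hU : ∀ k, S.IsDiscreteSolution (τ k) (ε k) (U k)) (hUD : ∀ k, U k 0 ∈ S.D)
    (hU₀ : Tendsto (fun k => U k 0) atTop (𝓝 u₀))
    (hEU₀ : Tendsto (fun k => S.energy 0 (U k 0)) atTop (𝓝 (S.energy 0 u₀))) :
    ∃ E C : ℝ, ∃ φ : ℕ → ℕ, StrictMono φ ∧ ∃ (y : ℕ → ℕ → ℝ) (u : ℝ → V) (A : ℝ → ℝ),
      S.IsViscosityLimit E C (fun k => τ (φ k)) (fun k => ε (φ k)) (fun k => U (φ k)) y u A := by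
  obtain ⟨G, hG⟩ := (((hΨ.psi_continuous.tendsto u₀).comp hU₀).add hEU₀).bddAbove_range
  obtain ⟨E, hEpos, C, hC, hchain⟩ := exists_isDiscreteChain hT hΨ hE ⟨u₀, hu₀⟩
    (le_max_left 0 G)
  choose y hy using fun k => hchain (τ k) (ε k) (U k) (hτ k) (hε k) (hU k) (hUD k)
    ((hG (mem_range_self k)).trans (le_max_right 0 G))
  obtain ⟨M, hM0, hM⟩ := IsDiscreteChain.exists_cost_bound (C := C) hT hΨ hE hEpos
  have hK := hE.isCompact_sublevel hEpos
  have hmono := fun k => discreteCost_mono hΨ (hτ k) (U k) (hy k).nonneg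
  obtain ⟨φ, hφ, u, A, hlim⟩ := exists_subseq_tendsto_of_monotone hK (hΨ.psi_modulus hK)
    (a := 0) (b := S.T) (M := M) (U := fun k => pwConst (τ k) (U k))
    (A := fun k => S.discreteCost (τ k) (U k) (y k))
    (fun k t ht => (hy k).mem _ (ceil_le_ceil (hτ k) ht.2))
    (fun k => (hmono k).monotoneOn _)
    (fun k t ht => ⟨by simpa [discreteCost] using hmono k ht.1,
      (hmono k ht.2).trans (hM _ _ _ _ (hτ k) (hε k) (hy k))⟩)
    (fun k s t _ hst _ => psi_pwConst_le hΨ (hτ k) (U k) (hy k).nonneg hst)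
  have hu : u 0 = u₀ := by
    refine tendsto_nhds_unique (hlim 0 ⟨le_rfl, hT.le⟩).1 ?_
    simpa [pwConst, Function.comp_def] using hU₀.comp hφ.tendsto_atTop
  refine ⟨E, C, φ, hφ, fun k => y (φ k), u, A, ?_⟩
  exact {
    pos := hEpos
    nonneg := hC
    tau_pos := fun k => hτ _
    eps_pos := fun k => hε _
    chain := fun k => hy _
    tendsto_eps := hε₀.comp hφ.tendsto_atTop
    tendsto_ratio := hτε.comp hφ.tendsto_atTop
    tendsto_curve := fun t ht => (hlim t ht).1
    tendsto_cost := fun t ht => (hlim t ht).2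
    tendsto_energy := by rw [hu]; exact hEU₀.comp hφ.tendsto_atTop }

end RIS

end BalancedViscosity

theorem mainTheorem2 {V : Type*} [NormedAddCommGroup V] [NormedSpace ℝ V] [CompleteSpace V]
    [TopologicalSpace.SeparableSpace V] (hRN : HasRadonNikodymProperty V)
    (S : RIS V) (hT : 0 < S.T) (hΨ : S.DissipationAssumptions) (hE : S.EnergyAssumptions)
    (u₀ : V) (hu₀ : u₀ ∈ S.D)
    -- discrete solutions `U τ ε n`, for all step sizes `τ > 0` and viscosities `ε > 0`
    (U : ℝ → ℝ → ℕ → V)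
    (hU : ∀ τ ε : ℝ, 0 < τ → 0 < ε → S.IsDiscreteSolution τ ε (U τ ε))
    -- convergence of the initial data and of their energies as `τ, ε ↓ 0`
    (hU₀ : Tendsto (fun p : ℝ × ℝ => U p.1 p.2 0) (𝓝[>] 0 ×ˢ 𝓝[>] 0) (𝓝 u₀))
    (hEU₀ : Tendsto (fun p : ℝ × ℝ => S.extEnergy 0 (U p.1 p.2 0)) (𝓝[>] 0 ×ˢ 𝓝[>] 0)
      (𝓝 (S.extEnergy 0 u₀)))
    (τ ε : ℕ → ℝ) (hτ : ∀ k, 0 < τ k) (hε : ∀ k, 0 < ε k)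
    (hε₀ : Tendsto ε atTop (𝓝 0)) (hτε : Tendsto (fun k => τ k / ε k) atTop (𝓝 0)) :
    ∃ E : ℝ, 0 < E ∧ ∃ φ : ℕ → ℕ, StrictMono φ ∧ ∃ u : ℝ → V,
      S.IsBVCurve (S.sublevel E) u ∧
      (∀ t ∈ Icc 0 S.T,
        Tendsto (fun k => pwConst (τ (φ k)) (U (τ (φ k)) (ε (φ k))) t) atTop (𝓝 (u t))) ∧
      (∀ t ∈ Icc 0 S.T,
        Tendsto (fun k => pwAffine (τ (φ k)) (U (τ (φ k)) (ε (φ k))) t) atTop (𝓝 (u t))) ∧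
      (∀ t ∈ Icc 0 S.T,
        Tendsto (fun k => S.extEnergy t (pwConst (τ (φ k)) (U (τ (φ k)) (ε (φ k))) t)) atTop
          (𝓝 (S.extEnergy t (u t)))) ∧
      S.IsBVSolution u := by
  have hτ₀ : Tendsto τ atTop (𝓝 0) := by
    have := hτε.mul hε₀
    rw [zero_mul] at this
    exact this.congr fun k => div_mul_cancel₀ _ (hε k).ne'
  have hp : Tendsto (fun k => (τ k, ε k)) atTop (𝓝[>] 0 ×ˢ 𝓝[>] 0) :=
    (tendsto_nhdsWithin_iff.2 ⟨hτ₀, Eventually.of_forall hτ⟩).prodMk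
      (tendsto_nhdsWithin_iff.2 ⟨hε₀, Eventually.of_forall hε⟩)
  have h1 := hU₀.comp hp
  have h2 := hEU₀.comp hp
  rw [RIS.extEnergy_of_mem hu₀] at h2
  -- Initial states may lie outside `D` for finitely many `k`. Their extended energies converge to a
  -- finite value, so they belong to `D` from `k₀` on; the final subsequence is shifted by `k₀`.
  obtain ⟨k₀, hk₀⟩ := eventually_atTop.1 (h2.eventually_ne (EReal.coe_ne_top _))
  have hD : ∀ k, U (τ (k + k₀)) (ε (k + k₀)) 0 ∈ S.D := fun k =>
    RIS.mem_of_extEnergy_ne_top (hk₀ (k + k₀) (Nat.le_add_left _ _))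
  have hs := tendsto_add_atTop_nat k₀
  have h3 : Tendsto (fun k => S.energy 0 (U (τ (k + k₀)) (ε (k + k₀)) 0)) atTop
      (𝓝 (S.energy 0 u₀)) := by
    rw [← EReal.tendsto_coe]
    exact (h2.comp hs).congr fun k => RIS.extEnergy_of_mem (hD k)
  obtain ⟨E, C, φ, hφ, y, u, A, h⟩ := RIS.exists_isViscosityLimit hT hΨ hE hu₀
    (fun k => hτ (k + k₀)) (fun k => hε (k + k₀)) (hε₀.comp hs) (hτε.comp hs)
    (fun k => hU _ _ (hτ (k + k₀)) (hε (k + k₀))) hD (h1.comp hs) h3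
  have hcu := h.isControlled hΨ hE
  refine ⟨E, h.pos, fun k => φ k + k₀, hφ.add_const k₀, u,
    ⟨hcu.mem, (hcu.gaugeVar_ne_top hΨ le_rfl).lt_top⟩, h.tendsto_curve,
    fun t ht => h.tendsto_pwAffine hΨ ht, fun t ht => ?_, h.isBVSolution hRN hT hΨ hE⟩
  rw [RIS.extEnergy_of_mem (hcu.mem t ht).1]
  exact (EReal.tendsto_coe.2 (h.tendsto_energy_pwConst hRN hT hΨ hE ht)).congr fun k =>
    (RIS.extEnergy_of_mem (h.pwConst_mem k ht.2).1).symm
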